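/- Let $k$ be any field and let $X$ be a variety over $k$, i.e. an integral separated scheme of finite type over $k$. Let $U\subset X$ be an open subset and $D=X\setminus U$ with its reduced scheme structure. For a finitely generated saturated submonoid $P\subset\mathbb Z^n$ that generates $\mathbb Z^n$ as a group (equivalently $P=\sigma^\vee\cap\mathbb Z^n$ for a strongly convex rational polyhedral cone $\sigma$), the scheme $V=\operatorname{Spec}k[P]$ is called an affine toric variety over $k$, and the image $T\subset V$ of $\operatorname{Spec}k[\mathbb Z^n]$ is its big torus. Over an algebraically closed field $K$, an open subset $U$ of a $K$-scheme $Y$ is called a toroidal embedding if for every closed point $y\in Y$ there are an affine toric variety $V$ over $K$ with big torus $T$, a closed point $s\in V$, and an isomorphism of $K$-algebras $\widehat{\mathcal O}_{Y,y}\cong\widehat{\mathcal O}_{V,s}$ that takes the ideal generated by the ideal of $Y\setminus U$ to the ideal generated by the ideal of $V\setminus T$ (both closed sets with their reduced structures). Over an arbitrary field $k$, $U\subset X$ is toroidal if its base change to an algebraic closure of $k$ is a toroidal embedding. It is a strict toroidal embedding if moreover the irreducible components of $X\setminus U$, with their reduced structures, are normal. Assume that $U\subset X$ is a strict toroidal embedding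 and that $D$ is geometrically reduced over $k$ (this is automatic when $k$ is perfect, in particular in characteristic zero). Let $x$ be a closed point of $X$. Then there exist an affine toric variety $V$ over $k$ with big torus $T$, an open neighbourhood $W$ of $x$ in $X$, and an étale $k$-morphism $\varphi:W\to V$ such that $U\cap W=\varphi^{-1}(T)$. -/

import Mathlib

open CategoryTheory CategoryTheory.Limits AlgebraicGeometry

universe u

namespace Toroidal

noncomputable section

/-! ### Affine toric varieties -/

/-- `P` is the monoid of lattice points `σᵛ ∩ ℤⁿ` of the dual of a strongly convex rational
polyhedral cone `σ`: a finitely generated saturated submonoid of `ℤⁿ` that generates `ℤⁿ`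
as a group. -/
structure IsToricMonoid {n : ℕ} (P : AddSubmonoid (Fin n → ℤ)) : Prop where
  fg : P.FG
  generates : AddSubgroup.closure (P : Set (Fin n → ℤ)) = ⊤
  saturated : ∀ (m : ℕ) (v : Fin n → ℤ), 0 < m → m • v ∈ P → v ∈ P

/-- The coordinate ring `k[P]`. -/
abbrev coordRing (k : Type u) [Field k] {n : ℕ} (P : AddSubmonoid (Fin n → ℤ)) : Type u :=
  AddMonoidAlgebra k P

/-- The affine toric variety `V = Spec k[P]`. -/
abbrev toricVariety (k : Type u) [Field k] {n : ℕ} (P : AddSubmonoid (Fin n → ℤ)) :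
    Scheme.{u} :=
  Spec (.of (coordRing k P))

/-- The structure morphism `V ⟶ Spec k`. -/
abbrev toricVarietyStr (k : Type u) [Field k] {n : ℕ} (P : AddSubmonoid (Fin n → ℤ)) :
    toricVariety k P ⟶ Spec (.of k) :=
  Spec.map (CommRingCat.ofHom (algebraMap k (coordRing k P)))

/-- The morphism `Spec k[ℤⁿ] ⟶ Spec k[P]` from the split `n`-dimensional torus, given by the
inclusion `k[P] ⊆ k[ℤⁿ]`. -/
def torusToVariety (k : Type u) [Field k] {n : ℕ} (P : AddSubmonoid (Fin n → ℤ)) :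
    Spec (.of (AddMonoidAlgebra k (Fin n → ℤ))) ⟶ toricVariety k P :=
  Spec.map (CommRingCat.ofHom
    (AddMonoidAlgebra.mapDomainRingHom k P.subtype))

/-- The big torus `T ⊆ V`, as a subset of `V`. -/
def bigTorus (k : Type u) [Field k] {n : ℕ} (P : AddSubmonoid (Fin n → ℤ)) :
    Set (toricVariety k P) :=
  Set.range (torusToVariety k P)

/-! ### Completed local rings -/

/-- The completion of the local ring of `Y` at `y`. -/
abbrev completedStalk (Y : Scheme.{u}) (y : Y) : Type u :=
  AdicCompletion (IsLocalRing.maximalIdeal (Y.presheaf.stalk y)) (Y.presheaf.stalk y)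

/-- The structure map from `K` to the completed local ring at a point of a `K`-scheme. -/
def constants {K : Type u} [Field K] {Y : Scheme.{u}} (g : Y ⟶ Spec (.of K)) (y : Y) :
    K →+* completedStalk Y y :=
  (algebraMap (Y.presheaf.stalk y) (completedStalk Y y)).comp
    ((Scheme.ΓSpecIso (.of K)).inv ≫ g.appTop ≫ Y.presheaf.germ ⊤ y trivial).hom

/-- The ideal of the local ring at `y` of all germs vanishing on the closed subset `Z`
(the stalk at `y` of the radical ideal sheaf of `Z`). -/
def stalkIdeal (Y : Scheme.{u}) (Z : Set Y) (y : Y) : Ideal (Y.presheaf.stalk y) :=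
  PrimeSpectrum.vanishingIdeal (Y.fromSpecStalk y ⁻¹' Z)

/-- The ideal generated by `stalkIdeal` in the completed local ring. -/
def completedIdeal (Y : Scheme.{u}) (Z : Set Y) (y : Y) : Ideal (completedStalk Y y) :=
  (stalkIdeal Y Z y).map (algebraMap (Y.presheaf.stalk y) (completedStalk Y y))

/-! ### Toroidal embeddings -/

/-- Toroidal embeddings over an algebraically closed field `K`: at each closed point `y`, the
completed local ring of `Y` is isomorphic, as a `K`-algebra, to the completed local ring of an
affine toric variety `V` at a closed point `s`, and the isomorphism takes the ideal of `Y ∖ U` to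
the ideal of `V ∖ T`. -/
def IsToroidalOverAlgClosed {K : Type u} [Field K] [IsAlgClosed K] {Y : Scheme.{u}}
    (g : Y ⟶ Spec (.of K)) (U : Y.Opens) : Prop :=
  ∀ y : Y, IsClosed ({y} : Set Y) →
    ∃ (n : ℕ) (P : AddSubmonoid (Fin n → ℤ)) (_ : IsToricMonoid P)
      (s : toricVariety K P) (_ : IsClosed ({s} : Set (toricVariety K P)))
      (e : completedStalk Y y ≃+* completedStalk (toricVariety K P) s),
        (∀ a : K, e (constants g y a) = constants (toricVarietyStr K P) s a) ∧
        (completedIdeal Y (U : Set Y)ᶜ y).map (e : completedStalk Y y →+* _) =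
          completedIdeal (toricVariety K P) (bigTorus K P)ᶜ s

/-- An open subset `U ⊆ X` of a `k`-scheme is a toroidal embedding if its base change to the
algebraic closure of `k` is one. -/
def IsToroidal {k : Type u} [Field k] {X : Scheme.{u}} (f : X ⟶ Spec (.of k))
    (U : X.Opens) : Prop :=
  IsToroidalOverAlgClosed
    (pullback.snd f
      (Spec.map (CommRingCat.ofHom (algebraMap k (AlgebraicClosure k)))))
    (pullback.fst f
      (Spec.map (CommRingCat.ofHom (algebraMap k (AlgebraicClosure k)))) ⁻¹ᵁ U)

/-- A scheme is normal if all its local rings are integrally closed domains. -/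
def IsNormalScheme (Y : Scheme.{u}) : Prop :=
  ∀ y : Y, IsDomain (Y.presheaf.stalk y) ∧ IsIntegrallyClosed (Y.presheaf.stalk y)

/-- A closed subset of a scheme, with its reduced scheme structure. -/
abbrev reducedSubscheme {X : Scheme.{u}} (Z : TopologicalSpace.Closeds X) : Scheme.{u} :=
  (Scheme.IdealSheafData.vanishingIdeal Z).subscheme

/-- The closed immersion of a closed subset with its reduced scheme structure. -/
abbrev reducedSubschemeMap {X : Scheme.{u}} (Z : TopologicalSpace.Closeds X) :
    reducedSubscheme Z ⟶ X :=
  (Scheme.IdealSheafData.vanishingIdeal Z).subschemeι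

/-- `Z` is an irreducible component of the subset `D`. -/
def IsComponentOf {X : Scheme.{u}} (Z : TopologicalSpace.Closeds X) (D : Set X) : Prop :=
  Maximal (fun S : Set X => IsIrreducible S ∧ S ⊆ D) (Z : Set X)

/-- Strict toroidal embeddings: toroidal embeddings such that the irreducible components of
`X ∖ U`, with their reduced scheme structure, are normal. -/
structure IsStrictToroidal {k : Type u} [Field k] {X : Scheme.{u}} (f : X ⟶ Spec (.of k))
    (U : X.Opens) : Prop where
  toroidal : IsToroidal f U
  strict : ∀ Z : TopologicalSpace.Closeds X, IsComponentOf Z (U : Set X)ᶜ →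
    IsNormalScheme (reducedSubscheme Z)

end

end Toroidal

/-!
# Étale charts of strict toroidal embeddings

Let `A` be the local ring of `X` at `x`, let `K` be an algebraic closure of `k`, and let `T` be the
completed local ring of `X_K` at a point over `x`. By hypothesis `T` is the completion of a monoid
algebra `K[P]` at a closed point. After inverting the monomials that do not vanish there, the point
lies on the closed orbit (`exists_isToricPoint`), and then `T` is the ring of all power series
supported on a lattice, in boundary variables, which measure the heights above the facets of the
cone, and in variables in the unit directions (`FormalChart`, `IsToricPoint.exists_formalChart`).
The boundary becomes the union of the formal branches given by the boundary variables.

The main point is that every formal branch is defined over `A`. Since `D` is geometrically reduced,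
each irreducible component of `D` through `x` decomposes into formal branches, and what has to be
shown is that there is only one of them. The component is normal over `k`, but its base change to
`K` need not be normal when `K` is not separable over `k`, so that analytic irreducibility is not
immediate. Two facts replace it. The component of `D_K` has no coordinate system where two of its
branches meet: by logarithmic derivations of the chart, there are at least as many coordinates as
the rank of a facet of the lattice, and if they stayed coordinates where two branches meet, there
would be at most as many as the rank of a face of codimension two
(`CoordinateSystem.restrict_pair_eq_zero`). On the other hand a function `a` with `a / g` integral
is divisible by `g`, where `g` comes from the normal component over `k`: some `q`-th power, `q` a
power of the characteristic exponent, is divisible because the fraction becomes defined over a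
separable extension (`exists_pow_mem_span_pow`), and the Frobenius splitting of the power series
ring removes the power (`FormalChart.mem_span_of_pow_mem_span_pow`). If there were two branches,
separating them would give an `a` annihilated modulo `g` by the ideal of their intersection, hence
an associated prime of `g` containing this ideal whose local ring is a discrete valuation ring by
the second fact; there coordinates do exist, which is absurd (`FormalChart.subsingleton_branches`).

Consequently the boundary monomials of the chart are, up to units of `T`, elements of `A`
(`exists_eq_unit_mul_monomial`), and as lattices are free, they can be chosen multiplicatively
(`exists_boundaryHom`). They are completed by units of `A` that are coordinates in the unit
directions (`exists_units_span`) to a homomorphism from the monoid algebra over `k` to `A`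
(`exists_toricHom`). Over `K` it identifies the completion of the monoid algebra with `T`, because
it differs from the original chart by units and a linear change of coordinates
(`exists_isAdicDense`). By descent from `T` it is flat (`flat_of_isAdicDense`) and unramified
(`FormalChart.formallyUnramified`), and the monomials in the interior of the cone cut out the
boundary, so it spreads out to an étale morphism on a neighbourhood of `x`
(`exists_etale_neighbourhood`, `exists_etale_chart`).
-/

/-! ### Multivariate power series -/

namespace Toroidal

open MvPowerSeries

section PowerSeries

variable {σ : Type*} {K : Type*} [Field K]

/-- The exponent vector of a monomial, seen as an integer vector. -/
def intExp (m : σ →₀ ℕ) : σ → ℤ := fun s => (m s : ℤ)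

@[simp] lemma intExp_apply (m : σ →₀ ℕ) (s : σ) : intExp m s = (m s : ℤ) := rfl

lemma intExp_add (m m' : σ →₀ ℕ) : intExp (m + m') = intExp m + intExp m' := by
  ext; simp

@[simp] lemma intExp_zero : intExp (0 : σ →₀ ℕ) = 0 := by ext; simp

lemma intExp_injective : Function.Injective (intExp (σ := σ)) := by
  intro a b h
  ext s
  simpa using congrFun h s

/-- The part of a power series not involving the variables in `E`. -/
noncomputable def killFun (E : Set σ) (f : MvPowerSeries σ K) : MvPowerSeries σ K := by
  classical
  exact fun m => if ∀ s ∈ E, m s = 0 then coeff m f else 0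

lemma coeff_killFun_of_pos {E : Set σ} {m : σ →₀ ℕ} (h : ∀ s ∈ E, m s = 0)
    (f : MvPowerSeries σ K) : coeff m (killFun E f) = coeff m f := by
  classical
  exact if_pos h

lemma coeff_killFun_of_neg {E : Set σ} {m : σ →₀ ℕ} (h : ¬ ∀ s ∈ E, m s = 0)
    (f : MvPowerSeries σ K) : coeff m (killFun E f) = 0 := by
  classical
  exact if_neg h

lemma killFun_C (E : Set σ) (a : K) : killFun E (C (σ := σ) a) = C a := by
  classical
  ext m
  by_cases h : ∀ s ∈ E, m s = 0
  · rw [coeff_killFun_of_pos h]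
  · rw [coeff_killFun_of_neg h, coeff_C, if_neg]
    rintro rfl
    exact h (by simp)

/-- Setting the variables in `E` equal to zero. -/
noncomputable def kill (K : Type*) [Field K] (E : Set σ) :
    MvPowerSeries σ K →ₐ[K] MvPowerSeries σ K where
  toFun := killFun E
  map_one' := by
    have := killFun_C (σ := σ) E (1 : K)
    rwa [map_one] at this
  map_zero' := by
    have := killFun_C (σ := σ) E (0 : K)
    rwa [map_zero] at this
  map_add' f g := by
    ext m
    by_cases h : ∀ s ∈ E, m s = 0
    · simp [coeff_killFun_of_pos h]
    · simp [coeff_killFun_of_neg h]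
  map_mul' f g := by
    classical
    ext m
    by_cases h : ∀ s ∈ E, m s = 0
    · rw [coeff_killFun_of_pos h, coeff_mul, coeff_mul]
      refine Finset.sum_congr rfl fun p hp => ?_
      have hp' := Finset.HasAntidiagonal.mem_antidiagonal.mp hp
      have h1 : ∀ s ∈ E, p.1 s = 0 := fun s hs => by
        have := h s hs; rw [← hp'] at this; simp at this; omega
      have h2 : ∀ s ∈ E, p.2 s = 0 := fun s hs => by
        have := h s hs; rw [← hp'] at this; simp at this; omega
      rw [coeff_killFun_of_pos h1, coeff_killFun_of_pos h2]
    · rw [coeff_killFun_of_neg h, coeff_mul]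
      symm
      refine Finset.sum_eq_zero fun p hp => ?_
      have hp' := Finset.HasAntidiagonal.mem_antidiagonal.mp hp
      by_cases h1 : ∀ s ∈ E, p.1 s = 0
      · have h2 : ¬ ∀ s ∈ E, p.2 s = 0 := fun h2 => h fun s hs => by
          rw [← hp']; simp [h1 s hs, h2 s hs]
        rw [coeff_killFun_of_neg h2, mul_zero]
      · rw [coeff_killFun_of_neg h1, zero_mul]
  commutes' a := killFun_C E a

lemma coeff_kill_of_pos {E : Set σ} {m : σ →₀ ℕ} (h : ∀ s ∈ E, m s = 0)
    (f : MvPowerSeries σ K) : coeff m (kill K E f) = coeff m f :=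
  coeff_killFun_of_pos h f

lemma coeff_kill_of_neg {E : Set σ} {m : σ →₀ ℕ} (h : ¬ ∀ s ∈ E, m s = 0)
    (f : MvPowerSeries σ K) : coeff m (kill K E f) = 0 :=
  coeff_killFun_of_neg h f

lemma kill_eq_zero_iff {E : Set σ} {f : MvPowerSeries σ K} :
    kill K E f = 0 ↔ ∀ m : σ →₀ ℕ, (∀ s ∈ E, m s = 0) → coeff m f = 0 := by
  constructor
  · intro h m hm
    rw [← coeff_kill_of_pos hm, h, map_zero]
  · intro h
    ext m
    by_cases hm : ∀ s ∈ E, m s = 0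
    · rw [coeff_kill_of_pos hm, h m hm, map_zero]
    · rw [coeff_kill_of_neg hm, map_zero]

lemma kill_singleton_eq_zero_iff {i : σ} {f : MvPowerSeries σ K} :
    kill K {i} f = 0 ↔ X i ∣ f := by
  rw [kill_eq_zero_iff, X_dvd_iff]
  simp

lemma kill_kill (E F : Set σ) (f : MvPowerSeries σ K) :
    kill K E (kill K F f) = kill K (E ∪ F) f := by
  ext m
  by_cases hE : ∀ s ∈ E, m s = 0
  · rw [coeff_kill_of_pos hE]
    by_cases hF : ∀ s ∈ F, m s = 0
    · rw [coeff_kill_of_pos hF, coeff_kill_of_pos (E := E ∪ F) (fun s hs => hs.elim (hE s) (hF s))]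
    · rw [coeff_kill_of_neg hF, coeff_kill_of_neg (E := E ∪ F)
        (fun h => hF fun s hs => h s (Or.inr hs))]
  · rw [coeff_kill_of_neg hE, coeff_kill_of_neg (E := E ∪ F)
      (fun h => hE fun s hs => h s (Or.inl hs))]

@[simp] lemma constantCoeff_kill (E : Set σ) (f : MvPowerSeries σ K) :
    constantCoeff (kill K E f) = constantCoeff f := by
  rw [← coeff_zero_eq_constantCoeff_apply, ← coeff_zero_eq_constantCoeff_apply,
    coeff_kill_of_pos (by simp)]

lemma order_le_order_kill (E : Set σ) (f : MvPowerSeries σ K) : f.order ≤ (kill K E f).order := by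
  refine le_order fun d hd => ?_
  by_cases h : ∀ s ∈ E, d s = 0
  · rw [coeff_kill_of_pos h, coeff_of_lt_order hd]
  · rw [coeff_kill_of_neg h]

lemma kill_monomial_of_pos {E : Set σ} {m : σ →₀ ℕ} (h : ∀ s ∈ E, m s = 0) (a : K) :
    kill K E (monomial m a) = monomial m a := by
  classical
  ext d
  by_cases hd : d = m
  · subst hd; rw [coeff_kill_of_pos h]
  · by_cases h' : ∀ s ∈ E, d s = 0
    · rw [coeff_kill_of_pos h']
    · rw [coeff_kill_of_neg h', coeff_monomial, if_neg hd]

lemma kill_monomial_of_neg {E : Set σ} {m : σ →₀ ℕ} (h : ¬ ∀ s ∈ E, m s = 0) (a : K) :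
    kill K E (monomial m a) = 0 := by
  classical
  refine kill_eq_zero_iff.mpr fun d hd => ?_
  rw [coeff_monomial, if_neg]
  rintro rfl
  exact h hd

/-! #### Series supported on a lattice -/

/-- The power series all of whose exponents lie in the lattice `L`. -/
def IsSupp (L : Submodule ℤ (σ → ℤ)) (f : MvPowerSeries σ K) : Prop :=
  ∀ m : σ →₀ ℕ, coeff m f ≠ 0 → intExp m ∈ L

/-- The projection of a power series onto the part supported on the lattice `L`. -/
noncomputable def proj (L : Submodule ℤ (σ → ℤ)) (f : MvPowerSeries σ K) : MvPowerSeries σ K := by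
  classical
  exact fun m => if intExp m ∈ L then coeff m f else 0

lemma coeff_proj_of_mem {L : Submodule ℤ (σ → ℤ)} {m : σ →₀ ℕ} (h : intExp m ∈ L)
    (f : MvPowerSeries σ K) : coeff m (proj L f) = coeff m f := by
  classical
  exact if_pos h

lemma coeff_proj_of_notMem {L : Submodule ℤ (σ → ℤ)} {m : σ →₀ ℕ} (h : intExp m ∉ L)
    (f : MvPowerSeries σ K) : coeff m (proj L f) = 0 := by
  classical
  exact if_neg h

lemma isSupp_proj (L : Submodule ℤ (σ → ℤ)) (f : MvPowerSeries σ K) : IsSupp L (proj L f) := by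
  intro m hm
  by_contra h
  exact hm (coeff_proj_of_notMem h f)

lemma proj_eq_self {L : Submodule ℤ (σ → ℤ)} {f : MvPowerSeries σ K} (h : IsSupp L f) :
    proj L f = f := by
  ext m
  by_cases hm : intExp m ∈ L
  · rw [coeff_proj_of_mem hm]
  · rw [coeff_proj_of_notMem hm]
    by_contra h'
    exact hm (h m (Ne.symm h'))

lemma proj_add (L : Submodule ℤ (σ → ℤ)) (f g : MvPowerSeries σ K) :
    proj L (f + g) = proj L f + proj L g := by
  ext m
  by_cases hm : intExp m ∈ L
  · simp [coeff_proj_of_mem hm]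
  · simp [coeff_proj_of_notMem hm]

/-- The projection is linear over the series supported on the lattice, because the complement of
a subgroup is stable under translation by the subgroup. -/
lemma proj_mul {L : Submodule ℤ (σ → ℤ)} {f : MvPowerSeries σ K} (h : IsSupp L f)
    (g : MvPowerSeries σ K) : proj L (f * g) = f * proj L g := by
  classical
  ext m
  by_cases hm : intExp m ∈ L
  · rw [coeff_proj_of_mem hm, coeff_mul, coeff_mul]
    refine Finset.sum_congr rfl fun p hp => ?_
    by_cases h0 : coeff p.1 f = 0
    · simp [h0]
    · rw [coeff_proj_of_mem]
      have := h _ h0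
      rw [← Finset.HasAntidiagonal.mem_antidiagonal.mp hp, intExp_add] at hm
      exact (Submodule.add_mem_iff_right _ this).mp hm
  · rw [coeff_proj_of_notMem hm, coeff_mul]
    symm
    refine Finset.sum_eq_zero fun p hp => ?_
    by_cases h0 : coeff p.1 f = 0
    · simp [h0]
    · rw [coeff_proj_of_notMem, mul_zero]
      intro h2
      apply hm
      rw [← Finset.HasAntidiagonal.mem_antidiagonal.mp hp, intExp_add]
      exact add_mem (h _ h0) h2

lemma X_dvd_proj (L : Submodule ℤ (σ → ℤ)) {f : MvPowerSeries σ K} {i : σ} (h : X i ∣ f) :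
    X i ∣ proj L f := by
  rw [X_dvd_iff] at h ⊢
  intro m hm
  by_cases h' : intExp m ∈ L
  · rw [coeff_proj_of_mem h', h m hm]
  · rw [coeff_proj_of_notMem h']

lemma isSupp_monomial {L : Submodule ℤ (σ → ℤ)} {m : σ →₀ ℕ} (h : intExp m ∈ L) (a : K) :
    IsSupp L (monomial m a) := by
  classical
  intro d hd
  rw [coeff_monomial] at hd
  split_ifs at hd with h'
  · rwa [h']
  · exact absurd rfl hd

lemma isSupp_kill {L : Submodule ℤ (σ → ℤ)} {f : MvPowerSeries σ K} (hf : IsSupp L f)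
    (E : Set σ) : IsSupp L (kill K E f) := by
  intro m hm
  apply hf
  by_cases h : ∀ s ∈ E, m s = 0
  · rwa [coeff_kill_of_pos h] at hm
  · exact absurd (coeff_kill_of_neg h f) hm

/-! #### The Frobenius splitting -/

/-- The standard Frobenius splitting of a power series ring over a perfect field of
characteristic `p`, with `coeff m (frobSplit p f) = (coeff (p • m) f) ^ (1 / p)`. -/
noncomputable def frobSplit (p : ℕ) [Fact p.Prime] [CharP K p] [PerfectRing K p]
    (f : MvPowerSeries σ K) : MvPowerSeries σ K :=
  fun m => (frobeniusEquiv K p).symm (coeff (p • m) f)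

section Frob

variable (p : ℕ) [Fact p.Prime] [CharP K p] [PerfectRing K p]

lemma coeff_frobSplit (f : MvPowerSeries σ K) (m : σ →₀ ℕ) :
    coeff m (frobSplit p f) = (frobeniusEquiv K p).symm (coeff (p • m) f) := rfl

lemma frobSplit_add (f g : MvPowerSeries σ K) :
    frobSplit p (f + g) = frobSplit p f + frobSplit p g := by
  ext m
  simp [coeff_frobSplit]

lemma X_dvd_frobSplit {f : MvPowerSeries σ K} {i : σ} (h : X i ∣ f) : X i ∣ frobSplit p f := by
  rw [X_dvd_iff] at h ⊢
  intro m hm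
  rw [coeff_frobSplit, h _ (by simp [hm]), map_zero]

lemma frobSplit_pow_mul (f g : MvPowerSeries σ K) :
    frobSplit p (f ^ p * g) = f * frobSplit p g := by
  classical
  have hp : p ≠ 0 := (Fact.out : p.Prime).ne_zero
  have hpow : ∀ m : σ →₀ ℕ, coeff (p • m) (f ^ p) = (coeff m f) ^ p := by
    intro m
    have : ExpChar K p := ExpChar.prime Fact.out
    rw [← map_frobenius_expand p hp (f := f), coeff_map, coeff_expand_smul, frobenius_def]
  have hpow0 : ∀ m : σ →₀ ℕ, (∀ m', p • m' ≠ m) → coeff m (f ^ p) = 0 := by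
    intro m hm
    have : ExpChar K p := ExpChar.prime Fact.out
    rw [← map_frobenius_expand p hp (f := f), coeff_map]
    have : coeff m (f.expand p hp) = 0 := by
      by_contra h
      have hs : m ∈ (f.expand p hp).support := h
      rw [support_expand] at hs
      obtain ⟨m', _, h'⟩ := hs
      exact hm m' h'
    rw [this, map_zero]
  ext m
  rw [coeff_frobSplit, coeff_mul, coeff_mul, map_sum]
  symm
  have hinj : Function.Injective (fun q : (σ →₀ ℕ) × (σ →₀ ℕ) => (p • q.1, p • q.2)) := by
    rintro ⟨a, b⟩ ⟨a', b'⟩ h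
    simp only [Prod.mk.injEq] at h
    have aux : ∀ x y : σ →₀ ℕ, p • x = p • y → x = y := fun x y hxy => by
      ext s
      have := DFunLike.congr_fun hxy s
      simpa [hp] using this
    rw [aux _ _ h.1, aux _ _ h.2]
  -- only the pairs of multiples of `p` contribute, since `f ^ p` has no other coefficients
  rw [← Finset.sum_subset (s₁ := (Finset.HasAntidiagonal.antidiagonal m).map ⟨_, hinj⟩)
    (s₂ := Finset.HasAntidiagonal.antidiagonal (p • m))]
  · rw [Finset.sum_map]
    refine Finset.sum_congr rfl fun q _ => ?_
    simp only [Function.Embedding.coeFn_mk, coeff_frobSplit]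
    rw [hpow, map_mul]
    congr 1
    have := (frobeniusEquiv K p).symm_apply_apply (coeff q.1 f)
    rw [frobeniusEquiv_apply, frobenius_def] at this
    exact this.symm
  · intro q hq
    obtain ⟨q', hq', rfl⟩ := Finset.mem_map.mp hq
    simp only [Function.Embedding.coeFn_mk, Finset.HasAntidiagonal.mem_antidiagonal]
    rw [← smul_add, Finset.HasAntidiagonal.mem_antidiagonal.mp hq']
  · intro q hq hq'
    rw [hpow0, zero_mul, map_zero]
    intro a ha
    apply hq'
    have hq2 := Finset.HasAntidiagonal.mem_antidiagonal.mp hq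
    have hle : ∀ s, a s ≤ m s := fun s => by
      have := DFunLike.congr_fun hq2 s
      rw [← ha] at this
      simp only [Finsupp.add_apply, Finsupp.smul_apply, smul_eq_mul] at this
      have h3 : p * a s ≤ p * m s := by omega
      exact Nat.le_of_mul_le_mul_left h3 (Nat.pos_of_ne_zero hp)
    refine Finset.mem_map.mpr ⟨(a, m - a), ?_, ?_⟩
    · rw [Finset.HasAntidiagonal.mem_antidiagonal]
      ext s; simp [hle s]
    · simp only [Function.Embedding.coeFn_mk]
      ext s
      · simp [ha]
      · have := DFunLike.congr_fun hq2 s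
        rw [← ha] at this
        simp only [Finsupp.add_apply, Finsupp.smul_apply, smul_eq_mul] at this
        simp only [Finsupp.smul_apply, Finsupp.tsub_apply, smul_eq_mul, Nat.mul_sub]
        omega

end Frob

/-! #### Logarithmic derivations -/

/-- The logarithmic derivation `t ^ m ↦ l m • t ^ m` of the series supported on a lattice, followed
by the projection to the series supported on a sublattice `F`. -/
noncomputable def logDer (F : Submodule ℤ (σ → ℤ)) (l : F →ₗ[ℤ] ℤ) (f : MvPowerSeries σ K) :
    MvPowerSeries σ K := by
  classical
  exact fun m => if h : intExp m ∈ F then ((l ⟨intExp m, h⟩ : ℤ) : K) * coeff m f else 0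

lemma coeff_logDer_of_mem {F : Submodule ℤ (σ → ℤ)} (l : F →ₗ[ℤ] ℤ) (f : MvPowerSeries σ K)
    {m : σ →₀ ℕ} (h : intExp m ∈ F) :
    coeff m (logDer F l f) = ((l ⟨intExp m, h⟩ : ℤ) : K) * coeff m f := by
  classical
  exact dif_pos h

lemma coeff_logDer_of_notMem {F : Submodule ℤ (σ → ℤ)} (l : F →ₗ[ℤ] ℤ) (f : MvPowerSeries σ K)
    {m : σ →₀ ℕ} (h : intExp m ∉ F) : coeff m (logDer F l f) = 0 := by
  classical
  exact dif_neg h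

lemma logDer_add {F : Submodule ℤ (σ → ℤ)} (l : F →ₗ[ℤ] ℤ) (f g : MvPowerSeries σ K) :
    logDer F l (f + g) = logDer F l f + logDer F l g := by
  ext m
  by_cases h : intExp m ∈ F
  · simp [coeff_logDer_of_mem l _ h, mul_add]
  · simp [coeff_logDer_of_notMem l _ h]

lemma logDer_smul {F : Submodule ℤ (σ → ℤ)} (l : F →ₗ[ℤ] ℤ) (a : K) (f : MvPowerSeries σ K) :
    logDer F l (a • f) = a • logDer F l f := by
  ext m
  by_cases h : intExp m ∈ F
  · simp [coeff_logDer_of_mem l _ h]; ring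
  · simp [coeff_logDer_of_notMem l _ h]

/-- The Leibniz rule along the face cut out by the variables in `E`. -/
lemma logDer_mul {L F : Submodule ℤ (σ → ℤ)} {E : Set σ}
    (hF : ∀ v : σ → ℤ, v ∈ F ↔ v ∈ L ∧ ∀ s ∈ E, v s = 0) (l : F →ₗ[ℤ] ℤ)
    {f g : MvPowerSeries σ K} (hf : IsSupp L f) (hg : IsSupp L g) :
    logDer F l (f * g) = kill K E f * logDer F l g + kill K E g * logDer F l f := by
  classical
  ext m
  rw [map_add, coeff_mul, mul_comm (kill K E g), coeff_mul, ← Finset.sum_add_distrib]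
  by_cases h : intExp m ∈ F
  · rw [coeff_logDer_of_mem l _ h, coeff_mul, Finset.mul_sum]
    refine Finset.sum_congr rfl fun q hq => ?_
    have hq' := Finset.HasAntidiagonal.mem_antidiagonal.mp hq
    have h1 : ∀ s ∈ E, q.1 s = 0 := fun s hs => by
      have := ((hF _).mp h).2 s hs
      rw [← hq'] at this; simp at this; omega
    have h2 : ∀ s ∈ E, q.2 s = 0 := fun s hs => by
      have := ((hF _).mp h).2 s hs
      rw [← hq'] at this; simp at this; omega
    by_cases f0 : coeff q.1 f = 0
    · have : coeff q.1 (logDer F l f) = 0 := by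
        by_cases h' : intExp q.1 ∈ F
        · rw [coeff_logDer_of_mem l _ h', f0, mul_zero]
        · rw [coeff_logDer_of_notMem l _ h']
      rw [coeff_kill_of_pos h1, f0, this]; simp
    by_cases g0 : coeff q.2 g = 0
    · have : coeff q.2 (logDer F l g) = 0 := by
        by_cases h' : intExp q.2 ∈ F
        · rw [coeff_logDer_of_mem l _ h', g0, mul_zero]
        · rw [coeff_logDer_of_notMem l _ h']
      rw [coeff_kill_of_pos h2, g0, this]; simp
    have m1 : intExp q.1 ∈ F := (hF _).mpr ⟨hf _ f0, fun s hs => by simp [h1 s hs]⟩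
    have m2 : intExp q.2 ∈ F := (hF _).mpr ⟨hg _ g0, fun s hs => by simp [h2 s hs]⟩
    rw [coeff_kill_of_pos h1, coeff_kill_of_pos h2, coeff_logDer_of_mem l _ m1,
      coeff_logDer_of_mem l _ m2]
    have : (⟨intExp m, h⟩ : F) = ⟨intExp q.1, m1⟩ + ⟨intExp q.2, m2⟩ := by
      ext s; simp [← hq']
    rw [this, map_add]
    push_cast
    ring
  · rw [coeff_logDer_of_notMem l _ h]
    symm
    refine Finset.sum_eq_zero fun q hq => ?_
    have hq' := Finset.HasAntidiagonal.mem_antidiagonal.mp hq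
    have aux : ∀ (a b : MvPowerSeries σ K) (c d : σ →₀ ℕ), IsSupp L a → c + d = m →
        coeff c (kill K E a) * coeff d (logDer F l b) = 0 := by
      intro a b c d ha hcd
      by_cases hd : intExp d ∈ F
      · by_cases hc : coeff c (kill K E a) = 0
        · rw [hc, zero_mul]
        · exfalso
          apply h
          have hc' : ∀ s ∈ E, c s = 0 := by
            by_contra h'
            exact hc (coeff_kill_of_neg h' _)
          rw [coeff_kill_of_pos hc'] at hc
          have : intExp c ∈ F := (hF _).mpr ⟨ha _ hc, fun s hs => by simp [hc' s hs]⟩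
          rw [← hcd, intExp_add]
          exact add_mem this hd
      · rw [coeff_logDer_of_notMem l _ hd, mul_zero]
    rw [aux f g q.1 q.2 hf hq', mul_comm (coeff q.1 _),
      aux g f q.2 q.1 hg (by rw [← hq', add_comm]),
      add_zero]

/-- A power series of order at least `n` for every `n` vanishes. -/
lemma eq_zero_of_forall_le_order {f : MvPowerSeries σ K} (h : ∀ n : ℕ, (n : ℕ∞) ≤ f.order) :
    f = 0 := by
  rw [← order_eq_top_iff]
  exact ENat.eq_top_iff_forall_ge.mpr h

lemma le_order_add' {f g : MvPowerSeries σ K} {n : ℕ∞} (hf : n ≤ f.order) (hg : n ≤ g.order) :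
    n ≤ (f + g).order :=
  (le_min hf hg).trans (min_order_le_add)

lemma le_order_sub' {f g : MvPowerSeries σ K} {n : ℕ∞} (hf : n ≤ f.order) (hg : n ≤ g.order) :
    n ≤ (f - g).order := by
  rw [sub_eq_add_neg]
  exact le_order_add' hf (by rwa [order_neg])

lemma le_order_mul_left' {f g : MvPowerSeries σ K} {n : ℕ∞} (hg : n ≤ g.order) :
    n ≤ (f * g).order :=
  (hg.trans le_add_self).trans le_order_mul

end PowerSeries

/-! ### Flat ring homomorphisms and ideal quotients -/

section Flat

variable {R T : Type*} [CommRing R] [CommRing T] [Algebra R T]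

/-- Along a flat extension, formation of the colon ideal `J : r` commutes with extension. -/
lemma mem_map_colon_of_flat [Module.Flat R T] {J : Ideal R} {r : R} {x : T}
    (hx : x * algebraMap R T r ∈ J.map (algebraMap R T)) :
    x ∈ (J.colon {r}).map (algebraMap R T) := by
  classical
  rw [Ideal.map, Ideal.span, Submodule.mem_span_iff_exists_finset_subset] at hx
  obtain ⟨c, t, ht, -, hsum⟩ := hx
  have hpre : ∀ y : t, ∃ a ∈ J, algebraMap R T a = y := fun y => ht y.2
  choose a haJ ha using hpre
  let f : Option t → R := fun o => o.elim r (fun y => - a y)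
  let z : Option t → T := fun o => o.elim x (fun y => c y)
  have hz : ∑ i, f i • z i = 0 := by
    rw [Fintype.sum_option]
    simp only [f, z, Option.elim_none, Option.elim_some, Algebra.smul_def, map_neg, ha]
    rw [← Finset.sum_coe_sort] at hsum
    simp only [smul_eq_mul] at hsum
    rw [mul_comm, ← hsum, ← Finset.sum_add_distrib]
    exact Finset.sum_eq_zero fun y _ => by ring
  obtain ⟨κ, b, y, hy, hb⟩ := Module.Flat.isTrivialRelation_of_sum_smul_eq_zero
    (R := R) (M := T) hz
  have hx' : x = ∑ j, b none j • y j := hy none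
  rw [hx']
  refine Ideal.sum_mem _ fun j _ => ?_
  rw [Algebra.smul_def]
  refine Ideal.mul_mem_right _ _ (Ideal.mem_map_of_mem _ ?_)
  rw [Submodule.mem_colon_singleton, smul_eq_mul]
  have := hb j
  rw [Fintype.sum_option] at this
  simp only [f, Option.elim_none, Option.elim_some] at this
  have h2 : b none j * r = ∑ i : t, a i * b (some i) j := by
    rw [mul_comm, ← sub_eq_zero, ← this, sub_eq_add_neg, ← Finset.sum_neg_distrib]
    congr 1
    exact Finset.sum_congr rfl fun i _ => by ring
  rw [h2]
  exact Ideal.sum_mem _ fun i _ => Ideal.mul_mem_right _ _ (haJ i)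

/-- Along a flat extension, extension of ideals commutes with binary intersections. -/
lemma map_inf_of_flat [Module.Flat R T] (J₁ J₂ : Ideal R) :
    (J₁ ⊓ J₂).map (algebraMap R T) = J₁.map (algebraMap R T) ⊓ J₂.map (algebraMap R T) := by
  classical
  refine le_antisymm (le_inf (Ideal.map_mono inf_le_left) (Ideal.map_mono inf_le_right)) ?_
  rintro x ⟨h₁, h₂⟩
  rw [SetLike.mem_coe, Ideal.map, Ideal.span, Submodule.mem_span_iff_exists_finset_subset]
    at h₁ h₂
  obtain ⟨c₁, t₁, ht₁, -, hs₁⟩ := h₁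
  obtain ⟨c₂, t₂, ht₂, -, hs₂⟩ := h₂
  have hp₁ : ∀ y : t₁, ∃ a ∈ J₁, algebraMap R T a = y := fun y => ht₁ y.2
  have hp₂ : ∀ y : t₂, ∃ a ∈ J₂, algebraMap R T a = y := fun y => ht₂ y.2
  choose a₁ haJ₁ ha₁ using hp₁
  choose a₂ haJ₂ ha₂ using hp₂
  rw [← Finset.sum_coe_sort] at hs₁ hs₂
  let f : t₁ ⊕ t₂ → R := Sum.elim a₁ (fun y => - a₂ y)
  let z : t₁ ⊕ t₂ → T := Sum.elim (fun y => c₁ y) (fun y => c₂ y)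
  have hz : ∑ i, f i • z i = 0 := by
    rw [Fintype.sum_sum_type]
    simp only [f, z, Sum.elim_inl, Sum.elim_inr, Algebra.smul_def, map_neg, ha₁, ha₂]
    have e₁ : ∑ y : t₁, (y : T) * c₁ y = x := by
      rw [← hs₁]; exact Finset.sum_congr rfl fun y _ => by rw [smul_eq_mul, mul_comm]
    have e₂ : ∑ y : t₂, -(y : T) * c₂ y = -x := by
      rw [← hs₂, ← Finset.sum_neg_distrib]
      exact Finset.sum_congr rfl fun y _ => by rw [smul_eq_mul]; ring
    rw [e₁, e₂, add_neg_cancel]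
  obtain ⟨κ, b, y, hy, hb⟩ := Module.Flat.isTrivialRelation_of_sum_smul_eq_zero
    (R := R) (M := T) hz
  have hx' : x = ∑ j, algebraMap R T (∑ i : t₁, a₁ i * b (Sum.inl i) j) * y j := by
    rw [← hs₁]
    calc ∑ i : t₁, c₁ i • (i : T)
        = ∑ i : t₁, ∑ j, algebraMap R T (a₁ i * b (Sum.inl i) j) * y j := by
          refine Finset.sum_congr rfl fun i _ => ?_
          have := hy (Sum.inl i)
          simp only [z, Sum.elim_inl] at this
          rw [this, smul_eq_mul, Finset.sum_mul]
          refine Finset.sum_congr rfl fun j _ => ?_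
          rw [Algebra.smul_def, map_mul, ha₁]; ring
      _ = _ := by
          rw [Finset.sum_comm]
          exact Finset.sum_congr rfl fun j _ => by rw [map_sum, Finset.sum_mul]
  rw [hx']
  refine Ideal.sum_mem _ fun j _ => Ideal.mul_mem_right _ _ (Ideal.mem_map_of_mem _ ⟨?_, ?_⟩)
  · exact Ideal.sum_mem _ fun i _ => Ideal.mul_mem_right _ _ (haJ₁ i)
  · have h := hb j
    rw [Fintype.sum_sum_type] at h
    simp only [f, Sum.elim_inl, Sum.elim_inr] at h
    have h2 : ∑ i : t₁, a₁ i * b (Sum.inl i) j = ∑ i : t₂, a₂ i * b (Sum.inr i) j := by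
      rw [← sub_eq_zero, ← h, sub_eq_add_neg, ← Finset.sum_neg_distrib]
      congr 1
      exact Finset.sum_congr rfl fun i _ => by ring
    rw [SetLike.mem_coe, h2]
    exact Ideal.sum_mem _ fun i _ => Ideal.mul_mem_right _ _ (haJ₂ i)

lemma map_finset_inf_of_flat [Module.Flat R T] {ι : Type*} (s : Finset ι) (J : ι → Ideal R) :
    (s.inf J).map (algebraMap R T) = s.inf fun i => (J i).map (algebraMap R T) := by
  classical
  induction s using Finset.induction_on with
  | empty => simp [Ideal.map_top]
  | insert a s ha ih => rw [Finset.inf_insert, Finset.inf_insert, map_inf_of_flat, ih]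

/-- Along a flat extension of a Noetherian ring, formation of `J : N` commutes with extension. -/
lemma mem_map_colon_ideal_of_flat [Module.Flat R T] [IsNoetherianRing R] {J N : Ideal R} {x : T}
    (hx : ∀ r ∈ N, x * algebraMap R T r ∈ J.map (algebraMap R T)) :
    x ∈ (J.colon (N : Set R)).map (algebraMap R T) := by
  classical
  obtain ⟨s, hs⟩ := (inferInstance : IsNoetherianRing R).noetherian N
  have h1 : s.inf (fun r => J.colon {r}) ≤ J.colon (N : Set R) := by
    intro a ha
    rw [Submodule.mem_colon]
    intro n hn
    have : N ≤ J.colon {a} := by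
      rw [← hs, Submodule.span_le]
      intro r hr
      have := (Submodule.mem_finsetInf.mp ha) r hr
      rw [Submodule.mem_colon_singleton] at this
      rw [SetLike.mem_coe, Submodule.mem_colon_singleton, smul_eq_mul, mul_comm]
      exact this
    have := this hn
    rw [Submodule.mem_colon_singleton, smul_eq_mul, mul_comm] at this
    exact this
  refine Ideal.map_mono h1 ?_
  rw [map_finset_inf_of_flat, Submodule.mem_finsetInf]
  intro r hr
  exact mem_map_colon_of_flat (hx r (hs ▸ Submodule.subset_span hr))

end Flat

/-! ### Dense homomorphisms into local rings -/

section Dense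

open IsLocalRing

variable {R T : Type*} [CommRing R] [CommRing T] [IsLocalRing T]

/-- A ring homomorphism `φ : R → T` to a local ring with maximal ideal `𝔪` which induces
isomorphisms `R / 𝔫 ^ n ≃ T / 𝔪 ^ n` for all `n`, where `𝔫 = φ⁻¹ 𝔪`. -/
structure IsAdicDense (φ : R →+* T) : Prop where
  approx : ∀ (x : T) (n : ℕ), ∃ r : R, x - φ r ∈ maximalIdeal T ^ n
  mem_pow : ∀ (r : R) (n : ℕ), φ r ∈ maximalIdeal T ^ n → r ∈ (maximalIdeal T).comap φ ^ n

/-- If every element of `T` is approximated to first order and `𝔫` generates `𝔪`, then every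
element is approximated to any order. -/
lemma exists_approx_of_map_eq (φ : R →+* T)
    (h1 : ∀ x : T, ∃ r : R, x - φ r ∈ maximalIdeal T)
    (h2 : ((maximalIdeal T).comap φ).map φ = maximalIdeal T) (x : T) (n : ℕ) :
    ∃ r : R, x - φ r ∈ maximalIdeal T ^ n := by
  induction n generalizing x with
  | zero => exact ⟨0, by simp⟩
  | succ n ih =>
    obtain ⟨r, hr⟩ := ih x
    suffices H : ∀ y ∈ maximalIdeal T ^ n, ∃ s, y - φ s ∈ maximalIdeal T ^ (n + 1) by
      obtain ⟨s, hs⟩ := H _ hr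
      exact ⟨r + s, by rwa [map_add, ← sub_sub]⟩
    intro y hy
    have h3 : maximalIdeal T ^ n =
      Ideal.span (φ '' (((maximalIdeal T).comap φ ^ n : Ideal R))) := by
      conv_lhs => rw [← h2, ← Ideal.map_pow]
      rfl
    rw [h3] at hy
    refine Submodule.span_induction ?_ ?_ ?_ ?_ hy
    · rintro _ ⟨s, -, rfl⟩
      exact ⟨s, by simp⟩
    · exact ⟨0, by simp⟩
    · rintro a b - - ⟨s, hs⟩ ⟨t, ht⟩
      refine ⟨s + t, ?_⟩
      rw [map_add, add_sub_add_comm]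
      exact Ideal.add_mem _ hs ht
    · rintro c a ha ⟨s, hs⟩
      obtain ⟨d, hd⟩ := h1 c
      have ha' : a ∈ maximalIdeal T ^ n := by rw [h3]; exact ha
      refine ⟨d * s, ?_⟩
      have : c • a - φ (d * s) = (c - φ d) * a + φ d * (a - φ s) := by
        rw [map_mul, smul_eq_mul]; ring
      rw [this]
      refine Ideal.add_mem _ ?_ (Ideal.mul_mem_left _ _ hs)
      rw [pow_succ']
      exact Ideal.mul_mem_mul hd ha'

/-- The preimage of the maximal ideal is maximal if the residue field is attained. -/
lemma comap_isMaximal_of_approx (φ : R →+* T)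
    (h1 : ∀ x : T, ∃ r : R, x - φ r ∈ maximalIdeal T) :
    ((maximalIdeal T).comap φ).IsMaximal := by
  have hs : Function.Surjective ((residue T).comp φ) := by
    intro y
    obtain ⟨x, rfl⟩ := residue_surjective y
    obtain ⟨r, hr⟩ := h1 x
    refine ⟨r, ?_⟩
    rw [RingHom.comp_apply, ← sub_eq_zero, ← map_sub, residue_eq_zero_iff, ← neg_mem_iff, neg_sub]
    exact hr
  have := RingHom.ker_isMaximal_of_surjective _ hs
  rwa [← RingHom.comap_ker, ker_residue] at this

/-- A flat homomorphism for which the maximal ideal is extended and the residue field is attained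
is dense. -/
lemma IsAdicDense.of_flat [Algebra R T] [Module.Flat R T]
    (h1 : ∀ x : T, ∃ r : R, x - algebraMap R T r ∈ maximalIdeal T)
    (h2 : ((maximalIdeal T).comap (algebraMap R T)).map (algebraMap R T) = maximalIdeal T) :
    IsAdicDense (algebraMap R T) where
  approx := exists_approx_of_map_eq _ h1 h2
  mem_pow r n hr := by
    set 𝔫 := (maximalIdeal T).comap (algebraMap R T) with h𝔫
    by_contra hn
    have h4 : (1 : T) ∈ ((𝔫 ^ n).colon {r}).map (algebraMap R T) := by
      apply mem_map_colon_of_flat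
      rwa [one_mul, Ideal.map_pow, h2]
    have h5 : (𝔫 ^ n).colon {r} ≠ ⊤ := by
      intro h
      apply hn
      have := (Ideal.eq_top_iff_one _).mp h
      rwa [Submodule.mem_colon_singleton, one_smul] at this
    obtain ⟨M, hM, hle⟩ := Ideal.exists_le_maximal _ h5
    have h6 : 𝔫 ≤ M := by
      refine Ideal.IsPrime.le_of_pow_le (n := n) (hP := hM.isPrime) (le_trans (fun a ha => ?_) hle)
      rw [Submodule.mem_colon_singleton, smul_eq_mul]
      exact Ideal.mul_mem_right _ _ ha
    have h7 := (comap_isMaximal_of_approx _ h1).eq_of_le hM.ne_top h6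
    rw [← h7] at hle
    have := Ideal.map_mono (f := algebraMap R T) hle h4
    rw [h2] at this
    exact (maximalIdeal.isMaximal T).ne_top ((Ideal.eq_top_iff_one _).mpr this)

end Dense

/-! ### Extending additive maps to completions -/

section Lift

open IsLocalRing MvPowerSeries

variable {R T : Type*} [CommRing R] [CommRing T] [IsLocalRing T] {φ : R →+* T}
variable {σ K : Type*} [Field K]

/-- A homomorphism to power series sending `I` to series without constant term sends `I ^ n` to
series of order at least `n`. -/
lemma le_order_of_mem_pow {S : Type*} [CommRing S] (ρ : S →+* MvPowerSeries σ K) {I : Ideal S}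
    (hρ : ∀ x ∈ I, 1 ≤ (ρ x).order) (n : ℕ) : ∀ x ∈ I ^ n, (n : ℕ∞) ≤ (ρ x).order := by
  induction n with
  | zero => simp
  | succ n ih =>
    intro x hx
    rw [pow_succ] at hx
    refine Submodule.mul_induction_on hx ?_ ?_
    · intro a ha b hb
      rw [map_mul]
      push_cast
      exact (add_le_add (ih a ha) (hρ b hb)).trans le_order_mul
    · intro a b ha hb
      rw [map_add]
      exact le_order_add' ha hb

/-- A derivation along such a homomorphism lowers the order by at most one. -/
lemma le_order_of_mem_pow_succ {S : Type*} [CommRing S] (ρ : S →+* MvPowerSeries σ K)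
    {I : Ideal S} (hρ : ∀ x ∈ I, 1 ≤ (ρ x).order) (D : S →+ MvPowerSeries σ K)
    (hD : ∀ x y, D (x * y) = ρ x * D y + ρ y * D x) (n : ℕ) :
    ∀ x ∈ I ^ (n + 1), (n : ℕ∞) ≤ (D x).order := by
  induction n with
  | zero => simp
  | succ n ih =>
    intro x hx
    rw [pow_succ] at hx
    refine Submodule.mul_induction_on hx ?_ ?_
    · intro a ha b hb
      rw [hD]
      refine le_order_add' ?_ ?_
      · rw [mul_comm]
        exact le_order_mul_left' (le_order_of_mem_pow ρ hρ _ _ ha)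
      · push_cast
        rw [add_comm]
        exact (add_le_add (hρ b hb) (ih a ha)).trans le_order_mul
    · intro a b ha hb
      rw [map_add]
      exact le_order_add' ha hb

/-- Two derivations along the same local homomorphism to power series agree if they agree on a
dense subring. -/
lemma derivation_ext (hφ : IsAdicDense φ) (ρ : T →+* MvPowerSeries σ K)
    (hρ : ∀ x ∈ maximalIdeal T, 1 ≤ (ρ x).order) (D D' : T →+ MvPowerSeries σ K)
    (hD : ∀ x y, D (x * y) = ρ x * D y + ρ y * D x)
    (hD' : ∀ x y, D' (x * y) = ρ x * D' y + ρ y * D' x)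
    (h : ∀ r, D (φ r) = D' (φ r)) (x : T) : D x = D' x := by
  rw [← sub_eq_zero]
  refine eq_zero_of_forall_le_order fun n => ?_
  obtain ⟨r, hr⟩ := hφ.approx x (n + 1)
  have : D x - D' x = D (x - φ r) - D' (x - φ r) := by
    rw [map_sub, map_sub, h]; ring
  rw [this]
  exact le_order_sub' (le_order_of_mem_pow_succ ρ hρ D hD n _ hr)
    (le_order_of_mem_pow_succ ρ hρ D' hD' n _ hr)

/-- `H` is a continuous extension of `h` along `φ`, up to a loss of one order. -/
def IsLift (φ : R →+* T) (h : R → MvPowerSeries σ K) (H : T → MvPowerSeries σ K) : Prop :=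
  ∀ (x : T) (n : ℕ) (r : R), x - φ r ∈ maximalIdeal T ^ (n + 1) → (n : ℕ∞) ≤ (H x - h r).order

lemma exists_isLift (hφ : IsAdicDense φ) (h : R →+ MvPowerSeries σ K)
    (hh : ∀ n : ℕ, ∀ r ∈ (maximalIdeal T).comap φ ^ (n + 1), (n : ℕ∞) ≤ (h r).order) :
    ∃ H : T → MvPowerSeries σ K, IsLift φ h H := by
  choose a ha using hφ.approx
  let H : T → MvPowerSeries σ K := fun x d => coeff d (h (a x (d.degree + 2)))
  have hHd : ∀ x d, coeff d (H x) = coeff d (h (a x (d.degree + 2))) := fun _ _ => rfl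
  refine ⟨H, fun x n r hr => ?_⟩
  refine le_order fun d hd => ?_
  have hd' : d.degree < n := by exact_mod_cast hd
  have h1 : coeff d (h (a x (d.degree + 2))) - coeff d (h r) = 0 := by
    rw [← map_sub, ← map_sub]
    apply coeff_of_lt_order
    have h2 : φ (a x (d.degree + 2) - r) ∈ maximalIdeal T ^ (d.degree + 1 + 1) := by
      have : φ (a x (d.degree + 2) - r) = (x - φ r) - (x - φ (a x (d.degree + 2))) := by
        rw [map_sub]; ring
      rw [this]
      exact Ideal.sub_mem _ (Ideal.pow_le_pow_right (by omega) hr) (ha _ _)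
    refine lt_of_lt_of_le ?_ (hh _ _ (hφ.mem_pow _ _ h2))
    exact_mod_cast Nat.lt_succ_self _
  rw [map_sub, hHd, h1]

lemma IsLift.map_apply {h : R → MvPowerSeries σ K} {H : T → MvPowerSeries σ K}
    (hH : IsLift φ h H) (r : R) : H (φ r) = h r := by
  rw [← sub_eq_zero]
  exact eq_zero_of_forall_le_order fun n => hH _ n _ (by simp)

lemma IsLift.map_add (hφ : IsAdicDense φ) {h : R →+ MvPowerSeries σ K}
    {H : T → MvPowerSeries σ K} (hH : IsLift φ h H) (x y : T) : H (x + y) = H x + H y := by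
  rw [← sub_eq_zero]
  refine eq_zero_of_forall_le_order fun n => ?_
  obtain ⟨r, hr⟩ := hφ.approx x (n + 1)
  obtain ⟨s, hs⟩ := hφ.approx y (n + 1)
  have h1 := hH _ n _ hr
  have h2 := hH _ n _ hs
  have h3 := hH (x + y) n (r + s) (by
    rw [_root_.map_add, add_sub_add_comm]; exact Ideal.add_mem _ hr hs)
  have : H (x + y) - (H x + H y)
      = (H (x + y) - h (r + s)) - ((H x - h r) + (H y - h s)) := by
    rw [_root_.map_add]; ring
  rw [this]
  exact le_order_sub' h3 (le_order_add' h1 h2)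

/-- A derivation along `ρ ∘ φ` on a dense subring extends to a derivation along `ρ`. -/
lemma exists_derivation_lift (hφ : IsAdicDense φ) (ρ : T →+* MvPowerSeries σ K)
    (hρ : ∀ x ∈ maximalIdeal T, 1 ≤ (ρ x).order) (h : R →+ MvPowerSeries σ K)
    (hD : ∀ x y, h (x * y) = ρ (φ x) * h y + ρ (φ y) * h x) :
    ∃ D : T →+ MvPowerSeries σ K, (∀ r, D (φ r) = h r) ∧
      ∀ x y, D (x * y) = ρ x * D y + ρ y * D x := by
  obtain ⟨H, hH⟩ := exists_isLift hφ h
    (le_order_of_mem_pow_succ (ρ.comp φ) (I := (maximalIdeal T).comap φ)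
      (fun x hx => hρ _ hx) h hD)
  refine ⟨⟨⟨H, ?_⟩, hH.map_add hφ⟩, hH.map_apply, fun x y => ?_⟩
  · have := hH.map_apply 0
    rwa [map_zero, map_zero] at this
  · change H (x * y) = ρ x * H y + ρ y * H x
    rw [← sub_eq_zero]
    refine eq_zero_of_forall_le_order fun n => ?_
    obtain ⟨r, hr⟩ := hφ.approx x (n + 1)
    obtain ⟨s, hs⟩ := hφ.approx y (n + 1)
    have h1 := hH _ n _ hr
    have h2 := hH _ n _ hs
    have h3 := hH (x * y) n (r * s) (by
      have : x * y - φ (r * s) = (x - φ r) * y + φ r * (y - φ s) := by rw [map_mul]; ring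
      rw [this]
      exact Ideal.add_mem _ (Ideal.mul_mem_right _ _ hr) (Ideal.mul_mem_left _ _ hs))
    have h4 : ∀ z ∈ maximalIdeal T ^ (n + 1), (n : ℕ∞) ≤ (ρ z).order := fun z hz =>
      le_trans (by exact_mod_cast n.le_succ) (le_order_of_mem_pow ρ hρ (n + 1) z hz)
    have : H (x * y) - (ρ x * H y + ρ y * H x)
        = (H (x * y) - h (r * s)) - ((h s * ρ (x - φ r) + ρ x * (H y - h s))
          + (h r * ρ (y - φ s) + ρ y * (H x - h r))) := by
      rw [hD, map_sub, map_sub]; ring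
    rw [this]
    exact le_order_sub' h3 (le_order_add'
      (le_order_add' (le_order_mul_left' (h4 _ hr)) (le_order_mul_left' h2))
      (le_order_add' (le_order_mul_left' (h4 _ hs)) (le_order_mul_left' h1)))

/-- A homomorphism to power series sending `𝔫` to series without constant term extends to the
completion. -/
lemma exists_ringHom_lift (hφ : IsAdicDense φ) (h : R →+* MvPowerSeries σ K)
    (hh : ∀ r ∈ (maximalIdeal T).comap φ, 1 ≤ (h r).order) :
    ∃ H : T →+* MvPowerSeries σ K, (∀ r, H (φ r) = h r) ∧
      ∀ x ∈ maximalIdeal T, 1 ≤ (H x).order := by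
  have hh' : ∀ n : ℕ, ∀ r ∈ (maximalIdeal T).comap φ ^ (n + 1), (n : ℕ∞) ≤ (h r).order :=
    fun n r hr => le_trans (by exact_mod_cast n.le_succ) (le_order_of_mem_pow h hh (n + 1) r hr)
  obtain ⟨H, hH⟩ := exists_isLift hφ h.toAddMonoidHom hh'
  refine ⟨⟨⟨⟨H, ?_⟩, fun x y => ?_⟩, ?_, hH.map_add hφ⟩, hH.map_apply, fun x hx => ?_⟩
  · have := hH.map_apply 1
    rw [map_one] at this
    exact this.trans (map_one h)
  · change H (x * y) = H x * H y
    rw [← sub_eq_zero]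
    refine eq_zero_of_forall_le_order fun n => ?_
    obtain ⟨r, hr⟩ := hφ.approx x (n + 1)
    obtain ⟨s, hs⟩ := hφ.approx y (n + 1)
    have h1 := hH _ n _ hr
    have h2 := hH _ n _ hs
    have h3 := hH (x * y) n (r * s) (by
      have : x * y - φ (r * s) = (x - φ r) * y + φ r * (y - φ s) := by rw [map_mul]; ring
      rw [this]
      exact Ideal.add_mem _ (Ideal.mul_mem_right _ _ hr) (Ideal.mul_mem_left _ _ hs))
    have h5 : h.toAddMonoidHom (r * s) = h.toAddMonoidHom r * h.toAddMonoidHom s := map_mul h r s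
    have : H (x * y) - H x * H y
        = (H (x * y) - h.toAddMonoidHom (r * s))
          - (h.toAddMonoidHom s * (H x - h.toAddMonoidHom r)
            + H x * (H y - h.toAddMonoidHom s)) := by
      rw [h5]; ring
    rw [this]
    exact le_order_sub' h3 (le_order_add' (le_order_mul_left' h1) (le_order_mul_left' h2))
  · have := hH.map_apply 0
    rwa [map_zero, map_zero] at this
  · obtain ⟨r, hr⟩ := hφ.approx x 2
    have h1 := hH x 1 r hr
    have h2 : r ∈ (maximalIdeal T).comap φ := by
      have : φ r = x - (x - φ r) := by ring
      rw [Ideal.mem_comap, this]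
      exact Ideal.sub_mem _ hx (Ideal.pow_le_self (by norm_num) hr)
    have : H x = (H x - h.toAddMonoidHom r) + h r := (sub_add_cancel _ _).symm
    change 1 ≤ (H x).order
    rw [this]
    exact le_order_add' (by exact_mod_cast h1) (hh r h2)

end Lift

/-! ### Formal toric charts -/

section Chart

open IsLocalRing MvPowerSeries

/-- A formal toric chart: an embedding `Θ` of a local `K`-algebra `T` into a ring of power series
in boundary variables (indexed by `ι`) and unit-direction variables (indexed by `κ`), whose image
consists of the series supported on a lattice `L`. The lattice points of the nonnegative orthant
have to behave like those of the dual cone of a pointed cone: there are points `facet i` whose only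
vanishing boundary coordinate is the `i`-th, and points `prim i` with `i`-th coordinate one. -/
structure FormalChart (K T ι κ : Type*) [Field K] [CommRing T] [IsLocalRing T] [Algebra K T] where
  L : Submodule ℤ (ι ⊕ κ → ℤ)
  Θ : T →ₐ[K] MvPowerSeries (ι ⊕ κ) K
  injective : Function.Injective Θ
  mem_range : ∀ f, IsSupp L f ↔ ∃ x, Θ x = f
  mem_maximalIdeal : ∀ x, x ∈ maximalIdeal T ↔ constantCoeff (Θ x) = 0
  mem_pow_of_le_order : ∀ N : ℕ, ∃ M : ℕ, ∀ x, (M : ℕ∞) ≤ (Θ x).order → x ∈ maximalIdeal T ^ N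
  single_mem : ∀ j : κ, intExp (Finsupp.single (Sum.inr j) 1) ∈ L
  facet : ∀ i : ι, ∃ w : ι ⊕ κ →₀ ℕ, w (Sum.inl i) = 0 ∧ (∀ j ≠ i, 1 ≤ w (Sum.inl j)) ∧
    (∀ j : κ, w (Sum.inr j) = 0) ∧ intExp w ∈ L
  prim : ∀ i : ι, ∃ v : ι ⊕ κ →₀ ℕ, v (Sum.inl i) = 1 ∧ (∀ j : κ, v (Sum.inr j) = 0) ∧ intExp v ∈ L

namespace FormalChart

variable {K T ι κ : Type*} [Field K] [CommRing T] [IsLocalRing T] [Algebra K T]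
variable (c : FormalChart K T ι κ)

instance isDomain_mvPowerSeries (σ K : Type*) [Field K] : IsDomain (MvPowerSeries σ K) :=
  NoZeroDivisors.to_isDomain _

lemma isSupp (x : T) : IsSupp c.L (c.Θ x) := (c.mem_range _).mpr ⟨x, rfl⟩

/-- The composite of the chart with setting the boundary variables in `E` to zero. -/
noncomputable def restrict (E : Set ι) : T →ₐ[K] MvPowerSeries (ι ⊕ κ) K :=
  (kill K (Sum.inl '' E)).comp c.Θ

lemma restrict_apply (E : Set ι) (x : T) : c.restrict E x = kill K (Sum.inl '' E) (c.Θ x) := rfl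

/-- The prime ideal of `T` of the boundary component `t i = 0`. -/
noncomputable def prime (i : ι) : Ideal T := RingHom.ker (c.restrict {i})

lemma mem_prime {i : ι} {x : T} : x ∈ c.prime i ↔ c.restrict {i} x = 0 := Iff.rfl

lemma mem_prime' {i : ι} {x : T} : x ∈ c.prime i ↔ X (Sum.inl i) ∣ c.Θ x := by
  rw [mem_prime, restrict_apply, Set.image_singleton, kill_singleton_eq_zero_iff]

instance (i : ι) : (c.prime i).IsPrime := RingHom.ker_isPrime _

lemma one_le_order_restrict (E : Set ι) {x : T} (hx : x ∈ maximalIdeal T) :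
    1 ≤ (c.restrict E x).order := by
  rw [c.mem_maximalIdeal] at hx
  exact (one_le_order_iff_constCoeff_eq_zero.mpr hx).trans (order_le_order_kill _ _)

lemma restrict_restrict (E F : Set ι) (x : T) :
    kill K (Sum.inl '' E) (c.restrict F x) = c.restrict (E ∪ F) x := by
  rw [restrict_apply, kill_kill, ← Set.image_union, restrict_apply]

lemma exists_monomial {m : ι ⊕ κ →₀ ℕ} (h : intExp m ∈ c.L) :
    ∃ y, c.Θ y = monomial m 1 := (c.mem_range _).mp (isSupp_monomial h 1)

/-- The faces of the lattice of the chart. -/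
def face (E : Set ι) : Submodule ℤ (ι ⊕ κ → ℤ) where
  carrier := {v | v ∈ c.L ∧ ∀ s ∈ (Sum.inl '' E : Set (ι ⊕ κ)), v s = 0}
  add_mem' := fun ha hb => ⟨add_mem ha.1 hb.1, fun s hs => by
    rw [Pi.add_apply, ha.2 s hs, hb.2 s hs, add_zero]⟩
  zero_mem' := ⟨zero_mem _, fun _ _ => rfl⟩
  smul_mem' := fun n v hv => ⟨Submodule.smul_mem _ _ hv.1, fun s hs => by
    rw [Pi.smul_apply, hv.2 s hs, smul_zero]⟩

lemma mem_face {E : Set ι} {v : ι ⊕ κ → ℤ} :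
    v ∈ c.face E ↔ v ∈ c.L ∧ ∀ s ∈ (Sum.inl '' E : Set (ι ⊕ κ)), v s = 0 := Iff.rfl

/-- Every element of the facet lattice is a difference of two nonnegative ones. -/
lemma exists_sub_of_mem_face [Finite ι] [Finite κ] (i : ι) {v : ι ⊕ κ → ℤ} (hv : v ∈ c.face {i}) :
    ∃ m m' : ι ⊕ κ →₀ ℕ, intExp m ∈ c.face {i} ∧ intExp m' ∈ c.face {i} ∧
      v = intExp m - intExp m' := by
  classical
  have := Fintype.ofFinite ι
  have := Fintype.ofFinite κ
  obtain ⟨w, hwi, hwj, hwκ, hwL⟩ := c.facet i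
  let u : ι ⊕ κ →₀ ℕ := w + ∑ j : κ, Finsupp.single (Sum.inr j) 1
  have hsumL : ∀ s : Finset κ,
      intExp (∑ j ∈ s, Finsupp.single (Sum.inr j : ι ⊕ κ) 1) ∈ c.L := by
    intro s
    induction s using Finset.induction_on with
    | empty => simp
    | insert a s ha ih =>
      rw [Finset.sum_insert ha, intExp_add]; exact add_mem (c.single_mem a) ih
  have huL : intExp u ∈ c.L := by
    rw [intExp_add]; exact add_mem hwL (hsumL _)
  have hsum : ∀ s : ι ⊕ κ, (∑ j : κ, Finsupp.single (Sum.inr j : ι ⊕ κ) 1) s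
      = ∑ j : κ, (Finsupp.single (Sum.inr j : ι ⊕ κ) 1) s := fun s => Finsupp.finsetSum_apply _ _ _
  have hui : u (Sum.inl i) = 0 := by
    simp [u, hwi]
  have hus : ∀ s, s ≠ Sum.inl i → 1 ≤ u s := by
    rintro (j | j) hs
    · have : j ≠ i := fun h => hs (by rw [h])
      simpa [u, hsum] using hwj j this
    · have : (∑ j' : κ, (Finsupp.single (Sum.inr j' : ι ⊕ κ) 1) (Sum.inr j)) = 1 := by
        simp [Finsupp.single_apply]
      simp only [u, Finsupp.add_apply, hsum, this]
      omega
  let N : ℕ := ∑ s, (v s).natAbs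
  have hN : ∀ s, (v s).natAbs ≤ N := fun s =>
    Finset.single_le_sum (f := fun s => (v s).natAbs) (fun _ _ => Nat.zero_le _) (Finset.mem_univ s)
  let m : ι ⊕ κ →₀ ℕ := Finsupp.equivFunOnFinite.symm fun s => (v s + N * u s).toNat
  have hvi : v (Sum.inl i) = 0 := hv.2 _ ⟨i, rfl, rfl⟩
  have hm : intExp m = v + N • intExp u := by
    ext s
    have h1 : 0 ≤ v s + N * u s := by
      by_cases hs : s = Sum.inl i
      · rw [hs, hvi, hui]; simp
      · have h2 := hN s
        have h3 := hus s hs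
        have h4 : N * 1 ≤ N * u s := Nat.mul_le_mul_left _ h3
        have : ((N * 1 : ℕ) : ℤ) ≤ ((N * u s : ℕ) : ℤ) := by exact_mod_cast h4
        push_cast at this
        omega
    simp [m, Int.toNat_of_nonneg h1]
  have hm' : intExp (N • u) = N • intExp u := by ext s; simp
  refine ⟨m, N • u, ?_, ?_, ?_⟩
  · rw [mem_face, hm]
    refine ⟨add_mem hv.1 (nsmul_mem huL _), ?_⟩
    rintro _ ⟨j, rfl, rfl⟩
    simp [hvi, hui]
  · rw [mem_face, hm']
    refine ⟨nsmul_mem huL _, ?_⟩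
    rintro _ ⟨j, rfl, rfl⟩
    simp [hui]
  · rw [hm, hm', add_sub_cancel_right]

/-- Cutting a facet with a further boundary hyperplane decreases the rank of the lattice. -/
lemma finrank_face_pair_lt [Finite ι] [Finite κ] {i j : ι} (hij : i ≠ j) :
    Module.finrank ℤ (c.face {i, j}) < Module.finrank ℤ (c.face {i}) := by
  obtain ⟨w, hwi, hwj, -, hwL⟩ := c.facet i
  let f : c.face {i} →ₗ[ℤ] ℤ := (LinearMap.proj (Sum.inl j)).comp (c.face {i}).subtype
  have hw : intExp w ∈ c.face {i} := ⟨hwL, by rintro _ ⟨k, rfl, rfl⟩; simp [hwi]⟩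
  have h1 : Module.finrank ℤ (LinearMap.range f) + Module.finrank ℤ (LinearMap.ker f)
      = Module.finrank ℤ (c.face {i}) := by
    rw [← Submodule.finrank_quotient_add_finrank (LinearMap.ker f),
      f.quotKerEquivRange.finrank_eq]
  have h2 : 0 < Module.finrank ℤ (LinearMap.range f) := by
    rw [Module.finrank_pos_iff]
    refine ⟨⟨0, ⟨f ⟨_, hw⟩, ⟨_, rfl⟩⟩, ?_⟩⟩
    intro h
    have := congrArg Subtype.val h
    have h4 := hwj j hij.symm
    change (0 : ℤ) = (w (Sum.inl j) : ℤ) at this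
    omega
  have h3 : Module.finrank ℤ (LinearMap.ker f) = Module.finrank ℤ (c.face {i, j}) := by
    have hle : c.face {i, j} ≤ c.face {i} := fun v hv =>
      ⟨hv.1, fun s hs => hv.2 s (Set.image_mono (by simp) hs)⟩
    have : LinearMap.ker f = (c.face {i, j}).comap (c.face {i}).subtype := by
      ext ⟨v, hv⟩
      rw [LinearMap.mem_ker, Submodule.mem_comap]
      constructor
      · intro h
        refine ⟨hv.1, ?_⟩
        rintro _ ⟨k, (rfl | rfl), rfl⟩
        · exact hv.2 _ ⟨_, rfl, rfl⟩
        · exact h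
      · intro h
        exact h.2 _ ⟨j, by simp, rfl⟩
    rw [this]
    exact (Submodule.comapSubtypeEquivOfLe hle).finrank_eq
  omega

/-- A derivation along a restriction homomorphism of the chart is determined by its values on the
monomials. -/
lemma derivation_eq_zero (ρ : T →+* MvPowerSeries (ι ⊕ κ) K) [Finite ι] [Finite κ]
    (hρ : ∀ x ∈ maximalIdeal T, 1 ≤ (ρ x).order) (D : T →+ MvPowerSeries (ι ⊕ κ) K)
    (hD : ∀ x y, D (x * y) = ρ x * D y + ρ y * D x) (hK : ∀ (a : K) x, D (a • x) = a • D x)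
    (h : ∀ m y, c.Θ y = monomial m 1 → D y = 0) (x : T) : D x = 0 := by
  classical
  refine eq_zero_of_forall_le_order fun N => ?_
  obtain ⟨M, hM⟩ := c.mem_pow_of_le_order (N + 1)
  have hfin : {m : ι ⊕ κ →₀ ℕ | m.degree < M}.Finite := by
    refine (Finsupp.finite_of_degree_le M).subset fun m (hm : m.degree < M) =>
      (show m.degree ≤ M from le_of_lt hm)
  have key : ∀ s : Finset (ι ⊕ κ →₀ ℕ), ∃ y : T, D y = 0 ∧
      c.Θ y = ∑ m ∈ s, monomial m (coeff m (c.Θ x)) := by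
    intro s
    induction s using Finset.induction_on with
    | empty => exact ⟨0, by simp, by simp⟩
    | insert m s hm ih =>
      obtain ⟨y, hy, hy'⟩ := ih
      by_cases h0 : coeff m (c.Θ x) = 0
      · exact ⟨y, hy, by rw [Finset.sum_insert hm, h0, hy', map_zero, zero_add]⟩
      · obtain ⟨z, hz⟩ := c.exists_monomial (c.isSupp x m h0)
        refine ⟨coeff m (c.Θ x) • z + y, ?_, ?_⟩
        · rw [map_add, hK, h m z hz, hy]; simp
        · rw [map_add, map_smul, hz, hy', Finset.sum_insert hm, ← map_smul, smul_eq_mul, mul_one]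
  obtain ⟨y, hy, hy'⟩ := key hfin.toFinset
  have hxy : x - y ∈ maximalIdeal T ^ (N + 1) := by
    refine hM _ (le_order fun d hd => ?_)
    rw [map_sub, map_sub, hy', map_sum]
    simp only [coeff_monomial]
    rw [Finset.sum_ite_eq, if_pos, sub_self]
    rw [Set.Finite.mem_toFinset]
    exact_mod_cast hd
  have : D x = D (x - y) := by rw [map_sub, hy, sub_zero]
  rw [this]
  exact le_order_of_mem_pow_succ ρ hρ D hD N _ hxy

end FormalChart

end Chart

/-! ### Coordinate derivations and the crossing of boundary branches -/

section Crossing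

open IsLocalRing MvPowerSeries

/-- A coordinate system on `Spec B` away from `g`: elements `x j` together with derivations
`∂ j` with `∂ i (x j) = δ i j * g`, such that the differentials of the `x j` generate all
differentials after multiplication by `g`. -/
structure CoordinateSystem (K B : Type*) [Field K] [CommRing B] [Algebra K B] (g : B) where
  n : ℕ
  x : Fin n → B
  der : Fin n → Derivation K B B
  der_x : ∀ i j, der i (x j) = if i = j then g else 0
  smul_D : ∀ b, g • KaehlerDifferential.D K B b = ∑ j, der j b • KaehlerDifferential.D K B (x j)

/-- The chain rule for derivations along a homomorphism. -/
lemma CoordinateSystem.chain_rule {K B P : Type*} [Field K] [CommRing B] [Algebra K B]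
    [CommRing P] [Algebra K P] {g : B} (S : CoordinateSystem K B g) (ρ : B →ₐ[K] P)
    (δ : B →ₗ[K] P) (hδ : ∀ b b', δ (b * b') = ρ b * δ b' + ρ b' * δ b) (b : B) :
    ρ g * δ b = ∑ j, ρ (S.der j b) * δ (S.x j) := by
  let _ : Algebra B P := ρ.toRingHom.toAlgebra
  have : IsScalarTower K B P := IsScalarTower.of_algebraMap_eq fun a => (ρ.commutes a).symm
  let d : Derivation K B P := Derivation.mk' δ fun b b' => by
    rw [Algebra.smul_def, Algebra.smul_def]; exact hδ b b'
  have h := congrArg d.liftKaehlerDifferential (S.smul_D b)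
  rw [map_smul, map_sum, Derivation.liftKaehlerDifferential_comp_D, Algebra.smul_def] at h
  simp only [map_smul, Derivation.liftKaehlerDifferential_comp_D, Algebra.smul_def] at h
  exact h

variable {K A B T ι κ : Type*} [Field K] [CommRing T] [IsLocalRing T] [Algebra K T]
variable [CommRing A] [Algebra K A] [CommRing B] [Algebra K B] [Algebra A B] [IsScalarTower K A B]
variable [Algebra A T] [IsScalarTower K A T]

/-- The chain rule for maps on a ring surjecting to the one carrying the coordinates. -/
lemma CoordinateSystem.chain_rule_of_surjective {P : Type*} [CommRing P] [Algebra K P] {g : B}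
    (S : CoordinateSystem K B g) (hs : Function.Surjective (algebraMap A B)) (ρ : B →ₐ[K] P)
    (δ : A →ₗ[K] P)
    (hδ : ∀ b b', δ (b * b') = ρ (algebraMap A B b) * δ b' + ρ (algebraMap A B b') * δ b)
    (h0 : ∀ a, algebraMap A B a = 0 → δ a = 0) (a : A) (x : Fin S.n → A)
    (hx : ∀ j, algebraMap A B (x j) = S.x j) :
    ρ g * δ a = ∑ j, ρ (S.der j (algebraMap A B a)) * δ (x j) := by
  have hc : ∀ a a', algebraMap A B a = algebraMap A B a' → δ a = δ a' := by
    intro a a' h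
    rw [← sub_eq_zero, ← map_sub]
    exact h0 _ (by rw [map_sub, h, sub_self])
  let t := Function.surjInv hs
  have ht : ∀ b, algebraMap A B (t b) = b := Function.surjInv_eq hs
  let δ' : B →ₗ[K] P :=
    { toFun := fun b => δ (t b)
      map_add' := fun b b' => by
        rw [← map_add]; exact hc _ _ (by rw [map_add, ht, ht, ht])
      map_smul' := fun r b => by
        rw [RingHom.id_apply, ← map_smul]
        exact hc _ _ (by rw [ht, ← IsScalarTower.coe_toAlgHom' K A B, map_smul,
          IsScalarTower.coe_toAlgHom', ht]) }
  have hδ' : ∀ a, δ' (algebraMap A B a) = δ a := fun a => hc _ _ (ht _)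
  have := S.chain_rule ρ δ' (fun b b' => by
    rw [← ht b, ← ht b', ← map_mul, hδ', hδ', hδ', hδ]) (algebraMap A B a)
  rw [hδ'] at this
  rw [this]
  exact Finset.sum_congr rfl fun j _ => by rw [← hx, hδ']

variable (c : FormalChart K T ι κ)

/-- Restriction to a boundary stratum factors through any quotient whose kernel vanishes there. -/
lemma exists_restrict_quotient (hs : Function.Surjective (algebraMap A B)) {E : Set ι}
    (hE : ∀ a : A, algebraMap A B a = 0 → c.restrict E (algebraMap A T a) = 0) :
    ∃ ρ : B →ₐ[K] MvPowerSeries (ι ⊕ κ) K,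
      ∀ a, ρ (algebraMap A B a) = c.restrict E (algebraMap A T a) := by
  let π : A →ₐ[K] B := IsScalarTower.toAlgHom K A B
  let e := Ideal.quotientKerAlgEquivOfSurjective (f := π) hs
  let f : A →ₐ[K] MvPowerSeries (ι ⊕ κ) K := (c.restrict E).comp (IsScalarTower.toAlgHom K A T)
  refine ⟨(Ideal.Quotient.liftₐ (RingHom.ker π) f fun a ha => hE a ha).comp
    (e.symm : B →ₐ[K] _), fun a => ?_⟩
  have : e.symm (algebraMap A B a) = Ideal.Quotient.mk _ a := by
    rw [AlgEquiv.symm_apply_eq]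
    rfl
  rw [AlgHom.comp_apply]
  change (Ideal.Quotient.liftₐ _ _ _) (e.symm (algebraMap A B a)) = _
  rw [this]
  rfl

/-- A derivation of the quotient `B` of the dense subring `A` extends to a derivation on `T` along
restriction to a stratum. -/
lemma exists_derivation_extension (hd : IsAdicDense (algebraMap A T))
    {E : Set ι} (ρ : B →ₐ[K] MvPowerSeries (ι ⊕ κ) K)
    (hρ : ∀ a, ρ (algebraMap A B a) = c.restrict E (algebraMap A T a)) (δ : Derivation K B B) :
    ∃ D : T →+ MvPowerSeries (ι ⊕ κ) K,
      (∀ a : A, D (algebraMap A T a) = ρ (δ (algebraMap A B a))) ∧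
      (∀ x y, D (x * y) = c.restrict E x * D y + c.restrict E y * D x) ∧
      ∀ (r : K) x, D (r • x) = r • D x := by
  obtain ⟨D, h1, h2⟩ := exists_derivation_lift hd (c.restrict E).toRingHom
    (fun x hx => c.one_le_order_restrict E hx)
    (ρ.toLinearMap.toAddMonoidHom.comp
      (δ.toLinearMap.toAddMonoidHom.comp (algebraMap A B).toAddMonoidHom)) (by
      intro x y
      change ρ (δ (algebraMap A B (x * y))) = c.restrict E _ * ρ (δ (algebraMap A B y)) +
        c.restrict E _ * ρ (δ (algebraMap A B x))
      rw [map_mul, Derivation.leibniz, map_add, smul_eq_mul, smul_eq_mul, map_mul, map_mul,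
        hρ, hρ])
  refine ⟨D, h1, h2, fun r x => ?_⟩
  have h3 : D (algebraMap K T r) = 0 := by
    rw [IsScalarTower.algebraMap_apply K A T]
    refine (h1 _).trans ?_
    change ρ (δ (algebraMap A B (algebraMap K A r))) = 0
    rw [← IsScalarTower.algebraMap_apply, Derivation.map_algebraMap, map_zero]
  have h4 : c.restrict E (algebraMap K T r) = algebraMap K _ r := AlgHom.commutes _ _
  rw [Algebra.smul_def, h2, h3, mul_zero, add_zero, Algebra.smul_def]
  exact congrArg (· * D x) h4

variable (hd : IsAdicDense (algebraMap A T)) (hs : Function.Surjective (algebraMap A B))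
  {E : Set ι} (hE : (RingHom.ker (algebraMap A B)).map (algebraMap A T) = ⨅ i ∈ E, c.prime i)

omit [Algebra K A] [Algebra K B] [IsScalarTower K A B] [IsScalarTower K A T] in
include hE in
lemma restrict_eq_zero_of_mem_ker {i : ι} (hi : i ∈ E) {F : Set ι} (hiF : i ∈ F) (a : A)
    (ha : algebraMap A B a = 0) : c.restrict F (algebraMap A T a) = 0 := by
  have h1 : algebraMap A T a ∈ c.prime i := by
    have : algebraMap A T a ∈ ⨅ i ∈ E, c.prime i := hE ▸ Ideal.mem_map_of_mem _ ha
    rw [Ideal.mem_iInf] at this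
    exact (Ideal.mem_iInf.mp (this i)) hi
  have h2 : F = F ∪ {i} := (Set.union_eq_left.mpr (by simpa using hiF)).symm
  rw [h2, ← c.restrict_restrict, c.mem_prime.mp h1, map_zero]

include hd hs hE in
/-- On the facet `i`, there are at least as many coordinates as the rank of the facet. -/
lemma CoordinateSystem.finrank_face_le [Finite ι] [Finite κ] {i : ι} (hi : i ∈ E) {g : B}
    (S : CoordinateSystem K B g) (ρ : B →ₐ[K] MvPowerSeries (ι ⊕ κ) K)
    (hρ : ∀ a, ρ (algebraMap A B a) = c.restrict {i} (algebraMap A T a)) (hg : ρ g ≠ 0) :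
    Module.finrank ℤ (c.face {i}) ≤ S.n := by
  classical
  choose xA hxA using fun j => hs (S.x j)
  choose D hDA hDL hDK using fun j => exists_derivation_extension c hd ρ hρ (S.der j)
  let β := Module.finBasis ℤ (c.face {i})
  let der : (c.face {i} →ₗ[ℤ] ℤ) → T →+ MvPowerSeries (ι ⊕ κ) K := fun l =>
    ⟨⟨fun x => logDer (c.face {i}) l (c.Θ x), by
      have := logDer_smul l (0 : K) (0 : MvPowerSeries (ι ⊕ κ) K)
      rw [zero_smul, zero_smul] at this
      rwa [map_zero]⟩, fun x y => by
      simp only [map_add, logDer_add]⟩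
  have hder : ∀ l x, der l x = logDer (c.face {i}) l (c.Θ x) := fun _ _ => rfl
  have hderL : ∀ l x y, der l (x * y) = c.restrict {i} x * der l y + c.restrict {i} y * der l x :=
    fun l x y => by
      rw [hder, map_mul, logDer_mul (fun v => c.mem_face) l (c.isSupp x) (c.isSupp y)]
      rfl
  have hder0 : ∀ l x, c.restrict {i} x = 0 → der l x = 0 := by
    intro l x hx
    rw [c.restrict_apply, kill_eq_zero_iff] at hx
    ext m
    rw [map_zero, hder]
    by_cases hm : intExp m ∈ c.face {i}
    · rw [coeff_logDer_of_mem l _ hm, hx m (fun s hs => ?_), mul_zero]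
      have := hm.2 s hs
      simpa using this
    · rw [coeff_logDer_of_notMem l _ hm]
  -- both sides are derivations along the restriction, and they agree on the dense subring `A` by
  -- the chain rule
  have hmain : ∀ l x, ρ g * der l x = ∑ j, D j x * der l (algebraMap A T (xA j)) := by
    intro l
    let D1 : T →+ MvPowerSeries (ι ⊕ κ) K := (AddMonoidHom.mulLeft (ρ g)).comp (der l)
    let D2 : T →+ MvPowerSeries (ι ⊕ κ) K :=
      ∑ j, (AddMonoidHom.mulRight (der l (algebraMap A T (xA j)))).comp (D j)
    have hD1 : ∀ x, D1 x = ρ g * der l x := fun _ => rfl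
    have hD2 : ∀ x, D2 x = ∑ j, D j x * der l (algebraMap A T (xA j)) := fun x => by
      simp [D2]
    intro x
    rw [← hD1, ← hD2]
    refine derivation_ext hd (c.restrict {i}).toRingHom
      (fun x hx => c.one_le_order_restrict _ hx) D1 D2 ?_ ?_ ?_ x
    · intro x y
      rw [hD1, hD1, hD1, hderL]
      change _ = c.restrict {i} x * _ + c.restrict {i} y * _
      ring
    · intro x y
      change _ = c.restrict {i} x * _ + c.restrict {i} y * _
      rw [hD2, hD2, hD2, Finset.mul_sum, Finset.mul_sum, ← Finset.sum_add_distrib]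
      exact Finset.sum_congr rfl fun j _ => by rw [hDL]; ring
    · intro a
      rw [hD1, hD2]
      let δ : A →ₗ[K] MvPowerSeries (ι ⊕ κ) K :=
        { toFun := fun a => der l (algebraMap A T a)
          map_add' := fun a b => by rw [map_add, map_add]
          map_smul' := fun r a => by
            rw [RingHom.id_apply, hder, hder, ← IsScalarTower.coe_toAlgHom' K A T, map_smul,
              map_smul, logDer_smul] }
      have := S.chain_rule_of_surjective hs ρ δ (fun b b' => by
        change der l _ = _ * der l _ + _ * der l _
        rw [map_mul, hderL, hρ, hρ]) (fun a ha => hder0 _ _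
          (restrict_eq_zero_of_mem_ker c hE hi (Set.mem_singleton i) a ha)) a xA hxA
      refine this.trans (Finset.sum_congr rfl fun j _ => ?_)
      rw [hDA]
      rfl
  -- the Jacobian matrix of the coordinates; a relation between its columns would be one between
  -- the linear forms `β.coord s`, tested on the monomials of the facet
  let M : Matrix (Fin S.n) (Fin (Module.finrank ℤ (c.face {i}))) (MvPowerSeries (ι ⊕ κ) K) :=
    Matrix.of fun j s => der (β.coord s) (algebraMap A T (xA j))
  have hinj : Function.Injective M.mulVecLin := by
    rw [injective_iff_map_eq_zero]
    intro a ha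
    have h1 : ∀ m : ι ⊕ κ →₀ ℕ, ∀ hm : intExp m ∈ c.face {i},
        ∑ s, β.coord s ⟨intExp m, hm⟩ • a s = 0 := by
      intro m hm
      obtain ⟨y, hy⟩ := c.exists_monomial hm.1
      have h2 : ∑ s, a s * (ρ g * der (β.coord s) y) = 0 := by
        simp only [hmain, Finset.mul_sum]
        rw [Finset.sum_comm]
        refine Finset.sum_eq_zero fun j _ => ?_
        have h3 : ∑ s, M j s * a s = 0 := congrFun ha j
        calc _ = D j y * ∑ s, M j s * a s := by
              rw [Finset.mul_sum]
              exact Finset.sum_congr rfl fun s _ => by simp only [M, Matrix.of_apply]; ring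
          _ = 0 := by rw [h3, mul_zero]
      have h4 : ∀ s, der (β.coord s) y
          = ((β.coord s ⟨intExp m, hm⟩ : ℤ) : MvPowerSeries (ι ⊕ κ) K) * monomial m 1 := by
        intro s
        rw [hder, hy]
        ext d
        rw [← zsmul_eq_mul, map_zsmul]
        by_cases hdm : d = m
        · subst hdm
          rw [coeff_logDer_of_mem _ _ hm, zsmul_eq_mul]
        · by_cases hdF : intExp d ∈ c.face {i}
          · rw [coeff_logDer_of_mem _ _ hdF, coeff_monomial, if_neg hdm]; simp
          · rw [coeff_logDer_of_notMem _ _ hdF, coeff_monomial, if_neg hdm]; simp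
      have h5 : (ρ g * monomial m 1) * ∑ s, β.coord s ⟨intExp m, hm⟩ • a s = 0 := by
        rw [← h2, Finset.mul_sum]
        refine Finset.sum_congr rfl fun s _ => ?_
        rw [h4, zsmul_eq_mul]; ring
      refine (mul_eq_zero.mp h5).resolve_left (mul_ne_zero hg ?_)
      intro h6
      have := congrArg (coeff m) h6
      simp at this
    have h2 : ∀ v : c.face {i}, ∑ s, β.coord s v • a s = 0 := by
      rintro ⟨v, hv⟩
      obtain ⟨m, m', hm, hm', hmm⟩ := c.exists_sub_of_mem_face i hv
      have : (⟨v, hv⟩ : c.face {i}) = ⟨_, hm⟩ - ⟨_, hm'⟩ := Subtype.ext hmm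
      rw [this]
      simp only [map_sub, sub_smul, Finset.sum_sub_distrib]
      rw [h1 m hm, h1 m' hm', sub_zero]
    ext1 t
    have := h2 (β t)
    simpa [Finsupp.single_apply] using this
  have := card_le_of_injective _ _ hinj
  simpa using this

/-- Derivations with linearly independent behaviour on coordinates along restriction to a
codimension two stratum, vanishing on both boundary primes: their number is bounded by the rank of
the stratum. -/
lemma le_finrank_face_pair [Finite ι] [Finite κ] (Q : Type*) [Field Q]
    [Algebra (MvPowerSeries (ι ⊕ κ) K) Q] [IsFractionRing (MvPowerSeries (ι ⊕ κ) K) Q] {i j : ι}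
    {n : ℕ}
    (D : Fin n → T →+ MvPowerSeries (ι ⊕ κ) K)
    (hDL : ∀ s x y, D s (x * y) = c.restrict {i, j} x * D s y + c.restrict {i, j} y * D s x)
    (hDK : ∀ s (r : K) x, D s (r • x) = r • D s x)
    (hDi : ∀ s, ∀ x ∈ c.prime i, D s x = 0) (hDj : ∀ s, ∀ x ∈ c.prime j, D s x = 0)
    (x : Fin n → T) (g : MvPowerSeries (ι ⊕ κ) K) (hg : g ≠ 0)
    (hx : ∀ s t, D s (x t) = if s = t then g else 0) :
    n ≤ Module.finrank ℤ (c.face {i, j}) := by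
  classical
  let F := c.face {i, j}
  have hmon : ∀ m : ι ⊕ κ →₀ ℕ, algebraMap _ Q (monomial m (1 : K)) ≠ 0 := by
    intro m h
    rw [IsFractionRing.to_map_eq_zero_iff] at h
    have := congrArg (coeff m) h
    simp at this
  -- the logarithmic values of the derivations on monomials
  let φ : (ι ⊕ κ →₀ ℕ) → T → Fin n → Q := fun m y s =>
    algebraMap _ Q (D s y) / algebraMap _ Q (monomial m (1 : K))
  have hres : ∀ m y, c.Θ y = monomial m 1 → intExp m ∈ F → c.restrict {i, j} y = monomial m 1 := by
    intro m y hy hm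
    rw [c.restrict_apply, hy, kill_monomial_of_pos]
    intro s hs
    simpa using hm.2 s hs
  have hφadd : ∀ m y m' y', c.Θ y = monomial m 1 → c.Θ y' = monomial m' 1 → intExp m ∈ F →
      intExp m' ∈ F → φ (m + m') (y * y') = φ m y + φ m' y' := by
    intro m y m' y' hy hy' hm hm'
    ext s
    have h1 : algebraMap _ Q (monomial (m + m') (1 : K))
        = algebraMap _ Q (monomial m (1 : K)) * algebraMap _ Q (monomial m' (1 : K)) := by
      rw [← map_mul, monomial_mul_monomial, one_mul]
    simp only [φ, Pi.add_apply, hDL, hres m y hy hm, hres m' y' hy' hm', map_add, map_mul, h1]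
    have := hmon m
    have := hmon m'
    field_simp
    ring
  let G : Set (F × (Fin n → Q)) :=
    {γ | ∃ m y, ∃ h : intExp m ∈ F, c.Θ y = monomial m 1 ∧ γ = (⟨intExp m, h⟩, φ m y)}
  let Γ := Submodule.span ℤ G
  have hdiff : ∀ γ ∈ Γ, ∃ m y m' y', ∃ h : intExp m ∈ F, ∃ h' : intExp m' ∈ F,
      c.Θ y = monomial m 1 ∧ c.Θ y' = monomial m' 1 ∧
      γ = (⟨intExp m, h⟩ - ⟨intExp m', h'⟩, φ m y - φ m' y') := by
    intro γ hγ
    have h0 : intExp (0 : ι ⊕ κ →₀ ℕ) ∈ F := by rw [intExp_zero]; exact zero_mem _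
    have hΘ1 : c.Θ 1 = monomial (0 : ι ⊕ κ →₀ ℕ) (1 : K) := map_one _
    have hφ0 : φ 0 1 = 0 := by
      have := hφadd 0 1 0 1 hΘ1 hΘ1 h0 h0
      rwa [add_zero, mul_one, left_eq_add] at this
    rw [show Γ = AddSubgroup.toIntSubmodule (AddSubgroup.closure G) from
      Submodule.toAddSubgroup_injective (Submodule.span_int_eq_addSubgroupClosure G)] at hγ
    refine AddSubgroup.closure_induction (p := fun γ _ => ∃ m y m' y',
      ∃ h : intExp m ∈ F, ∃ h' : intExp m' ∈ F,
      c.Θ y = monomial m 1 ∧ c.Θ y' = monomial m' 1 ∧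
      γ = (⟨intExp m, h⟩ - ⟨intExp m', h'⟩, φ m y - φ m' y')) ?_ ?_ ?_ ?_ hγ
    · rintro _ ⟨m, y, h, hy, rfl⟩
      refine ⟨m, y, 0, 1, h, h0, hy, hΘ1, ?_⟩
      have : (⟨intExp 0, h0⟩ : F) = 0 := Subtype.ext intExp_zero
      rw [hφ0, sub_zero, this, sub_zero]
    · exact ⟨0, 1, 0, 1, h0, h0, hΘ1, hΘ1, by simp [Prod.zero_eq_mk]⟩
    · rintro _ _ - - ⟨m₁, y₁, m₁', y₁', h₁, h₁', hy₁, hy₁', rfl⟩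
        ⟨m₂, y₂, m₂', y₂', h₂, h₂', hy₂, hy₂', rfl⟩
      refine ⟨m₁ + m₂, y₁ * y₂, m₁' + m₂', y₁' * y₂',
        by rw [intExp_add]; exact add_mem h₁ h₂, by rw [intExp_add]; exact add_mem h₁' h₂',
        by rw [map_mul, hy₁, hy₂, monomial_mul_monomial, one_mul],
        by rw [map_mul, hy₁', hy₂', monomial_mul_monomial, one_mul], ?_⟩
      rw [hφadd _ _ _ _ hy₁ hy₂ h₁ h₂, hφadd _ _ _ _ hy₁' hy₂' h₁' h₂', Prod.mk_add_mk]
      congr 1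
      · ext1
        simp only [AddSubgroupClass.coe_sub, Submodule.coe_add, intExp_add]
        abel
      · abel
    · rintro _ - ⟨m, y, m', y', h, h', hy, hy', rfl⟩
      refine ⟨m', y', m, y, h', h, hy', hy, ?_⟩
      rw [Prod.neg_mk, neg_sub, neg_sub]
  let pr : Γ →ₗ[ℤ] F := (LinearMap.fst ℤ F (Fin n → Q)).comp Γ.subtype
  have hpr : Function.Injective pr := by
    rw [injective_iff_map_eq_zero]
    rintro ⟨γ, hγ⟩ h0
    obtain ⟨m, y, m', y', h, h', hy, hy', rfl⟩ := hdiff γ hγ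
    have h1 : intExp m = intExp m' := congrArg Subtype.val (sub_eq_zero.mp h0)
    have h2 : m = m' := intExp_injective h1
    subst h2
    have h3 : y = y' := c.injective (hy.trans hy'.symm)
    subst h3
    simp
  have hfin : Module.Finite ℤ Γ := Module.Finite.of_injective pr hpr
  have htf : Module.IsTorsionFree ℤ Γ := Function.Injective.moduleIsTorsionFree pr hpr (by simp)
  have hrank : Module.finrank ℤ Γ ≤ Module.finrank ℤ F :=
    LinearMap.finrank_le_finrank_of_injective hpr
  refine le_trans ?_ hrank
  let γ := Module.finBasis ℤ Γ
  let M : Matrix (Fin (Module.finrank ℤ Γ)) (Fin n) Q :=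
    Matrix.of fun t s => (γ t : F × (Fin n → Q)).2 s
  have hinj : Function.Injective M.mulVecLin := by
    rw [injective_iff_map_eq_zero]
    intro a ha
    have hvan : ∀ z ∈ Γ, ∑ s, z.2 s * a s = 0 := by
      intro z hz
      let ev : F × (Fin n → Q) →ₗ[ℤ] Q :=
        { toFun := fun z => ∑ s, z.2 s * a s
          map_add' := fun z w => by simp [add_mul, Finset.sum_add_distrib]
          map_smul' := fun r z => by simp [← Finset.mul_sum, mul_assoc] }
      have h1 : ev.comp Γ.subtype = 0 := by
        refine γ.ext fun t => ?_
        exact congrFun ha t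
      exact LinearMap.congr_fun h1 ⟨z, hz⟩
    obtain ⟨b, hb⟩ := IsLocalization.exist_integer_multiples_of_finite
      (nonZeroDivisors (MvPowerSeries (ι ⊕ κ) K)) a
    choose a' ha' using hb
    let D' : T →+ MvPowerSeries (ι ⊕ κ) K := ∑ s, (AddMonoidHom.mulLeft (a' s)).comp (D s)
    have hD' : ∀ x, D' x = ∑ s, a' s * D s x := fun x => by simp [D']
    have hzero : ∀ x, D' x = 0 := by
      refine c.derivation_eq_zero (c.restrict {i, j}).toRingHom
        (fun x hx => c.one_le_order_restrict _ hx) D' ?_ ?_ ?_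
      · intro x y
        change _ = c.restrict {i, j} x * _ + c.restrict {i, j} y * _
        rw [hD', hD', hD', Finset.mul_sum, Finset.mul_sum, ← Finset.sum_add_distrib]
        exact Finset.sum_congr rfl fun s _ => by rw [hDL]; ring
      · intro r x
        rw [hD', hD', Finset.smul_sum]
        exact Finset.sum_congr rfl fun s _ => by rw [hDK, mul_smul_comm]
      · intro m y hy
        by_cases hm : intExp m ∈ F
        · have h1 := hvan _ (Submodule.subset_span ⟨m, y, hm, hy, rfl⟩)
          simp only [φ] at h1
          have h2 : algebraMap _ Q (D' y) = 0 := by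
            rw [hD', map_sum]
            calc _ = algebraMap _ Q (b : MvPowerSeries (ι ⊕ κ) K) *
              algebraMap _ Q (monomial m (1 : K)) *
                    ∑ s, algebraMap _ Q (D s y) / algebraMap _ Q (monomial m (1 : K)) * a s := by
                  rw [Finset.mul_sum]
                  refine Finset.sum_congr rfl fun s _ => ?_
                  rw [map_mul, ha', Algebra.smul_def]
                  have := hmon m
                  field_simp
              _ = 0 := by rw [h1, mul_zero]
          rwa [IsFractionRing.to_map_eq_zero_iff] at h2
        · rw [hD']
          have hmL : intExp m ∈ c.L := c.isSupp y m (by rw [hy]; simp)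
          have h3 : m (Sum.inl i) ≠ 0 ∨ m (Sum.inl j) ≠ 0 := by
            by_contra hcon
            push Not at hcon
            apply hm
            refine ⟨hmL, ?_⟩
            rintro _ ⟨k, (rfl | rfl), rfl⟩
            · simpa using hcon.1
            · simpa using hcon.2
          refine Finset.sum_eq_zero fun s _ => ?_
          rcases h3 with h3 | h3
          · rw [hDi s y, mul_zero]
            rw [c.mem_prime, c.restrict_apply, hy, kill_monomial_of_neg]
            simpa using h3
          · rw [hDj s y, mul_zero]
            rw [c.mem_prime, c.restrict_apply, hy, kill_monomial_of_neg]
            simpa using h3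
    ext1 s
    have h4 := hzero (x s)
    rw [hD'] at h4
    simp only [hx] at h4
    rw [Finset.sum_eq_single s (fun t _ ht => by rw [if_neg ht, mul_zero]) (by simp), if_pos rfl]
      at h4
    have h5 := (mul_eq_zero.mp h4).resolve_right hg
    have h6 := ha' s
    rw [h5, map_zero, Algebra.smul_def, eq_comm, mul_eq_zero] at h6
    refine h6.resolve_left ?_
    rw [IsFractionRing.to_map_eq_zero_iff]
    exact nonZeroDivisors.ne_zero b.2
  have := card_le_of_injective _ _ hinj
  simpa using this

include hd hs hE in
/-- If the boundary components indexed by `E` are the formal branches of `Spec B`, then `Spec B` is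
not smooth where two of them meet: any coordinate system degenerates there. -/
theorem CoordinateSystem.restrict_pair_eq_zero [Finite ι] [Finite κ] {i j : ι} (hi : i ∈ E)
    (hj : j ∈ E) (hij : i ≠ j) {g : B} (S : CoordinateSystem K B g) (a : A)
    (ha : algebraMap A B a = g) : c.restrict {i, j} (algebraMap A T a) = 0 := by
  by_contra hne
  -- extended derivations kill the boundary primes
  have hder : ∀ i ∈ E, ∃ D : Fin S.n → T →+ MvPowerSeries (ι ⊕ κ) K,
      (∀ s, ∀ (a b : A), algebraMap A B b = S.der s (algebraMap A B a) →
        D s (algebraMap A T a) = c.restrict {i} (algebraMap A T b)) ∧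
      (∀ s x y, D s (x * y) = c.restrict {i} x * D s y + c.restrict {i} y * D s x) ∧
      (∀ s (r : K) x, D s (r • x) = r • D s x) ∧ ∀ s, ∀ x ∈ c.prime i, D s x = 0 := by
    intro i hi
    obtain ⟨ρ, hρ⟩ := exists_restrict_quotient c (A := A) hs (E := {i})
      (restrict_eq_zero_of_mem_ker c hE hi (Set.mem_singleton i))
    choose D hDA hDL hDK using fun s => exists_derivation_extension c hd ρ hρ (S.der s)
    refine ⟨D, fun s a b hab => by rw [hDA, ← hab, hρ], hDL, hDK, fun s x hx => ?_⟩
    obtain ⟨w, hwi, hwj, -, hwL⟩ := c.facet i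
    obtain ⟨y, hy⟩ := c.exists_monomial hwL
    have h1 : x * y ∈ ⨅ i ∈ E, c.prime i := by
      rw [Ideal.mem_iInf]
      intro k
      rw [Ideal.mem_iInf]
      intro hk
      by_cases hki : k = i
      · subst hki; exact Ideal.mul_mem_right _ _ hx
      · refine Ideal.mul_mem_left _ _ ?_
        rw [c.mem_prime, c.restrict_apply, hy, kill_monomial_of_neg]
        have := hwj k hki
        simp; omega
    have h2 : ∀ z ∈ ⨅ i ∈ E, c.prime i, D s z = 0 := by
      intro z hz
      rw [← hE] at hz
      have hres : ∀ u ∈ (RingHom.ker (algebraMap A B)).map (algebraMap A T),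
          c.restrict {i} u = 0 := fun u hu => by
        rw [hE, Ideal.mem_iInf] at hu
        exact (Ideal.mem_iInf.mp (hu i)) hi
      refine Submodule.span_induction (p := fun z _ => D s z = 0) ?_ (map_zero _) ?_ ?_ hz
      · rintro _ ⟨a, haker, rfl⟩
        rw [hDA, (show algebraMap A B a = 0 from haker), map_zero, map_zero]
      · intro u v _ _ hu hv
        rw [map_add, hu, hv, add_zero]
      · intro r u hu' hu
        rw [smul_eq_mul, hDL, hu, hres u hu', mul_zero, zero_mul, add_zero]
    have h3 := h2 _ h1
    rw [hDL, c.mem_prime.mp hx, zero_mul, zero_add] at h3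
    refine (mul_eq_zero.mp h3).resolve_left ?_
    rw [c.restrict_apply, hy, kill_monomial_of_pos (by simp [hwi])]
    intro h4
    have := congrArg (coeff w) h4
    simp at this
  obtain ⟨D, hDA, hDL, hDK, hD0⟩ := hder i hi
  obtain ⟨D', hDA', hDL', hDK', hD0'⟩ := hder j hj
  choose xA hxA using fun j => hs (S.x j)
  have hne' : c.restrict {i} (algebraMap A T a) ≠ 0 := by
    intro h
    apply hne
    have : ({i, j} : Set ι) = {j} ∪ {i} := by rw [Set.pair_comm, Set.insert_eq]
    rw [this, ← c.restrict_restrict, h, map_zero]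
  have hle1 : Module.finrank ℤ (c.face {i}) ≤ S.n := by
    obtain ⟨ρ, hρ⟩ := exists_restrict_quotient c (A := A) hs (E := {i})
      (restrict_eq_zero_of_mem_ker c hE hi (Set.mem_singleton i))
    exact S.finrank_face_le c hd hs hE hi ρ hρ (by rwa [← ha, hρ])
  have e1 : ({i, j} : Set ι) = {j} ∪ {i} := by rw [Set.pair_comm, Set.insert_eq]
  have e2 : ({i, j} : Set ι) = {i} ∪ {j} := Set.insert_eq _ _
  let D'' : Fin S.n → T →+ MvPowerSeries (ι ⊕ κ) K := fun s =>
    (kill K (Sum.inl '' {j})).toRingHom.toAddMonoidHom.comp (D s)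
  have hD'' : ∀ s x, D'' s x = kill K (Sum.inl '' {j}) (D s x) := fun _ _ => rfl
  let D''' : Fin S.n → T →+ MvPowerSeries (ι ⊕ κ) K := fun s =>
    (kill K (Sum.inl '' {i})).toRingHom.toAddMonoidHom.comp (D' s)
  have hD''' : ∀ s x, D''' s x = kill K (Sum.inl '' {i}) (D' s x) := fun _ _ => rfl
  have hL'' : ∀ s x y, D'' s (x * y)
      = c.restrict {i, j} x * D'' s y + c.restrict {i, j} y * D'' s x := by
    intro s x y
    rw [hD'', hD'', hD'', hDL, map_add, map_mul, map_mul, c.restrict_restrict,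
      c.restrict_restrict, e1]
  have hL''' : ∀ s x y, D''' s (x * y)
      = c.restrict {i, j} x * D''' s y + c.restrict {i, j} y * D''' s x := by
    intro s x y
    rw [hD''', hD''', hD''', hDL', map_add, map_mul, map_mul, c.restrict_restrict,
      c.restrict_restrict, e2]
  have heq : ∀ s x, D'' s x = D''' s x := by
    intro s
    refine derivation_ext hd (c.restrict {i, j}).toRingHom
      (fun x hx => c.one_le_order_restrict _ hx) (D'' s) (D''' s) (hL'' s) (hL''' s) ?_
    intro a
    obtain ⟨b, hb⟩ := hs (S.der s (algebraMap A B a))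
    rw [hD'', hD''', hDA s a b hb, hDA' s a b hb, c.restrict_restrict, c.restrict_restrict,
      ← e1, ← e2]
  have hle2 := le_finrank_face_pair c (FractionRing (MvPowerSeries (ι ⊕ κ) K)) D'' hL''
    (fun s r x => by rw [hD'', hDK, map_smul, ← hD''])
    (fun s x hx => by rw [hD'', hD0 s x hx, map_zero])
    (fun s x hx => by rw [heq, hD''', hD0' s x hx, map_zero])
    (fun t => algebraMap A T (xA t)) (c.restrict {i, j} (algebraMap A T a)) hne (by
      intro s t
      split_ifs with hst
      · rw [hD'', hDA s (xA t) a (by rw [hxA, S.der_x, if_pos hst, ha]), c.restrict_restrict, e1]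
      · rw [hD'', hDA s (xA t) 0 (by rw [hxA, S.der_x, if_neg hst, map_zero]), map_zero,
          map_zero, map_zero])
  exact absurd (hle1.trans hle2) (not_le.mpr (c.finrank_face_pair_lt hij))

end Crossing

/-! ### Differentials of fields and of discrete valuation rings over a perfect field -/

section Kaehler

open KaehlerDifferential TensorProduct

open scoped IntermediateField.algebraAdjoinAdjoin in
/-- The differentials of a separating transcendence basis form a basis of the differentials. -/
lemma exists_basis_kaehlerDifferential {K L ι : Type u} [Field K] [Field L] [Algebra K L]
    {v : ι → L} (hb : AlgebraicIndependent K v)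
    [Algebra.IsSeparable (IntermediateField.adjoin K (Set.range v)) L] :
    ∃ b : Module.Basis ι L (Ω[L⁄K]), ∀ i, b i = D K L (v i) := by
  let P := MvPolynomial ι K
  let R₀ := Algebra.adjoin K (Set.range v)
  let F := IntermediateField.adjoin K (Set.range v)
  let _ : Algebra P R₀ := hb.aevalEquiv.toRingEquiv.toRingHom.toAlgebra
  let _ : Algebra P L := ((algebraMap R₀ L).comp (algebraMap P R₀)).toAlgebra
  have : IsScalarTower P R₀ L := IsScalarTower.of_algebraMap_eq fun _ => rfl
  have hv : ∀ p : P, algebraMap P L p = MvPolynomial.aeval v p := fun p => rfl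
  have : IsScalarTower K P L := IsScalarTower.of_algebraMap_eq fun a => by
    rw [hv, MvPolynomial.algebraMap_eq, MvPolynomial.aeval_C]
  have h1 : Algebra.FormallyEtale P R₀ :=
    .of_equiv (AlgEquiv.ofBijective (Algebra.ofId P R₀) hb.aevalEquiv.bijective)
  have h2 : Algebra.FormallyEtale R₀ F := .of_isLocalization (nonZeroDivisors _)
  have h3 : Algebra.FormallyEtale F L := Algebra.FormallyEtale.of_isSeparable _ L
  have h4 : Algebra.FormallyEtale R₀ L := .comp R₀ F L
  have h5 : Algebra.FormallyEtale P L := .comp P R₀ L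
  refine ⟨((mvPolynomialBasis K ι).baseChange L).map
    (tensorKaehlerEquivOfFormallyEtale K P L), fun i => ?_⟩
  rw [Module.Basis.map_apply, Module.Basis.baseChange_apply, mvPolynomialBasis_apply,
    tensorKaehlerEquivOfFormallyEtale_apply, mapBaseChange_tmul, one_smul, map_D, hv,
    MvPolynomial.aeval_X]

/-- A finitely generated extension of a perfect field has a finite separating transcendence basis,
whose differentials form a basis. -/
lemma exists_isTranscendenceBasis_basis (K L : Type u) [Field K] [Field L] [Algebra K L]
    [PerfectField K] [Algebra.EssFiniteType K L] :
    ∃ (s : Finset L) (b : Module.Basis s L (Ω[L⁄K])),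
      IsTranscendenceBasis K ((↑) : s → L) ∧ ∀ i, b i = D K L (i : L) := by
  obtain ⟨s, hs, H⟩ := exists_isTranscendenceBasis_and_isSeparable_of_perfectField K L
  have : Algebra.IsSeparable (↥(IntermediateField.adjoin K (Set.range ((↑) : s → L)))) L := by
    convert! H <;> simp
  obtain ⟨b, hb⟩ := exists_basis_kaehlerDifferential hs.1
  exact ⟨s, b, hs, hb⟩

/-- Algebraically independent elements are at most as many as the rank of the differentials. -/
lemma card_le_finrank_kaehlerDifferential {K L : Type u} [Field K] [Field L] [Algebra K L]
    [PerfectField K] [Algebra.EssFiniteType K L] {ι : Type u} [Fintype ι] {v : ι → L}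
    (hv : AlgebraicIndependent K v) : Fintype.card ι ≤ Module.finrank L (Ω[L⁄K]) := by
  obtain ⟨s, b, hs, -⟩ := exists_isTranscendenceBasis_basis K L
  have h1 := hv.lift_cardinalMk_le_trdeg
  rw [← hs.lift_cardinalMk_eq_trdeg] at h1
  rw [Module.finrank_eq_card_basis b]
  simpa using h1

end Kaehler

section DVR

open KaehlerDifferential TensorProduct IsLocalRing

variable {K O : Type u} [Field K] [CommRing O] [Algebra K O] [IsLocalRing O] [IsNoetherianRing O]

/-- In a Noetherian local ring with principal maximal ideal `(π)`, every nonzero element is a unit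
times a power of `π`. -/
lemma exists_eq_unit_mul_pow {π : O} (hπ : maximalIdeal O = Ideal.span {π}) {x : O} (hx : x ≠ 0) :
    ∃ (u : Oˣ) (n : ℕ), x = u * π ^ n := by
  have h1 : ∃ n, x ∉ maximalIdeal O ^ n := by
    by_contra! h
    have := Ideal.iInf_pow_eq_bot_of_isLocalRing (maximalIdeal O) (maximalIdeal.isMaximal O).ne_top
    exact hx (by rw [← Ideal.mem_bot, ← this, Ideal.mem_iInf]; exact h)
  classical
  have h2 : Nat.find h1 ≠ 0 := by
    intro h
    have := Nat.find_spec h1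
    rw [h] at this
    simp at this
  obtain ⟨n, hn⟩ := Nat.exists_eq_succ_of_ne_zero h2
  have h3 : x ∈ maximalIdeal O ^ n := by
    by_contra h
    have := Nat.find_min' h1 h
    omega
  have h4 : x ∉ maximalIdeal O ^ (n + 1) := by
    have := Nat.find_spec h1
    rwa [hn] at this
  rw [hπ, Ideal.span_singleton_pow, Ideal.mem_span_singleton'] at h3
  obtain ⟨a, ha⟩ := h3
  have hu : IsUnit a := by
    by_contra hu
    apply h4
    rw [← ha, pow_succ']
    refine Ideal.mul_mem_mul ((mem_maximalIdeal a).mpr hu) ?_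
    rw [hπ, Ideal.span_singleton_pow]
    exact Ideal.mem_span_singleton_self _
  exact ⟨hu.unit, n, ha.symm⟩

lemma isDomain_of_maximalIdeal_eq_span {π : O} (hπ : maximalIdeal O = Ideal.span {π})
    (h0 : π ∈ nonZeroDivisors O) : IsDomain O := by
  have : NoZeroDivisors O := by
    refine ⟨fun {a b} hab => ?_⟩
    by_contra! h
    obtain ⟨u, n, rfl⟩ := exists_eq_unit_mul_pow hπ h.1
    obtain ⟨v, m, rfl⟩ := exists_eq_unit_mul_pow hπ h.2
    have h1 : (π ^ (n + m)) * (u * v : Oˣ) = 0 := by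
      rw [← hab]; push_cast; ring
    rw [Units.mul_left_eq_zero] at h1
    exact nonZeroDivisors.ne_zero (pow_mem h0 (n + m)) h1
  exact NoZeroDivisors.to_isDomain _

omit [IsNoetherianRing O] in
/-- Lifts of algebraically independent residues are algebraically independent together with a
uniformizer. -/
lemma algebraicIndependent_option {ι : Type u} {π : O} (hπ : maximalIdeal O = Ideal.span {π})
    (h0 : π ∈ nonZeroDivisors O) {y : ι → O}
    (hy : AlgebraicIndependent K fun i => residue O (y i)) :
    AlgebraicIndependent K (fun o : Option ι => o.elim π y) := by
  have hres : ∀ p : MvPolynomial ι K, residue O (MvPolynomial.aeval y p)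
      = MvPolynomial.aeval (fun i => residue O (y i)) p := by
    intro p
    have := MvPolynomial.comp_aeval_apply (f := y) (IsScalarTower.toAlgHom K O (ResidueField O)) p
    exact this
  have hy' : AlgebraicIndependent K y := by
    rw [algebraicIndependent_iff]
    intro p hp
    refine (algebraicIndependent_iff.mp hy) p ?_
    rw [← hres, hp, map_zero]
  rw [hy'.option_iff_transcendental]
  have hS : ∀ a : Algebra.adjoin K (Set.range y), (a : O) ∈ maximalIdeal O → a = 0 := by
    rintro ⟨a, ha⟩ ham
    rw [Algebra.adjoin_range_eq_range_aeval] at ha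
    obtain ⟨p, rfl⟩ := ha
    have h1 : residue O (MvPolynomial.aeval y p) = 0 := (residue_eq_zero_iff _).mpr ham
    rw [hres] at h1
    have h2 := (algebraicIndependent_iff.mp hy) p h1
    ext1
    simp [h2]
  have key : ∀ n, ∀ q : Polynomial (Algebra.adjoin K (Set.range y)), q.natDegree ≤ n →
      Polynomial.aeval π q = 0 → q = 0 := by
    intro n
    induction n with
    | zero =>
      intro q hq h
      rw [Polynomial.eq_C_of_natDegree_le_zero hq, Polynomial.aeval_C] at h
      rw [Polynomial.eq_C_of_natDegree_le_zero hq, hS (q.coeff 0) (by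
        change algebraMap (Algebra.adjoin K (Set.range y)) O (q.coeff 0) ∈ _
        rw [h]; exact zero_mem _), map_zero]
    | succ n ih =>
      intro q hq h
      have h1 := q.divX_mul_X_add
      have h2 : Polynomial.aeval π q.divX * π + (q.coeff 0 : O) = 0 := by
        rw [← h]
        conv_rhs => rw [← h1]
        simp
      have h3 : q.coeff 0 = 0 := by
        refine hS _ ?_
        rw [eq_neg_of_add_eq_zero_right h2, neg_mem_iff, hπ]
        exact Ideal.mul_mem_left _ _ (Ideal.mem_span_singleton_self _)
      rw [h3, ZeroMemClass.coe_zero, add_zero] at h2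
      have h4 := (mem_nonZeroDivisors_iff.mp h0).2 _ h2
      have h5 := ih q.divX (by rw [Polynomial.natDegree_divX_eq_natDegree_tsub_one]; omega) h4
      rw [← h1, h5, h3]; simp
  rw [transcendental_iff]
  exact fun q hq => key _ q le_rfl hq

omit [IsNoetherianRing O] in
/-- The differentials of lifts of a generating set of residue differentials, together with that of
a uniformizer, generate the differentials. -/
lemma span_range_D_option [Module.Finite O (Ω[O⁄K])] {ι : Type u} {π : O}
    (hπ : maximalIdeal O = Ideal.span {π}) {y : ι → O}
    (hy : Submodule.span (ResidueField O)
      (Set.range fun i => D K (ResidueField O) (residue O (y i))) = ⊤) :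
    Submodule.span O (Set.range fun o : Option ι => D K O (o.elim π y)) = ⊤ := by
  rw [← IsLocalRing.map_tensorProduct_mk_eq_top, eq_top_iff]
  set k := ResidueField O with hk
  set N := (Submodule.span O (Set.range fun o : Option ι => D K O (o.elim π y))).map
    (TensorProduct.mk O k (Ω[O⁄K]) 1) with hN
  have hsur : Function.Surjective (algebraMap O k) := residue_surjective
  have hNk : ∀ (a : k), ∀ z ∈ N, a • z ∈ N := by
    intro a z hz
    obtain ⟨a, rfl⟩ := hsur a
    rw [algebraMap_smul]
    exact Submodule.smul_mem _ _ hz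
  have hND : ∀ o : Option ι, (1 : k) ⊗ₜ[O] D K O (o.elim π y) ∈ N := fun o =>
    ⟨_, Submodule.subset_span ⟨o, rfl⟩, rfl⟩
  have hker : ∀ z, mapBaseChange K O k z = 0 → z ∈ N := by
    intro z hz
    obtain ⟨w, rfl⟩ := (exact_kerCotangentToTensor_mapBaseChange K O k hsur z).mp hz
    obtain ⟨⟨w, hw⟩, rfl⟩ := Ideal.toCotangent_surjective _ w
    rw [kerCotangentToTensor_toCotangent]
    have hw' : w ∈ maximalIdeal O := (residue_eq_zero_iff _).mp hw
    rw [hπ, Ideal.mem_span_singleton'] at hw'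
    obtain ⟨u, rfl⟩ := hw'
    simp only [Derivation.leibniz, tmul_add, tmul_smul]
    have hπ0 : (algebraMap O k π) = 0 := by
      refine (residue_eq_zero_iff _).mpr ?_
      rw [hπ]; exact Ideal.mem_span_singleton_self _
    refine Submodule.add_mem _ (Submodule.smul_mem _ _ (hND none)) ?_
    rw [smul_tmul', ← Algebra.algebraMap_eq_smul_one, hπ0, zero_tmul]
    exact zero_mem _
  intro z _
  have h1 : mapBaseChange K O k z ∈ Submodule.span k
      (Set.range fun i => D K k (residue O (y i))) := by rw [hy]; trivial
  have h2 : ∀ w ∈ Submodule.span k (Set.range fun i => D K k (residue O (y i))),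
      ∃ n ∈ N, mapBaseChange K O k n = w := by
    intro w hw
    refine Submodule.span_induction ?_ ?_ ?_ ?_ hw
    · rintro _ ⟨i, rfl⟩
      refine ⟨_, hND (some i), ?_⟩
      rw [mapBaseChange_tmul, one_smul, map_D]
      rfl
    · exact ⟨0, zero_mem _, map_zero _⟩
    · rintro _ _ _ _ ⟨n, hn, rfl⟩ ⟨m, hm, rfl⟩
      exact ⟨n + m, add_mem hn hm, map_add _ _ _⟩
    · rintro a _ _ ⟨n, hn, rfl⟩
      exact ⟨a • n, hNk _ _ hn, map_smul _ _ _⟩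
  obtain ⟨n, hn, hnz⟩ := h2 _ h1
  have h3 := hker (z - n) (by rw [map_sub, hnz, sub_self])
  simpa using add_mem h3 hn

/-- The differentials of a discrete valuation ring essentially of finite type over a perfect field
are free. -/
lemma free_kaehlerDifferential_of_maximalIdeal_eq_span [PerfectField K] [Algebra.EssFiniteType K O]
    {π : O} (hπ : maximalIdeal O = Ideal.span {π}) (h0 : π ∈ nonZeroDivisors O) :
    Module.Free O (Ω[O⁄K]) := by
  have := isDomain_of_maximalIdeal_eq_span hπ h0
  have : Algebra.EssFiniteType K (ResidueField O) := Algebra.EssFiniteType.comp K O _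
  obtain ⟨s, b, hs, hb⟩ := exists_isTranscendenceBasis_basis K (ResidueField O)
  choose y hy using fun i : s => residue_surjective (i : ResidueField O)
  have hspan := span_range_D_option (K := K) hπ (y := y) (by
    rw [← b.span_eq]
    congr 1
    ext i
    simp [hb, hy])
  have hind : AlgebraicIndependent K (fun o : Option s => o.elim π y) :=
    algebraicIndependent_option hπ h0 (by simpa only [hy] using hs.1)
  let L := FractionRing O
  have : Algebra.EssFiniteType O L := Algebra.EssFiniteType.of_isLocalization L (nonZeroDivisors O)
  have : Algebra.EssFiniteType K L := Algebra.EssFiniteType.comp K O L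
  have hindL : AlgebraicIndependent K (fun o : Option s => algebraMap O L (o.elim π y)) :=
    hind.map' (f := IsScalarTower.toAlgHom K O L) (IsFractionRing.injective O L)
  have hcard := card_le_finrank_kaehlerDifferential hindL
  have hspanL : ⊤ ≤ Submodule.span L
      (Set.range fun o : Option s => D K L (algebraMap O L (o.elim π y))) := by
    rw [← span_range_map_derivation_of_isLocalization K O L (nonZeroDivisors O), Submodule.span_le]
    rintro _ ⟨x, rfl⟩
    have hx : D K O x ∈ Submodule.span O (Set.range fun o : Option s => D K O (o.elim π y)) := by
      rw [hspan]; trivial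
    have h1 := Submodule.mem_map_of_mem (f := KaehlerDifferential.map K K O L) hx
    rw [Submodule.map_span, map_D, ← Set.range_comp] at h1
    simp only [Function.comp_def, map_D] at h1
    change KaehlerDifferential.map K K O L (D K O x) ∈ _
    rw [map_D]
    exact Submodule.span_le_restrictScalars O L _ h1
  have hlin := linearIndependent_of_top_le_span_of_card_le_finrank hspanL hcard
  have hlinO : LinearIndependent O (fun o : Option s => D K O (o.elim π y)) := by
    have h1 : LinearIndependent O (fun o : Option s => D K L (algebraMap O L (o.elim π y))) :=
      hlin.restrict_scalars (by
        intro a b hab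
        simpa [Algebra.smul_def] using hab)
    have h2 : (fun o : Option s => D K L (algebraMap O L (o.elim π y)))
        = (KaehlerDifferential.map K K O L) ∘ (fun o : Option s => D K O (o.elim π y)) := by
      ext o; simp
    rw [h2] at h1
    exact LinearIndependent.of_comp _ h1
  exact Module.Free.of_basis (Module.Basis.mk hlinO hspan.ge)

omit [IsNoetherianRing O] in
lemma free_kaehlerDifferential_of_maximalIdeal_eq_bot (h : maximalIdeal O = ⊥) :
    Module.Free O (Ω[O⁄K]) := by
  let _ := (isField_iff_maximalIdeal_eq.mpr h).toField
  exact Module.Free.of_divisionRing O _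

end DVR

section Coordinates

open KaehlerDifferential

/-- If the differentials of a local ring of `Spec B` are free, there is a coordinate system near
that point. -/
lemma exists_coordinateSystem {K B : Type u} [Field K] [CommRing B] [Algebra K B]
    [Algebra.EssFiniteType K B] [IsNoetherianRing B] (𝔮 : Ideal B) [𝔮.IsPrime]
    (hfree : Module.Free (Localization.AtPrime 𝔮) (Ω[Localization.AtPrime 𝔮⁄K])) :
    ∃ g ∉ 𝔮, Nonempty (CoordinateSystem K B g) := by
  classical
  set O := Localization.AtPrime 𝔮
  have : Algebra.EssFiniteType B O := Algebra.EssFiniteType.of_isLocalization O 𝔮.primeCompl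
  have : Algebra.EssFiniteType K O := Algebra.EssFiniteType.comp K B O
  have : IsNoetherianRing O := IsLocalization.isNoetherianRing 𝔮.primeCompl O inferInstance
  have : Module.FinitePresentation O (Ω[O⁄K]) := Module.finitePresentation_of_finite O _
  have : Module.FinitePresentation B (Ω[B⁄K]) := Module.finitePresentation_of_finite B _
  have hspan : Submodule.span O (Set.range fun x : B => D K O (algebraMap B O x)) = ⊤ := by
    rw [← span_range_map_derivation_of_isLocalization K B O 𝔮.primeCompl]
    congr 1
    ext
    simp
  obtain ⟨κ, a, b', hb'⟩ := Module.exists_basis_of_span_of_flat (R := O)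
    (fun x : B => D K O (algebraMap B O x)) hspan
  have : Finite κ := Module.Finite.finite_basis b'
  obtain ⟨n, ⟨e⟩⟩ := Finite.exists_equiv_fin κ
  let b := b'.reindex e
  let x : Fin n → B := fun j => a (e.symm j)
  have hb : ∀ j, b j = D K O (algebraMap B O (x j)) := fun j => by
    rw [Module.Basis.reindex_apply, hb']
  let f : Ω[B⁄K] →ₗ[B] Ω[O⁄K] := KaehlerDifferential.map K K B O
  have hf : ∀ y, f (D K B y) = D K O (algebraMap B O y) := fun y => map_D K K B O y
  have hloc : IsLocalizedModule 𝔮.primeCompl f := isLocalizedModule_map K B O 𝔮.primeCompl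
  -- the coordinate functionals of the basis, and the expansion in the basis, spread out up to
  -- denominators, which are collected in `g`
  choose h s hs using fun j => Module.FinitePresentation.exists_lift_of_isLocalizedModule
    𝔮.primeCompl (Algebra.linearMap B O) ((b.coord j).restrictScalars B ∘ₗ f)
  have hs' : ∀ j m, algebraMap B O (h j m) = algebraMap B O (s j) * b.coord j (f m) := by
    intro j m
    have := LinearMap.congr_fun (hs j) m
    simp only [LinearMap.comp_apply, Algebra.linearMap_apply, LinearMap.smul_apply,
      LinearMap.restrictScalars_apply] at this
    rw [this, Submonoid.smul_def, Algebra.smul_def]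
  let σ : B := ∏ i, (s i : B)
  have hσ : σ ∈ 𝔮.primeCompl := Submonoid.prod_mem _ fun i _ => (s i).2
  let h' : Fin n → Ω[B⁄K] →ₗ[B] B := fun j => (∏ i ∈ Finset.univ.erase j, (s i : B)) • h j
  have hh' : ∀ j m, algebraMap B O (h' j m) = algebraMap B O σ * b.coord j (f m) := by
    intro j m
    rw [LinearMap.smul_apply, smul_eq_mul, map_mul, hs', ← mul_assoc, ← map_mul,
      mul_comm _ (s j : B),
      Finset.mul_prod_erase _ (fun i => (s i : B)) (Finset.mem_univ j)]
  have h1 : ∀ p : Fin n × Fin n, ∃ t : 𝔮.primeCompl,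
      (t : B) * h' p.1 (D K B (x p.2)) = t * if p.1 = p.2 then σ else 0 := by
    rintro ⟨i, j⟩
    refine IsLocalization.exists_of_eq (S := O) ?_
    rw [hh', hf, ← hb, Module.Basis.coord_apply, Module.Basis.repr_self, Finsupp.single_apply]
    by_cases hij : i = j
    · rw [if_pos hij.symm, if_pos hij, mul_one]
    · rw [if_neg (Ne.symm hij), if_neg hij, mul_zero, map_zero]
  choose t ht using h1
  let F : Ω[B⁄K] →ₗ[B] Ω[B⁄K] := ∑ j, (h' j).smulRight (D K B (x j))
  have hF : ∀ m, F m = ∑ j, h' j m • D K B (x j) := fun m => by simp [F]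
  obtain ⟨t₀, ht₀⟩ := Module.Finite.exists_smul_of_comp_eq_of_isLocalizedModule 𝔮.primeCompl f
    (σ • LinearMap.id) F (by
      refine LinearMap.ext fun m => ?_
      rw [LinearMap.comp_apply, LinearMap.comp_apply, hF, map_sum, LinearMap.smul_apply,
        LinearMap.id_apply, map_smul]
      conv_lhs => rw [← b.sum_repr (f m)]
      rw [Finset.smul_sum]
      refine Finset.sum_congr rfl fun j _ => ?_
      rw [map_smul, hf, ← hb, ← algebraMap_smul O (h' j m), hh', ← algebraMap_smul O σ, smul_smul]
      rfl)
  let τ : B := t₀ * ∏ p, (t p : B)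
  have hτ : τ ∈ 𝔮.primeCompl := mul_mem t₀.2 (Submonoid.prod_mem _ fun p _ => (t p).2)
  refine ⟨τ * σ, (mul_mem hτ hσ : τ * σ ∈ 𝔮.primeCompl),
    ⟨⟨n, x, fun j => (τ • h' j).compDer (D K B), ?_, ?_⟩⟩⟩
  · intro i j
    change τ • h' i (D K B (x j)) = _
    have h2 : τ = (t₀ * ∏ p ∈ Finset.univ.erase (i, j), (t p : B)) * t (i, j) := by
      simp only [τ]
      rw [mul_assoc, mul_comm _ (t (i, j) : B),
        Finset.mul_prod_erase _ (fun p => (t p : B)) (Finset.mem_univ _)]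
    rw [smul_eq_mul, h2, mul_assoc, ht (i, j)]
    split_ifs
    · ring
    · rw [mul_zero, mul_zero]
  · intro y
    have h2 : (t₀ : B) • σ • D K B y = (t₀ : B) • ∑ j, h' j (D K B y) • D K B (x j) := by
      rw [← hF]
      exact LinearMap.congr_fun ht₀ (D K B y)
    have h3 : τ = (∏ p, (t p : B)) * t₀ := mul_comm _ _
    calc (τ * σ) • D K B y = (∏ p, (t p : B)) • (t₀ : B) • σ • D K B y := by
          rw [h3, mul_smul, mul_smul]
      _ = τ • ∑ j, h' j (D K B y) • D K B (x j) := by rw [h2, h3, mul_smul]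
      _ = _ := by
          rw [Finset.smul_sum]
          exact Finset.sum_congr rfl fun j _ => by rw [smul_smul]; rfl

end Coordinates

/-! ### Normal boundary components are formally irreducible -/

section Codim

variable {B : Type u} [CommRing B]

/-- If `g` is a nonzerodivisor and `p = (g : a)` is prime with `a` not "integral over `g`", then
`p` becomes principal, generated by a nonzerodivisor, after localization at `p`. -/
lemma exists_maximalIdeal_eq_span [IsNoetherianRing B] {g a : B} (hg : g ∈ nonZeroDivisors B)
    (hint : ∀ P : Polynomial B, P.Monic → (P.scaleRoots g).eval a = 0 → a ∈ Ideal.span {g})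
    (ha : a ∉ Ideal.span {g}) (p : Ideal B) [p.IsPrime]
    (hp : ∀ y, y ∈ p ↔ y * a ∈ Ideal.span {g}) :
    ∃ π : Localization.AtPrime p, π ∈ nonZeroDivisors (Localization.AtPrime p) ∧
      IsLocalRing.maximalIdeal (Localization.AtPrime p) = Ideal.span {π} := by
  have hg' : ∀ x y, x * g = y * g → x = y :=
    fun x y h => (mul_cancel_right_mem_nonZeroDivisors hg).mp h
  have hgp : g ∈ p := (hp g).mpr (Ideal.mul_mem_right _ _ (Ideal.mem_span_singleton_self g))
  -- otherwise `a / g` maps the finitely generated ideal `p` to itself, and Cayley-Hamilton makes it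
  -- integral
  have hex : ∃ y ∈ p, ∃ u ∉ p, u * g = y * a := by
    by_contra! hcon
    have h1 : ∀ y : p, ∃ u : p, (u : B) * g = y * a := by
      rintro ⟨y, hy⟩
      obtain ⟨u, hu⟩ := Ideal.mem_span_singleton'.mp ((hp y).mp hy)
      refine ⟨⟨u, ?_⟩, hu⟩
      by_contra hup
      exact hcon y hy u hup hu
    choose φ hφ using h1
    let Φ : p →ₗ[B] p :=
      { toFun := φ
        map_add' := fun x y => Subtype.ext (hg' _ _ (by
          rw [hφ, Submodule.coe_add, Submodule.coe_add, add_mul, add_mul, hφ, hφ]))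
        map_smul' := fun r x => Subtype.ext (hg' _ _ (by
          rw [hφ, RingHom.id_apply, Submodule.coe_smul, Submodule.coe_smul, smul_eq_mul,
            smul_eq_mul, mul_assoc, mul_assoc, hφ])) }
    obtain ⟨P, hP, hPΦ⟩ := LinearMap.exists_monic_and_aeval_eq_zero B Φ
    apply ha
    refine hint P hP (hg' _ _ ?_)
    have hpow : ∀ n : ℕ, (((Φ ^ n) ⟨g, hgp⟩ : p) : B) * g ^ n = a ^ n * g := by
      intro n
      induction n with
      | zero => simp
      | succ n ih =>
        rw [pow_succ', Module.End.mul_apply, pow_succ' g, ← mul_assoc]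
        change ((φ ((Φ ^ n) ⟨g, hgp⟩) : p) : B) * g * g ^ n = _
        rw [hφ, mul_right_comm, ih]; ring
    have h2 := congrArg (Subtype.val) (LinearMap.congr_fun hPΦ ⟨g, hgp⟩)
    rw [Polynomial.aeval_eq_sum_range, LinearMap.sum_apply] at h2
    simp only [LinearMap.smul_apply, Submodule.coe_sum, Submodule.coe_smul, LinearMap.zero_apply,
      Submodule.coe_zero, smul_eq_mul] at h2
    rw [Polynomial.eval_eq_sum_range, Polynomial.natDegree_scaleRoots, zero_mul,
      ← zero_mul (g ^ P.natDegree), ← h2, Finset.sum_mul, Finset.sum_mul]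
    refine Finset.sum_congr rfl fun i hi => ?_
    have hi' : i ≤ P.natDegree := by simpa [Nat.lt_succ_iff] using hi
    rw [Polynomial.coeff_scaleRoots, mul_assoc, ← hpow, mul_assoc (P.coeff i)]
    conv_rhs => rw [← Nat.sub_add_cancel hi', pow_add]
    ring
  obtain ⟨y, hy, u, hu, huy⟩ := hex
  set O := Localization.AtPrime p
  have hunit : IsUnit (algebraMap B O u) := IsLocalization.map_units O (⟨u, hu⟩ : p.primeCompl)
  refine ⟨algebraMap B O y, ?_, ?_⟩
  · rw [mem_nonZeroDivisors_iff_right]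
    intro z hz
    obtain ⟨⟨w, s⟩, hw⟩ := IsLocalization.surj p.primeCompl z
    have h1 : algebraMap B O (w * y) = 0 := by
      rw [map_mul, ← hw, mul_right_comm, hz, zero_mul]
    obtain ⟨t, ht⟩ := (IsLocalization.map_eq_zero_iff p.primeCompl O _).mp h1
    have h2 : (t : B) * w * u = 0 := by
      apply hg'
      rw [mul_assoc, huy, zero_mul, ← mul_assoc, mul_assoc (t : B), ht, zero_mul]
    have h3 : algebraMap B O w = 0 := by
      rw [IsLocalization.map_eq_zero_iff p.primeCompl O]
      exact ⟨t * ⟨u, hu⟩, by rw [← h2]; change (t : B) * u * w = _; ring⟩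
    rw [h3] at hw
    exact ((IsLocalization.map_units O s).mul_left_eq_zero).mp hw
  · rw [← Localization.AtPrime.map_eq_maximalIdeal]
    refine le_antisymm (Ideal.map_le_iff_le_comap.mpr fun z hz => ?_) ?_
    · obtain ⟨v, hv⟩ := Ideal.mem_span_singleton'.mp ((hp z).mp hz)
      have h1 : z * u = v * y := by
        apply hg'
        rw [mul_assoc, huy, mul_assoc, mul_comm y g, ← mul_assoc v, hv]; ring
      rw [Ideal.mem_comap, Ideal.mem_span_singleton']
      refine ⟨algebraMap B O v * (hunit.unit⁻¹ : Oˣ), ?_⟩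
      rw [mul_right_comm, ← map_mul, ← h1, map_mul, mul_assoc, IsUnit.mul_val_inv, mul_one]
    · rw [Ideal.span_singleton_le_iff_mem]
      exact Ideal.mem_map_of_mem _ hy

/-- A localization of a reduced ring at a prime not meeting a subring over which everything is
integral up to units is a field. -/
lemma maximalIdeal_localization_eq_bot {B₀ : Type*} [CommRing B₀] [Algebra B₀ B]
    [IsReduced B] (hint : ∀ b : B, ∃ s : Bˣ, IsIntegral B₀ ((s : B) * b)) (q : Ideal B) [q.IsPrime]
    (hq : ∀ b : B₀, algebraMap B₀ B b ∈ q → b = 0) :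
    IsLocalRing.maximalIdeal (Localization.AtPrime q) = ⊥ := by
  set O := Localization.AtPrime q
  have : IsReduced O := inferInstanceAs (IsReduced (Localization q.primeCompl))
  rw [← Localization.AtPrime.map_eq_maximalIdeal, Ideal.map_eq_bot_iff_le_ker]
  intro b hb
  rw [RingHom.mem_ker]
  obtain ⟨s, P, hP, hPs⟩ := hint b
  set h := (s : B) * b with hh
  have hhq : h ∈ q := Ideal.mul_mem_left _ _ hb
  have hP0 : P ≠ 0 := by
    rintro rfl
    have h1 : (0 : B₀) = 1 := by
      rw [← Polynomial.leadingCoeff_zero]; exact hP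
    have h2 : (0 : B) = 1 := by rw [← map_zero (algebraMap B₀ B), h1, map_one]
    exact (Ideal.IsPrime.ne_top ‹_› ((Ideal.eq_top_iff_one q).mpr (h2 ▸ q.zero_mem)))
  obtain ⟨Q, hQ, hQ0⟩ := P.exists_eq_pow_rootMultiplicity_mul_and_not_dvd hP0 0
  rw [map_zero, sub_zero] at hQ hQ0
  rw [Polynomial.X_dvd_iff] at hQ0
  rw [hQ, Polynomial.eval₂_mul, Polynomial.eval₂_X_pow] at hPs
  have h1 : IsUnit (algebraMap B O (Q.eval₂ (algebraMap B₀ B) h)) := by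
    refine IsLocalization.map_units O (⟨_, fun hcon => hQ0 ?_⟩ : q.primeCompl)
    apply hq
    rw [← Q.divX_mul_X_add, Polynomial.eval₂_add, Polynomial.eval₂_mul, Polynomial.eval₂_X,
      Polynomial.eval₂_C] at hcon
    exact (Ideal.add_mem_iff_right _ (Ideal.mul_mem_left _ _ hhq)).mp hcon
  have h2 := congrArg (algebraMap B O) hPs
  rw [map_mul, map_zero, h1.mul_left_eq_zero, map_pow] at h2
  have h4 : algebraMap B O h = 0 := IsReduced.eq_zero _ ⟨_, h2⟩
  rw [hh, map_mul, (s.isUnit.map (algebraMap B O)).mul_right_eq_zero] at h4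
  exact h4

end Codim

section Unibranch

open IsLocalRing MvPowerSeries

variable {K A B : Type u} {T ι κ : Type*} [Field K] [PerfectField K] [CommRing T] [IsLocalRing T]
  [Algebra K T]
variable [CommRing A] [Algebra K A] [CommRing B] [Algebra K B] [Algebra A B] [IsScalarTower K A B]
variable [Algebra A T] [IsScalarTower K A T]

/-- If `B` is (a localization of a base change of) a normal domain, and the formal branches of
`Spec B` are boundary components of a toric chart, then there is only one branch. -/
theorem FormalChart.subsingleton_branches [Finite ι] [Finite κ] (c : FormalChart K T ι κ)
    [IsNoetherianRing A] [IsLocalRing A] [IsLocalHom (algebraMap A T)] [Module.Flat A T]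
    (hd : IsAdicDense (algebraMap A T))
    (hs : Function.Surjective (algebraMap A B)) {E : Set ι}
    (hE : (RingHom.ker (algebraMap A B)).map (algebraMap A T) = ⨅ i ∈ E, c.prime i)
    [Algebra.EssFiniteType K B] {B₀ : Type*} [CommRing B₀] [IsDomain B₀] [Algebra B₀ B]
    (hnzd : ∀ b : B₀, b ≠ 0 → algebraMap B₀ B b ∈ nonZeroDivisors B)
    (hunit : ∀ b : B, ∃ s : Bˣ, IsIntegral B₀ ((s : B) * b))
    (hIC : ∀ (a : B) (g : B₀), g ≠ 0 → ∀ P : Polynomial B, P.Monic →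
      (P.scaleRoots (algebraMap B₀ B g)).eval a = 0 → a ∈ Ideal.span {algebraMap B₀ B g}) :
    E.Subsingleton := by
  have hff : Module.FaithfullyFlat A T := Module.FaithfullyFlat.of_flat_of_isLocalHom
  have : IsNoetherianRing B := isNoetherianRing_of_surjective A B _ hs
  have hmemE : ∀ x, x ∈ ⨅ i ∈ E, c.prime i ↔ ∀ i ∈ E, x ∈ c.prime i := fun x => by
    simp only [Ideal.mem_iInf]
  have hcomap : ∀ a : A, algebraMap A T a ∈ ⨅ i ∈ E, c.prime i → algebraMap A B a = 0 := by
    intro a ha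
    rw [← hE] at ha
    have h1 : a ∈ ((RingHom.ker (algebraMap A B)).map (algebraMap A T)).comap (algebraMap A T) := ha
    rwa [Ideal.comap_map_eq_self_of_faithfullyFlat] at h1
  have hred : IsReduced B := by
    refine ⟨fun b ⟨n, hn⟩ => ?_⟩
    obtain ⟨a, rfl⟩ := hs b
    refine hcomap a ((hmemE _).mpr fun i hi => ?_)
    have h1 : algebraMap A T (a ^ n) ∈ ⨅ i ∈ E, c.prime i := by
      rw [← hE]
      exact Ideal.mem_map_of_mem _ (by rw [RingHom.mem_ker, map_pow]; exact hn)
    have h2 := (hmemE _).mp h1 i hi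
    rw [map_pow] at h2
    exact Ideal.IsPrime.mem_of_pow_mem inferInstance n h2
  intro i₀ hi₀ j₀ hj₀
  by_contra hij
  -- the ideal of functions vanishing where the branch `i₀` meets another branch
  let C₀ : Ideal A := ⨅ j ∈ E \ {i₀},
    RingHom.ker ((c.restrict {i₀, j}).toRingHom.comp (algebraMap A T))
  have hC₀ : ∀ a, a ∈ C₀ ↔ ∀ j ∈ E \ {i₀}, c.restrict {i₀, j} (algebraMap A T a) = 0 := fun a => by
    simp only [C₀, Ideal.mem_iInf]
    rfl
  have hC₀ker : RingHom.ker (algebraMap A B) ≤ C₀ := fun a ha => (hC₀ a).mpr fun j hj =>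
    restrict_eq_zero_of_mem_ker c hE hi₀ (by simp) a ha
  let C : Ideal B := C₀.map (algebraMap A B)
  have hC : ∀ a, algebraMap A B a ∈ C ↔ a ∈ C₀ := by
    intro a
    have : C.comap (algebraMap A B) = C₀ := by
      rw [Ideal.comap_map_of_surjective' _ hs, sup_eq_left]
      exact hC₀ker
    rw [← Ideal.mem_comap, this]
  have hcoord : ∀ g : B, Nonempty (CoordinateSystem K B g) → g ∈ C := by
    rintro g ⟨S⟩
    obtain ⟨a, rfl⟩ := hs g
    rw [hC, hC₀]
    intro j hj
    exact S.restrict_pair_eq_zero c hd hs hE hi₀ hj.1 (fun h => hj.2 h.symm) a rfl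
  -- this ideal meets the base ring
  have hCB : ∃ g : B₀, g ≠ 0 ∧ algebraMap B₀ B g ∈ C := by
    by_contra! hcon
    obtain ⟨q, hq, hCq, hdis⟩ := Ideal.exists_le_prime_disjoint C
      ((nonZeroDivisors B₀).map (algebraMap B₀ B)) (by
        rw [Set.disjoint_left]
        rintro _ hx ⟨b, hb, rfl⟩
        exact hcon b (nonZeroDivisors.ne_zero hb) hx)
    have hbot := maximalIdeal_localization_eq_bot (B₀ := B₀) hunit q (fun b hb => by
      by_contra hb0
      exact Set.disjoint_left.mp hdis hb ⟨b, mem_nonZeroDivisors_of_ne_zero hb0, rfl⟩)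
    obtain ⟨g, hgq, hg⟩ := exists_coordinateSystem q
      (free_kaehlerDifferential_of_maximalIdeal_eq_bot (K := K) hbot)
    exact hgq (hCq (hcoord g hg))
  obtain ⟨g₀, hg₀, hgC⟩ := hCB
  set g := algebraMap B₀ B g₀ with hgdef
  have hgn := hnzd g₀ hg₀
  obtain ⟨γ, hγ⟩ := hs g
  -- `γ` does not vanish on any branch
  have hγi : ∀ i ∈ E, c.restrict {i} (algebraMap A T γ) ≠ 0 := by
    intro i hi h0
    obtain ⟨w, hwi, hwj, -, hwL⟩ := c.facet i
    obtain ⟨y, hy⟩ := c.exists_monomial hwL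
    have h1 : y * algebraMap A T γ ∈ (RingHom.ker (algebraMap A B)).map (algebraMap A T) := by
      rw [hE, hmemE]
      intro j hj
      by_cases hji : j = i
      · subst hji; exact Ideal.mul_mem_left _ _ h0
      · refine Ideal.mul_mem_right _ _ ?_
        rw [c.mem_prime, c.restrict_apply, hy, kill_monomial_of_neg]
        have := hwj j hji
        simp; omega
    have h2 := mem_map_colon_of_flat h1
    have h3 : (RingHom.ker (algebraMap A B)).colon {γ} ≤ RingHom.ker (algebraMap A B) := by
      intro r hr
      rw [Submodule.mem_colon_singleton, smul_eq_mul, RingHom.mem_ker, map_mul, hγ] at hr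
      exact (mem_nonZeroDivisors_iff_right.mp hgn) _ hr
    have h4 := Ideal.map_mono (f := algebraMap A T) h3 h2
    rw [hE, hmemE] at h4
    have h5 := h4 i hi
    rw [c.mem_prime, c.restrict_apply, hy, kill_monomial_of_pos (by simp [hwi])] at h5
    have := congrArg (coeff w) h5
    simp at this
  -- splitting of elements of `C₀` along the branch `i₀` and the other branches
  have hsplit : ∀ a ∈ C₀, ∃ x y : T, algebraMap A T a = x + y ∧ x ∈ c.prime i₀ ∧
      ∀ j ∈ E, j ≠ i₀ → y ∈ c.prime j := by
    intro a ha
    obtain ⟨y, hy⟩ := (c.mem_range _).mp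
      (isSupp_kill (c.isSupp (algebraMap A T a)) (Sum.inl '' {i₀}))
    refine ⟨algebraMap A T a - y, y, by ring, ?_, fun j hj hji => ?_⟩
    · rw [c.mem_prime, map_sub, sub_eq_zero, c.restrict_apply, c.restrict_apply, hy, kill_kill,
        Set.union_self]
    · rw [c.mem_prime, c.restrict_apply, hy, kill_kill, ← Set.image_union, Set.union_comm]
      exact (hC₀ a).mp ha j ⟨hj, hji⟩
  obtain ⟨α, β, hαβ, hα, hβ⟩ := hsplit γ ((hC γ).mp (hγ ▸ hgC))
  let J : Ideal A := Ideal.span {γ} ⊔ RingHom.ker (algebraMap A B)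
  have hJT : J.map (algebraMap A T) = Ideal.span {algebraMap A T γ} ⊔ ⨅ i ∈ E, c.prime i := by
    rw [Ideal.map_sup, hE, Ideal.map_span, Set.image_singleton]
  have hαcolon : α ∈ (J.colon (C₀ : Set A)).map (algebraMap A T) := by
    refine mem_map_colon_ideal_of_flat fun a ha => ?_
    obtain ⟨x, y, hxy, hx, hy⟩ := hsplit a ha
    have h1 : α * algebraMap A T a = x * algebraMap A T γ + (α * y - x * β) := by
      rw [hxy, hαβ]; ring
    rw [h1, hJT]
    refine Submodule.add_mem_sup (Ideal.mul_mem_left _ _ (Ideal.mem_span_singleton_self _)) ?_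
    rw [hmemE]
    intro j hj
    by_cases hji : j = i₀
    · subst hji
      exact Ideal.sub_mem _ (Ideal.mul_mem_right _ _ hα) (Ideal.mul_mem_right _ _ hx)
    · exact Ideal.sub_mem _ (Ideal.mul_mem_left _ _ (hy j hj hji))
        (Ideal.mul_mem_left _ _ (hβ j hj hji))
  have hαJ : α ∉ J.map (algebraMap A T) := by
    intro hmem
    rw [hJT, Submodule.mem_sup] at hmem
    obtain ⟨u, hu, w, hw, huw⟩ := hmem
    obtain ⟨z, rfl⟩ := Ideal.mem_span_singleton'.mp hu
    rw [hmemE] at hw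
    have hconst : ∀ i, constantCoeff (c.restrict {i} z) = constantCoeff (c.Θ z) := fun i => by
      rw [c.restrict_apply, constantCoeff_kill]
    -- on the branch `i₀` the quotient vanishes, on the branch `j₀` it is one
    have h1 := congrArg (c.restrict {i₀}) huw
    rw [map_add, map_mul, c.mem_prime.mp (hw i₀ hi₀), c.mem_prime.mp hα, add_zero, mul_eq_zero,
      or_iff_left (hγi i₀ hi₀)] at h1
    have h2 := congrArg (c.restrict {j₀}) huw
    have h3 : c.restrict {j₀} (algebraMap A T γ) = c.restrict {j₀} α := by
      rw [hαβ, map_add, c.mem_prime.mp (hβ j₀ hj₀ (Ne.symm hij)), add_zero]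
    rw [map_add, map_mul, c.mem_prime.mp (hw j₀ hj₀), add_zero, ← h3,
      mul_eq_right₀ (hγi j₀ hj₀)] at h2
    have h4 := hconst i₀
    have h5 := hconst j₀
    rw [h1] at h4
    rw [h2, ← h4] at h5
    simp at h5
  -- hence some element of `B` is multiplied by `C` into `(g)` without lying in it
  have hex : ∃ a : B, a ∉ Ideal.span {g} ∧ ∀ h ∈ C, h * a ∈ Ideal.span {g} := by
    have h1 : ¬ J.colon (C₀ : Set A) ≤ J := fun h => hαJ (Ideal.map_mono h hαcolon)
    obtain ⟨a, ha, haJ⟩ := Set.not_subset.mp h1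
    have hJ : ∀ x, x ∈ J ↔ algebraMap A B x ∈ Ideal.span {g} := by
      intro x
      have : J = (Ideal.span {g}).comap (algebraMap A B) := by
        have h3 : Ideal.span {g} = (Ideal.span {γ}).map (algebraMap A B) := by
          rw [Ideal.map_span, Set.image_singleton, hγ]
        rw [h3, Ideal.comap_map_of_surjective' _ hs]
      rw [this, Ideal.mem_comap]
    refine ⟨algebraMap A B a, fun h => haJ ((hJ a).mpr h), fun h hh => ?_⟩
    obtain ⟨h, rfl⟩ := hs h
    rw [← map_mul, ← hJ, mul_comm]
    exact Submodule.mem_colon.mp ha h ((hC h).mp hh)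
  -- a maximal annihilator of such an element modulo `g` is prime, and contains `C`
  let S : Set (Ideal B) := {p | ∃ a, a ∉ Ideal.span {g} ∧ (∀ h ∈ C, h * a ∈ Ideal.span {g}) ∧
    ∀ y, y ∈ p ↔ y * a ∈ Ideal.span {g}}
  have hannih : ∀ a : B, ∀ y, y ∈ (Ideal.span {g}).colon {a} ↔ y * a ∈ Ideal.span {g} :=
    fun a y => by
    rw [Submodule.mem_colon_singleton, smul_eq_mul]
  have hSne : S.Nonempty := by
    obtain ⟨a, ha, haC⟩ := hex
    exact ⟨_, a, ha, haC, hannih a⟩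
  obtain ⟨p, ⟨a, ha, haC, hpa⟩, hmax⟩ :=
    set_has_maximal_iff_noetherian.mpr ‹IsNoetherian B B› S hSne
  have hp : Ideal.IsPrime p := by
    refine ⟨fun h => ha ?_, fun {x y} hxy => ?_⟩
    · have := (hpa 1).mp (h ▸ trivial)
      rwa [one_mul] at this
    · by_contra! hcon
      have hya : y * a ∉ Ideal.span {g} := fun h => hcon.2 ((hpa y).mpr h)
      have hle : p ≤ (Ideal.span {g}).colon {y * a} := fun z hz => by
        rw [hannih, mul_left_comm]
        exact Ideal.mul_mem_left _ _ ((hpa z).mp hz)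
      have hmem : (Ideal.span {g}).colon {y * a} ∈ S := ⟨y * a, hya, fun h hh => by
        rw [mul_left_comm]; exact Ideal.mul_mem_left _ _ (haC h hh), hannih _⟩
      refine hmax _ hmem (lt_of_le_of_ne hle fun heq => hcon.1 ?_)
      rw [heq, hannih, ← mul_assoc]
      exact (hpa _).mp hxy
  have hCp : C ≤ p := fun h hh => (hpa h).mpr (haC h hh)
  -- by normality it is a prime of height one with regular local ring, so `B` has coordinates there,
  -- which contradicts `C ≤ p`
  obtain ⟨π, hπ0, hπ⟩ := exists_maximalIdeal_eq_span hgn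
    (fun P hP h => hIC a g₀ hg₀ P hP h) ha p hpa
  have : IsNoetherianRing (Localization.AtPrime p) :=
    IsLocalization.isNoetherianRing (Ideal.primeCompl p) _ inferInstance
  have : Algebra.EssFiniteType B (Localization.AtPrime p) :=
    Algebra.EssFiniteType.of_isLocalization _ (Ideal.primeCompl p)
  have : Algebra.EssFiniteType K (Localization.AtPrime p) := Algebra.EssFiniteType.comp K B _
  obtain ⟨g', hg'p, hg'⟩ := exists_coordinateSystem p
    (free_kaehlerDifferential_of_maximalIdeal_eq_span (K := K) hπ hπ0)
  exact hg'p (hCp (hcoord g' hg'))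

end Unibranch

/-! ### Integral elements in base changes of normal domains -/

section Integral

open TensorProduct

variable {k K B₀ L : Type u} [Field k] [Field K] [Algebra k K] [CommRing B₀] [IsDomain B₀]
  [Algebra k B₀] [Field L] [Algebra k L] [Algebra B₀ L] [IsScalarTower k B₀ L]

omit [IsDomain B₀] in
/-- The base change of a normal domain to a finite separable extension is integrally closed in the
base change of the fraction field. -/
lemma mem_range_of_isIntegral_of_isSeparable [IsIntegrallyClosed B₀] [IsFractionRing B₀ L]
    (F : Type u) [Field F] [Algebra k F] [FiniteDimensional k F] [Algebra.IsSeparable k F]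
    (τ : L ⊗[k] F) (hτ : IsIntegral B₀ τ) :
    τ ∈ (Algebra.TensorProduct.map (IsScalarTower.toAlgHom k B₀ L) (AlgHom.id k F)).range := by
  let S := B₀ ⊗[k] F
  have h1 : Algebra.FormallyEtale k F := Algebra.FormallyEtale.of_isSeparable k F
  have h2 : Algebra.FinitePresentation k F :=
    Algebra.FinitePresentation.of_finiteType.mp inferInstance
  have h3 : Algebra.Smooth k F := ⟨inferInstance, h2⟩
  let e : L ⊗[B₀] S ≃ₐ[B₀] L ⊗[k] F := Algebra.TensorProduct.cancelBaseChange k B₀ B₀ L F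
  let e' : S ⊗[B₀] L ≃ₐ[B₀] L ⊗[k] F := (Algebra.TensorProduct.comm B₀ S L).trans e
  have he' : ∀ (b : B₀) (f : F) (l : L), e' ((b ⊗ₜ f) ⊗ₜ l) = (b • l) ⊗ₜ f := fun b f l => rfl
  have h4 : IsIntegral S (e'.symm τ) := (hτ.map e'.symm).tower_top
  obtain ⟨w, hw⟩ := (TensorProduct.toIntegralClosure_bijective_of_smooth
    (R := B₀) (S := S) (B := L)).2 ⟨e'.symm τ, h4⟩
  have h5 : ∀ w, e' (TensorProduct.toIntegralClosure B₀ S L w : S ⊗[B₀] L) ∈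
      (Algebra.TensorProduct.map (IsScalarTower.toAlgHom k B₀ L) (AlgHom.id k F)).range := by
    intro w
    induction w with
    | zero => simp
    | add x y hx hy =>
      rw [map_add, Subalgebra.coe_add, map_add]
      exact add_mem hx hy
    | tmul s x =>
      obtain ⟨b, hb⟩ := IsIntegrallyClosed.isIntegral_iff.mp x.2
      induction s using TensorProduct.induction_on with
      | zero => simp
      | add s t hs ht =>
        rw [add_tmul, map_add, Subalgebra.coe_add, map_add]
        exact add_mem hs ht
      | tmul b' f =>
        refine ⟨(b' * b) ⊗ₜ f, ?_⟩
        change _ = e' ((b' ⊗ₜ f) ⊗ₜ (x : L))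
        rw [he', ← hb]
        simp [Algebra.smul_def]
  have h6 := h5 w
  rw [hw] at h6
  simpa using h6

/-- A `q`-power of any element of `L ⊗ K` comes from a finite separable subextension, where `q` is
a power of the characteristic exponent. -/
lemma exists_pow_mem_range_isSeparable [Algebra.IsAlgebraic k K] (q : ℕ) [ExpChar k q]
    (t : L ⊗[k] K) :
    ∃ (N : ℕ) (F : IntermediateField k K), FiniteDimensional k F ∧ Algebra.IsSeparable k F ∧
      t ^ q ^ N ∈ (Algebra.TensorProduct.map (AlgHom.id k L) F.val).range := by
  have : ExpChar (L ⊗[k] K) q :=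
    expChar_of_injective_algebraMap (FaithfulSMul.algebraMap_injective k (L ⊗[k] K)) q
  induction t with
  | zero => exact ⟨0, ⊥, inferInstance, inferInstance, by simp⟩
  | tmul l x =>
    have hpi : IsPurelyInseparable (separableClosure k K) K := inferInstance
    have : ExpChar (separableClosure k K) q :=
      expChar_of_injective_algebraMap (algebraMap k (separableClosure k K)).injective q
    obtain ⟨N, ⟨y, hy⟩, hN⟩ := (isPurelyInseparable_iff_pow_mem (separableClosure k K) q).mp hpi x
    have hys : IsSeparable k y := mem_separableClosure_iff.mp hy
    refine ⟨N, IntermediateField.adjoin k {y},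
      IntermediateField.adjoin.finiteDimensional hys.isIntegral,
      (IntermediateField.isSeparable_adjoin_simple_iff_isSeparable _ _).mpr hys,
      (l ^ q ^ N) ⊗ₜ ⟨y, IntermediateField.mem_adjoin_simple_self k y⟩, ?_⟩
    rw [Algebra.TensorProduct.tmul_pow, ← hN]
    rfl
  | add x y hx hy =>
    obtain ⟨N, F, hF, hFs, z, hz⟩ := hx
    obtain ⟨M, G, hG, hGs, w, hw⟩ := hy
    have hle : ∀ {F G : IntermediateField k K} (h : F ≤ G) (z : L ⊗[k] F),
        Algebra.TensorProduct.map (AlgHom.id k L) F.val z ∈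
          (Algebra.TensorProduct.map (AlgHom.id k L) G.val).range := by
      intro F G h z
      refine ⟨Algebra.TensorProduct.map (AlgHom.id k L) (IntermediateField.inclusion h) z, ?_⟩
      rw [AlgHom.toRingHom_eq_coe, RingHom.coe_coe, ← AlgHom.comp_apply,
        ← Algebra.TensorProduct.map_comp]
      rfl
    refine ⟨N + M, F ⊔ G, inferInstance, inferInstance, ?_⟩
    rw [add_pow_expChar_pow]
    refine add_mem ?_ ?_
    · rw [pow_add, pow_mul]
      refine pow_mem ?_ _
      rw [← hz]
      exact hle le_sup_left z
    · rw [add_comm, pow_add, pow_mul]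
      refine pow_mem ?_ _
      rw [← hw]
      exact hle le_sup_right w

/-- In the base change of a normal domain `B₀` to an algebraic extension: if `a / g` is integral,
with `g ∈ B₀`, then `a ^ Q` is divisible by `g ^ Q` for some power `Q` of the characteristic
exponent. -/
lemma exists_pow_mem_span_pow [IsIntegrallyClosed B₀] [Algebra.IsAlgebraic k K]
    (q : ℕ) [ExpChar k q] (a : B₀ ⊗[k] K) {g : B₀} (hg : g ≠ 0) (P : Polynomial (B₀ ⊗[k] K))
    (hP : P.Monic) (hPa : (P.scaleRoots (algebraMap B₀ (B₀ ⊗[k] K) g)).eval a = 0) :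
    ∃ N : ℕ, a ^ q ^ N ∈ Ideal.span {algebraMap B₀ (B₀ ⊗[k] K) g ^ q ^ N} := by
  let L := FractionRing B₀
  let ι : B₀ ⊗[k] K →ₐ[k] L ⊗[k] K :=
    Algebra.TensorProduct.map (IsScalarTower.toAlgHom k B₀ L) (AlgHom.id k K)
  have hι : Function.Injective ι :=
    Module.Flat.rTensor_preserves_injective_linearMap (M := K)
      (IsScalarTower.toAlgHom k B₀ L).toLinearMap (IsFractionRing.injective B₀ L)
  have hιB : ∀ b : B₀, ι (algebraMap B₀ _ b) = algebraMap B₀ (L ⊗[k] K) b := by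
    intro b
    change ι (b ⊗ₜ 1) = algebraMap B₀ L b ⊗ₜ 1
    simp [ι]
  have hg0 : algebraMap B₀ L g ≠ 0 := by simpa using hg
  let γ : L ⊗[k] K := (algebraMap B₀ L g)⁻¹ ⊗ₜ 1
  have hγ : algebraMap B₀ (L ⊗[k] K) g * γ = 1 := by
    change (algebraMap B₀ L g ⊗ₜ[k] (1 : K)) * _ = 1
    rw [Algebra.TensorProduct.tmul_mul_tmul, mul_inv_cancel₀ hg0, mul_one]
    rfl
  have hγu : IsUnit (algebraMap B₀ (L ⊗[k] K) g) := IsUnit.of_mul_eq_one _ hγ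
  -- the fraction `t = a / g` in `Frac B₀ ⊗ K`
  let t := ι a * γ
  have hat : ι a = algebraMap B₀ (L ⊗[k] K) g * t := by
    rw [mul_left_comm, hγ, mul_one]
  have ht : ι.toRingHom.IsIntegralElem t := by
    refine ⟨P, hP, ?_⟩
    have h1 := Polynomial.scaleRoots_eval₂_mul (p := P) ι.toRingHom t (algebraMap B₀ _ g)
    have h2 : ι.toRingHom (algebraMap B₀ _ g) * t = ι.toRingHom a := by
      change ι _ * t = ι a
      rw [hιB, hat]
    rw [h2, Polynomial.eval₂_at_apply, hPa, map_zero] at h1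
    have h3 : ι.toRingHom (algebraMap B₀ _ g) = algebraMap B₀ (L ⊗[k] K) g := hιB g
    rw [h3] at h1
    exact (hγu.pow _).mul_right_eq_zero.mp h1.symm
  have hint : Algebra.IsIntegral B₀ (B₀ ⊗[k] K) := inferInstance
  have htB : IsIntegral B₀ t := by
    obtain ⟨Q, hQ, hQt⟩ := ht
    let _ : Algebra (B₀ ⊗[k] K) (L ⊗[k] K) := ι.toRingHom.toAlgebra
    have : IsScalarTower B₀ (B₀ ⊗[k] K) (L ⊗[k] K) :=
      IsScalarTower.of_algebraMap_eq fun b => (hιB b).symm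
    exact isIntegral_trans t ⟨Q, hQ, hQt⟩
  -- up to a power of the characteristic exponent, `t` is defined over a finite separable extension,
  -- where the base change of `B₀` is integrally closed
  obtain ⟨N, F, hF, hFs, τ, hτ⟩ := exists_pow_mem_range_isSeparable q t
  have hτint : IsIntegral B₀ τ := by
    let f : L ⊗[k] F →ₐ[B₀] L ⊗[k] K := Algebra.TensorProduct.map (AlgHom.id B₀ L) F.val
    have hf : Function.Injective f :=
      Module.Flat.lTensor_preserves_injective_linearMap (M := L) F.val.toLinearMap
        F.val.injective
    rw [← isIntegral_algHom_iff f hf]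
    have : f τ = t ^ q ^ N := hτ
    rw [this]
    exact htB.pow _
  obtain ⟨z, hz⟩ := mem_range_of_isIntegral_of_isSeparable F τ hτint
  let z' : B₀ ⊗[k] K := Algebra.TensorProduct.map (AlgHom.id k B₀) F.val z
  have hz' : ι z' = t ^ q ^ N := by
    rw [← hτ, ← hz]
    change (ι.comp (Algebra.TensorProduct.map (AlgHom.id k B₀) F.val)) z
      = ((Algebra.TensorProduct.map (AlgHom.id k L) F.val).comp
        (Algebra.TensorProduct.map (IsScalarTower.toAlgHom k B₀ L) (AlgHom.id k F))) z
    congr 1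
    rw [← Algebra.TensorProduct.map_comp, ← Algebra.TensorProduct.map_comp]
    rfl
  refine ⟨N, Ideal.mem_span_singleton'.mpr ⟨z', hι ?_⟩⟩
  rw [map_mul, map_pow, map_pow, hιB, hz', hat, ← mul_pow, mul_comm]

/-- The same statement for a localization of the base change. -/
lemma exists_pow_mem_span_pow_of_isLocalization [IsIntegrallyClosed B₀] [Algebra.IsAlgebraic k K]
    (q : ℕ) [ExpChar k q] {B : Type u} [CommRing B] [Algebra (B₀ ⊗[k] K) B]
    (M : Submonoid (B₀ ⊗[k] K)) [IsLocalization M B] [Algebra B₀ B] [IsScalarTower B₀ (B₀ ⊗[k] K) B]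
    (a : B) {g : B₀} (hg : g ≠ 0) (P : Polynomial B)
    (hP : P.Monic) (hPa : (P.scaleRoots (algebraMap B₀ B g)).eval a = 0) :
    ∃ N : ℕ, a ^ q ^ N ∈ Ideal.span {algebraMap B₀ B g ^ q ^ N} := by
  set R := B₀ ⊗[k] K
  -- clear the denominators of the coefficients
  let b : M := IsLocalization.commonDenom M P.support P.coeff
  have hlift : P.scaleRoots (algebraMap R B b) ∈ Polynomial.lifts (algebraMap R B) :=
    IsLocalization.scaleRoots_commonDenom_mem_lifts M P
      (by rw [hP.leadingCoeff]; exact ⟨1, map_one _⟩)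
  obtain ⟨P₁, hP₁, hdeg, hP₁m⟩ := Polynomial.lifts_and_natDegree_eq_and_monic hlift
    ((Polynomial.monic_scaleRoots_iff _).mpr hP)
  obtain ⟨⟨α, s⟩, hα⟩ := IsLocalization.surj M a
  simp only at hα
  set gR := algebraMap B₀ R g
  have hgB : algebraMap B₀ B g = algebraMap R B gR := IsScalarTower.algebraMap_apply B₀ R B g
  have hscale : ∀ (p : Polynomial B) (x r : B), p.eval x = 0 →
      (p.scaleRoots r).eval (r * x) = 0 := by
    intro p x r h
    have := Polynomial.scaleRoots_eval₂_mul (p := p) (RingHom.id B) x r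
    simp only [RingHom.id_apply, Polynomial.eval₂_id] at this
    rw [this, h, mul_zero]
  have hcomm : ∀ (p : Polynomial B) (r r' : B),
      (p.scaleRoots r).scaleRoots r' = (p.scaleRoots r').scaleRoots r := fun p r r' => by
    rw [← Polynomial.scaleRoots_mul, mul_comm, Polynomial.scaleRoots_mul]
  have hcommR : ∀ (p : Polynomial R) (r r' : R),
      (p.scaleRoots r).scaleRoots r' = (p.scaleRoots r').scaleRoots r := fun p r r' => by
    rw [← Polynomial.scaleRoots_mul, mul_comm, Polynomial.scaleRoots_mul]
  have h1 := hscale _ _ (algebraMap R B s) (hscale _ _ (algebraMap R B b) hPa)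
  rw [hcomm P, ← hP₁, hcomm, hgB] at h1
  have hmap : ∀ (p : Polynomial R) (hp : p.Monic) (r : R),
      (p.map (algebraMap R B)).scaleRoots (algebraMap R B r)
        = (p.scaleRoots r).map (algebraMap R B) := by
    intro p hp r
    rcases subsingleton_or_nontrivial B with hB | hB
    · exact Subsingleton.elim _ _
    · exact (Polynomial.map_scaleRoots p r _
        (by rw [hp.leadingCoeff, map_one]; exact one_ne_zero)).symm
  have hx : algebraMap R B s * (algebraMap R B b * a) = algebraMap R B (b * α) := by
    rw [map_mul, ← hα]; ring
  have hP₂m := (Polynomial.monic_scaleRoots_iff (s : R)).mpr hP₁m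
  rw [hmap P₁ hP₁m, hmap _ hP₂m, hx, Polynomial.eval_map, Polynomial.eval₂_at_apply,
    IsLocalization.map_eq_zero_iff M B] at h1
  obtain ⟨m, hm⟩ := h1
  rcases Nat.eq_zero_or_pos (P₁.natDegree) with h0 | hpos
  · -- a monic polynomial of degree zero has no root unless `B` is trivial
    have : P = 1 := by
      rw [← hP.natDegree_eq_zero]
      rw [hdeg, Polynomial.natDegree_scaleRoots] at h0
      exact h0
    rw [this, Polynomial.one_scaleRoots, Polynomial.eval_one] at hPa
    have : a ^ q ^ 0 = 0 := by rw [← mul_one (a ^ q ^ 0), hPa, mul_zero]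
    exact ⟨0, by rw [this]; exact zero_mem _⟩
  · have h2 : (((P₁.scaleRoots (s : R)).scaleRoots (m : R)).scaleRoots gR).eval
        ((m : R) * (b * α)) = 0 := by
      have h3 := Polynomial.scaleRoots_eval₂_mul (p := (P₁.scaleRoots (s : R)).scaleRoots gR)
        (RingHom.id R) (b * α) (m : R)
      simp only [RingHom.id_apply, Polynomial.eval₂_id] at h3
      rw [hcommR, h3, Polynomial.natDegree_scaleRoots, Polynomial.natDegree_scaleRoots,
        ← Nat.succ_pred_eq_of_pos hpos, pow_succ, mul_assoc, hm, mul_zero]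
    obtain ⟨N, hN⟩ := exists_pow_mem_span_pow q _ hg _
      ((Polynomial.monic_scaleRoots_iff (m : R)).mpr hP₂m) h2
    refine ⟨N, ?_⟩
    obtain ⟨y, hy⟩ := Ideal.mem_span_singleton'.mp hN
    have h4 : IsUnit (algebraMap R B (m * (b * s) : M)) := IsLocalization.map_units B _
    have h5 : algebraMap R B (m * (b * s) : M) * a = algebraMap R B (m * (b * α)) := by
      rw [Submonoid.coe_mul, Submonoid.coe_mul, map_mul, map_mul, map_mul, map_mul, ← hα]; ring
    have h6 : (algebraMap R B (m * (b * s) : M)) ^ q ^ N * a ^ q ^ N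
        = algebraMap R B y * algebraMap B₀ B g ^ q ^ N := by
      rw [← mul_pow, h5, ← map_pow, ← hy, map_mul, map_pow, hgB]
    rw [← Ideal.unit_mul_mem_iff_mem _ (h4.pow (q ^ N)), h6]
    exact Ideal.mul_mem_left _ _ (Ideal.mem_span_singleton_self _)

end Integral

section Frobenius

open IsLocalRing MvPowerSeries

variable {K A B T ι κ : Type*} [Field K] [CommRing T] [IsLocalRing T] [Algebra K T]
variable [CommRing A] [CommRing B] [Algebra A B] [Algebra A T]

lemma frobSplit_one {σ : Type*} (p : ℕ) [Fact p.Prime] [CharP K p] [PerfectRing K p] :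
    frobSplit p (1 : MvPowerSeries σ K) = 1 := by
  classical
  ext m
  rw [coeff_frobSplit, coeff_one, coeff_one]
  have : p • m = 0 ↔ m = 0 := by
    have hp : p ≠ 0 := (Fact.out : p.Prime).ne_zero
    simp [hp]
  simp only [this]
  split_ifs <;> simp

/-- Frobenius splitting of a power series ring: if `f ^ Q` is divisible by `g ^ Q` modulo the ideal
of a union of coordinate hyperplanes, then `f` is divisible by `g` modulo that ideal. -/
lemma exists_eq_mul_add_of_pow [PerfectField K] {σ : Type*} (q : ℕ) [ExpChar K q] (N : ℕ)
    (S : Set σ) {f g z w : MvPowerSeries σ K} (hw : ∀ i ∈ S, X i ∣ w)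
    (h : f ^ q ^ N = g ^ q ^ N * z + w) :
    ∃ z' w', (∀ i ∈ S, X i ∣ w') ∧ f = g * z' + w' := by
  rcases ‹ExpChar K q› with _ | hp
  · rw [one_pow, pow_one, pow_one] at h
    exact ⟨z, w, hw, h⟩
  · have : Fact q.Prime := ⟨hp⟩
    have : PerfectRing K q := PerfectField.toPerfectRing q
    induction N generalizing z w with
    | zero =>
      rw [pow_zero, pow_one, pow_one] at h
      exact ⟨z, w, hw, h⟩
    | succ N ih =>
      refine ih (z := frobSplit q z) (w := frobSplit q w)
        (fun i hi => X_dvd_frobSplit q (hw i hi)) ?_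
      have h1 := congrArg (frobSplit q) h
      rw [frobSplit_add, pow_succ, pow_mul, pow_mul, ← mul_one ((f ^ q ^ N) ^ q),
        frobSplit_pow_mul, frobSplit_pow_mul, frobSplit_one, mul_one] at h1
      exact h1

/-- Divisibility modulo formal branches can be tested after raising to a power of the
characteristic exponent. -/
lemma FormalChart.mem_span_of_pow_mem_span_pow [PerfectField K] (c : FormalChart K T ι κ)
    [IsLocalRing A] [IsLocalHom (algebraMap A T)] [Module.Flat A T]
    (hs : Function.Surjective (algebraMap A B)) {E : Set ι}
    (hE : (RingHom.ker (algebraMap A B)).map (algebraMap A T) = ⨅ i ∈ E, c.prime i)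
    (q : ℕ) [ExpChar K q] (N : ℕ) {a g : B} (h : a ^ q ^ N ∈ Ideal.span {g ^ q ^ N}) :
    a ∈ Ideal.span {g} := by
  have hff : Module.FaithfullyFlat A T := Module.FaithfullyFlat.of_flat_of_isLocalHom
  obtain ⟨a, rfl⟩ := hs a
  obtain ⟨g, rfl⟩ := hs g
  obtain ⟨y, hy⟩ := Ideal.mem_span_singleton'.mp h
  obtain ⟨y, rfl⟩ := hs y
  have hmemE : ∀ x, x ∈ ⨅ i ∈ E, c.prime i ↔ ∀ i ∈ E, x ∈ c.prime i := fun x => by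
    simp only [Ideal.mem_iInf]
  have h1 : algebraMap A T (a ^ q ^ N - g ^ q ^ N * y) ∈ ⨅ i ∈ E, c.prime i := by
    rw [← hE]
    refine Ideal.mem_map_of_mem _ ?_
    rw [RingHom.mem_ker, map_sub, map_mul, map_pow, map_pow, ← hy]
    ring
  rw [hmemE] at h1
  have h2 : (c.Θ (algebraMap A T a)) ^ q ^ N = (c.Θ (algebraMap A T g)) ^ q ^ N *
      c.Θ (algebraMap A T y) + c.Θ (algebraMap A T (a ^ q ^ N - g ^ q ^ N * y)) := by
    simp only [map_sub, map_mul, map_pow]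
    ring
  obtain ⟨z, w, hw, hzw⟩ := exists_eq_mul_add_of_pow q N (Sum.inl '' E) (by
    rintro _ ⟨i, hi, rfl⟩
    exact c.mem_prime'.mp (h1 i hi)) h2
  obtain ⟨z', hz'⟩ := (c.mem_range _).mp (isSupp_proj c.L z)
  obtain ⟨w', hw'⟩ := (c.mem_range _).mp (isSupp_proj c.L w)
  have h3 : algebraMap A T a = algebraMap A T g * z' + w' := by
    apply c.injective
    rw [map_add, map_mul, hz', hw', ← proj_mul (c.isSupp _), ← proj_add, ← hzw,
      proj_eq_self (c.isSupp _)]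
  have h4 : algebraMap A T a ∈ (Ideal.span {g} ⊔ RingHom.ker (algebraMap A B)).map
    (algebraMap A T) := by
    rw [h3, Ideal.map_sup, hE, Ideal.map_span, Set.image_singleton]
    refine Submodule.add_mem_sup (Ideal.mul_mem_right _ _ (Ideal.mem_span_singleton_self _)) ?_
    rw [hmemE]
    intro i hi
    rw [c.mem_prime', hw']
    exact X_dvd_proj _ (hw _ ⟨i, hi, rfl⟩)
  rw [← Ideal.mem_comap, Ideal.comap_map_eq_self_of_faithfullyFlat] at h4
  obtain ⟨u, hu, v, hv, huv⟩ := Submodule.mem_sup.mp h4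
  obtain ⟨x, rfl⟩ := Ideal.mem_span_singleton'.mp hu
  rw [← huv, map_add, (show algebraMap A B v = 0 from hv), add_zero, map_mul]
  exact Ideal.mul_mem_left _ _ (Ideal.mem_span_singleton_self _)

end Frobenius

/-! ### Boundary components and formal branches -/

section Quotient

lemma isLocalization_of_surjective {R R' S S' : Type*} [CommRing R] [CommRing R'] [CommRing S]
    [CommRing S'] [Algebra R S] [Algebra R' S'] (N : Submonoid R) [IsLocalization N S]
    (π : R →+* R') (ρ : S →+* S') (hπ : Function.Surjective π) (hρ : Function.Surjective ρ)
    (hcomm : ∀ x, ρ (algebraMap R S x) = algebraMap R' S' (π x))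
    (hker : RingHom.ker ρ ≤ (RingHom.ker π).map (algebraMap R S)) :
    IsLocalization (N.map π) S' where
  map_units := by
    rintro ⟨_, n, hn, rfl⟩
    change IsUnit (algebraMap R' S' (π n))
    rw [← hcomm]
    exact (IsLocalization.map_units S ⟨n, hn⟩).map ρ
  surj z := by
    obtain ⟨z, rfl⟩ := hρ z
    obtain ⟨⟨x, s⟩, h⟩ := IsLocalization.surj N z
    refine ⟨⟨π x, ⟨π s, s, s.2, rfl⟩⟩, ?_⟩
    change ρ z * algebraMap R' S' (π s) = algebraMap R' S' (π x)
    rw [← hcomm, ← hcomm, ← h, map_mul]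
  exists_of_eq {x y} h := by
    obtain ⟨x, rfl⟩ := hπ x
    obtain ⟨y, rfl⟩ := hπ y
    rw [← hcomm, ← hcomm, ← sub_eq_zero, ← map_sub, ← map_sub] at h
    obtain ⟨⟨w, s⟩, hw⟩ := (IsLocalization.mem_map_algebraMap_iff N S).mp (hker h)
    simp only [← map_mul] at hw
    obtain ⟨t, ht⟩ := (IsLocalization.eq_iff_exists N S).mp hw
    refine ⟨⟨π (t * s), t * s, (t * s).2, rfl⟩, ?_⟩
    have h1 : π (t * ((x - y) * s)) = 0 := by
      rw [ht, map_mul, (show π w = 0 from w.2), mul_zero]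
    rw [← sub_eq_zero]
    simp only [map_mul, map_sub] at h1
    change π (t * s) * π x - π (t * s) * π y = 0
    rw [map_mul, ← h1]
    ring

end Quotient

section Branches

open IsLocalRing MvPowerSeries TensorProduct

variable {k K A A' : Type u} {T ι κ : Type*} [Field k] [Field K] [Algebra k K]
  [PerfectField K] [Algebra.IsAlgebraic k K] [CommRing T] [IsLocalRing T] [Algebra K T]
  [CommRing A] [Algebra k A]
  [CommRing A'] [IsNoetherianRing A'] [IsLocalRing A'] [Algebra K A'] [Algebra.EssFiniteType K A']
  [Algebra (A ⊗[k] K) A']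
  [Algebra A' T] [IsScalarTower K A' T] [IsLocalHom (algebraMap A' T)] [Module.Flat A' T]

/-- A normal prime of the local ring of a variety over `k` has at most one formal branch among the
boundary components of a formal toric chart of the base change to `K`. -/
theorem FormalChart.subsingleton_of_isIntegrallyClosed [Finite ι] [Finite κ]
    (c : FormalChart K T ι κ)
    (N : Submonoid (A ⊗[k] K)) [IsLocalization N A']
    (hd : IsAdicDense (algebraMap A' T)) (𝔭 : Ideal A) [𝔭.IsPrime] [IsIntegrallyClosed (A ⧸ 𝔭)]
    {E : Set ι}
    (hE : 𝔭.map ((algebraMap A' T).comp ((algebraMap (A ⊗[k] K) A').comp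
      (algebraMap A (A ⊗[k] K)))) = ⨅ i ∈ E, c.prime i) :
    E.Subsingleton := by
  let B₀ := A ⧸ 𝔭
  let R := A ⊗[k] K
  let f : A →+* A' := (algebraMap R A').comp (algebraMap A R)
  let J : Ideal A' := 𝔭.map f
  let B := A' ⧸ J
  let π : R →ₐ[k] B₀ ⊗[k] K := Algebra.TensorProduct.map (Ideal.Quotient.mkₐ k 𝔭) (AlgHom.id k K)
  have hπ : Function.Surjective π :=
    Algebra.TensorProduct.map_surjective _ _ Ideal.Quotient.mk_surjective Function.surjective_id
  have hπker : RingHom.ker π = 𝔭.map (algebraMap A R) := by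
    have := Algebra.TensorProduct.rTensor_ker (R := k) (B := A ⧸ 𝔭) (C := K)
      (Ideal.Quotient.mkₐ k 𝔭) (Ideal.Quotient.mkₐ_surjective k 𝔭)
    have h0 : RingHom.ker (Ideal.Quotient.mkₐ k 𝔭) = 𝔭 := Ideal.mk_ker
    rw [h0] at this
    exact this
  have hle : RingHom.ker π ≤ RingHom.ker ((Ideal.Quotient.mk J).comp (algebraMap R A')) := by
    rw [hπker, Ideal.map_le_iff_le_comap]
    intro a ha
    exact Ideal.Quotient.eq_zero_iff_mem.mpr (Ideal.mem_map_of_mem f ha)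
  let g : B₀ ⊗[k] K →+* B := RingHom.liftOfSurjective π.toRingHom hπ
    ⟨(Ideal.Quotient.mk J).comp (algebraMap R A'), hle⟩
  have hg : ∀ x, g (π x) = Ideal.Quotient.mk J (algebraMap R A' x) := fun x =>
    RingHom.liftOfRightInverse_comp_apply π.toRingHom _ _ _ x
  let _ : Algebra (B₀ ⊗[k] K) B := g.toAlgebra
  let _ : Algebra B₀ B := (g.comp (algebraMap B₀ (B₀ ⊗[k] K))).toAlgebra
  have htow : IsScalarTower B₀ (B₀ ⊗[k] K) B :=
    IsScalarTower.of_algebraMap_eq (R := B₀) (S := B₀ ⊗[k] K) (A := B) fun _ => rfl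
  -- `B = A' / 𝔭 A'` is a localization of the base change of the normal domain `A / 𝔭`
  have hloc : IsLocalization (N.map π.toRingHom) B := by
    refine isLocalization_of_surjective N π.toRingHom (Ideal.Quotient.mk J) hπ
      Ideal.Quotient.mk_surjective (fun x => (hg x).symm) ?_
    rw [Ideal.mk_ker]
    change J ≤ Ideal.map _ (RingHom.ker π)
    rw [hπker, Ideal.map_map]
  have hs : Function.Surjective (algebraMap A' B) := Ideal.Quotient.mk_surjective
  have hkerB : RingHom.ker (algebraMap A' B) = J := Ideal.mk_ker
  have hE' : (RingHom.ker (algebraMap A' B)).map (algebraMap A' T) = ⨅ i ∈ E, c.prime i := by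
    rw [hkerB, ← hE, Ideal.map_map]
  have hflat : Module.Flat B₀ B := by
    have := IsLocalization.flat B (N.map π.toRingHom)
    exact Module.Flat.trans B₀ (B₀ ⊗[k] K) B
  obtain ⟨q, hq⟩ := ExpChar.exists k
  have : ExpChar K q := expChar_of_injective_algebraMap (algebraMap k K).injective q
  refine c.subsingleton_branches (B := B) (B₀ := B₀) hd hs hE' (fun b hb => ?_) (fun b => ?_)
    (fun a g hg P hP hPa => ?_)
  · have h1 : IsSMulRegular B b := by
      have h2 : IsSMulRegular B₀ b := (IsRegular.of_ne_zero hb).left.isSMulRegular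
      exact h2.of_flat
    rw [mem_nonZeroDivisors_iff_right]
    intro y hy
    refine h1 ?_
    simp only [Algebra.smul_def]
    rw [mul_comm, hy, mul_zero]
  · obtain ⟨⟨x, s⟩, h⟩ := IsLocalization.surj (N.map π.toRingHom) b
    obtain ⟨u, hu⟩ := IsLocalization.map_units B s
    refine ⟨u, ?_⟩
    rw [hu, mul_comm, h]
    exact (Algebra.IsIntegral.isIntegral (R := B₀) x).algebraMap
  · obtain ⟨n, hn⟩ := exists_pow_mem_span_pow_of_isLocalization q (N.map π.toRingHom) a hg P hP hPa
    exact c.mem_span_of_pow_mem_span_pow hs hE' q n hn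

end Branches

section Divisors

open IsLocalRing MvPowerSeries

variable {K A T ι κ : Type*} [Field K] [CommRing T] [IsLocalRing T] [Algebra K T]
  (c : FormalChart K T ι κ)

namespace FormalChart

include c in
lemma isDomain : IsDomain T := c.injective.isDomain c.Θ.toRingHom

/-- Elements of the chart that are divisible by a monomial as power series are divisible by it
in the chart. -/
lemma exists_eq_mul_of_coeff_eq_zero {w : ι ⊕ κ →₀ ℕ} (hw : intExp w ∈ c.L) {y x : T}
    (hy : c.Θ y = monomial w 1) (hx : ∀ m, ¬ w ≤ m → coeff m (c.Θ x) = 0) : ∃ z, x = y * z := by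
  let g : MvPowerSeries (ι ⊕ κ) K := fun m => coeff (w + m) (c.Θ x)
  have hg : ∀ m, coeff m g = coeff (w + m) (c.Θ x) := fun m => rfl
  have hgL : IsSupp c.L g := by
    intro m hm
    rw [hg] at hm
    have h1 := c.isSupp x _ hm
    rw [intExp_add] at h1
    exact (Submodule.add_mem_iff_right _ hw).mp h1
  obtain ⟨z, hz⟩ := (c.mem_range g).mp hgL
  refine ⟨z, c.injective ?_⟩
  rw [map_mul, hy, hz]
  ext m
  rw [coeff_monomial_mul]
  split_ifs with h
  · rw [one_mul, hg, add_tsub_cancel_of_le h]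
  · exact hx m h

lemma coeff_eq_zero_of_mem_prime_pow {i : ι} {n : ℕ} {x : T} (hx : x ∈ c.prime i ^ n)
    {m : ι ⊕ κ →₀ ℕ} (hm : m (Sum.inl i) < n) : coeff m (c.Θ x) = 0 := by
  have h1 : c.prime i ≤ (Ideal.span {X (Sum.inl i)}).comap c.Θ.toRingHom := fun y hy =>
    Ideal.mem_span_singleton.mpr (c.mem_prime'.mp hy)
  have h2 := (Ideal.pow_right_mono h1 n).trans (Ideal.le_comap_pow _ n) hx
  rw [Ideal.mem_comap, Ideal.span_singleton_pow, Ideal.mem_span_singleton] at h2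
  exact X_pow_dvd_iff.mp h2 m hm

lemma monomial_mem_prime {i : ι} {w : ι ⊕ κ →₀ ℕ} {y : T} (hy : c.Θ y = monomial w 1) :
    y ∈ c.prime i ↔ w (Sum.inl i) ≠ 0 := by
  rw [c.mem_prime', hy, X_dvd_iff]
  constructor
  · intro h h0
    have := h w h0
    rw [coeff_monomial_same] at this
    exact one_ne_zero this
  · intro h m hm
    rw [coeff_monomial_ne]
    rintro rfl
    exact h hm

/-- The ideal extended from a prime containing the boundary ideal is an intersection of boundary
primes. -/
lemma exists_map_eq_iInf [Finite ι] [CommRing A] [IsNoetherianRing A] [Algebra A T]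
    [Module.Flat A T] {I : Ideal A}
    (hI : I.IsRadical) (hIT : I.map (algebraMap A T) = ⨅ i, c.prime i) {𝔭 : Ideal A}
    (h𝔭 : 𝔭 ∈ I.minimalPrimes) : ∃ E : Set ι, 𝔭.map (algebraMap A T) = ⨅ i ∈ E, c.prime i := by
  classical
  have hfin : I.minimalPrimes.Finite := I.finite_minimalPrimes_of_isNoetherianRing A
  have hprime : 𝔭.IsPrime := h𝔭.1.1
  let J : Ideal A := (hfin.toFinset.erase 𝔭).inf id
  have hJ : ¬ J ≤ 𝔭 := by
    rw [hprime.inf_le']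
    rintro ⟨𝔮, h𝔮, hle⟩
    rw [Finset.mem_erase, Set.Finite.mem_toFinset] at h𝔮
    exact h𝔮.1 (le_antisymm hle (h𝔭.2 h𝔮.2.1 hle))
  obtain ⟨a, haJ, ha𝔭⟩ := SetLike.not_le_iff_exists.mp hJ
  have hcolon : 𝔭 = I.colon {a} := by
    ext x
    rw [Submodule.mem_colon_singleton, smul_eq_mul]
    constructor
    · intro hx
      rw [← hI.radical, ← Ideal.sInf_minimalPrimes, Ideal.mem_sInf]
      intro 𝔮 h𝔮
      by_cases h : 𝔮 = 𝔭
      · exact h ▸ Ideal.mul_mem_right _ _ hx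
      · refine Ideal.mul_mem_left _ _ ?_
        exact (Finset.inf_le (f := id) (by simpa [h] using h𝔮) : J ≤ 𝔮) haJ
    · intro h
      exact (hprime.mem_or_mem (h𝔭.1.2 h)).resolve_right ha𝔭
  refine ⟨{i | algebraMap A T a ∉ c.prime i}, ?_⟩
  ext x
  simp only [Ideal.mem_iInf, Set.mem_ofPred_eq]
  have h1 : x ∈ 𝔭.map (algebraMap A T) ↔ x * algebraMap A T a ∈ I.map (algebraMap A T) := by
    constructor
    · intro hx
      have h2 : 𝔭.map (algebraMap A T) ≤ (I.map (algebraMap A T)).colon {algebraMap A T a} := by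
        rw [Ideal.map_le_iff_le_comap]
        intro y hy
        rw [Ideal.mem_comap, Submodule.mem_colon_singleton, smul_eq_mul, ← map_mul]
        rw [hcolon, Submodule.mem_colon_singleton] at hy
        exact Ideal.mem_map_of_mem _ hy
      exact Submodule.mem_colon_singleton.mp (h2 hx)
    · intro hx
      rw [hcolon]
      exact mem_map_colon_of_flat hx
  rw [h1, hIT, Ideal.mem_iInf]
  refine forall_congr' fun i => ?_
  rw [Ideal.IsPrime.mul_mem_iff_mem_or_mem (I := c.prime i) inferInstance]
  tauto

/-- If every minimal prime of the boundary ideal has at most one formal branch, then every boundary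
prime of the chart is extended from a prime ideal. -/
lemma exists_map_eq_prime [Finite ι] [CommRing A] [IsNoetherianRing A] [Algebra A T]
    [Module.Flat A T] {I : Ideal A}
    (hI : I.IsRadical) (hIT : I.map (algebraMap A T) = ⨅ i, c.prime i)
    (hsub : ∀ 𝔭 ∈ I.minimalPrimes, ∀ E : Set ι,
      𝔭.map (algebraMap A T) = ⨅ i ∈ E, c.prime i → E.Subsingleton) (i : ι) :
    ∃ 𝔭 : Ideal A, 𝔭.map (algebraMap A T) = c.prime i := by
  classical
  have hfin : I.minimalPrimes.Finite := I.finite_minimalPrimes_of_isNoetherianRing A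
  have h1 : hfin.toFinset.inf id = I := by
    rw [Finset.inf_id_eq_sInf, hfin.coe_toFinset, Ideal.sInf_minimalPrimes, hI.radical]
  have h2 : hfin.toFinset.inf (fun 𝔭 => 𝔭.map (algebraMap A T)) ≤ c.prime i := by
    have := map_finset_inf_of_flat (T := T) hfin.toFinset id
    rw [h1, hIT] at this
    simp only [id] at this
    rw [← this]
    exact iInf_le _ i
  obtain ⟨𝔭, h𝔭, hle⟩ := (inferInstance : (c.prime i).IsPrime).inf_le'.mp h2
  rw [Set.Finite.mem_toFinset] at h𝔭
  obtain ⟨E, hE⟩ := c.exists_map_eq_iInf hI hIT h𝔭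
  have hi : i ∈ E := by
    by_contra hi
    obtain ⟨w, hwi, hwj, -, hwL⟩ := c.facet i
    obtain ⟨y, hy⟩ := c.exists_monomial hwL
    refine (c.monomial_mem_prime hy).mp (hle ?_) hwi
    rw [hE]
    simp only [Ideal.mem_iInf]
    intro j hj
    rw [c.monomial_mem_prime hy]
    have := hwj j (fun h => hi (h ▸ hj))
    omega
  have hEi : E = {i} := (hsub 𝔭 h𝔭 E hE).eq_singleton_of_mem hi
  exact ⟨𝔭, by simp [hE, hEi]⟩

lemma _root_.Ideal.exists_eq_unit_mul_of_map_eq_span [CommRing A] [IsDomain T] [Algebra A T]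
    {J : Ideal A} {y : T} (hy : y ≠ 0) (hJ : J.map (algebraMap A T) = Ideal.span {y}) :
    ∃ g ∈ J, ∃ u : Tˣ, algebraMap A T g = u * y := by
  by_contra! hcon
  have h1 : J.map (algebraMap A T) ≤ maximalIdeal T * Ideal.span {y} := by
    rw [Ideal.map_le_iff_le_comap]
    intro g hg
    have h2 : algebraMap A T g ∈ Ideal.span {y} := hJ ▸ Ideal.mem_map_of_mem (algebraMap A T) hg
    obtain ⟨h, hh⟩ := Ideal.mem_span_singleton'.mp h2
    rw [Ideal.mem_comap, ← hh]
    refine Ideal.mul_mem_mul ?_ (Ideal.mem_span_singleton_self y)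
    rw [IsLocalRing.mem_maximalIdeal, mem_nonunits_iff]
    rintro ⟨u, rfl⟩
    exact hcon g hg u hh.symm
  rw [hJ] at h1
  obtain ⟨m, hm, h2⟩ := Ideal.mem_mul_span_singleton.mp (h1 (Ideal.mem_span_singleton_self y))
  have h3 : m = 1 := by
    have : (m - 1) * y = 0 := by rw [sub_mul, h2, one_mul, sub_self]
    exact sub_eq_zero.mp ((mul_eq_zero.mp this).resolve_right hy)
  exact (Ideal.ne_top_iff_one _).mp (inferInstance : (maximalIdeal T).IsMaximal).ne_top (h3 ▸ hm)

/-- Every boundary monomial of the chart is, up to a unit, extended from the subring, if all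
boundary primes are. -/
theorem exists_eq_unit_mul_monomial [Finite ι] [Finite κ] [CommRing A] [IsNoetherianRing A]
    [Algebra A T]
    [Module.Flat A T] (h𝔭 : ∀ i, ∃ 𝔭 : Ideal A, 𝔭.map (algebraMap A T) = c.prime i)
    {w : ι ⊕ κ →₀ ℕ} (hw0 : ∀ j, w (Sum.inr j) = 0) (hw : intExp w ∈ c.L) {y : T}
    (hy : c.Θ y = monomial w 1) : ∃ (g : A) (u : Tˣ), algebraMap A T g = u * y := by
  classical
  cases nonempty_fintype ι
  choose 𝔭 h𝔭 using h𝔭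
  choose v hv1 hv0 hvL using c.prim
  choose f hfi hfj hf0 hfL using c.facet
  choose yv hyv using fun i => c.exists_monomial (hvL i)
  choose yf hyf using fun i => c.exists_monomial (hfL i)
  have := c.isDomain
  -- a bound for the multiplicities of `y` and its comparison monomials along all components
  let N : ℕ := ∑ i, ∑ j, w (Sum.inl i) * v i (Sum.inl j)
  have hN : ∀ i j, w (Sum.inl i) * v i (Sum.inl j) ≤ N := fun i j =>
    (Finset.single_le_sum (f := fun j => w (Sum.inl i) * v i (Sum.inl j))
      (fun _ _ => Nat.zero_le _) (Finset.mem_univ j)).trans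
      (Finset.single_le_sum (f := fun i => ∑ j, w (Sum.inl i) * v i (Sum.inl j))
      (fun _ _ => Nat.zero_le _) (Finset.mem_univ i))
  let D : ι → Ideal A := fun i => ∏ j ∈ Finset.univ.erase i, 𝔭 j ^ N
  have hD : ∀ i, (D i).map (algebraMap A T) = ∏ j ∈ Finset.univ.erase i, c.prime j ^ N := by
    intro i
    rw [← Ideal.mapHom_apply, map_prod]
    exact Finset.prod_congr rfl fun j _ => by rw [Ideal.mapHom_apply, Ideal.map_pow, h𝔭]
  let J : ι → Ideal A := fun i => (𝔭 i ^ w (Sum.inl i)).colon (D i : Set A)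
  have hJ : (Finset.univ.inf J).map (algebraMap A T) = Ideal.span {y} := by
    rw [map_finset_inf_of_flat]
    refine le_antisymm (fun x hx => ?_) ?_
    · rw [Submodule.mem_finsetInf] at hx
      obtain ⟨z, hz⟩ := c.exists_eq_mul_of_coeff_eq_zero hw hy (x := x) (fun m hm => by
        obtain ⟨s, hs⟩ : ∃ s, m s < w s := by
          by_contra! h
          exact hm h
        rcases s with i | j
        swap
        · rw [hw0] at hs; omega
        -- a monomial in the other boundary primes, invertible along the `i`-th component
        let Y : T := ∏ j ∈ Finset.univ.erase i, yf i ^ N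
        have hY : Y ∈ (D i).map (algebraMap A T) := by
          rw [hD]
          refine Ideal.prod_mem_prod fun j hj => Ideal.pow_mem_pow ?_ _
          rw [c.monomial_mem_prime (hyf i)]
          have := hfj i j (Finset.ne_of_mem_erase hj)
          omega
        have hxY : x * Y ∈ c.prime i ^ w (Sum.inl i) := by
          have h1 := hx i (Finset.mem_univ i)
          have h2 : (J i).map (algebraMap A T) * (D i).map (algebraMap A T)
              ≤ c.prime i ^ w (Sum.inl i) := by
            rw [← Ideal.map_mul, ← h𝔭, ← Ideal.map_pow]
            refine Ideal.map_mono (Ideal.mul_le.mpr fun r hr s hs => ?_)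
            exact Submodule.mem_colon.mp hr s hs
          exact h2 (Ideal.mul_mem_mul h1 hY)
        have hΘY : c.Θ Y = monomial (((Finset.univ.erase i).card * N) • f i) 1 := by
          simp only [Y, Finset.prod_const, map_pow, hyf, monomial_pow, one_pow, smul_smul]
        have h3 := c.coeff_eq_zero_of_mem_prime_pow hxY
          (m := ((Finset.univ.erase i).card * N) • f i + m) (by
            rw [Finsupp.add_apply, Finsupp.smul_apply, hfi, smul_zero, zero_add]
            exact hs)
        rw [map_mul, mul_comm (c.Θ x), hΘY, coeff_add_monomial_mul, one_mul] at h3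
        exact h3)
      rw [hz]
      exact Ideal.mul_mem_right _ _ (Ideal.mem_span_singleton_self y)
    · rw [Ideal.span_singleton_le_iff_mem, Submodule.mem_finsetInf]
      intro i _
      refine mem_map_colon_ideal_of_flat fun r hr => ?_
      have hr' : algebraMap A T r ∈ ∏ j ∈ Finset.univ.erase i, c.prime j ^ N := by
        rw [← hD]
        exact Ideal.mem_map_of_mem _ hr
      rw [Ideal.map_pow, h𝔭]
      obtain ⟨z, hz⟩ := c.exists_eq_mul_of_coeff_eq_zero (w := w (Sum.inl i) • v i)
        (y := yv i ^ w (Sum.inl i)) (x := y * algebraMap A T r)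
        (by
          have : intExp (w (Sum.inl i) • v i) = w (Sum.inl i) • intExp (v i) := by
            ext s; simp [intExp_apply]
          rw [this]
          exact Submodule.smul_of_tower_mem _ _ (hvL i))
        (by rw [map_pow, hyv, monomial_pow, one_pow])
        (fun m hm => by
          obtain ⟨s, hs⟩ : ∃ s, m s < (w (Sum.inl i) • v i) s := by
            by_contra! h
            exact hm h
          rw [Finsupp.smul_apply, smul_eq_mul] at hs
          rcases s with j | j
          swap
          · rw [hv0] at hs; omega
          rw [map_mul, hy, coeff_monomial_mul]
          split_ifs with hle
          swap
          · rfl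
          rw [one_mul]
          by_cases hji : j = i
          · subst hji
            rw [hv1, mul_one] at hs
            exact absurd (hle (Sum.inl j)) (by omega)
          · refine c.coeff_eq_zero_of_mem_prime_pow (i := j) (n := N)
              ((Ideal.prod_le_inf.trans (Finset.inf_le (f := fun j => c.prime j ^ N)
              (by simp [hji]))) hr') ?_
            rw [Finsupp.tsub_apply]
            have := hN i j
            omega)
      rw [hz]
      refine Ideal.mul_mem_right _ _ (Ideal.pow_mem_pow ?_ _)
      rw [c.monomial_mem_prime (hyv i), hv1]
      exact one_ne_zero
  have hy0 : y ≠ 0 := by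
    rintro rfl
    rw [map_zero] at hy
    have := congrArg (coeff w) hy
    rw [coeff_monomial_same, map_zero] at this
    exact zero_ne_one this
  obtain ⟨g, -, u, hu⟩ := Ideal.exists_eq_unit_mul_of_map_eq_span (A := A) hy0 hJ
  exact ⟨g, u, hu⟩

end FormalChart

end Divisors

/-! ### Flatness of dense homomorphisms to complete local rings -/

section DenseFlat

open IsLocalRing

lemma _root_.RingHom.injective_of_surjective_of_isNoetherianRing {S : Type*} [CommRing S]
    [IsNoetherianRing S] (f : S →+* S) (hf : Function.Surjective f) : Function.Injective f := by
  let a : ℕ →o Ideal S := ⟨fun n => RingHom.ker (f ^ n), monotone_nat_of_le_succ fun n x hx => by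
    rw [RingHom.mem_ker] at hx ⊢
    rw [pow_succ', RingHom.mul_def, RingHom.comp_apply, hx, map_zero]⟩
  obtain ⟨n, hn⟩ := monotone_stabilizes_iff_noetherian.mpr ‹IsNoetherianRing S› a
  rw [injective_iff_map_eq_zero]
  intro x hx
  have hs : Function.Surjective (f ^ n : S →+* S) := by
    rw [RingHom.coe_pow]
    exact hf.iterate n
  obtain ⟨y, rfl⟩ := hs x
  have h1 : y ∈ a (n + 1) := by
    change (f ^ (n + 1)) y = 0
    rw [pow_succ', RingHom.mul_def, RingHom.comp_apply, hx]
  rw [← hn (n + 1) (Nat.le_succ n)] at h1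
  exact h1

variable {R T : Type*} [CommRing R] [CommRing T] [IsLocalRing T]

/-- The completion of a Noetherian ring at a maximal ideal is flat, in terms of dense
homomorphisms. -/
theorem IsAdicDense.flat [IsNoetherianRing R] [Algebra R T] (hd : IsAdicDense (algebraMap R T))
    [IsAdicComplete (maximalIdeal T) T] : Module.Flat R T := by
  let 𝔫 : Ideal R := (maximalIdeal T).comap (algebraMap R T)
  have htop : ∀ n, (𝔫 ^ n • ⊤ : Submodule R R) = 𝔫 ^ n := fun n => by simp
  have hexact : ∀ n r, algebraMap R T r ∈ maximalIdeal T ^ n ↔ r ∈ (𝔫 ^ n • ⊤ : Submodule R R) := by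
    intro n r
    rw [htop]
    exact ⟨hd.mem_pow r n, fun h => Ideal.le_comap_pow _ n h⟩
  choose ρ hρ using hd.approx
  have key : ∀ n (x : T) (r : R), x - algebraMap R T r ∈ maximalIdeal T ^ n →
      (Submodule.mkQ (𝔫 ^ n • ⊤ : Submodule R R)) (ρ x n) = Submodule.mkQ _ r := by
    intro n x r hr
    rw [Submodule.mkQ_apply, Submodule.mkQ_apply, Submodule.Quotient.eq, ← hexact, map_sub]
    have := sub_mem hr (hρ x n)
    convert this using 1
    ring
  let f : ∀ n : ℕ, T →ₗ[R] R ⧸ (𝔫 ^ n • ⊤ : Submodule R R) := fun n =>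
    { toFun := fun x => Submodule.mkQ _ (ρ x n)
      map_add' := fun x y => by
        rw [← map_add]
        refine key _ _ _ ?_
        rw [map_add, add_sub_add_comm]
        exact add_mem (hρ x n) (hρ y n)
      map_smul' := fun r x => by
        rw [RingHom.id_apply, ← map_smul]
        refine key _ _ _ ?_
        rw [smul_eq_mul, map_mul, Algebra.smul_def, ← mul_sub]
        exact Ideal.mul_mem_left _ _ (hρ x n) }
  have hf : ∀ n x, f n x = Submodule.mkQ _ (ρ x n) := fun _ _ => rfl
  let F : T →ₗ[R] AdicCompletion 𝔫 R := AdicCompletion.lift 𝔫 f (by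
    intro m n hmn
    ext x
    have h1 : x - algebraMap R T (ρ x n) ∈ maximalIdeal T ^ m := Ideal.pow_le_pow_right hmn (hρ x n)
    rw [LinearMap.comp_apply, hf, hf, key _ _ _ h1]
    rfl)
  have hF : ∀ n x, (F x).val n = f n x := fun n x => rfl
  have hinj : Function.Injective F := by
    rw [injective_iff_map_eq_zero]
    intro x hx
    refine IsHausdorff.haus (I := maximalIdeal T) inferInstance x fun n => ?_
    have h1 : f n x = 0 := by rw [← hF, hx]; rfl
    rw [hf, Submodule.mkQ_apply, Submodule.Quotient.mk_eq_zero, ← hexact] at h1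
    rw [SModEq.zero, smul_eq_mul, Ideal.mul_top]
    have := add_mem (hρ x n) h1
    rwa [sub_add_cancel] at this
  have hsurj : Function.Surjective F := by
    intro z
    obtain ⟨s, rfl⟩ := AdicCompletion.mk_surjective 𝔫 R z
    obtain ⟨x, hx⟩ := IsPrecomplete.prec (I := maximalIdeal T) inferInstance
      (f := fun n => algebraMap R T (s n)) (fun {m n} hmn => by
        rw [SModEq.sub_mem, smul_eq_mul, Ideal.mul_top, ← map_sub, hexact, ← SModEq.sub_mem]
        exact s.2 hmn)
    refine ⟨x, AdicCompletion.ext fun n => ?_⟩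
    rw [hF, hf, key n x (s n)]
    · rfl
    · have := hx n
      rw [SModEq.sub_mem, smul_eq_mul, Ideal.mul_top] at this
      rw [← neg_mem_iff, neg_sub]
      exact this
  exact Module.Flat.of_linearEquiv (LinearEquiv.ofBijective F ⟨hinj, hsurj⟩)

/-- If a homomorphism is dense, then so is every homomorphism whose maximal ideal differs from its
maximal ideal by an automorphism of the source, provided it generates the maximal ideal and attains
the residue field. -/
theorem IsAdicDense.of_ringEquiv [IsNoetherianRing T] {θ : R →+* T} (hθ : IsAdicDense θ)
    (φ : R →+* T) (τ : R ≃+* R)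
    (hτ : ∀ r, φ (τ r) ∈ maximalIdeal T ↔ θ r ∈ maximalIdeal T)
    (h1 : ∀ x : T, ∃ r : R, x - φ r ∈ maximalIdeal T)
    (h2 : ((maximalIdeal T).comap φ).map φ = maximalIdeal T) : IsAdicDense φ := by
  refine ⟨exists_approx_of_map_eq φ h1 h2, fun r n hr => ?_⟩
  let 𝔫 := (maximalIdeal T).comap θ
  let 𝔪 := (maximalIdeal T).comap φ
  have hm : 𝔪.comap (τ : R →+* R) = 𝔫 := by
    ext r
    exact hτ r
  have hmn : 𝔫.map (τ : R →+* R) = 𝔪 := by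
    rw [← hm]
    exact Ideal.map_comap_of_surjective (τ : R →+* R) τ.surjective 𝔪
  let S := T ⧸ maximalIdeal T ^ n
  have hker : RingHom.ker ((Ideal.Quotient.mk (maximalIdeal T ^ n)).comp θ) = 𝔫 ^ n := by
    ext r
    rw [RingHom.mem_ker, RingHom.comp_apply, Ideal.Quotient.eq_zero_iff_mem]
    exact ⟨hθ.mem_pow r n, fun h => Ideal.le_comap_pow _ n h⟩
  have hθs : Function.Surjective ((Ideal.Quotient.mk (maximalIdeal T ^ n)).comp θ) := by
    intro y
    obtain ⟨x, rfl⟩ := Ideal.Quotient.mk_surjective y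
    obtain ⟨r, hr⟩ := hθ.approx x n
    exact ⟨r, (Ideal.Quotient.eq.mpr hr).symm⟩
  let ψ : R →+* S := ((Ideal.Quotient.mk (maximalIdeal T ^ n)).comp φ).comp (τ : R →+* R)
  have hψ : RingHom.ker ((Ideal.Quotient.mk (maximalIdeal T ^ n)).comp θ) ≤ RingHom.ker ψ := by
    rw [hker]
    intro r hr
    rw [RingHom.mem_ker, RingHom.comp_apply, RingHom.comp_apply, Ideal.Quotient.eq_zero_iff_mem]
    refine Ideal.le_comap_pow φ n ?_
    change τ r ∈ 𝔪 ^ n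
    rw [← hmn, ← Ideal.map_pow]
    exact Ideal.mem_map_of_mem _ hr
  let g : S →+* S := RingHom.liftOfSurjective _ hθs ⟨ψ, hψ⟩
  have hg : ∀ r, g (Ideal.Quotient.mk _ (θ r)) = ψ r := fun r =>
    RingHom.liftOfRightInverse_comp_apply _ _ _ _ r
  have hgs : Function.Surjective g := by
    intro y
    obtain ⟨x, rfl⟩ := Ideal.Quotient.mk_surjective y
    obtain ⟨r, hr⟩ := exists_approx_of_map_eq φ h1 h2 x n
    refine ⟨Ideal.Quotient.mk _ (θ (τ.symm r)), ?_⟩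
    rw [hg]
    refine (Ideal.Quotient.eq.mpr ?_).symm
    simpa using hr
  have hgi := RingHom.injective_of_surjective_of_isNoetherianRing g hgs
  have h3 : g (Ideal.Quotient.mk _ (θ (τ.symm r))) = 0 := by
    rw [hg]
    refine Ideal.Quotient.eq_zero_iff_mem.mpr ?_
    simpa using hr
  have h4 := (injective_iff_map_eq_zero g).mp hgi _ h3
  have h5 : τ.symm r ∈ 𝔫 ^ n := hθ.mem_pow _ _ (Ideal.Quotient.eq_zero_iff_mem.mp h4)
  have h6 := Ideal.mem_map_of_mem (τ : R →+* R) h5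
  rw [Ideal.map_pow, hmn] at h6
  simpa using h6

end DenseFlat

/-! ### Local equations of the boundary -/

section BoundaryHom

open IsLocalRing MvPowerSeries

variable {K A T ι κ : Type*} [Field K] [CommRing T] [IsLocalRing T] [Algebra K T]
  (c : FormalChart K T ι κ)

namespace FormalChart

/-- The lattice of exponents of Laurent monomials in the boundary variables alone. -/
def boundaryLattice : Submodule ℤ (ι → ℤ) where
  carrier := {q | Sum.elim q 0 ∈ c.L}
  add_mem' {a b} ha hb := by
    have h : (Sum.elim (a + b) 0 : ι ⊕ κ → ℤ) = Sum.elim a 0 + Sum.elim b 0 := by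
      ext (i | j) <;> simp
    change Sum.elim (a + b) 0 ∈ c.L
    rw [h]
    exact add_mem ha hb
  zero_mem' := by
    have h : Sum.elim (0 : ι → ℤ) (0 : κ → ℤ) = 0 := by ext (i | j) <;> rfl
    change Sum.elim (0 : ι → ℤ) (0 : κ → ℤ) ∈ c.L
    rw [h]
    exact zero_mem _
  smul_mem' n v hv := by
    have h : (Sum.elim (n • v) 0 : ι ⊕ κ → ℤ) = n • Sum.elim v 0 := by
      ext (i | j) <;> simp
    change Sum.elim (n • v) 0 ∈ c.L
    rw [h]
    exact Submodule.smul_mem _ _ hv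

lemma mem_boundaryLattice {q : ι → ℤ} : q ∈ c.boundaryLattice ↔ Sum.elim q 0 ∈ c.L := Iff.rfl

/-- `c.IsBoundaryMonomial w y` means that `y` is the monomial with exponent `w`, which only
involves boundary variables. -/
structure IsBoundaryMonomial (w : ι → ℕ) (y : T) : Prop where
  exists_eq : ∃ w' : ι ⊕ κ →₀ ℕ, (∀ i, w' (Sum.inl i) = w i) ∧ (∀ j, w' (Sum.inr j) = 0) ∧
    c.Θ y = monomial w' 1

variable {c}

lemma IsBoundaryMonomial.one : c.IsBoundaryMonomial 0 1 :=
  ⟨0, fun _ => rfl, fun _ => rfl, by rw [map_one]; rfl⟩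

lemma IsBoundaryMonomial.mul {w w' : ι → ℕ} {y y' : T} (h : c.IsBoundaryMonomial w y)
    (h' : c.IsBoundaryMonomial w' y') : c.IsBoundaryMonomial (w + w') (y * y') := by
  obtain ⟨v, hv, hv0, hy⟩ := h
  obtain ⟨v', hv', hv0', hy'⟩ := h'
  refine ⟨v + v', fun i => ?_, fun j => ?_, ?_⟩
  · rw [Finsupp.add_apply, hv, hv']; rfl
  · rw [Finsupp.add_apply, hv0, hv0']
  · rw [map_mul, hy, hy', monomial_mul_monomial, one_mul]

lemma IsBoundaryMonomial.ne_zero {w : ι → ℕ} {y : T} (h : c.IsBoundaryMonomial w y) : y ≠ 0 := by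
  obtain ⟨v, -, -, hy⟩ := h
  rintro rfl
  rw [map_zero] at hy
  have := congrArg (coeff v) hy
  rw [coeff_monomial_same, map_zero] at this
  exact zero_ne_one this

lemma IsBoundaryMonomial.eq {w : ι → ℕ} {y y' : T} (h : c.IsBoundaryMonomial w y)
    (h' : c.IsBoundaryMonomial w y') : y = y' := by
  obtain ⟨v, hv, hv0, hy⟩ := h
  obtain ⟨v', hv', hv0', hy'⟩ := h'
  have : v = v' := by
    ext (i | j)
    · rw [hv, hv']
    · rw [hv0, hv0']
  exact c.injective (by rw [hy, hy', this])

variable (c)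

lemma exists_isBoundaryMonomial [Finite ι] [Finite κ] {w : ι → ℕ}
    (hw : (fun i => (w i : ℤ)) ∈ c.boundaryLattice) : ∃ y, c.IsBoundaryMonomial w y := by
  let w' : ι ⊕ κ →₀ ℕ := Finsupp.equivFunOnFinite.symm (Sum.elim w 0)
  have h : intExp w' = Sum.elim (fun i => (w i : ℤ)) 0 := by
    ext (i | j) <;> simp [intExp_apply, w']
  obtain ⟨y, hy⟩ := c.exists_monomial (m := w') (h ▸ hw)
  exact ⟨y, w', fun _ => rfl, fun _ => rfl, hy⟩

/-- There is a boundary monomial involving every boundary variable. -/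
lemma exists_pos_mem_boundaryLattice [Finite ι] : ∃ w : ι → ℕ, (∀ i, 1 ≤ w i) ∧
    (fun i => (w i : ℤ)) ∈ c.boundaryLattice := by
  classical
  cases nonempty_fintype ι
  choose v hv1 hv0 hvL using c.prim
  refine ⟨fun i => ∑ j, v j (Sum.inl i), fun i => ?_, ?_⟩
  · rw [← hv1 i]
    exact Finset.single_le_sum (f := fun j => v j (Sum.inl i)) (fun _ _ => Nat.zero_le _)
      (Finset.mem_univ i)
  · have : (fun i => ((∑ j, v j (Sum.inl i) : ℕ) : ℤ)) = ∑ j, fun i => (v j (Sum.inl i) : ℤ) := by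
      ext i
      simp
    rw [this]
    refine Submodule.sum_mem _ fun j _ => ?_
    rw [mem_boundaryLattice]
    convert! hvL j using 1
    ext (i | i)
    · rfl
    · simp [intExp_apply, hv0]

variable [CommRing A] [IsDomain A] [Algebra A T] (F : Type*) [Field F] [Algebra A F]
  [IsFractionRing A F]

/-- Pairs of a rational function `a / b` and a Laurent monomial in the boundary variables that
agree up to a unit. -/
def boundaryEquations : AddSubgroup (Additive Fˣ × c.boundaryLattice) where
  carrier := {p | ∃ (a b : A) (w₁ w₂ : ι → ℕ) (y₁ y₂ : T) (u : Tˣ), b ≠ 0 ∧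
    (p.1.toMul : F) * algebraMap A F b = algebraMap A F a ∧ c.IsBoundaryMonomial w₁ y₁ ∧
    c.IsBoundaryMonomial w₂ y₂ ∧ (∀ i, (p.2 : ι → ℤ) i = w₁ i - w₂ i) ∧
    algebraMap A T a * y₂ = u * algebraMap A T b * y₁}
  zero_mem' := ⟨1, 1, 0, 0, 1, 1, 1, one_ne_zero, by simp, .one, .one, by simp, by simp⟩
  add_mem' := by
    rintro ⟨x, q⟩ ⟨x', q'⟩ ⟨a, b, w₁, w₂, y₁, y₂, u, hb, hx, h₁, h₂, hq, hu⟩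
      ⟨a', b', w₁', w₂', y₁', y₂', u', hb', hx', h₁', h₂', hq', hu'⟩
    refine ⟨a * a', b * b', _, _, _, _, u * u', mul_ne_zero hb hb', ?_, h₁.mul h₁', h₂.mul h₂',
      fun i => ?_, ?_⟩
    · simp only [Prod.mk_add_mk, toMul_add, Units.val_mul, map_mul, ← hx, ← hx']
      ring
    · have h := hq i
      have h' := hq' i
      simp only [Prod.mk_add_mk, Submodule.coe_add, Pi.add_apply, Nat.cast_add] at h h' ⊢
      rw [h, h']
      ring
    · rw [map_mul, map_mul, Units.val_mul]
      linear_combination (algebraMap A T a' * y₂') * hu + (u * algebraMap A T b * y₁) * hu'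
  neg_mem' := by
    rintro ⟨x, q⟩ ⟨a, b, w₁, w₂, y₁, y₂, u, hb, hx, h₁, h₂, hq, hu⟩
    refine ⟨b, a, w₂, w₁, y₂, y₁, u⁻¹, ?_, ?_, h₂, h₁, fun i => ?_, ?_⟩
    · rintro rfl
      rw [map_zero, mul_eq_zero] at hx
      rcases hx with hx | hx
      · exact x.toMul.ne_zero hx
      · exact hb ((map_eq_zero_iff _ (IsFractionRing.injective A F)).mp hx)
    · simp only [Prod.neg_mk, toMul_neg, Units.val_inv_eq_inv_val, ← hx]
      rw [inv_mul_cancel_left₀ x.toMul.ne_zero]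
    · have h := hq i
      simp only [Prod.neg_mk, NegMemClass.coe_neg, Pi.neg_apply] at h ⊢
      rw [h]
      ring
    · rw [mul_assoc, hu, mul_assoc, Units.inv_mul_cancel_left]

/-- Compatible local equations of the boundary: a homomorphism from the lattice of boundary
exponents to the group of rational functions whose values on effective exponents are regular
functions that agree with the corresponding monomials of the chart up to units. -/
theorem exists_boundaryHom [Finite ι] [Finite κ] [IsNoetherianRing A] [Module.FaithfullyFlat A T]
    (h𝔭 : ∀ i, ∃ 𝔭 : Ideal A, 𝔭.map (algebraMap A T) = c.prime i) :
    ∃ G : c.boundaryLattice →+ Additive Fˣ, ∀ (q : c.boundaryLattice) (w : ι → ℕ) (y : T),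
      (∀ i, (q : ι → ℤ) i = w i) → c.IsBoundaryMonomial w y →
      ∃ (g : A) (u : Tˣ), algebraMap A F g = ((G q).toMul : F) ∧ algebraMap A T g = u * y := by
  have hdom := c.isDomain
  have hinj : Function.Injective (algebraMap A T) := FaithfulSMul.algebraMap_injective A T
  let S := (c.boundaryEquations (A := A) F).toIntSubmodule
  let π : S →ₗ[ℤ] c.boundaryLattice :=
    (LinearMap.snd ℤ (Additive Fˣ) c.boundaryLattice).domRestrict S
  -- every element of the lattice is a difference of effective ones, by adding a multiple of an
  -- element with positive coordinates
  have hπ : Function.Surjective π := by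
    intro q
    obtain ⟨w₀, hw₀, hw₀L⟩ := c.exists_pos_mem_boundaryLattice
    obtain ⟨N, hN⟩ : ∃ N : ℕ, ∀ i, 0 ≤ (q : ι → ℤ) i + N * w₀ i := by
      cases nonempty_fintype ι
      refine ⟨∑ i, ((q : ι → ℤ) i).natAbs, fun i => ?_⟩
      have h1 : ((q : ι → ℤ) i).natAbs ≤ ∑ i, ((q : ι → ℤ) i).natAbs :=
        Finset.single_le_sum (f := fun i => ((q : ι → ℤ) i).natAbs) (fun _ _ => Nat.zero_le _)
          (Finset.mem_univ i)
      have h2 := Nat.mul_le_mul h1 (hw₀ i)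
      have h3 : -(((q : ι → ℤ) i).natAbs : ℤ) ≤ (q : ι → ℤ) i := by omega
      have h4 : (((q : ι → ℤ) i).natAbs : ℤ) ≤
          ((∑ i, ((q : ι → ℤ) i).natAbs : ℕ) : ℤ) * w₀ i := by
        rw [mul_one] at h2
        exact_mod_cast h2
      linarith
    let w₁ : ι → ℕ := fun i => ((q : ι → ℤ) i + N * w₀ i).toNat
    have hw₁ : ∀ i, (w₁ i : ℤ) = (q : ι → ℤ) i + N * w₀ i := fun i => Int.toNat_of_nonneg (hN i)
    have hL₂ : (fun i => ((N • w₀) i : ℤ)) ∈ c.boundaryLattice := by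
      have : (fun i => ((N • w₀) i : ℤ)) = N • fun i => (w₀ i : ℤ) := by
        ext i; simp
      rw [this]
      exact Submodule.smul_of_tower_mem _ _ hw₀L
    have hL₁ : (fun i => (w₁ i : ℤ)) ∈ c.boundaryLattice := by
      have : (fun i => (w₁ i : ℤ)) = (q : ι → ℤ) + fun i => ((N • w₀) i : ℤ) := by
        ext i
        rw [hw₁]
        simp
      rw [this]
      exact add_mem q.2 hL₂
    obtain ⟨y₁, hy₁⟩ := c.exists_isBoundaryMonomial hL₁
    obtain ⟨y₂, hy₂⟩ := c.exists_isBoundaryMonomial hL₂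
    have hg : ∀ {w : ι → ℕ} {y : T}, (fun i => (w i : ℤ)) ∈ c.boundaryLattice →
        c.IsBoundaryMonomial w y → ∃ (g : A) (u : Tˣ), g ≠ 0 ∧ algebraMap A T g = u * y := by
      intro w y hw hy
      obtain ⟨w', hw', hw0, hy'⟩ := hy
      have hw'L : intExp w' ∈ c.L := by
        have : intExp w' = Sum.elim (fun i => (w i : ℤ)) 0 := by
          ext (i | j) <;> simp [intExp_apply, hw', hw0]
        rw [this]
        exact hw
      obtain ⟨g, u, hu⟩ := c.exists_eq_unit_mul_monomial h𝔭 hw0 hw'L hy'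
      refine ⟨g, u, ?_, hu⟩
      rintro rfl
      rw [map_zero] at hu
      exact mul_ne_zero u.ne_zero
        (IsBoundaryMonomial.ne_zero (c := c) ⟨w', hw', hw0, hy'⟩) hu.symm
    obtain ⟨g₁, u₁, hg₁, hu₁⟩ := hg hL₁ hy₁
    obtain ⟨g₂, u₂, hg₂, hu₂⟩ := hg hL₂ hy₂
    have hg₁' : algebraMap A F g₁ ≠ 0 := by
      rwa [Ne, map_eq_zero_iff _ (IsFractionRing.injective A F)]
    have hg₂' : algebraMap A F g₂ ≠ 0 := by
      rwa [Ne, map_eq_zero_iff _ (IsFractionRing.injective A F)]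
    refine ⟨⟨(Additive.ofMul (Units.mk0 _ hg₁' / Units.mk0 _ hg₂'), q), g₁, g₂, w₁, N • w₀, y₁, y₂,
      u₁ * u₂⁻¹, hg₂, ?_, hy₁, hy₂, fun i => ?_, ?_⟩, rfl⟩
    · simp [div_mul_cancel₀ _ hg₂']
    · rw [hw₁]
      simp
    · rw [hu₁, hu₂, Units.val_mul]
      have := u₂.inv_mul
      linear_combination (- (u₁ : T) * y₂ * y₁) * this
  -- the lattice is free, so the equations can be chosen compatibly
  obtain ⟨h, hh⟩ := Module.projective_lifting_property π LinearMap.id hπ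
  refine ⟨((LinearMap.fst ℤ (Additive Fˣ) c.boundaryLattice).comp
    (S.subtype.comp h)).toAddMonoidHom, fun q w y hq hy => ?_⟩
  have hq' : ((h q : S) : Additive Fˣ × c.boundaryLattice).2 = q := LinearMap.congr_fun hh q
  obtain ⟨a, b, w₁, w₂, y₁, y₂, u, hb, hx, h₁, h₂, hw, hu⟩ := (h q).2
  rw [hq'] at hw
  have hy₁ : y₁ = y * y₂ := by
    refine h₁.eq (?_ : c.IsBoundaryMonomial w₁ _)
    have : w₁ = w + w₂ := by
      ext i
      have h1 := hw i
      rw [hq] at h1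
      rw [Pi.add_apply]
      omega
    rw [this]
    exact hy.mul h₂
  have hab : algebraMap A T a = algebraMap A T b * (u * y) := by
    apply mul_right_cancel₀ h₂.ne_zero
    rw [hu, hy₁]
    ring
  -- `a / b` is regular because `T` is faithfully flat over `A`
  have hmem : a ∈ ((Ideal.span {b}).map (algebraMap A T)).comap (algebraMap A T) := by
    rw [Ideal.mem_comap, hab, Ideal.map_span, Set.image_singleton]
    exact Ideal.mul_mem_right _ _ (Ideal.mem_span_singleton_self _)
  rw [Ideal.comap_map_eq_self_of_faithfullyFlat] at hmem
  obtain ⟨g, rfl⟩ := Ideal.mem_span_singleton.mp hmem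
  refine ⟨g, u, ?_, ?_⟩
  · rw [map_mul, mul_comm] at hx
    exact (mul_left_cancel₀ (by rwa [Ne, map_eq_zero_iff _ (IsFractionRing.injective A F)]) hx).symm
  · rw [map_mul] at hab
    exact mul_left_cancel₀ (by rwa [Ne, map_eq_zero_iff _ hinj]) hab

end FormalChart

end BoundaryHom

/-! ### Coordinates in the unit directions -/

section Coordinates

open IsLocalRing MvPowerSeries

lemma span_range_mkQ_comp {K V β : Type*} [Field K] [AddCommGroup V] [Module K V]
    (N : Submodule K V) (g : β → V) : Submodule.span K (Set.range (N.mkQ ∘ g)) = ⊤ ↔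
      N ⊔ Submodule.span K (Set.range g) = ⊤ := by
  rw [Set.range_comp, ← Submodule.map_span]
  constructor
  · intro hg
    have h1 := congrArg (Submodule.comap N.mkQ) hg
    rwa [Submodule.comap_map_mkQ, Submodule.comap_top] at h1
  · intro hg
    have h1 := congrArg (Submodule.map N.mkQ) hg
    rw [Submodule.map_sup, Submodule.mkQ_map_self, bot_sup_eq, Submodule.map_top,
      Submodule.range_mkQ] at h1
    exact h1

/-- Exchange lemma: modulo `N`, a finite spanning family can be replaced by one of the same size
taken from a given spanning family. -/
lemma exists_family_span_eq_top {K V α κ : Type*} [Field K] [AddCommGroup V] [Module K V] [Finite κ]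
    [Nonempty α] (N : Submodule K V) (f : α → V) (hf : N ⊔ Submodule.span K (Set.range f) = ⊤)
    (y : κ → V) (hy : N ⊔ Submodule.span K (Set.range y) = ⊤) :
    ∃ a : κ → α, N ⊔ Submodule.span K (Set.range (f ∘ a)) = ⊤ := by
  classical
  cases nonempty_fintype κ
  obtain ⟨κ', b, -, hb, hli⟩ := exists_linearIndependent' K (N.mkQ ∘ f)
  rw [(span_range_mkQ_comp N f).mpr hf] at hb
  have hys := (span_range_mkQ_comp N y).mpr hy
  have hfin : Module.Finite K (V ⧸ N) := ⟨⟨Finset.univ.image (N.mkQ ∘ y), by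
    rw [Finset.coe_image, Finset.coe_univ, Set.image_univ]
    exact hys⟩⟩
  have : Finite κ' := hli.finite
  cases nonempty_fintype κ'
  have hcard : Fintype.card κ' ≤ Fintype.card κ := by
    refine hli.fintype_card_le_finrank.trans ?_
    have := finrank_range_le_card (R := K) (N.mkQ ∘ y)
    rwa [Set.finrank, hys, finrank_top] at this
  obtain ⟨e⟩ := Function.Embedding.nonempty_of_card_le hcard
  refine ⟨fun j => if h : ∃ i, e i = j then b h.choose else Classical.arbitrary α,
    (span_range_mkQ_comp N _).mp (top_le_iff.mp ?_)⟩
  rw [← hb]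
  refine Submodule.span_mono ?_
  rintro _ ⟨i, rfl⟩
  refine ⟨e i, ?_⟩
  have h : ∃ i', e i' = e i := ⟨i, rfl⟩
  have h2 : h.choose = i := e.injective h.choose_spec
  simp only [Function.comp_apply, dif_pos h, h2]

variable {K A T ι κ : Type*} [Field K] [CommRing T] [IsLocalRing T] [Algebra K T]
  (c : FormalChart K T ι κ)

namespace FormalChart

/-- Evaluation at the closed point of the chart. -/
noncomputable def ev : T →+* K := constantCoeff.comp c.Θ.toRingHom

lemma ev_apply (x : T) : c.ev x = constantCoeff (c.Θ x) := rfl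

lemma mem_maximalIdeal_iff_ev {x : T} : x ∈ maximalIdeal T ↔ c.ev x = 0 := c.mem_maximalIdeal x

@[simp]
lemma ev_algebraMap (a : K) : c.ev (algebraMap K T a) = a := by
  rw [ev_apply, AlgHom.commutes]
  exact constantCoeff_C a

lemma sub_ev_mem (x : T) : x - algebraMap K T (c.ev x) ∈ maximalIdeal T := by
  rw [c.mem_maximalIdeal_iff_ev, map_sub, ev_algebraMap, sub_self]

/-- The ideal generated by the nontrivial boundary monomials. -/
def boundaryIdeal : Ideal T := Ideal.span {y | ∃ w : ι → ℕ, w ≠ 0 ∧ c.IsBoundaryMonomial w y}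

/-- The maximal ideal is generated to first order by the boundary monomials and the variables in
the unit directions. -/
lemma mem_boundaryIdeal_sup [Finite ι] [Finite κ] (y : κ → T) (hy : ∀ j, c.Θ (y j) = X (Sum.inr j))
    {x : T} (hx : x ∈ maximalIdeal T) :
    x ∈ c.boundaryIdeal ⊔ Ideal.span (Set.range y) ⊔ maximalIdeal T ^ 2 := by
  classical
  obtain ⟨M, hM⟩ := c.mem_pow_of_le_order 2
  let S := (Finsupp.finite_of_degree_lt (σ := ι ⊕ κ) M).toFinset
  have hz : ∀ m : ι ⊕ κ →₀ ℕ, ∃ z : T, c.Θ z = monomial m (coeff m (c.Θ x)) ∧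
      z ∈ c.boundaryIdeal ⊔ Ideal.span (Set.range y) := by
    intro m
    by_cases h0 : coeff m (c.Θ x) = 0
    · exact ⟨0, by rw [h0, map_zero, map_zero], zero_mem _⟩
    have hmL : intExp m ∈ c.L := c.isSupp x m h0
    obtain ⟨z, hz⟩ := c.exists_monomial hmL
    refine ⟨algebraMap K T (coeff m (c.Θ x)) * z, ?_, Ideal.mul_mem_left _ _ ?_⟩
    · rw [map_mul, hz, AlgHom.commutes]
      change C _ * _ = _
      rw [← monomial_zero_eq_C_apply, monomial_mul_monomial, zero_add, mul_one]
    by_cases hr : ∀ j, m (Sum.inr j) = 0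
    · refine Ideal.mem_sup_left (Ideal.subset_span ⟨fun i => m (Sum.inl i), fun h => h0 ?_, m,
        fun _ => rfl, hr, hz⟩)
      have : m = 0 := by
        ext (i | j)
        · exact congrFun h i
        · exact hr j
      rw [this]
      exact (c.mem_maximalIdeal x).mp hx
    · push Not at hr
      obtain ⟨j, hj⟩ := hr
      obtain ⟨z', hz'⟩ := c.exists_eq_mul_of_coeff_eq_zero (c.single_mem j) (hy j) (x := z)
        (fun m' hm' => by
          rw [hz, coeff_monomial_ne]
          rintro rfl
          refine hm' (Finsupp.single_le_iff.mpr (by omega)))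
      rw [hz']
      exact Ideal.mem_sup_right (Ideal.mul_mem_right _ _ (Ideal.subset_span ⟨j, rfl⟩))
  choose z hz hzm using hz
  have h1 : x - ∑ m ∈ S, z m ∈ maximalIdeal T ^ 2 := by
    refine hM _ (le_order fun m hm => ?_)
    rw [map_sub, map_sum, map_sub, map_sum]
    simp only [hz, coeff_monomial]
    have hmS : m ∈ S := by
      rw [Set.Finite.mem_toFinset]
      exact_mod_cast hm
    rw [Finset.sum_ite_eq, if_pos hmS, sub_self]
  rw [← sub_add_cancel x (∑ m ∈ S, z m)]
  exact add_mem (Ideal.mem_sup_right h1)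
    (Ideal.mem_sup_left (Ideal.sum_mem _ fun m _ => hzm m))

lemma boundaryIdeal_le : c.boundaryIdeal ≤ maximalIdeal T := by
  refine Ideal.span_le.mpr ?_
  rintro y ⟨w, hw, w', hw', hw0, hy⟩
  rw [SetLike.mem_coe, c.mem_maximalIdeal, hy, ← coeff_zero_eq_constantCoeff_apply,
    coeff_monomial_ne]
  rintro rfl
  exact hw (funext fun i => (hw' i).symm)

/-- There are units of the subring `A` which, up to constants, are coordinates in the unit
directions of the chart. -/
theorem exists_units_span [Finite ι] [Finite κ] [CommRing A] [IsLocalRing A] [Algebra A T]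
    (hspan : ∀ x : T, ∃ y ∈ Submodule.span K (Set.range (algebraMap A T)),
      x - y ∈ maximalIdeal T ^ 2) :
    ∃ a : κ → Aˣ, maximalIdeal T ≤ c.boundaryIdeal ⊔ Ideal.span (Set.range fun j =>
      algebraMap A T (a j) - algebraMap K T (c.ev (algebraMap A T (a j)))) ⊔
        maximalIdeal T ^ 2 := by
  classical
  cases nonempty_fintype κ
  choose y hy using fun j : κ => (c.mem_range (X (Sum.inr j))).mp
    (isSupp_monomial (c.single_mem j) 1)
  let I : Ideal T := c.boundaryIdeal ⊔ maximalIdeal T ^ 2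
  have hI : I ≤ maximalIdeal T := sup_le c.boundaryIdeal_le (Ideal.pow_le_self two_ne_zero)
  -- the vector space of elements without linear part in the unit directions
  let N : Submodule K T := I.restrictScalars K ⊔ Submodule.span K {1}
  have h1N : (1 : T) ∈ N := Submodule.mem_sup_right (Submodule.mem_span_singleton_self _)
  have hcN : ∀ b : K, algebraMap K T b ∈ N := fun b => by
    rw [Algebra.algebraMap_eq_smul_one]
    exact Submodule.smul_mem _ _ h1N
  have hIN : ∀ x ∈ I, x ∈ N := fun x hx => Submodule.mem_sup_left hx
  have hyspan : N ⊔ Submodule.span K (Set.range y) = ⊤ := by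
    rw [eq_top_iff]
    intro x _
    have h := c.mem_boundaryIdeal_sup y hy (c.sub_ev_mem x)
    rw [sup_right_comm] at h
    obtain ⟨i, hi, s, hs, his⟩ := Submodule.mem_sup.mp h
    rw [← sub_add_cancel x (algebraMap K T (c.ev x)), ← his]
    refine add_mem (add_mem (Submodule.mem_sup_left (hIN i hi)) ?_) (Submodule.mem_sup_left (hcN _))
    obtain ⟨t, rfl⟩ := (Submodule.mem_span_range_iff_exists_fun T).mp hs
    refine Submodule.sum_mem _ fun j _ => ?_
    have h2 : t j • y j = (t j - algebraMap K T (c.ev (t j))) * y j + c.ev (t j) • y j := by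
      rw [smul_eq_mul, Algebra.smul_def]; ring
    rw [h2]
    refine add_mem (Submodule.mem_sup_left (hIN _ (Ideal.mem_sup_right ?_)))
      (Submodule.mem_sup_right (Submodule.smul_mem _ _ (Submodule.subset_span ⟨j, rfl⟩)))
    rw [pow_two]
    refine Ideal.mul_mem_mul (c.sub_ev_mem _) ?_
    rw [c.mem_maximalIdeal, hy, constantCoeff_X]
  have hAspan : N ⊔ Submodule.span K (Set.range (algebraMap A T)) = ⊤ := by
    rw [eq_top_iff]
    intro x _
    obtain ⟨s, hs, hxs⟩ := hspan x
    rw [← sub_add_cancel x s]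
    exact add_mem (Submodule.mem_sup_left (hIN _ (Ideal.mem_sup_right hxs)))
      (Submodule.mem_sup_right hs)
  -- elements of `A` with the same linear parts as the variables, up to a change of basis
  obtain ⟨b, hb⟩ := exists_family_span_eq_top N (algebraMap A T) hAspan y hyspan
  -- a nonunit becomes a unit by subtracting `1`, which does not change its linear part
  have hunit : ∀ j, ∃ u : Aˣ, ∃ s : T, s ∈ N ∧ algebraMap A T (b j) = algebraMap A T u + s := by
    intro j
    by_cases hbj : IsUnit (b j)
    · exact ⟨hbj.unit, 0, zero_mem _, by simp⟩
    · obtain ⟨u, hu⟩ := (IsLocalRing.isUnit_or_isUnit_one_sub_self (b j)).resolve_left hbj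
      refine ⟨-u, 1, h1N, ?_⟩
      rw [Units.val_neg, hu, map_neg, map_sub, map_one]
      ring
  choose a s hs has using hunit
  refine ⟨a, fun x hx => ?_⟩
  have ha : N ⊔ Submodule.span K (Set.range fun j => algebraMap A T (a j)) = ⊤ := by
    rw [eq_top_iff, ← hb]
    refine sup_le le_sup_left (Submodule.span_le.mpr ?_)
    rintro _ ⟨j, rfl⟩
    rw [Function.comp_apply, has j]
    exact add_mem (Submodule.mem_sup_right (Submodule.subset_span ⟨j, rfl⟩))
      (Submodule.mem_sup_left (hs j))
  obtain ⟨n, hn, t, ht, rfl⟩ := Submodule.mem_sup.mp (ha ▸ Submodule.mem_top : x ∈ N ⊔ _)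
  obtain ⟨i, hi, e, he, rfl⟩ := Submodule.mem_sup.mp hn
  obtain ⟨β, rfl⟩ := Submodule.mem_span_singleton.mp he
  obtain ⟨γ, rfl⟩ := (Submodule.mem_span_range_iff_exists_fun K).mp ht
  let δ : κ → T := fun j => algebraMap A T (a j) - algebraMap K T (c.ev (algebraMap A T (a j)))
  have h3 : ∑ j, γ j • algebraMap A T (a j) = ∑ j, γ j • δ j
      + algebraMap K T (∑ j, γ j * c.ev (algebraMap A T (a j))) := by
    rw [map_sum, ← Finset.sum_add_distrib]
    refine Finset.sum_congr rfl fun j _ => ?_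
    rw [map_mul, ← Algebra.smul_def, ← smul_add, sub_add_cancel]
  have hδ : ∑ j, γ j • δ j ∈ Ideal.span (Set.range δ) := Ideal.sum_mem _ fun j _ => by
    rw [Algebra.smul_def]
    exact Ideal.mul_mem_left _ _ (Ideal.subset_span ⟨j, rfl⟩)
  have hδm : ∑ j, γ j • δ j ∈ maximalIdeal T := by
    refine (Ideal.span_le.mpr ?_ : Ideal.span (Set.range δ) ≤ _) hδ
    rintro _ ⟨j, rfl⟩
    exact c.sub_ev_mem _
  rw [h3, ← Algebra.algebraMap_eq_smul_one] at hx ⊢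
  have h4 : algebraMap K T β + algebraMap K T (∑ j, γ j * c.ev (algebraMap A T (a j))) = 0 := by
    rw [← map_add]
    have h5 : c.ev _ = 0 := c.mem_maximalIdeal_iff_ev.mp
      (sub_mem (sub_mem hx (hI hi)) hδm)
    have h6 : i + algebraMap K T β + (∑ j, γ j • δ j
      + algebraMap K T (∑ j, γ j * c.ev (algebraMap A T (a j)))) - i - ∑ j, γ j • δ j
      = algebraMap K T (β + ∑ j, γ j * c.ev (algebraMap A T (a j))) := by
      rw [map_add]; ring
    rw [h6, ev_algebraMap] at h5
    rw [h5, map_zero]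
  have h7 : i + algebraMap K T β + (∑ j, γ j • δ j
      + algebraMap K T (∑ j, γ j * c.ev (algebraMap A T (a j)))) = i + ∑ j, γ j • δ j := by
    linear_combination h4
  rw [h7, sup_right_comm]
  exact add_mem (Ideal.mem_sup_left hi) (Ideal.mem_sup_right hδ)

end FormalChart

end Coordinates

/-! ### The homomorphism from the monoid algebra -/

section ToricHom

open IsLocalRing MvPowerSeries

variable {K A T ι κ : Type*} [Field K] [CommRing T] [IsLocalRing T] [Algebra K T]
  (c : FormalChart K T ι κ)

namespace FormalChart

lemma comp_inl_mem_boundaryLattice [Finite κ] {v : ι ⊕ κ → ℤ} (hv : v ∈ c.L) :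
    v ∘ Sum.inl ∈ c.boundaryLattice := by
  classical
  cases nonempty_fintype κ
  rw [mem_boundaryLattice]
  have h : Sum.elim (v ∘ Sum.inl) 0 =
      v - ∑ j : κ, v (Sum.inr j) • intExp (Finsupp.single (Sum.inr j : ι ⊕ κ) 1) := by
    ext (i | j)
    · simp [intExp_apply]
    · simp [intExp_apply, Finsupp.single_apply, Finset.sum_apply]
  rw [h]
  exact sub_mem hv (Submodule.sum_mem _ fun j _ => Submodule.smul_mem _ _ (c.single_mem j))

variable [CommRing A] [IsDomain A] [Algebra A T]

/-- A monoid homomorphism from the lattice points of the cone of a chart to the subring `A`, which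
agrees with the chart up to units and takes prescribed values in the unit directions. -/
theorem exists_toricHom [Finite ι] [Fintype κ] [IsNoetherianRing A] [Module.FaithfullyFlat A T]
    (h𝔭 : ∀ i, ∃ 𝔭 : Ideal A, 𝔭.map (algebraMap A T) = c.prime i) {M : Type*} [AddCommGroup M]
    (Λ : M →+ (ι ⊕ κ → ℤ)) (hΛ : ∀ m, Λ m ∈ c.L) (P : AddSubmonoid M)
    (hP : ∀ m, m ∈ P ↔ ∀ i, 0 ≤ Λ m (Sum.inl i)) (a : κ → Aˣ) :
    ∃ ψ : Multiplicative P →* A,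
      (∀ m : P, ∃ (w : ι → ℕ) (y : T) (u : Tˣ), c.IsBoundaryMonomial w y ∧
        (∀ i, (w i : ℤ) = Λ m (Sum.inl i)) ∧ algebraMap A T (ψ (.ofAdd m)) = u * y) ∧
      (∀ m : P, (∀ i, Λ m (Sum.inl i) = 0) →
        ψ (.ofAdd m) = (∏ j, a j ^ Λ m (Sum.inr j) : Aˣ)) := by
  let F := FractionRing A
  obtain ⟨G, hG⟩ := c.exists_boundaryHom F h𝔭
  let q : M → c.boundaryLattice := fun m => ⟨Λ m ∘ Sum.inl, c.comp_inl_mem_boundaryLattice (hΛ m)⟩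
  have hq : ∀ m m', q (m + m') = q m + q m' := fun m m' => by
    ext i
    simp [q]
  have hex : ∀ m : P, ∃ (w : ι → ℕ) (y : T) (g : A) (u : Tˣ), c.IsBoundaryMonomial w y ∧
      (∀ i, (w i : ℤ) = Λ m (Sum.inl i)) ∧ algebraMap A F g = ((G (q m)).toMul : F) ∧
      algebraMap A T g = u * y := by
    intro m
    have hm := (hP m).mp m.2
    let w : ι → ℕ := fun i => (Λ m (Sum.inl i)).toNat
    have hw : ∀ i, (w i : ℤ) = Λ m (Sum.inl i) := fun i => Int.toNat_of_nonneg (hm i)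
    obtain ⟨y, hy⟩ := c.exists_isBoundaryMonomial (w := w) (by
      have : (fun i => (w i : ℤ)) = q m := funext hw
      rw [this]
      exact (q m).2)
    obtain ⟨g, u, hg, hu⟩ := hG (q m) w y (fun i => (hw i).symm) hy
    exact ⟨w, y, g, u, hy, hw, hg, hu⟩
  choose w y g u hy hw hg hu using hex
  have hinj : Function.Injective (algebraMap A F) := IsFractionRing.injective A F
  have hg0 : ∀ m : P, (∀ i, Λ m (Sum.inl i) = 0) → g m = 1 := by
    intro m hm
    apply hinj
    have : q m = 0 := Subtype.ext (funext hm)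
    rw [hg, this, map_zero, map_one]
    rfl
  have hgadd : ∀ m m' : P, g (m + m') = g m * g m' := by
    intro m m'
    apply hinj
    rw [map_mul, hg, hg, hg, AddSubmonoid.coe_add, hq, map_add, toMul_add, Units.val_mul]
  let e : M → Aˣ := fun m => ∏ j, a j ^ Λ m (Sum.inr j)
  have he : ∀ m m', e (m + m') = e m * e m' := fun m m' => by
    simp only [e, map_add, Pi.add_apply, zpow_add, Finset.prod_mul_distrib]
  refine ⟨{ toFun := fun m => g m.toAdd * e m.toAdd
            map_one' := ?_
            map_mul' := fun m m' => ?_ }, fun m => ⟨w m, y m, Units.map (algebraMap A T) (e m) *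
              u m,
              hy m, hw m, ?_⟩, fun m hm => ?_⟩
  · rw [toAdd_one, hg0 0 (fun i => by simp)]
    simp [e]
  · rw [toAdd_mul, hgadd, AddSubmonoid.coe_add, he, Units.val_mul]
    ring
  · change algebraMap A T (g m * e m) = _
    rw [map_mul, hu, Units.val_mul, Units.coe_map]
    change _ = algebraMap A T (e m) * _ * _
    ring
  · change g m * e m = e m
    rw [hg0 m hm, one_mul]

lemma IsBoundaryMonomial.mem_boundaryIdeal {c : FormalChart K T ι κ} {w : ι → ℕ} {y : T}
    (h : c.IsBoundaryMonomial w y) (hw : w ≠ 0) : y ∈ c.boundaryIdeal :=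
  Ideal.subset_span ⟨w, hw, h⟩

/-- The diagonal automorphism of a monoid algebra given by a character of the monoid. -/
noncomputable def _root_.AddMonoidAlgebra.twist (K : Type*) [Field K] {M : Type*} [AddCommMonoid M]
    (χ : Multiplicative M →* Kˣ) : AddMonoidAlgebra K M ≃ₐ[K] AddMonoidAlgebra K M :=
  AlgEquiv.ofAlgHom
    (AddMonoidAlgebra.lift K (AddMonoidAlgebra K M) M
      { toFun := fun m => AddMonoidAlgebra.single m.toAdd (χ m : K)
        map_one' := by rw [map_one χ]; rfl
        map_mul' := fun m m' => by
          rw [AddMonoidAlgebra.single_mul_single, map_mul χ, Units.val_mul]; rfl })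
    (AddMonoidAlgebra.lift K (AddMonoidAlgebra K M) M
      { toFun := fun m => AddMonoidAlgebra.single m.toAdd ((χ m)⁻¹ : Kˣ)
        map_one' := by rw [map_one χ, inv_one]; rfl
        map_mul' := fun m m' => by
          rw [AddMonoidAlgebra.single_mul_single, map_mul χ, mul_inv, Units.val_mul]; rfl })
    (by
      ext m
      simp [AddMonoidAlgebra.lift_single])
    (by
      ext m
      simp [AddMonoidAlgebra.lift_single])

lemma _root_.AddMonoidAlgebra.twist_single (K : Type*) [Field K] {M : Type*} [AddCommMonoid M]
    (χ : Multiplicative M →* Kˣ) (m : M) (b : K) :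
    AddMonoidAlgebra.twist K χ (AddMonoidAlgebra.single m b)
      = AddMonoidAlgebra.single m (b * χ (.ofAdd m)) := by
  simp [AddMonoidAlgebra.twist, AddMonoidAlgebra.lift_single]

variable [IsLocalRing A]

/-- A homomorphism from the monoid algebra of the cone of a chart to a subring `A` which identifies
the completion of the monoid algebra with the ring of the chart. -/
theorem exists_isAdicDense [Finite ι] [Finite κ] [IsNoetherianRing A] [IsNoetherianRing T]
    [Module.FaithfullyFlat A T]
    (h𝔭 : ∀ i, ∃ 𝔭 : Ideal A, 𝔭.map (algebraMap A T) = c.prime i)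
    (hspan : ∀ x : T, ∃ y ∈ Submodule.span K (Set.range (algebraMap A T)),
      x - y ∈ maximalIdeal T ^ 2)
    {M : Type*} [AddCommGroup M]
    (Λ : M →+ (ι ⊕ κ → ℤ)) (hΛ : ∀ v, v ∈ c.L ↔ ∃ m, Λ m = v) (P : AddSubmonoid M)
    (hP : ∀ m, m ∈ P ↔ ∀ i, 0 ≤ Λ m (Sum.inl i))
    (θ : AddMonoidAlgebra K P →ₐ[K] T) (hθ : IsAdicDense θ.toRingHom) (ε : Multiplicative M →* Kˣ)
    (hθ0 : ∀ m : P, (∀ i, Λ m (Sum.inl i) = 0) →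
      c.ev (θ (AddMonoidAlgebra.single m 1)) = ε (.ofAdd m))
    (hθ1 : ∀ m : P, (∃ i, Λ m (Sum.inl i) ≠ 0) → c.ev (θ (AddMonoidAlgebra.single m 1)) = 0) :
    ∃ ψ : Multiplicative P →* A,
      (∀ m : P, ∃ (w : ι → ℕ) (y : T) (u : Tˣ), c.IsBoundaryMonomial w y ∧
        (∀ i, (w i : ℤ) = Λ m (Sum.inl i)) ∧ algebraMap A T (ψ (.ofAdd m)) = u * y) ∧
      IsAdicDense (AddMonoidAlgebra.lift K T P
        ((algebraMap A T : A →* T).comp ψ)).toRingHom := by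
  classical
  cases nonempty_fintype κ
  obtain ⟨a, ha⟩ := c.exists_units_span (A := A) hspan
  have hΛL : ∀ m, Λ m ∈ c.L := fun m => (hΛ _).mpr ⟨m, rfl⟩
  obtain ⟨ψ, hψ, hψ0⟩ := c.exists_toricHom h𝔭 Λ hΛL P hP a
  refine ⟨ψ, hψ, ?_⟩
  let Φ := AddMonoidAlgebra.lift K T P ((algebraMap A T : A →* T).comp ψ)
  have hΦ : ∀ (m : P) (b : K), Φ (AddMonoidAlgebra.single m b)
      = algebraMap K T b * algebraMap A T (ψ (.ofAdd m)) := fun m b => by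
    rw [AddMonoidAlgebra.lift_single, Algebra.smul_def]; rfl
  have hevu : ∀ u : Aˣ, IsUnit (c.ev (algebraMap A T u)) := fun u =>
    (u.isUnit.map (algebraMap A T)).map c.ev
  -- the augmentation of `Φ` on monomials
  let ε' : Multiplicative M →* Kˣ :=
    { toFun := fun m => ∏ j, (Units.map (c.ev.comp (algebraMap A T)) (a j)) ^ Λ m.toAdd (Sum.inr j)
      map_one' := by simp
      map_mul' := fun m m' => by
        simp only [toAdd_mul, map_add, Pi.add_apply, zpow_add, Finset.prod_mul_distrib] }
  have hΦ0 : ∀ m : P, (∀ i, Λ m (Sum.inl i) = 0) →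
      c.ev (algebraMap A T (ψ (.ofAdd m))) = ε' (.ofAdd m) := by
    intro m hm
    rw [hψ0 m hm]
    change ((Units.map ((c.ev.comp (algebraMap A T) : A →+* K) : A →* K)
      (∏ j, a j ^ Λ m (Sum.inr j)) : Kˣ) : K) = _
    rw [map_prod]
    simp only [map_zpow]
    rfl
  have hwne : ∀ (m : P) (w : ι → ℕ), (∀ i, (w i : ℤ) = Λ m (Sum.inl i)) →
      (∃ i, Λ m (Sum.inl i) ≠ 0) → w ≠ 0 := by
    rintro m w hw ⟨i, hi⟩ rfl
    exact hi (hw i).symm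
  have hΦ1 : ∀ m : P, (∃ i, Λ m (Sum.inl i) ≠ 0) → c.ev (algebraMap A T (ψ (.ofAdd m))) = 0 := by
    intro m hm
    obtain ⟨w, y, u, hy, hw, hu⟩ := hψ m
    rw [hu, ← c.mem_maximalIdeal_iff_ev]
    exact Ideal.mul_mem_left _ _ (c.boundaryIdeal_le (hy.mem_boundaryIdeal (hwne m w hw hm)))
  let χ : Multiplicative P →* Kˣ := (ε / ε').comp (AddMonoidHom.toMultiplicative P.subtype)
  have hχ : ∀ r, c.ev (Φ (AddMonoidAlgebra.twist K χ r)) = c.ev (θ r) := by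
    intro r
    induction r using AddMonoidAlgebra.induction_linear with
    | zero => simp
    | add r s hr hs => rw [map_add, map_add, map_add, hr, hs, map_add, map_add]
    | single m b =>
      have h1 : AddMonoidAlgebra.single m b = algebraMap K (AddMonoidAlgebra K P) b *
          AddMonoidAlgebra.single m 1 := by
        rw [← Algebra.smul_def, AddMonoidAlgebra.smul_single, smul_eq_mul, mul_one]
      rw [AddMonoidAlgebra.twist_single, hΦ, map_mul, ev_algebraMap, h1, map_mul, AlgHom.commutes,
        map_mul, ev_algebraMap, mul_assoc]
      congr 1
      by_cases hm : ∀ i, Λ m (Sum.inl i) = 0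
      · rw [hΦ0 m hm, hθ0 m hm, ← Units.val_mul]
        congr 1
        change ε (.ofAdd (m : M)) / ε' (.ofAdd (m : M)) * ε' (.ofAdd (m : M)) = _
        rw [div_mul_cancel]
      · push Not at hm
        rw [hΦ1 m hm, hθ1 m hm, mul_zero]
  refine hθ.of_ringEquiv Φ.toRingHom (AddMonoidAlgebra.twist K χ).toRingEquiv (fun r => ?_)
    (fun x => ⟨algebraMap K _ (c.ev x), ?_⟩) ?_
  · rw [c.mem_maximalIdeal_iff_ev, c.mem_maximalIdeal_iff_ev]
    exact Eq.congr_left (hχ r)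
  · have : Φ.toRingHom (algebraMap K _ (c.ev x)) = algebraMap K T (c.ev x) := Φ.commutes _
    rw [this]
    exact c.sub_ev_mem x
  · let 𝔫 : Ideal (AddMonoidAlgebra K P) := (maximalIdeal T).comap Φ.toRingHom
    refine le_antisymm Ideal.map_comap_le ?_
    have hle : maximalIdeal T ≤ 𝔫.map Φ.toRingHom ⊔ maximalIdeal T • maximalIdeal T := by
      rw [smul_eq_mul, ← pow_two]
      refine ha.trans (sup_le_sup_right (sup_le (Ideal.span_le.mpr ?_) (Ideal.span_le.mpr ?_)) _)
      · rintro y ⟨w, hw, hy⟩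
        -- a boundary monomial is the image of a monomial up to a unit
        obtain ⟨w', hw', hw0, hyw⟩ := hy
        have hL : intExp w' ∈ c.L := by
          refine c.isSupp y w' ?_
          rw [hyw, coeff_monomial_same]
          exact one_ne_zero
        obtain ⟨m, hm⟩ := (hΛ _).mp hL
        have hm' : ∀ i, Λ m (Sum.inl i) = w i := fun i => by
          rw [hm, intExp_apply, hw']
        have hmP : m ∈ P := (hP m).mpr fun i => by rw [hm']; exact Int.natCast_nonneg _
        obtain ⟨w₁, y₁, u, hy₁, hw₁, hu⟩ := hψ ⟨m, hmP⟩
        have hww : w₁ = w := funext fun i => by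
          have := hw₁ i
          rw [hm'] at this
          exact_mod_cast this
        subst hww
        have hyy : y₁ = y := hy₁.eq ⟨w', hw', hw0, hyw⟩
        subst hyy
        have h2 : Φ.toRingHom (AddMonoidAlgebra.single ⟨m, hmP⟩ 1) = u * y₁ := by
          rw [← hu]
          change Φ _ = _
          rw [hΦ, map_one, one_mul]
        have h3 : (u : T) * y₁ ∈ 𝔫.map Φ.toRingHom := by
          rw [← h2]
          refine Ideal.mem_map_of_mem _ ?_
          rw [Ideal.mem_comap, h2]
          exact Ideal.mul_mem_left _ _ (c.boundaryIdeal_le (hy₁.mem_boundaryIdeal hw))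
        exact (Ideal.unit_mul_mem_iff_mem _ u.isUnit).mp h3
      · rintro _ ⟨j, rfl⟩
        obtain ⟨m, hm⟩ := (hΛ _).mp (c.single_mem j)
        have hm0 : ∀ i, Λ m (Sum.inl i) = 0 := fun i => by rw [hm, intExp_apply]; simp
        have hmP : m ∈ P := (hP m).mpr fun i => (hm0 i).ge
        have h1 : ψ (.ofAdd ⟨m, hmP⟩) = a j := by
          rw [hψ0 _ hm0]
          congr 1
          rw [Finset.prod_eq_single j]
          · simp [hm, intExp_apply]
          · intro j' _ hj'
            simp [hm, intExp_apply, hj'.symm]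
          · simp
        have h2 : Φ.toRingHom (AddMonoidAlgebra.single ⟨m, hmP⟩ 1 -
            algebraMap K _ (c.ev (algebraMap A T (a j)))) =
            algebraMap A T (a j) - algebraMap K T (c.ev (algebraMap A T (a j))) := by
          rw [map_sub, ← h1]
          change Φ _ - Φ _ = _
          rw [hΦ, map_one, one_mul, AlgHom.commutes]
        beta_reduce
        rw [SetLike.mem_coe, ← h2]
        refine Ideal.mem_map_of_mem _ ?_
        rw [Ideal.mem_comap, h2]
        exact c.sub_ev_mem _
    exact Submodule.le_of_le_smul_of_le_jacobson_bot (IsNoetherian.noetherian _)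
      (IsLocalRing.maximalIdeal_le_jacobson _) hle

end FormalChart

end ToricHom

/-! ### Flatness and unramifiedness of the homomorphism from the monoid algebra -/

section FlatDescent

open TensorProduct

lemma _root_.Module.Flat.of_faithfullyFlat_tower (R A T : Type*) [CommRing R] [CommRing A]
    [CommRing T]
    [Algebra R A] [Algebra A T] [Algebra R T] [IsScalarTower R A T] [Module.Flat R T]
    [Module.FaithfullyFlat A T] : Module.Flat R A := by
  rw [Module.Flat.iff_lTensor_injective']
  intro I
  have h1 : Function.Injective (I.subtype.baseChange A) := by
    rw [← Module.FaithfullyFlat.lTensor_injective_iff_injective A T]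
    have h2 : Function.Injective (I.subtype.lTensor T) :=
      Module.Flat.lTensor_preserves_injective_linearMap _ I.injective_subtype
    let e₁ := AlgebraTensorModule.cancelBaseChange R A A T I
    let e₂ := AlgebraTensorModule.cancelBaseChange R A A T R
    have h3 : ∀ x, e₂ ((I.subtype.baseChange A).lTensor T x) = I.subtype.lTensor T (e₁ x) := by
      intro x
      induction x with
      | zero => simp
      | add x y hx hy => rw [map_add, map_add, hx, hy, map_add, map_add]
      | tmul t y =>
        induction y with
        | zero => simp
        | add x y hx hy => rw [tmul_add, map_add, map_add, hx, hy, map_add, map_add]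
        | tmul a i => simp [e₁, e₂]
    intro x y hxy
    apply e₁.injective
    apply h2
    rw [← h3, ← h3, hxy]
  exact h1

lemma _root_.AddMonoidAlgebra.flat_mapRingHom (k K M : Type*) [Field k] [Field K] [Algebra k K]
    [AddCommMonoid M] : (AddMonoidAlgebra.mapRingHom M (algebraMap k K)).Flat := by
  let e := (AddMonoidAlgebra.scalarTensorEquiv k K (M := M)).toRingEquiv
  have h : AddMonoidAlgebra.mapRingHom M (algebraMap k K) = (e : _ →+* _).comp
      ((Algebra.TensorProduct.comm k _ _).toRingEquiv.toRingHom.comp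
        (algebraMap (AddMonoidAlgebra k M) (AddMonoidAlgebra k M ⊗[k] K))) := by
    ext x
    · simp [e]
    · simp [e]
  rw [h]
  refine RingHom.Flat.comp (RingHom.Flat.comp ?_ (RingHom.Flat.of_bijective
    (Algebra.TensorProduct.comm k _ _).bijective))
    (RingHom.Flat.of_bijective e.bijective)
  rw [RingHom.flat_algebraMap_iff]
  infer_instance

end FlatDescent

section Etale

open IsLocalRing MvPowerSeries TensorProduct

variable {k K A T M : Type*} [Field k] [Field K] [Algebra k K] [CommRing A] [Algebra k A]
  [CommRing T] [IsLocalRing T] [Algebra K T] [Algebra A T] [AddCommMonoid M]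

/-- If the completion of `K[M]` along a homomorphism to `T` is `T`, then `A` is flat over `k[M]` for
every subring `A` over which `T` is faithfully flat. -/
theorem flat_of_isAdicDense [AddMonoid.FG M] [IsAdicComplete (maximalIdeal T) T]
    [Module.FaithfullyFlat A T]
    (hkK : ∀ x : k, algebraMap K T (algebraMap k K x) = algebraMap A T (algebraMap k A x))
    (ψ : Multiplicative M →* A)
    (hd : IsAdicDense (AddMonoidAlgebra.lift K T M ((algebraMap A T : A →* T).comp ψ)).toRingHom) :
    (AddMonoidAlgebra.lift k A M ψ).toRingHom.Flat := by
  let φ := (AddMonoidAlgebra.lift k A M ψ).toRingHom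
  let Φ := (AddMonoidAlgebra.lift K T M ((algebraMap A T : A →* T).comp ψ)).toRingHom
  have hcomp : Φ.comp (AddMonoidAlgebra.mapRingHom M (algebraMap k K)) =
      (algebraMap A T).comp φ := by
    ext x
    · simp [Φ, φ, Algebra.smul_def, hkK, AddMonoidAlgebra.lift_single]
    · simp [Φ, φ, AddMonoidAlgebra.lift_single]
  have hnoeth : IsNoetherianRing (AddMonoidAlgebra K M) :=
    Algebra.FiniteType.isNoetherianRing K _
  have hΦ : Φ.Flat := by
    let _ : Algebra (AddMonoidAlgebra K M) T := Φ.toAlgebra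
    exact IsAdicDense.flat (R := AddMonoidAlgebra K M) hd
  have h1 : ((algebraMap A T).comp φ).Flat := by
    rw [← hcomp]
    exact RingHom.Flat.comp (AddMonoidAlgebra.flat_mapRingHom k K M) hΦ
  let _ : Algebra (AddMonoidAlgebra k M) A := φ.toAlgebra
  let _ : Algebra (AddMonoidAlgebra k M) T := ((algebraMap A T).comp φ).toAlgebra
  have : IsScalarTower (AddMonoidAlgebra k M) A T := IsScalarTower.of_algebraMap_eq fun _ => rfl
  have : Module.Flat (AddMonoidAlgebra k M) T := h1
  exact Module.Flat.of_faithfullyFlat_tower (AddMonoidAlgebra k M) A T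

variable {ι κ : Type*} (c : FormalChart K T ι κ)

/-- The maximal ideal of `T` is generated by monomials minus their values at the closed point. -/
lemma FormalChart.maximalIdeal_le_span [IsNoetherianRing T] (ψ : Multiplicative M →* A)
    (hd : IsAdicDense (AddMonoidAlgebra.lift K T M ((algebraMap A T : A →* T).comp ψ)).toRingHom) :
    maximalIdeal T ≤ Ideal.span (Set.range fun m =>
      algebraMap A T (ψ m) - algebraMap K T (c.ev (algebraMap A T (ψ m)))) := by
  let Φ := AddMonoidAlgebra.lift K T M ((algebraMap A T : A →* T).comp ψ)
  let J := Ideal.span (Set.range fun m =>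
      algebraMap A T (ψ m) - algebraMap K T (c.ev (algebraMap A T (ψ m))))
  have hJ : ∀ r, Φ r - algebraMap K T (c.ev (Φ r)) ∈ J := by
    intro r
    induction r using AddMonoidAlgebra.induction_linear with
    | zero => simp
    | add r s hr hs =>
      rw [map_add, map_add, map_add, add_sub_add_comm]
      exact add_mem hr hs
    | single m b =>
      have h1 : Φ (AddMonoidAlgebra.single m b)
          = algebraMap K T b * algebraMap A T (ψ (.ofAdd m)) := by
        rw [AddMonoidAlgebra.lift_single, Algebra.smul_def]; rfl
      rw [h1, map_mul, FormalChart.ev_algebraMap, map_mul, ← mul_sub]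
      exact Ideal.mul_mem_left _ _ (Ideal.subset_span ⟨_, rfl⟩)
  refine Submodule.le_of_le_smul_of_le_jacobson_bot (I := maximalIdeal T)
    (IsNoetherian.noetherian _) (IsLocalRing.maximalIdeal_le_jacobson _) fun x hx => ?_
  obtain ⟨r, hr⟩ := hd.approx x 2
  have h2 : Φ r ∈ maximalIdeal T := by
    have := sub_mem hx (Ideal.pow_le_self two_ne_zero hr)
    rwa [sub_sub_cancel] at this
  have h3 := hJ r
  rw [c.mem_maximalIdeal_iff_ev.mp h2, map_zero, sub_zero] at h3
  rw [smul_eq_mul, ← pow_two, ← add_sub_cancel (Φ r) x]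
  exact add_mem (Ideal.mem_sup_left h3) (Ideal.mem_sup_right hr)

variable {A' : Type*} [CommRing A'] [Algebra K A'] [Algebra (A ⊗[k] K) A']
  [Algebra A A'] [IsScalarTower A (A ⊗[k] K) A'] [Algebra A' T] [IsScalarTower A A' T]
  [IsScalarTower K A' T]

include c in
/-- The base change of `A` is dense to first order in the ring of the chart. -/
lemma FormalChart.exists_mem_span_sub_mem (N : Submonoid (A ⊗[k] K)) [IsLocalization N A']
    (hK : ∀ x : K, algebraMap (A ⊗[k] K) A' (1 ⊗ₜ x) = algebraMap K A' x)
    (hd : IsAdicDense (algebraMap A' T)) (x : T) :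
    ∃ y ∈ Submodule.span K (Set.range (algebraMap A T)), x - y ∈ maximalIdeal T ^ 2 := by
  let f : A ⊗[k] K →+* T := (algebraMap A' T).comp (algebraMap (A ⊗[k] K) A')
  have hf : ∀ (a : A) (b : K), f (a ⊗ₜ b) = b • algebraMap A T a := by
    intro a b
    have h1 : a ⊗ₜ[k] b = algebraMap A (A ⊗[k] K) a * (1 ⊗ₜ b) := by
      rw [Algebra.TensorProduct.algebraMap_apply, Algebra.TensorProduct.tmul_mul_tmul, mul_one,
        one_mul]
      rfl
    rw [h1, map_mul, mul_comm, Algebra.smul_def]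
    congr 1
    · change algebraMap A' T (algebraMap _ A' _) = _
      rw [hK, ← IsScalarTower.algebraMap_apply]
    · change algebraMap A' T (algebraMap _ A' _) = _
      rw [← IsScalarTower.algebraMap_apply A _ A', ← IsScalarTower.algebraMap_apply]
  have hfs : ∀ b, f b ∈ Submodule.span K (Set.range (algebraMap A T)) := by
    intro b
    induction b with
    | zero => rw [map_zero]; exact zero_mem _
    | add x y hx hy => rw [map_add]; exact add_mem hx hy
    | tmul a b =>
      rw [hf]
      exact Submodule.smul_mem _ _ (Submodule.subset_span ⟨a, rfl⟩)
  obtain ⟨x', hx'⟩ := hd.approx x 2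
  obtain ⟨⟨b, s⟩, hbs⟩ := IsLocalization.surj N x'
  have hsu : IsUnit (f s) := (IsLocalization.map_units A' s).map (algebraMap A' T)
  have hb : f b = algebraMap A' T x' * f s := by
    change algebraMap A' T _ = algebraMap A' T x' * algebraMap A' T _
    rw [← map_mul, hbs]
  have hev : c.ev (f s) ≠ 0 := (hsu.map c.ev).ne_zero
  -- the inverse of a unit with value `v` is approximated to first order by `2 v⁻¹ - v⁻² s`
  set v := (c.ev (f s))⁻¹
  have h1v : (1 : A ⊗[k] K) = 1 ⊗ₜ 1 := rfl
  have hf1 : ∀ b : K, f (1 ⊗ₜ b) = algebraMap K T b := fun b => by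
    rw [hf, map_one, Algebra.algebraMap_eq_smul_one]
  refine ⟨_, hfs (b * (1 ⊗ₜ (2 * v) - 1 ⊗ₜ (v ^ 2) * (s : A ⊗[k] K))), ?_⟩
  have h2 : 1 - algebraMap K T v * f s ∈ maximalIdeal T := by
    rw [c.mem_maximalIdeal_iff_ev, map_sub, map_one, map_mul, FormalChart.ev_algebraMap,
      inv_mul_cancel₀ hev,
      sub_self]
  have h3 : x - f (b * (1 ⊗ₜ (2 * v) - 1 ⊗ₜ (v ^ 2) * (s : A ⊗[k] K))) = (x - algebraMap A' T x') +
      algebraMap A' T x' * (1 - algebraMap K T v * f s) ^ 2 := by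
    rw [map_mul, map_sub, map_mul, hf1, hf1, hb, map_mul, map_pow, map_ofNat]
    ring
  rw [h3]
  exact add_mem hx' (Ideal.mul_mem_left _ _ (Ideal.pow_mem_pow h2 2))

/-- A derivation of `A` at the closed point of the chart vanishes if it vanishes on the monomials. -/
lemma FormalChart.derivation_eq_zero_of_monomials [IsNoetherianRing T] (ψ : Multiplicative M →* A)
    (hd : IsAdicDense (AddMonoidAlgebra.lift K T M ((algebraMap A T : A →* T).comp ψ)).toRingHom)
    (N : Submonoid (A ⊗[k] K)) [IsLocalization N A'] [Module.FaithfullyFlat A' T]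
    (hK : ∀ x : K, algebraMap (A ⊗[k] K) A' (1 ⊗ₜ x) = algebraMap K A' x)
    (D : A →ₗ[k] K) (hD : ∀ a b, D (a * b) = c.ev (algebraMap A T a) * D b
      + c.ev (algebraMap A T b) * D a) (hDψ : ∀ m, D (ψ m) = 0) : D = 0 := by
  let f : A ⊗[k] K →+* T := (algebraMap A' T).comp (algebraMap (A ⊗[k] K) A')
  have hf1 : ∀ b : K, f (1 ⊗ₜ b) = algebraMap K T b := fun b => by
    change algebraMap A' T (algebraMap _ A' _) = _
    rw [hK, ← IsScalarTower.algebraMap_apply]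
  have hf2 : ∀ a : A, f (a ⊗ₜ 1) = algebraMap A T a := fun a => by
    change algebraMap A' T (algebraMap _ A' (algebraMap A _ a)) = _
    rw [← IsScalarTower.algebraMap_apply A _ A', ← IsScalarTower.algebraMap_apply]
  let e : A ⊗[k] K →+* K := c.ev.comp f
  have he : ∀ a b, e (a ⊗ₜ b) = c.ev (algebraMap A T a) * b := by
    intro a b
    have h1 : a ⊗ₜ[k] b = (a ⊗ₜ 1) * (1 ⊗ₜ b) := by
      rw [Algebra.TensorProduct.tmul_mul_tmul, mul_one, one_mul]
    change c.ev (f _) = _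
    rw [h1, map_mul, hf1, hf2, map_mul, FormalChart.ev_algebraMap]
  let D' : A ⊗[k] K →ₗ[k] K := LinearMap.mul' k K ∘ₗ TensorProduct.map D LinearMap.id
  have hD' : ∀ a b, D' (a ⊗ₜ b) = D a * b := fun a b => rfl
  have hL : ∀ x y, D' (x * y) = e x * D' y + e y * D' x := by
    intro x y
    induction x with
    | zero => simp
    | add x x' hx hx' => rw [add_mul, map_add, hx, hx', map_add, map_add]; ring
    | tmul a b =>
      induction y with
      | zero => simp
      | add y y' hy hy' => rw [mul_add, map_add, hy, hy', map_add, map_add]; ring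
      | tmul a' b' =>
        rw [Algebra.TensorProduct.tmul_mul_tmul, hD', hD, he, he, hD', hD']
        ring
  have hD1 : D 1 = 0 := by
    have := hDψ 1
    rwa [map_one] at this
  -- the ideal of the closed point is generated by monomials minus constants after localization
  let n : Multiplicative M → A ⊗[k] K := fun m => ψ m ⊗ₜ 1 - 1 ⊗ₜ c.ev (algebraMap A T (ψ m))
  have hn : ∀ m, D' (n m) = 0 := fun m => by
    rw [map_sub, hD', hD', hDψ, hD1, zero_mul, zero_mul, sub_zero]
  have hen : ∀ m, e (n m) = 0 := fun m => by
    rw [map_sub, he, he, map_one, map_one, mul_one, one_mul, sub_self]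
  let J := Ideal.span (Set.range n)
  have hJ : ∀ x ∈ J, D' x = 0 := by
    intro x hx
    refine Submodule.span_induction ?_ (map_zero _) ?_ ?_ hx
    · rintro _ ⟨m, rfl⟩
      exact hn m
    · rintro x y - - hx hy
      rw [map_add, hx, hy, add_zero]
    · rintro a x hxJ hx
      have hex : e x = 0 := by
        have : J ≤ RingHom.ker e := Ideal.span_le.mpr (by rintro _ ⟨m, rfl⟩; exact hen m)
        exact this hxJ
      rw [smul_eq_mul, hL, hx, hex, mul_zero, zero_mul, add_zero]
  have hker : ∀ x, e x = 0 → D' x = 0 := by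
    intro x hx
    have h1 : f x ∈ maximalIdeal T := c.mem_maximalIdeal_iff_ev.mpr hx
    have h2 : algebraMap _ A' x ∈ ((J.map (algebraMap _ A')).map (algebraMap A' T)).comap
        (algebraMap A' T) := by
      have h3 := c.maximalIdeal_le_span ψ hd h1
      rw [Ideal.mem_comap, Ideal.map_map]
      refine (Ideal.span_le.mpr ?_ : Ideal.span _ ≤ Ideal.map f J) h3
      rintro _ ⟨m, rfl⟩
      have h4 : f (n m) = algebraMap A T (ψ m) - algebraMap K T (c.ev (algebraMap A T (ψ m))) := by
        rw [map_sub, hf1, hf2]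
      beta_reduce
      rw [SetLike.mem_coe, ← h4]
      exact Ideal.mem_map_of_mem _ (Ideal.subset_span ⟨m, rfl⟩)
    rw [Ideal.comap_map_eq_self_of_faithfullyFlat,
      IsLocalization.algebraMap_mem_map_algebraMap_iff N] at h2
    obtain ⟨s, hs, hsx⟩ := h2
    have h5 := hJ _ hsx
    rw [hL, hx, zero_mul, add_zero] at h5
    have hsu : IsUnit (e s) :=
      ((IsLocalization.map_units A' ⟨s, hs⟩).map (algebraMap A' T)).map c.ev
    exact (mul_eq_zero.mp h5).resolve_left hsu.ne_zero
  ext a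
  have h6 := hker (a ⊗ₜ 1 - 1 ⊗ₜ c.ev (algebraMap A T a)) (by
    rw [map_sub, he, he, map_one, map_one, mul_one, one_mul, sub_self])
  rw [map_sub, hD', hD', hD1, zero_mul, sub_zero, mul_one] at h6
  exact h6

include c in
/-- The homomorphism from the monoid algebra is unramified. -/
theorem FormalChart.formallyUnramified [IsNoetherianRing T] [IsLocalRing A]
    [Algebra.EssFiniteType k A]
    (ψ : Multiplicative M →* A)
    (hd : IsAdicDense (AddMonoidAlgebra.lift K T M ((algebraMap A T : A →* T).comp ψ)).toRingHom)
    (N : Submonoid (A ⊗[k] K)) [IsLocalization N A'] [Module.FaithfullyFlat A' T]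
    [IsLocalHom (algebraMap A T)]
    (hkK : ∀ x : k, algebraMap K T (algebraMap k K x) = algebraMap A T (algebraMap k A x))
    (hK : ∀ x : K, algebraMap (A ⊗[k] K) A' (1 ⊗ₜ x) = algebraMap K A' x) :
    (AddMonoidAlgebra.lift k A M ψ).toRingHom.FormallyUnramified := by
  let φ := (AddMonoidAlgebra.lift k A M ψ).toRingHom
  let R := AddMonoidAlgebra k M
  let _ : Algebra R A := φ.toAlgebra
  have htow : IsScalarTower k R A := IsScalarTower.of_algebraMap_eq fun x =>
    ((AddMonoidAlgebra.lift k A M ψ).commutes x).symm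
  have hess : Algebra.EssFiniteType R A := Algebra.EssFiniteType.of_comp k R A
  change Algebra.FormallyUnramified R A
  rw [Algebra.formallyUnramified_iff]
  rw [← IsLocalRing.subsingleton_tensorProduct (R := A)]
  let κA := ResidueField A
  have hlocev : ∀ a ∈ maximalIdeal A, (c.ev.comp (algebraMap A T)) a = 0 := by
    intro a ha
    rw [RingHom.comp_apply, ← c.mem_maximalIdeal_iff_ev, IsLocalRing.mem_maximalIdeal,
      mem_nonunits_iff]
    exact fun h => ha (isUnit_of_map_unit (algebraMap A T) a h)
  let j : κA →+* K := Ideal.Quotient.lift _ (c.ev.comp (algebraMap A T)) hlocev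
  have hj : ∀ a, j (algebraMap A κA a) = c.ev (algebraMap A T a) := fun a => rfl
  -- a nonzero functional on the cotangent space would give a nonzero derivation
  have hfun : ∀ (g : κA ⊗[A] Ω[A⁄R] →ₗ[κA] κA), g = 0 := by
    intro g
    have hg : ∀ (a : A) (w : Ω[A⁄R]), j (g (1 ⊗ₜ (a • w))) = c.ev (algebraMap A T a) *
      j (g (1 ⊗ₜ w)) := by
      intro a w
      rw [← smul_tmul, ← algebraMap_smul κA a, ← TensorProduct.smul_tmul', map_smul g, smul_eq_mul,
        map_mul, hj]
    let D : A →ₗ[k] K :=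
      { toFun := fun a => j (g (1 ⊗ₜ KaehlerDifferential.D R A a))
        map_add' := fun a b => by rw [map_add, tmul_add, map_add, map_add]
        map_smul' := fun x a => by
          rw [RingHom.id_apply, ← IsScalarTower.algebraMap_smul R x a, Derivation.map_smul,
            ← IsScalarTower.algebraMap_smul A (algebraMap k R x),
            ← IsScalarTower.algebraMap_apply k R A, hg, ← hkK, c.ev_algebraMap,
            Algebra.smul_def] }
    have hDa : ∀ a, D a = j (g (1 ⊗ₜ KaehlerDifferential.D R A a)) := fun a => rfl
    have hD0 : D = 0 := by
      refine c.derivation_eq_zero_of_monomials ψ hd N hK D (fun a b => ?_) fun m => ?_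
      · rw [hDa, hDa, hDa, Derivation.leibniz, tmul_add, map_add, map_add, hg, hg]
      · have h1 : ψ m = algebraMap R A (AddMonoidAlgebra.single m.toAdd 1) := by
          change _ = AddMonoidAlgebra.lift k A M ψ _
          rw [AddMonoidAlgebra.lift_single, one_smul]; rfl
        rw [hDa, h1, Derivation.map_algebraMap, tmul_zero, map_zero, map_zero]
    have h2 : ∀ w : Ω[A⁄R], g (1 ⊗ₜ w) = 0 := by
      intro w
      have hw : w ∈ Submodule.span A (Set.range (KaehlerDifferential.D R A)) := by
        rw [KaehlerDifferential.span_range_derivation]; trivial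
      refine Submodule.span_induction ?_ ?_ ?_ ?_ hw
      · rintro _ ⟨a, rfl⟩
        apply j.injective
        rw [map_zero, ← hDa, hD0]
        rfl
      · rw [tmul_zero, map_zero]
      · intro x y _ _ hx hy
        rw [tmul_add, map_add, hx, hy, add_zero]
      · intro a x _ hx
        apply j.injective
        rw [hg, hx, map_zero, mul_zero]
    refine LinearMap.ext fun x => ?_
    induction x with
    | zero => simp
    | add x y hx hy => rw [map_add, hx, hy, map_add]
    | tmul b w =>
      have : b ⊗ₜ[A] w = b • ((1 : κA) ⊗ₜ[A] w) := by rw [TensorProduct.smul_tmul', smul_eq_mul,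
        mul_one]
      rw [this, map_smul, h2, smul_zero]
      rfl
  refine subsingleton_of_forall_eq 0 fun x => ?_
  rw [← Module.forall_dual_apply_eq_zero_iff κA]
  intro g
  rw [hfun g]
  rfl

/-- The monomials of interior points of the cone cut out the boundary. -/
lemma FormalChart.boundary_eq_of_pos [Finite ι] [Module.FaithfullyFlat A T] {I : Ideal A}
    (hIT : I.map (algebraMap A T) = ⨅ i, c.prime i) {g : A} {w : ι → ℕ} {y : T} {u : Tˣ}
    (hy : c.IsBoundaryMonomial w y) (hw : ∀ i, w i ≠ 0) (hg : algebraMap A T g = u * y) :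
    g ∈ I ∧ ∀ x ∈ I, ∃ N : ℕ, x ^ N ∈ Ideal.span {g} := by
  cases nonempty_fintype ι
  obtain ⟨w', hw', hw0, hyw⟩ := hy
  constructor
  · have h1 : g ∈ (I.map (algebraMap A T)).comap (algebraMap A T) := by
      rw [Ideal.mem_comap, hg, hIT]
      refine Ideal.mul_mem_left _ _ ?_
      rw [Ideal.mem_iInf]
      intro i
      rw [c.monomial_mem_prime hyw, hw']
      exact hw i
    rwa [Ideal.comap_map_eq_self_of_faithfullyFlat] at h1
  · intro x hx
    let N := ∑ i, w i
    refine ⟨N, ?_⟩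
    have h1 : x ^ N ∈ ((Ideal.span {g}).map (algebraMap A T)).comap (algebraMap A T) := by
      rw [Ideal.mem_comap, Ideal.map_span, Set.image_singleton, hg, Ideal.mem_span_singleton,
        u.isUnit.mul_left_dvd, map_pow]
      have hL : intExp w' ∈ c.L := by
        refine c.isSupp y w' ?_
        rw [hyw, coeff_monomial_same]
        exact one_ne_zero
      obtain ⟨z, hz⟩ := c.exists_eq_mul_of_coeff_eq_zero hL hyw (x := algebraMap A T x ^ N) (by
        intro m hm
        obtain ⟨s, hs⟩ : ∃ s, m s < w' s := by
          by_contra! h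
          exact hm h
        rcases s with i | j
        swap
        · rw [hw0] at hs; omega
        have h2 : algebraMap A T x ∈ c.prime i := by
          have := hIT ▸ Ideal.mem_map_of_mem (algebraMap A T) hx
          exact (Ideal.mem_iInf.mp this) i
        refine c.coeff_eq_zero_of_mem_prime_pow (Ideal.pow_mem_pow h2 N) (hs.trans_le ?_)
        rw [hw']
        exact Finset.single_le_sum (f := w) (fun _ _ => Nat.zero_le _) (Finset.mem_univ i))
      exact ⟨z, hz⟩
    rwa [Ideal.comap_map_eq_self_of_faithfullyFlat] at h1

end Etale

/-! ### Facets of toric monoids -/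

section Facets

variable {n : ℕ}

/-- Fourier–Motzkin elimination: the saturation of a finitely generated monoid of lattice points is
cut out by finitely many integral linear forms. -/
lemma exists_forms_closure (S : Finset (Fin n → ℤ)) :
    ∃ F : Finset ((Fin n → ℤ) →ₗ[ℤ] ℤ), ∀ v,
      (∃ m : ℕ, 0 < m ∧ m • v ∈ AddSubmonoid.closure (S : Set (Fin n → ℤ))) ↔ ∀ l ∈ F, 0 ≤ l v := by
  classical
  induction S using Finset.induction_on with
  | empty =>
    refine ⟨Finset.univ.image (fun i => LinearMap.proj i) ∪
      Finset.univ.image (fun i => -LinearMap.proj i), fun v => ?_⟩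
    rw [Finset.coe_empty, AddSubmonoid.closure_empty]
    constructor
    · rintro ⟨m, hm, hv⟩ l hl
      have hv0 : v = 0 := (smul_eq_zero.mp (AddSubmonoid.mem_bot.mp hv)).resolve_left hm.ne'
      rw [hv0, map_zero]
    · intro h
      refine ⟨1, one_pos, ?_⟩
      rw [one_smul, AddSubmonoid.mem_bot]
      ext i
      have h1 := h (LinearMap.proj i) (by simp)
      have h2 := h (-LinearMap.proj i) (by simp)
      simp only [LinearMap.neg_apply, LinearMap.proj_apply] at h1 h2
      exact le_antisymm (neg_nonneg.mp h2) h1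
  | insert s S _ ih =>
    obtain ⟨F, hF⟩ := ih
    let comb : ((Fin n → ℤ) →ₗ[ℤ] ℤ) × ((Fin n → ℤ) →ₗ[ℤ] ℤ) → ((Fin n → ℤ) →ₗ[ℤ] ℤ) :=
      fun p => p.2 s • p.1 - p.1 s • p.2
    let F' := F.filter (fun l => 0 ≤ l s) ∪
      ((F.filter fun l => l s < 0) ×ˢ (F.filter fun l => 0 < l s)).image comb
    refine ⟨F', fun v => ?_⟩
    have hins : ∀ v, v ∈ AddSubmonoid.closure ((insert s S : Finset _) : Set (Fin n → ℤ)) ↔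
        ∃ a : ℕ, ∃ w ∈ AddSubmonoid.closure (S : Set (Fin n → ℤ)), a • s + w = v := by
      intro v
      rw [Finset.coe_insert, Set.insert_eq, AddSubmonoid.closure_union, AddSubmonoid.mem_sup]
      simp only [AddSubmonoid.mem_closure_singleton]
      constructor
      · rintro ⟨_, ⟨a, rfl⟩, w, hw, h⟩; exact ⟨a, w, hw, h⟩
      · rintro ⟨a, w, hw, h⟩; exact ⟨_, ⟨a, rfl⟩, w, hw, h⟩
    have hiff : (∃ m : ℕ, 0 < m ∧ m • v ∈
        AddSubmonoid.closure ((insert s S : Finset _) : Set (Fin n → ℤ))) ↔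
        ∃ m a : ℕ, 0 < m ∧ ∀ l ∈ F, (a : ℤ) * l s ≤ m * l v := by
      constructor
      · rintro ⟨m, hm, hv⟩
        obtain ⟨a, w, hw, h⟩ := (hins _).mp hv
        refine ⟨m, a, hm, fun l hl => ?_⟩
        have h1 := (hF w).mp ⟨1, one_pos, by rwa [one_smul]⟩ l hl
        have h2 := congrArg l h
        rw [map_add, map_nsmul, map_nsmul, nsmul_eq_mul, nsmul_eq_mul] at h2
        linarith
      · rintro ⟨m, a, hm, h⟩
        obtain ⟨m', hm', hw⟩ := (hF (m • v - a • s)).mpr fun l hl => by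
          have := h l hl
          rw [map_sub, map_nsmul, map_nsmul, nsmul_eq_mul, nsmul_eq_mul]
          linarith
        refine ⟨m' * m, Nat.mul_pos hm' hm, (hins _).mpr ⟨m' * a, _, hw, ?_⟩⟩
        rw [smul_sub, mul_smul, mul_smul, add_sub_cancel]
    rw [hiff]
    constructor
    · rintro ⟨m, a, hm, h⟩ l hl
      have hm' : (0 : ℤ) < m := by exact_mod_cast hm
      have ha : (0 : ℤ) ≤ a := Int.natCast_nonneg a
      rw [Finset.mem_union, Finset.mem_filter, Finset.mem_image] at hl
      rcases hl with ⟨hl, hs⟩ | ⟨⟨l₁, l₂⟩, hl, rfl⟩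
      · have := h l hl
        exact nonneg_of_mul_nonneg_right ((mul_nonneg ha hs).trans this) hm'
      · simp only [Finset.mem_product, Finset.mem_filter] at hl
        obtain ⟨⟨h1, h1s⟩, h2, h2s⟩ := hl
        have e1 := mul_le_mul_of_nonneg_left (h l₁ h1) h2s.le
        have e2 := mul_le_mul_of_nonneg_left (h l₂ h2) (neg_pos.mpr h1s).le
        have : 0 ≤ (m : ℤ) * (l₂ s * l₁ v - l₁ s * l₂ v) := by nlinarith
        simpa [comb] using nonneg_of_mul_nonneg_right this hm'
    · intro h
      have hpos : ∀ l ∈ F, 0 ≤ l s → 0 ≤ l v := fun l hl hs =>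
        h l (Finset.mem_union_left _ (Finset.mem_filter.mpr ⟨hl, hs⟩))
      have hpair : ∀ l₁ ∈ F, ∀ l₂ ∈ F, l₁ s < 0 → 0 < l₂ s → l₁ s * l₂ v ≤ l₂ s * l₁ v := by
        intro l₁ h₁ l₂ h₂ hs₁ hs₂
        have := h (comb (l₁, l₂)) (Finset.mem_union_right _ (Finset.mem_image_of_mem _
          (Finset.mem_product.mpr ⟨Finset.mem_filter.mpr ⟨h₁, hs₁⟩, Finset.mem_filter.mpr
          ⟨h₂, hs₂⟩⟩)))
        simp only [comb, LinearMap.sub_apply, LinearMap.smul_apply, smul_eq_mul] at this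
        linarith
      -- it suffices to find a nonnegative rational `a / m` between the lower and upper bounds
      by_cases hneg : ∃ l ∈ F, l s < 0 ∧ l v < 0
      · obtain ⟨l₀, hl₀, hmax⟩ := Finset.exists_max_image
          (F.filter fun l => l s < 0 ∧ l v < 0) (fun l => ((l v : ℚ) / l s))
          (by obtain ⟨l, hl, h'⟩ := hneg; exact ⟨l, Finset.mem_filter.mpr ⟨hl, h'⟩⟩)
        rw [Finset.mem_filter] at hl₀
        obtain ⟨hl₀, hs₀, hv₀⟩ := hl₀
        refine ⟨(l₀ s).natAbs, (l₀ v).natAbs, by omega, fun l hl => ?_⟩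
        have es : ((l₀ s).natAbs : ℤ) = - l₀ s := by omega
        have ev : ((l₀ v).natAbs : ℤ) = - l₀ v := by omega
        rw [es, ev]
        rcases lt_trichotomy (l s) 0 with hs | hs | hs
        · by_cases hv : l v < 0
          · have h1 := hmax l (Finset.mem_filter.mpr ⟨hl, hs, hv⟩)
            have hs' : (l s : ℚ) < 0 := by exact_mod_cast hs
            have hs₀' : (l₀ s : ℚ) < 0 := by exact_mod_cast hs₀
            rw [div_le_iff_of_neg hs', div_mul_eq_mul_div, div_le_iff_of_neg hs₀'] at h1
            have h2 : l v * l₀ s ≤ l₀ v * l s := by exact_mod_cast h1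
            linarith
          · nlinarith
        · have := hpos l hl hs.ge
          rw [hs]
          nlinarith
        · have := hpair l₀ hl₀ l hl hs₀ hs
          linarith
      · push Not at hneg
        refine ⟨1, 0, one_pos, fun l hl => ?_⟩
        rw [Nat.cast_zero, zero_mul, Nat.cast_one, one_mul]
        rcases lt_or_ge (l s) 0 with hs | hs
        · exact hneg l hl hs
        · exact hpos l hl hs

lemma IsToricMonoid.exists_forms {P : AddSubmonoid (Fin n → ℤ)} (hP : IsToricMonoid P) :
    ∃ F : Finset ((Fin n → ℤ) →ₗ[ℤ] ℤ), ∀ v, v ∈ P ↔ ∀ l ∈ F, 0 ≤ l v := by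
  obtain ⟨S, hS⟩ := hP.fg
  obtain ⟨F, hF⟩ := exists_forms_closure S
  refine ⟨F, fun v => ?_⟩
  rw [← hF, hS]
  exact ⟨fun h => ⟨1, one_pos, by rwa [one_smul]⟩, fun ⟨m, hm, h⟩ => hP.saturated m v hm h⟩

lemma IsToricMonoid.exists_pos {P : AddSubmonoid (Fin n → ℤ)} (hP : IsToricMonoid P)
    {l : (Fin n → ℤ) →ₗ[ℤ] ℤ} (hl : l ≠ 0) (hlP : ∀ v ∈ P, 0 ≤ l v) : ∃ v ∈ P, 0 < l v := by
  by_contra! h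
  have h1 : AddSubgroup.closure (P : Set (Fin n → ℤ)) ≤ l.toAddMonoidHom.ker :=
    (AddSubgroup.closure_le _).mpr fun v hv => le_antisymm (h v hv) (hlP v hv)
  rw [hP.generates] at h1
  exact hl (LinearMap.ext fun v => h1 (AddSubgroup.mem_top v))

/-- Dividing a nonzero form by the generator of its image. -/
lemma exists_primitive {M : Type*} [AddCommGroup M] {l : M →ₗ[ℤ] ℤ} (hl : l ≠ 0) :
    ∃ (d : ℤ) (l' : M →ₗ[ℤ] ℤ), 0 < d ∧ l = d • l' ∧ ∃ v, l' v = 1 := by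
  obtain ⟨g, hg⟩ := IsPrincipalIdealRing.principal (LinearMap.range l)
  have hg0 : g ≠ 0 := by
    rintro rfl
    rw [Submodule.span_zero_singleton, LinearMap.range_eq_bot] at hg
    exact hl hg
  have hd : LinearMap.range l = Submodule.span ℤ {|g|} := by
    rw [hg]
    exact (Int.span_natAbs g ▸ by rw [Int.natCast_natAbs] : Ideal.span {g} = Ideal.span {|g|})
  have hdvd : ∀ v, |g| ∣ l v := fun v =>
    Ideal.mem_span_singleton.mp (hd ▸ LinearMap.mem_range_self l v : l v ∈ Submodule.span ℤ {|g|})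
  have hpos : 0 < |g| := abs_pos.mpr hg0
  refine ⟨|g|, { toFun := fun v => l v / |g|
                 map_add' := fun v w => by rw [map_add, Int.add_ediv_of_dvd_left (hdvd v)]
                 map_smul' := fun a v => by
                  rw [map_smul, smul_eq_mul, Int.mul_ediv_assoc _ (hdvd v)]; rfl }, hpos, ?_, ?_⟩
  · ext v
    exact (Int.mul_ediv_cancel' (hdvd _)).symm
  · obtain ⟨v, hv⟩ : |g| ∈ LinearMap.range l := hd ▸ Submodule.mem_span_singleton_self _
    exact ⟨v, by change l v / |g| = 1; rw [hv, Int.ediv_self hpos.ne']⟩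

/-- An irredundant description of a toric monoid by primitive forms, one for each facet, with points
in the relative interiors of the facets and points at height one above them. -/
theorem IsToricMonoid.exists_facets {P : AddSubmonoid (Fin n → ℤ)} (hP : IsToricMonoid P) :
    ∃ (r : ℕ) (l : Fin r → ((Fin n → ℤ) →ₗ[ℤ] ℤ)), (∀ v, v ∈ P ↔ ∀ i, 0 ≤ l i v) ∧
      (∀ i, ∃ w, l i w = 0 ∧ ∀ j ≠ i, 0 < l j w) ∧
      (∀ i, ∃ v, l i v = 1 ∧ ∀ j, 0 ≤ l j v) := by
  classical
  -- choose a minimal set of forms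
  obtain ⟨F, hF, hmin⟩ : ∃ F : Finset ((Fin n → ℤ) →ₗ[ℤ] ℤ), (∀ v, v ∈ P ↔ ∀ l ∈ F, 0 ≤ l v) ∧
      ∀ l ∈ F, ∃ v, v ∉ P ∧ ∀ l' ∈ F, l' ≠ l → 0 ≤ l' v := by
    let p : ℕ → Prop := fun N => ∃ F : Finset ((Fin n → ℤ) →ₗ[ℤ] ℤ), F.card = N ∧
      ∀ v, v ∈ P ↔ ∀ l ∈ F, 0 ≤ l v
    have hp : ∃ N, p N := by
      obtain ⟨F, hF⟩ := hP.exists_forms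
      exact ⟨_, F, rfl, hF⟩
    obtain ⟨F, hcard, hF⟩ := Nat.find_spec hp
    refine ⟨F, hF, fun l hl => ?_⟩
    by_contra! hcon
    refine Nat.find_min hp (m := (F.erase l).card) ?_ ⟨_, rfl, fun v => ?_⟩
    · rw [← hcard]
      exact Finset.card_erase_lt_of_mem hl
    · constructor
      · exact fun hv l' hl' => (hF v).mp hv l' (Finset.mem_of_mem_erase hl')
      · intro h
        by_contra hv
        obtain ⟨l', hl', hne, hlt⟩ := hcon v hv
        exact absurd (h l' (Finset.mem_erase.mpr ⟨hne, hl'⟩)) (not_le.mpr hlt)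
  have hne : ∀ l ∈ F, l ≠ 0 := by
    rintro l hl rfl
    obtain ⟨v, hv, h⟩ := hmin 0 hl
    refine hv ((hF v).mpr fun l' hl' => ?_)
    by_cases h0 : l' = 0
    · rw [h0]; rfl
    · exact h l' hl' h0
  have hint : ∃ p, ∀ l ∈ F, 0 < l p := by
    choose! p hpP hp using fun l hl => hP.exists_pos (hne l hl) fun v hv => (hF v).mp hv l hl
    refine ⟨∑ l ∈ F, p l, fun l hl => ?_⟩
    rw [map_sum]
    exact Finset.sum_pos' (fun l' hl' => (hF _).mp (hpP l' hl') l hl) ⟨l, hl, hp l hl⟩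
  obtain ⟨p, hp⟩ := hint
  have hfacet : ∀ l ∈ F, ∃ w, l w = 0 ∧ ∀ l' ∈ F, l' ≠ l → 0 < l' w := by
    intro l hl
    obtain ⟨v, hv, h⟩ := hmin l hl
    have hlv : l v < 0 := by
      by_contra! hlv
      refine hv ((hF v).mpr fun l' hl' => ?_)
      by_cases h0 : l' = l
      · rwa [h0]
      · exact h l' hl' h0
    refine ⟨l p • v - l v • p, ?_, fun l' hl' hne' => ?_⟩
    · rw [map_sub, map_smul, map_smul, smul_eq_mul, smul_eq_mul]; ring
    · rw [map_sub, map_smul, map_smul, smul_eq_mul, smul_eq_mul]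
      have := mul_nonneg (hp l hl).le (h l' hl' hne')
      have := mul_pos (neg_pos.mpr hlv) (hp l' hl')
      linarith
  choose! d l' hd hl' hone using fun l hl => exists_primitive (hne l hl)
  let e := F.equivFin.symm
  have happ : ∀ l ∈ F, ∀ v, l v = d l * l' l v := fun l hl v => by
    conv_lhs => rw [hl' l hl]
    rfl
  have hfac : ∀ i, ∃ w, l' (e i) w = 0 ∧ ∀ j ≠ i, 0 < l' (e j) w := by
    intro i
    obtain ⟨w, hw, h⟩ := hfacet (e i) (e i).2
    refine ⟨w, ?_, fun j hj => ?_⟩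
    · rw [happ _ (e i).2, mul_eq_zero] at hw
      exact hw.resolve_left (hd _ (e i).2).ne'
    · have := h (e j) (e j).2 (fun h' => hj (e.injective (Subtype.ext h')))
      rw [happ _ (e j).2] at this
      exact pos_of_mul_pos_right this (hd _ (e j).2).le
  refine ⟨F.card, fun i => l' (e i), fun v => ?_, hfac, fun i => ?_⟩
  · rw [hF]
    constructor
    · intro h i
      have := h (e i) (e i).2
      rw [happ _ (e i).2] at this
      exact nonneg_of_mul_nonneg_right this (hd _ (e i).2)
    · intro h l hl
      have := h (F.equivFin ⟨l, hl⟩)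
      simp only [e, Equiv.symm_apply_apply] at this
      rw [happ l hl]
      exact mul_nonneg (hd l hl).le this
  · obtain ⟨v, hv⟩ := hone (e i) (e i).2
    obtain ⟨w, hw, h⟩ := hfac i
    let N : ℤ := ∑ j, |l' (e j) v|
    refine ⟨v + N • w, ?_, fun j => ?_⟩
    · rw [map_add, map_smul, hw, smul_zero, add_zero, hv]
    · rw [map_add, map_smul, smul_eq_mul]
      by_cases hj : j = i
      · subst hj
        rw [hw, hv]
        norm_num
      · have h1 : |l' (e j) v| ≤ N := Finset.single_le_sum (f := fun j => |l' (e j) v|)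
          (fun _ _ => abs_nonneg _) (Finset.mem_univ j)
        have h2 := neg_abs_le (l' (e j) v)
        have h3 := h j hj
        have h4 : N ≤ N * l' (e j) w := le_mul_of_one_le_right ((abs_nonneg _).trans h1) h3
        linarith

/-- Coordinates adapted to a toric monoid: heights above the facets, and coordinates on the group of
units. -/
theorem IsToricMonoid.exists_coordinates {P : AddSubmonoid (Fin n → ℤ)} (hP : IsToricMonoid P) :
    ∃ (r d : ℕ) (Λ : (Fin n → ℤ) →ₗ[ℤ] (Fin r ⊕ Fin d → ℤ)), Function.Injective Λ ∧
      (∀ v, v ∈ P ↔ ∀ i, 0 ≤ Λ v (Sum.inl i)) ∧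
      (∀ j, ∃ v, Λ v = Pi.single (Sum.inr j) 1) ∧
      (∀ i, ∃ w, Λ w (Sum.inl i) = 0 ∧ (∀ j ≠ i, 0 < Λ w (Sum.inl j)) ∧ ∀ j, Λ w (Sum.inr j) = 0) ∧
      (∀ i, ∃ v, Λ v (Sum.inl i) = 1 ∧ (∀ j, 0 ≤ Λ v (Sum.inl j)) ∧ ∀ j, Λ v (Sum.inr j) = 0) := by
  classical
  obtain ⟨r, l, hl, hfac, hprim⟩ := hP.exists_facets
  let ℓ : (Fin n → ℤ) →ₗ[ℤ] (Fin r → ℤ) := LinearMap.pi l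
  have hℓ : ∀ v i, ℓ v i = l i v := fun _ _ => rfl
  obtain ⟨s, hs⟩ := Module.projective_lifting_property ℓ.rangeRestrict LinearMap.id
    ℓ.surjective_rangeRestrict
  have hs' : ∀ v, ℓ (s (ℓ.rangeRestrict v)) = ℓ v := fun v =>
    congrArg Subtype.val (LinearMap.congr_fun hs (ℓ.rangeRestrict v))
  let H := LinearMap.ker ℓ
  let b := Module.finBasis ℤ H
  let π : (Fin n → ℤ) →ₗ[ℤ] H := (LinearMap.id - s ∘ₗ ℓ.rangeRestrict).codRestrict H fun v => by
    rw [LinearMap.mem_ker, LinearMap.sub_apply, map_sub, LinearMap.comp_apply, hs',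
      LinearMap.id_apply,
      sub_self]
  have hπ : ∀ v, (π v : Fin n → ℤ) = v - s (ℓ.rangeRestrict v) := fun _ => rfl
  have hπH : ∀ h : H, π h = h := fun h => Subtype.ext (by
    have : ℓ.rangeRestrict h = 0 := Subtype.ext h.2
    rw [hπ, this, map_zero, sub_zero])
  let Λ : (Fin n → ℤ) →ₗ[ℤ] (Fin r ⊕ Fin _ → ℤ) :=
    LinearMap.pi (Sum.elim l fun j => (b.coord j) ∘ₗ π)
  have hΛl : ∀ v i, Λ v (Sum.inl i) = l i v := fun _ _ => rfl
  have hΛr : ∀ v j, Λ v (Sum.inr j) = b.repr (π v) j := fun _ _ => rfl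
  have hadj : ∀ v, ∃ w, (∀ i, l i w = l i v) ∧ ∀ j, Λ w (Sum.inr j) = 0 := by
    intro v
    refine ⟨v - π v, fun i => ?_, fun j => ?_⟩
    · rw [map_sub, sub_eq_self]
      exact congrFun (π v).2 i
    · rw [hΛr, map_sub, hπH, sub_self, map_zero]
      rfl
  refine ⟨r, _, Λ, ?_, hl, fun j => ⟨b j, ?_⟩, fun i => ?_, fun i => ?_⟩
  · rw [injective_iff_map_eq_zero]
    intro v hv
    have h1 : v ∈ H := by
      rw [LinearMap.mem_ker]
      exact funext fun i => congrFun hv (Sum.inl i)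
    have h2 : π v = 0 := by
      apply b.repr.injective
      ext j
      rw [map_zero]
      exact congrFun hv (Sum.inr j)
    have h3 := hπH ⟨v, h1⟩
    rw [h2] at h3
    exact (congrArg Subtype.val h3).symm
  · ext (i | j')
    · rw [hΛl, Pi.single_eq_of_ne (by simp)]
      exact congrFun (b j).2 i
    · rw [hΛr, hπH, b.repr_self, Finsupp.single_apply, Pi.single_apply]
      simp [eq_comm]
  · obtain ⟨w, hw, h⟩ := hfac i
    obtain ⟨w', hw', h'⟩ := hadj w
    exact ⟨w', by rw [hΛl, hw', hw], fun j hj => by rw [hΛl, hw']; exact h j hj, h'⟩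
  · obtain ⟨w, hw, h⟩ := hprim i
    obtain ⟨w', hw', h'⟩ := hadj w
    exact ⟨w', by rw [hΛl, hw', hw], fun j => by rw [hΛl, hw']; exact h j, h'⟩

/-- Inverting the elements of a face of a toric monoid gives a toric monoid. -/
def localizeFace (P F : AddSubmonoid (Fin n → ℤ)) : AddSubmonoid (Fin n → ℤ) where
  carrier := {v | ∃ f ∈ F, v + f ∈ P}
  zero_mem' := ⟨0, zero_mem _, by rw [add_zero]; exact zero_mem _⟩
  add_mem' := by
    rintro v w ⟨f, hf, hv⟩ ⟨g, hg, hw⟩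
    exact ⟨f + g, add_mem hf hg, by rw [add_add_add_comm]; exact add_mem hv hw⟩

lemma le_localizeFace (P F : AddSubmonoid (Fin n → ℤ)) : P ≤ localizeFace P F := fun v hv =>
  ⟨0, zero_mem _, by rwa [add_zero]⟩

lemma neg_mem_localizeFace (P : AddSubmonoid (Fin n → ℤ)) {F : AddSubmonoid (Fin n → ℤ)}
    {f : Fin n → ℤ} (hf : f ∈ F) : -f ∈ localizeFace P F :=
  ⟨f, hf, by rw [neg_add_cancel]; exact zero_mem _⟩

lemma IsToricMonoid.localizeFace {P F : AddSubmonoid (Fin n → ℤ)} (hP : IsToricMonoid P)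
    (hFP : F ≤ P) (hF : ∀ v ∈ P, ∀ w ∈ P, v + w ∈ F → v ∈ F ∧ w ∈ F) :
    IsToricMonoid (localizeFace P F) where
  fg := by
    classical
    obtain ⟨S, hS⟩ := hP.fg
    refine ⟨S ∪ (S.filter (· ∈ F)).image Neg.neg, le_antisymm ?_ ?_⟩
    · rw [AddSubmonoid.closure_le]
      intro v hv
      rw [Finset.coe_union, Set.mem_union, Finset.mem_coe, Finset.mem_coe, Finset.mem_image] at hv
      rcases hv with hv | ⟨f, hf, rfl⟩
      · exact le_localizeFace P F (hS ▸ AddSubmonoid.subset_closure hv)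
      · exact neg_mem_localizeFace P (Finset.mem_filter.mp hf).2
    · set Q := AddSubmonoid.closure ((S ∪ (S.filter (· ∈ F)).image Neg.neg : Finset _) :
        Set (Fin n → ℤ))
      have hSQ : P ≤ Q := by
        rw [← hS]
        exact AddSubmonoid.closure_mono (by simp)
      have hneg : ∀ f ∈ P, f ∈ F → -f ∈ Q := by
        intro f hf
        rw [← hS] at hf
        refine AddSubmonoid.closure_induction (fun s hs hsF => AddSubmonoid.subset_closure ?_)
          (fun _ => by rw [neg_zero]; exact zero_mem _) (fun v w hv hw ihv ihw h => ?_) hf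
        · rw [Finset.coe_union]
          exact Or.inr (Finset.mem_coe.mpr
            (Finset.mem_image_of_mem _ (Finset.mem_filter.mpr ⟨hs, hsF⟩)))
        · rw [hS] at hv hw
          obtain ⟨h1, h2⟩ := hF v hv w hw h
          rw [neg_add]
          exact add_mem (ihv h1) (ihw h2)
      rintro v ⟨f, hf, hv⟩
      rw [← add_neg_cancel_right v f]
      exact add_mem (hSQ hv) (hneg f (hFP hf) hf)
  generates := by
    rw [eq_top_iff, ← hP.generates]
    exact AddSubgroup.closure_mono (le_localizeFace P F)
  saturated m v hm := by
    rintro ⟨f, hf, h⟩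
    refine ⟨f, hf, hP.saturated m _ hm ?_⟩
    rw [smul_add, ← Nat.sub_add_cancel hm, add_smul (m - 1) 1 f, one_smul,
      Nat.sub_add_cancel hm, add_comm _ f, ← add_assoc]
    exact add_mem h (AddSubmonoid.nsmul_mem _ (hFP hf) _)

end Facets

/-! ### Series expansions with respect to a system of monomials -/

section Expansion

open IsLocalRing MvPowerSeries

variable {K T σ : Type*} [Field K] [CommRing T] [IsLocalRing T] [Algebra K T]

/-- A system of elements `y m` of a local `K`-algebra `T`, for `m` in a lattice `L`, that are mapped
to the monomials by a homomorphism `H` to power series, tend to zero, and span `T` topologically. -/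
structure MonomialSystem (L : Submodule ℤ (σ → ℤ)) (H : T →ₐ[K] MvPowerSeries σ K) where
  y : (σ →₀ ℕ) → T
  map_y : ∀ m, intExp m ∈ L → H (y m) = monomial m 1
  decay : ∀ N : ℕ, ∃ D : ℕ, ∀ m, intExp m ∈ L → D ≤ m.degree → y m ∈ maximalIdeal T ^ N
  span : ∀ (N : ℕ) (x : T), ∃ z ∈ Submodule.span K (y '' {m | intExp m ∈ L}),
    x - z ∈ maximalIdeal T ^ N
  local_map : ∀ x ∈ maximalIdeal T, 1 ≤ (H x).order

namespace MonomialSystem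

variable {L : Submodule ℤ (σ → ℤ)} {H : T →ₐ[K] MvPowerSeries σ K} (S : MonomialSystem L H)

include S

lemma le_order {N : ℕ} {x : T} (hx : x ∈ maximalIdeal T ^ N) : (N : ℕ∞) ≤ (H x).order :=
  le_order_of_mem_pow H.toRingHom S.local_map N x hx

lemma isSupp (x : T) : IsSupp L (H x) := by
  intro m hm
  obtain ⟨z, hz, hxz⟩ := S.span (m.degree + 1) x
  have h1 : IsSupp L (H z) := by
    refine Submodule.span_induction ?_ ?_ ?_ ?_ hz
    · rintro _ ⟨m', hm', rfl⟩
      rw [S.map_y m' hm']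
      exact isSupp_monomial hm' 1
    · intro m' hm'
      rw [map_zero, map_zero] at hm'
      exact absurd rfl hm'
    · intro a b _ _ ha hb
      rw [map_add]
      intro m' hm'
      rw [map_add] at hm'
      by_cases h : coeff m' (H a) = 0
      · exact hb m' fun h' => hm' (by rw [h, h', add_zero])
      · exact ha m' h
    · intro b a _ ha
      rw [map_smul]
      intro m' hm'
      rw [map_smul] at hm'
      exact ha m' (right_ne_zero_of_smul hm')
  refine h1 m fun h0 => hm ?_
  have h2 : coeff m (H (x - z)) = 0 := coeff_of_lt_order
    (lt_of_lt_of_le (by exact_mod_cast Nat.lt_succ_self _) (S.le_order hxz))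
  rw [map_sub, map_sub, h0, sub_zero] at h2
  exact h2

/-- An element whose expansion is supported on `Q` up to large degree is approximated by
combinations of the monomials in `Q`. -/
lemma exists_sub_mem_pow (N : ℕ) : ∃ M : ℕ, ∀ (x : T) (Q : Set (σ →₀ ℕ)),
    (∀ m ∉ Q, m.degree < M → coeff m (H x) = 0) →
    ∃ z ∈ Submodule.span K (S.y '' {m | intExp m ∈ L ∧ m ∈ Q}), x - z ∈ maximalIdeal T ^ N := by
  classical
  obtain ⟨D, hD⟩ := S.decay N
  refine ⟨D, fun x Q hx => ?_⟩
  obtain ⟨z, hz, hxz⟩ := S.span (max N D) x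
  obtain ⟨l, hl, rfl⟩ := (Finsupp.mem_span_image_iff_linearCombination K).mp hz
  have hlL : ∀ m ∈ l.support, intExp m ∈ L := fun m hm => (Finsupp.mem_supported K l).mp hl hm
  have hHz : ∀ m, coeff m (H (Finsupp.linearCombination K S.y l)) = l m := by
    intro m
    rw [Finsupp.linearCombination_apply, Finsupp.sum, map_sum, map_sum,
      Finset.sum_congr rfl (g := fun m' => if m = m' then l m' else 0) fun m' hm' => by
        rw [map_smul, map_smul, S.map_y m' (hlL m' hm'), coeff_monomial, smul_eq_mul, mul_ite,
          mul_one, mul_zero],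
      Finset.sum_ite_eq, ite_eq_left_iff, Finsupp.notMem_support_iff]
    exact Eq.symm
  have hl0 : ∀ m ∈ l.support, m ∉ Q → D ≤ m.degree := by
    intro m hm hmQ
    by_contra! hlt
    refine Finsupp.mem_support_iff.mp hm ?_
    rw [← hHz]
    have h2 : coeff m (H (x - Finsupp.linearCombination K S.y l)) = 0 := coeff_of_lt_order
      (lt_of_lt_of_le (by exact_mod_cast hlt.trans_le (le_max_right N D)) (S.le_order hxz))
    rw [map_sub, map_sub, hx m hmQ hlt, zero_sub, neg_eq_zero] at h2
    exact h2
  refine ⟨∑ m ∈ l.support with m ∈ Q, l m • S.y m, sum_mem fun m hm => ?_, ?_⟩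
  · rw [Finset.mem_filter] at hm
    exact Submodule.smul_mem _ _ (Submodule.subset_span ⟨m, ⟨hlL m hm.1, hm.2⟩, rfl⟩)
  · rw [← sub_add_sub_cancel x (Finsupp.linearCombination K S.y l)]
    refine add_mem (Ideal.pow_le_pow_right (le_max_left N D) hxz) ?_
    rw [Finsupp.linearCombination_apply, Finsupp.sum,
      ← Finset.sum_filter_add_sum_filter_not l.support (· ∈ Q), add_sub_cancel_left]
    refine Ideal.sum_mem _ fun m hm => ?_
    rw [Finset.mem_filter] at hm
    rw [Algebra.smul_def]
    exact Ideal.mul_mem_left _ _ (hD m (hlL m hm.1) (hl0 m hm.1 hm.2))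

/-- Series of large order come from large powers of the maximal ideal. -/
lemma exists_mem_pow (N : ℕ) :
    ∃ M : ℕ, ∀ x, (M : ℕ∞) ≤ (H x).order → x ∈ maximalIdeal T ^ N := by
  obtain ⟨M, hM⟩ := S.exists_sub_mem_pow N
  refine ⟨M, fun x hx => ?_⟩
  obtain ⟨z, hz, hxz⟩ := hM x ∅ fun m _ hm =>
    coeff_of_lt_order (lt_of_lt_of_le (by exact_mod_cast hm) hx)
  simp only [Set.mem_empty_iff_false, and_false, Set.ofPred_false, Set.image_empty,
    Submodule.span_empty, Submodule.mem_bot] at hz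
  rwa [hz, sub_zero] at hxz

lemma injective [IsHausdorff (maximalIdeal T) T] : Function.Injective H := by
  rw [injective_iff_map_eq_zero]
  intro x hx
  refine IsHausdorff.haus (I := maximalIdeal T) inferInstance x fun N => ?_
  rw [SModEq.zero, smul_eq_mul, Ideal.mul_top]
  obtain ⟨M, hM⟩ := S.exists_mem_pow N
  exact hM x (by rw [hx, order_zero]; exact le_top)

lemma exists_eq [Finite σ] [IsPrecomplete (maximalIdeal T) T] {f : MvPowerSeries σ K}
    (hf : IsSupp L f) : ∃ x, H x = f := by
  classical
  let B : ℕ → Finset (σ →₀ ℕ) := fun D => (Finsupp.finite_of_degree_lt (σ := σ) D).toFinset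
  have hB : ∀ D m, m ∈ B D ↔ m.degree < D := fun D m => by
    simp only [B, Set.Finite.mem_toFinset]
    rfl
  choose D hD using S.decay
  -- truncate at a monotone sequence of degrees
  let E : ℕ → ℕ := fun N => N + ∑ j ∈ Finset.range (N + 1), D j
  have hEmono : Monotone E := fun a b h => Nat.add_le_add h
    (Finset.sum_le_sum_of_subset (Finset.range_mono (Nat.succ_le_succ h)))
  have hED : ∀ N, D N ≤ E N := fun N => (Finset.single_le_sum (f := D) (fun _ _ => Nat.zero_le _)
    (Finset.self_mem_range_succ N)).trans (Nat.le_add_left _ _)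
  let s : ℕ → T := fun N => ∑ m ∈ B (E N), coeff m f • S.y m
  have hHs : ∀ N m, m.degree < E N → coeff m (H (s N)) = coeff m f := by
    intro N m hm
    have h1 : ∀ m', coeff m (H (coeff m' f • S.y m')) = if m = m' then coeff m' f else 0 := by
      intro m'
      by_cases h0 : coeff m' f = 0
      · rw [h0, zero_smul, map_zero, map_zero, ite_self]
      · rw [map_smul, map_smul, S.map_y m' (hf m' h0), coeff_monomial, smul_eq_mul, mul_ite,
          mul_one, mul_zero]
    rw [map_sum, map_sum, Finset.sum_congr rfl fun m' _ => h1 m', Finset.sum_ite_eq,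
      if_pos ((hB _ _).mpr hm)]
  obtain ⟨x, hx⟩ := IsPrecomplete.prec (I := maximalIdeal T) inferInstance (f := s)
    (fun {a b} hab => by
      rw [SModEq.sub_mem, smul_eq_mul, Ideal.mul_top, ← neg_mem_iff, neg_sub]
      have h1 : s b - s a = ∑ m ∈ B (E b) \ B (E a), coeff m f • S.y m := by
        rw [sub_eq_iff_eq_add]
        exact (Finset.sum_sdiff (fun m hm => (hB _ _).mpr
          (((hB _ _).mp hm).trans_le (hEmono hab)))).symm
      rw [h1]
      refine Ideal.sum_mem _ fun m hm => ?_
      by_cases h0 : coeff m f = 0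
      · rw [h0, zero_smul]
        exact zero_mem _
      rw [Algebra.smul_def]
      refine Ideal.mul_mem_left _ _ (hD a m (hf m h0) ((hED a).trans ?_))
      rw [Finset.mem_sdiff, hB, hB] at hm
      exact not_lt.mp hm.2)
  refine ⟨x, ?_⟩
  ext m
  have h1 := hx (m.degree + 1)
  rw [SModEq.sub_mem, smul_eq_mul, Ideal.mul_top] at h1
  have h2 : coeff m (H (s (m.degree + 1) - x)) = 0 := coeff_of_lt_order
    (lt_of_lt_of_le (by exact_mod_cast Nat.lt_succ_self _) (S.le_order h1))
  rw [map_sub, map_sub, sub_eq_zero, hHs] at h2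
  · exact h2.symm
  · exact (Nat.lt_succ_self _).trans_le (Nat.le_add_right _ _)

lemma mem_maximalIdeal (x : T) : x ∈ maximalIdeal T ↔ constantCoeff (H x) = 0 := by
  constructor
  · exact fun h => one_le_order_iff_constCoeff_eq_zero.mp (S.local_map x h)
  · intro h
    rw [IsLocalRing.mem_maximalIdeal, mem_nonunits_iff]
    intro hu
    exact ((hu.map H).map constantCoeff).ne_zero h

end MonomialSystem

end Expansion

/-! ### The formal chart at a point of the closed orbit -/

section ToricPoint

open IsLocalRing MvPowerSeries

variable {K T M ι κ : Type*} [Field K] [CommRing T] [IsLocalRing T] [Algebra K T] [AddCommGroup M]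

open scoped Classical in
/-- The map `θ` exhibits the completion of `T` as that of the monoid algebra `K[P]` at a
`K`-rational point of the closed torus orbit. The linear coordinates `Λ` are the facet functionals
of `P` (on `ι`) and a coordinate system on the group of units of `P` (on `κ`). -/
structure IsToricPoint (Λ : M →ₗ[ℤ] (ι ⊕ κ → ℤ)) (P : AddSubmonoid M)
    (θ : AddMonoidAlgebra K P →ₐ[K] T) : Prop where
  injective : Function.Injective Λ
  mem_iff : ∀ m, m ∈ P ↔ ∀ i, 0 ≤ Λ m (Sum.inl i)
  single : ∀ j, ∃ v, ∀ s, Λ v s = if s = Sum.inr j then 1 else 0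
  facet : ∀ i, ∃ w, Λ w (Sum.inl i) = 0 ∧ (∀ j ≠ i, 0 < Λ w (Sum.inl j)) ∧
    ∀ j, Λ w (Sum.inr j) = 0
  prim : ∀ i, ∃ v, Λ v (Sum.inl i) = 1 ∧ (∀ j, 0 ≤ Λ v (Sum.inl j)) ∧ ∀ j, Λ v (Sum.inr j) = 0
  fg : P.FG
  dense : IsAdicDense θ.toRingHom
  mem_maximalIdeal : ∀ m : P, (∃ i, Λ m (Sum.inl i) ≠ 0) →
    θ (AddMonoidAlgebra.single m 1) ∈ maximalIdeal T
  residue : ∀ x : T, ∃ a : K, x - algebraMap K T a ∈ maximalIdeal T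

/-- A local `K`-algebra with residue field `K` has an evaluation at the closed point. -/
lemma exists_evaluation (h : ∀ x : T, ∃ a : K, x - algebraMap K T a ∈ maximalIdeal T) :
    ∃ ρ : T →ₐ[K] K, ∀ x, x ∈ maximalIdeal T ↔ ρ x = 0 := by
  have hbij : Function.Bijective (algebraMap K (ResidueField T)) := by
    refine ⟨(algebraMap K (ResidueField T)).injective, fun z => ?_⟩
    obtain ⟨x, rfl⟩ := residue_surjective z
    obtain ⟨a, ha⟩ := h x
    refine ⟨a, ?_⟩
    rw [← residue_eq_zero_iff, map_sub, sub_eq_zero] at ha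
    exact ha.symm
  let e : K ≃ₐ[K] ResidueField T := AlgEquiv.ofBijective (Algebra.ofId K _) hbij
  refine ⟨e.symm.toAlgHom.comp (IsScalarTower.toAlgHom K T (ResidueField T)), fun x => ?_⟩
  rw [← residue_eq_zero_iff]
  exact (map_eq_zero_iff e.symm e.symm.injective).symm

namespace IsToricPoint

variable {Λ : M →ₗ[ℤ] (ι ⊕ κ → ℤ)} {P : AddSubmonoid M} {θ : AddMonoidAlgebra K P →ₐ[K] T}
variable (h : IsToricPoint Λ P θ)

include h

/-- A lattice point is determined by its boundary part and its unit part. -/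
lemma exists_section [Finite κ] (m : ι ⊕ κ →₀ ℕ) : ∃ p : P, intExp m ∈ LinearMap.range Λ →
    (∀ i, Λ p (Sum.inl i) = m (Sum.inl i)) ∧ ∀ j, Λ p (Sum.inr j) = 0 := by
  classical
  cases nonempty_fintype κ
  by_cases hm : intExp m ∈ LinearMap.range Λ
  · obtain ⟨v, hv⟩ := hm
    choose e he using h.single
    have h1 : ∀ i, Λ (v - ∑ j, (m (Sum.inr j) : ℤ) • e j) (Sum.inl i) = m (Sum.inl i) := by
      intro i
      simp [hv, he]
    have h2 : ∀ j, Λ (v - ∑ j, (m (Sum.inr j) : ℤ) • e j) (Sum.inr j) = 0 := by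
      intro i
      simp [hv, he]
    exact ⟨⟨_, (h.mem_iff _).mpr fun i => by rw [h1]; positivity⟩, fun _ => ⟨h1, h2⟩⟩
  · exact ⟨0, fun h' => absurd h' hm⟩

lemma le_mul_of_mem [Fintype ι] : ∃ C : ℕ, ∀ p : P, ∃ N : ℕ,
    θ (AddMonoidAlgebra.single p 1) ∈ maximalIdeal T ^ N ∧ ∑ i, Λ p (Sum.inl i) ≤ C * N := by
  classical
  obtain ⟨S, hS⟩ := h.fg
  have hSP : ∀ s ∈ S, s ∈ P := fun s hs => hS ▸ AddSubmonoid.subset_closure hs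
  have hpos : ∀ p ∈ P, 0 ≤ ∑ i, Λ p (Sum.inl i) := fun p hp =>
    Finset.sum_nonneg fun i _ => (h.mem_iff p).mp hp i
  obtain ⟨C, hC⟩ := Int.eq_ofNat_of_zero_le
    (Finset.sum_nonneg fun s hs => hpos s (hSP s hs) : 0 ≤ ∑ s ∈ S, ∑ i, Λ s (Sum.inl i))
  refine ⟨C, fun p => ?_⟩
  have key : ∀ q ∈ AddSubmonoid.closure (S : Set M), ∀ hq : q ∈ P, ∃ N : ℕ,
      θ (AddMonoidAlgebra.single ⟨q, hq⟩ 1) ∈ maximalIdeal T ^ N ∧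
        ∑ i, Λ q (Sum.inl i) ≤ C * N := by
    intro q hq
    induction hq using AddSubmonoid.closure_induction with
    | mem s hs =>
      intro hsP
      by_cases h0 : ∃ i, Λ s (Sum.inl i) ≠ 0
      · refine ⟨1, by simpa using h.mem_maximalIdeal ⟨s, hsP⟩ h0, ?_⟩
        rw [Nat.cast_one, mul_one]
        refine le_trans ?_ hC.le
        exact Finset.single_le_sum (f := fun s => ∑ i, Λ s (Sum.inl i))
          (fun s hs => hpos s (hSP s hs)) hs
      · push Not at h0
        exact ⟨0, by simp, by simp [h0]⟩
    | zero => exact fun _ => ⟨0, by simp, by simp⟩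
    | add a b ha hb iha ihb =>
      rw [hS] at ha hb
      intro hab
      obtain ⟨N, h1, h2⟩ := iha ha
      obtain ⟨N', h1', h2'⟩ := ihb hb
      refine ⟨N + N', ?_, ?_⟩
      · have : AddMonoidAlgebra.single (⟨a + b, hab⟩ : P) (1 : K)
            = AddMonoidAlgebra.single (⟨a, ha⟩ : P) 1 * AddMonoidAlgebra.single ⟨b, hb⟩ 1 := by
          rw [AddMonoidAlgebra.single_mul_single, one_mul]; rfl
        rw [this, map_mul, pow_add]
        exact Ideal.mul_mem_mul h1 h1'
      · rw [map_add]
        simp only [Pi.add_apply, Finset.sum_add_distrib]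
        push_cast
        linarith
  exact key p (hS.symm ▸ p.2) p.2

/-- The units of the monoid algebra coming from a basis of the group of units of `P`. -/
lemma exists_units [Fintype κ] : ∃ u : κ → Tˣ, ∀ p p₀ : P,
    (∀ i, Λ p (Sum.inl i) = Λ p₀ (Sum.inl i)) → (∀ j, Λ p₀ (Sum.inr j) = 0) →
    θ (AddMonoidAlgebra.single p 1) =
      θ (AddMonoidAlgebra.single p₀ 1) * (∏ j, u j ^ Λ p (Sum.inr j) : Tˣ) := by
  classical
  choose e he using h.single
  have heP : ∀ (n : ℤ) (j), n • e j ∈ P := fun n j => (h.mem_iff _).mpr fun i => by simp [he]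
  let G : κ → Multiplicative ℤ →* T := fun j =>
    { toFun := fun n => θ (AddMonoidAlgebra.single ⟨n.toAdd • e j, heP _ j⟩ 1)
      map_one' := by
        rw [← map_one θ, AddMonoidAlgebra.one_def]
        congr 2
        exact Subtype.ext (zero_zsmul _)
      map_mul' := fun a b => by
        rw [← map_mul, AddMonoidAlgebra.single_mul_single, one_mul]
        congr 2
        exact Subtype.ext (add_zsmul _ _ _) }
  refine ⟨fun j => (G j).toHomUnits (.ofAdd 1), fun p p₀ h0 h1 => ?_⟩
  have h2 : ∀ (j) (n : ℤ), ((G j).toHomUnits (.ofAdd 1) ^ n : Tˣ)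
      = θ (AddMonoidAlgebra.single ⟨n • e j, heP n j⟩ 1) := by
    intro j n
    rw [← map_zpow, MonoidHom.coe_toHomUnits]
    change θ (AddMonoidAlgebra.single ⟨(n • (1 : ℤ)) • e j, _⟩ 1) = _
    congr 3
    rw [smul_eq_mul, mul_one]
  have h3 : p = p₀ + ∑ j, (⟨Λ p (Sum.inr j) • e j, heP _ j⟩ : P) := by
    refine Subtype.ext (h.injective ?_)
    rw [AddSubmonoid.coe_add, AddSubmonoid.coe_finsetSum, map_add, map_sum]
    funext s
    cases s with
    | inl i => simp [h0, he]
    | inr j => simp [h1, he]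
  have h4 : ∀ (s : Finset κ) (f : κ → P), AddMonoidAlgebra.single (∑ j ∈ s, f j) (1 : K)
      = ∏ j ∈ s, AddMonoidAlgebra.single (f j) 1 := by
    intro s f
    induction s using Finset.induction_on with
    | empty => rfl
    | insert a s ha ih =>
      rw [Finset.sum_insert ha, Finset.prod_insert ha, ← ih, AddMonoidAlgebra.single_mul_single,
        one_mul]
  conv_lhs => rw [h3]
  rw [← one_mul (1 : K), ← AddMonoidAlgebra.single_mul_single, map_mul, h4, map_prod, one_mul,
    Units.coe_prod]
  exact congrArg _ (Finset.prod_congr rfl fun j _ => (h2 j _).symm)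

end IsToricPoint

end ToricPoint

section ToricPoint

open IsLocalRing MvPowerSeries

variable {K T M ι κ : Type*} [Field K] [CommRing T] [IsLocalRing T] [Algebra K T] [AddCommGroup M]

/-- Modulo powers of the maximal ideal, the inverse of a unit in a subalgebra of a local algebra
with residue field `K` is in the subalgebra: it is a finite geometric series. -/
lemma inv_mem_of_mem (ρ : T →ₐ[K] K) (hρ : ∀ x, x ∈ maximalIdeal T ↔ ρ x = 0) {N : ℕ}
    {B : Subalgebra K T} (hB : ∀ x ∈ maximalIdeal T ^ N, x ∈ B) (u : Tˣ) (hu : (u : T) ∈ B) :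
    ((u⁻¹ : Tˣ) : T) ∈ B := by
  have h0 : ρ u ≠ 0 := (u.isUnit.map ρ).ne_zero
  let t : T := 1 - (ρ u)⁻¹ • (u : T)
  have htB : t ∈ B := sub_mem (one_mem _) (B.smul_mem hu _)
  have htm : t ∈ maximalIdeal T := by
    rw [hρ]
    simp [t, h0]
  have h1 : (u : T) * ((ρ u)⁻¹ • ∑ i ∈ Finset.range N, t ^ i) = 1 - t ^ N := by
    rw [← mul_neg_geom_sum, mul_smul_comm, ← smul_mul_assoc]
    congr 1
    simp [t]
  have h2 : ((u⁻¹ : Tˣ) : T) = (ρ u)⁻¹ • ∑ i ∈ Finset.range N, t ^ i + (u⁻¹ : Tˣ) * t ^ N := by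
    rw [← sub_eq_iff_eq_add, ← sub_eq_zero, sub_right_comm, sub_eq_zero]
    refine (Units.mul_right_inj u).mp ?_
    change (u : T) * (_ - _) = u * (_ * _)
    rw [mul_sub, h1, Units.mul_inv_cancel_left, Units.mul_inv, sub_sub_cancel]
  rw [h2]
  exact add_mem (B.smul_mem (sum_mem fun i _ => pow_mem htB i) _)
    (hB _ (Ideal.mul_mem_left _ _ (Ideal.pow_mem_pow htm N)))

/-- Ideals of a Noetherian local ring are closed. -/
lemma mem_of_forall_sub_mem_pow [IsNoetherianRing T] {J : Ideal T} {x : T}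
    (hx : ∀ N : ℕ, ∃ z ∈ J, x - z ∈ maximalIdeal T ^ N) : x ∈ J := by
  rw [← Ideal.Quotient.eq_zero_iff_mem, ← Submodule.mem_bot (R := T),
    ← Ideal.iInf_pow_smul_eq_bot_of_isLocalRing (M := T ⧸ J) _ (maximalIdeal.isMaximal T).ne_top,
    Submodule.mem_iInf]
  intro N
  obtain ⟨z, hz, hxz⟩ := hx N
  have h1 : Ideal.Quotient.mk J x = (x - z) • (1 : T ⧸ J) := by
    rw [Algebra.smul_def, mul_one, map_sub, Ideal.Quotient.algebraMap_eq,
      Ideal.Quotient.eq_zero_iff_mem.mpr hz, sub_zero]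
  rw [h1]
  exact Submodule.smul_mem_smul hxz trivial

open scoped Classical in
lemma constantCoeff_monomial_one {σ : Type*} (w : σ →₀ ℕ) :
    (constantCoeff (monomial w 1) : K) = if w = 0 then 1 else 0 := by
  rw [← coeff_zero_eq_constantCoeff_apply, coeff_monomial]
  simp only [eq_comm]

/-- The ring of a chart is Noetherian, since it is a direct summand of a power series ring. -/
theorem FormalChart.isNoetherianRing [Finite ι] [Finite κ] (c : FormalChart K T ι κ) :
    IsNoetherianRing T := by
  -- ideals are contracted from power series, by projecting to the series supported on the lattice
  have key : ∀ I : Ideal T, (I.map c.Θ.toRingHom).comap c.Θ.toRingHom = I := by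
    refine fun I => le_antisymm (fun x hx => ?_) Ideal.le_comap_map
    have h1 : ∀ f ∈ I.map c.Θ.toRingHom, ∀ g, ∃ y ∈ I, c.Θ y = proj c.L (f * g) := by
      intro f hf
      refine Submodule.span_induction ?_ ?_ ?_ ?_ hf
      · rintro _ ⟨a, ha, rfl⟩ g
        obtain ⟨t, ht⟩ := (c.mem_range _).mp (isSupp_proj c.L g)
        refine ⟨a * t, Ideal.mul_mem_right _ _ ha, ?_⟩
        rw [map_mul, ht]
        exact (proj_mul (c.isSupp a) g).symm
      · exact fun g => ⟨0, zero_mem _, by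
          rw [zero_mul, ← map_zero c.Θ, proj_eq_self (c.isSupp 0)]⟩
      · intro a b _ _ ha hb g
        obtain ⟨y, hy, hy'⟩ := ha g
        obtain ⟨z, hz, hz'⟩ := hb g
        exact ⟨y + z, add_mem hy hz, by rw [map_add, hy', hz', add_mul, proj_add]⟩
      · intro h a _ ha g
        obtain ⟨y, hy, hy'⟩ := ha (h * g)
        exact ⟨y, hy, by rw [hy', smul_eq_mul, mul_left_comm, mul_assoc]⟩
    obtain ⟨y, hy, hxy⟩ := h1 _ hx 1
    rw [mul_one] at hxy
    have h2 : c.Θ y = c.Θ x := hxy.trans (proj_eq_self (c.isSupp x))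
    rwa [← c.injective h2]
  have hmono : StrictMono fun I : Ideal T => I.map c.Θ.toRingHom :=
    Monotone.strictMono_of_injective (fun _ _ h => Ideal.map_mono h) fun I J hIJ => by
      rw [← key I, ← key J]
      exact congrArg _ hIJ
  exact isNoetherian_iff'.mpr hmono.wellFoundedGT

namespace IsToricPoint

variable {Λ : M →ₗ[ℤ] (ι ⊕ κ → ℤ)} {P : AddSubmonoid M} {θ : AddMonoidAlgebra K P →ₐ[K] T}
variable (h : IsToricPoint Λ P θ)

include h

open scoped Classical in
/-- The series expansion at a point of the closed orbit. -/
theorem exists_monomialSystem [Finite ι] [Finite κ] : ∃ (H : T →ₐ[K] MvPowerSeries (ι ⊕ κ) K)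
    (S : MonomialSystem (LinearMap.range Λ) H) (ε : Multiplicative M →* Kˣ),
    (∀ m : P, constantCoeff (H (θ (AddMonoidAlgebra.single m 1)))
      = if ∀ i, Λ m (Sum.inl i) = 0 then ((ε (.ofAdd (m : M)) : Kˣ) : K) else 0) ∧
    (∀ m, intExp m ∈ LinearMap.range Λ → ∃ p : P, (∀ i, Λ p (Sum.inl i) = m (Sum.inl i)) ∧
      θ (AddMonoidAlgebra.single p 1) ∣ S.y m) ∧
    ∀ p : P, ∃ w : ι ⊕ κ →₀ ℕ, (∀ i, (w (Sum.inl i) : ℤ) = Λ p (Sum.inl i)) ∧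
      monomial w (1 : K) ∣ H (θ (AddMonoidAlgebra.single p 1)) := by
  cases nonempty_fintype κ
  cases nonempty_fintype ι
  obtain ⟨ρ, hρ⟩ := exists_evaluation h.residue
  obtain ⟨u, hu⟩ := h.exists_units
  let ε₀ : κ → Kˣ := fun j => Units.map ρ (u j)
  -- a monomial `p` expands to `t ^ w p`, in the boundary variables, times a product of powers of
  -- the units `ε₀ j * (1 + s j)`, where `s j` are the variables in the unit directions
  let v : κ → (MvPowerSeries (ι ⊕ κ) K)ˣ := fun j =>
    IsUnit.unit (a := C (ε₀ j : K) * (1 + X (Sum.inr j)))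
    (by rw [isUnit_iff_constantCoeff]; simp)
  have hv : ∀ j, (v j : MvPowerSeries (ι ⊕ κ) K) = C (ε₀ j : K) * (1 + X (Sum.inr j)) :=
    fun j => IsUnit.unit_spec _
  have hvε : ∀ j, Units.map (constantCoeff (R := K) (σ := ι ⊕ κ)) (v j) = ε₀ j := fun j => by
    ext
    rw [Units.coe_map, MonoidHom.coe_coe, hv]
    simp
  let V : Multiplicative M →* (MvPowerSeries (ι ⊕ κ) K)ˣ :=
    { toFun := fun m => ∏ j, v j ^ Λ m.toAdd (Sum.inr j)
      map_one' := by simp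
      map_mul' := fun a b => by simp [zpow_add, Finset.prod_mul_distrib] }
  let w : P → (ι ⊕ κ →₀ ℕ) := fun p => Finsupp.equivFunOnFinite.symm
    (Sum.elim (fun i => (Λ p (Sum.inl i)).toNat) 0)
  have hwl : ∀ p i, (w p (Sum.inl i) : ℤ) = Λ p (Sum.inl i) := fun p i =>
    Int.toNat_of_nonneg ((h.mem_iff p).mp p.2 i)
  have hwr : ∀ p j, w p (Sum.inr j) = 0 := fun p j => rfl
  have hw0 : ∀ p, w p = 0 ↔ ∀ i, Λ p (Sum.inl i) = 0 := fun p => by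
    constructor
    · intro h0 i
      rw [← hwl, h0]; rfl
    · intro h0
      ext s
      cases s with
      | inl i => exact_mod_cast (hwl p i).trans (h0 i)
      | inr j => exact hwr p j
  let h₀ : Multiplicative P →* MvPowerSeries (ι ⊕ κ) K :=
    { toFun := fun p => monomial (w p.toAdd) (1 : K) * (V (.ofAdd (p.toAdd : M)) :
    MvPowerSeries (ι ⊕ κ) K)
      map_one' := by
        have : w 0 = 0 := (hw0 0).mpr (by simp)
        rw [toAdd_one, this]
        simp
      map_mul' := fun a b => by
        have h1 : w (a.toAdd + b.toAdd) = w a.toAdd + w b.toAdd := by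
          ext s
          cases s with
          | inl i => zify; rw [hwl]; simp [hwl]
          | inr j => rfl
        rw [toAdd_mul, h1, AddSubmonoid.coe_add, ofAdd_add, map_mul, Units.val_mul,
          mul_mul_mul_comm, monomial_mul_monomial, one_mul] }
  let h' : AddMonoidAlgebra K P →ₐ[K] MvPowerSeries (ι ⊕ κ) K := AddMonoidAlgebra.lift K _ P h₀
  have hh' : ∀ p, h' (AddMonoidAlgebra.single p 1) = monomial (w p) (1 : K) *
      (V (.ofAdd (p : M)) : MvPowerSeries (ι ⊕ κ) K) := by
    intro p
    change AddMonoidAlgebra.lift K _ P h₀ _ = _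
    rw [AddMonoidAlgebra.lift_single, one_smul]
    rfl
  let ε : Multiplicative M →* Kˣ := (Units.map (constantCoeff (R := K) (σ := ι ⊕ κ))).comp V
  have hVε : ∀ m, constantCoeff (V m : MvPowerSeries (ι ⊕ κ) K) = ε m := fun m => rfl
  have hcc : ∀ p : P, constantCoeff (h' (AddMonoidAlgebra.single p 1))
      = if ∀ i, Λ p (Sum.inl i) = 0 then ((ε (.ofAdd (p : M)) : Kˣ) : K) else 0 := by
    intro p
    rw [hh', map_mul, constantCoeff_monomial_one, hVε, ite_mul, one_mul, zero_mul]
    simp only [hw0]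
  have hεu : ∀ m : Multiplicative M, (ε m : K) = ρ (∏ j, u j ^ Λ m.toAdd (Sum.inr j) : Tˣ) := by
    intro m
    change _ = ((Units.map ρ.toRingHom.toMonoidHom
      (∏ j, u j ^ Λ m.toAdd (Sum.inr j) : Tˣ) : Kˣ) : K)
    congr 1
    change Units.map _ (∏ j, v j ^ Λ m.toAdd (Sum.inr j)) = _
    rw [map_prod, map_prod]
    refine Finset.prod_congr rfl fun j _ => ?_
    rw [map_zpow, map_zpow]
    exact congrArg (· ^ _) (hvε j)
  have hρθ : ∀ x, constantCoeff (h' x) = ρ (θ x) := by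
    have : (⟨constantCoeff (R := K) (σ := ι ⊕ κ), fun a => constantCoeff_C a⟩ :
        MvPowerSeries (ι ⊕ κ) K →ₐ[K] K).comp h' = ρ.comp θ := by
      refine AddMonoidAlgebra.algHom_ext (fun p => ?_) (AlgHom.ext fun a => ?_)
      swap
      · exact ((AlgHom.comp _ _).comp AddMonoidAlgebra.singleZeroAlgHom).commutes a |>.trans
          (((ρ.comp θ).comp AddMonoidAlgebra.singleZeroAlgHom).commutes a).symm
      change constantCoeff (h' (AddMonoidAlgebra.single p 1)) = ρ (θ (AddMonoidAlgebra.single p 1))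
      rw [hcc]
      split_ifs with h0
      · rw [hu p 0 (fun i => by simp [h0]) (fun j => by simp), hεu]
        have : AddMonoidAlgebra.single (0 : P) (1 : K) = 1 := rfl
        rw [this, map_one, one_mul]
        rfl
      · push Not at h0
        exact ((hρ _).mp (h.mem_maximalIdeal p h0)).symm
    exact fun x => DFunLike.congr_fun this x
  -- the expansion extends from the monoid algebra to `T` by density
  obtain ⟨H₀, hH₀, hHm⟩ := exists_ringHom_lift h.dense h'.toRingHom fun r hr => by
    rw [one_le_order_iff_constCoeff_eq_zero]
    exact (hρθ r).trans ((hρ _).mp hr)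
  let H : T →ₐ[K] MvPowerSeries (ι ⊕ κ) K :=
    AlgHom.mk H₀ fun a => by
        have h1 := hH₀ (algebraMap K _ a)
        rw [AlgHom.toRingHom_eq_coe, RingHom.coe_coe, AlgHom.commutes, AlgHom.toRingHom_eq_coe,
          RingHom.coe_coe, AlgHom.commutes] at h1
        exact h1
  have hH : ∀ r, H (θ r) = h' r := hH₀
  choose p hp using h.exists_section
  let z : κ → T := fun j => ((ε₀ j)⁻¹ : Kˣ) • (u j : T) - 1
  have hzm : ∀ j, z j ∈ maximalIdeal T := fun j => by
    rw [hρ, map_sub, map_one, Units.smul_def, map_smul, smul_eq_mul, sub_eq_zero]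
    exact (ε₀ j).inv_mul
  -- the elements of `T` with a given monomial as expansion
  let y : (ι ⊕ κ →₀ ℕ) → T := fun m =>
    θ (AddMonoidAlgebra.single (p m) 1) * ∏ j, z j ^ m (Sum.inr j)
  have hHu : ∀ j, H (u j) = v j := by
    intro j
    obtain ⟨e, he⟩ := h.single j
    have heP : e ∈ P := (h.mem_iff _).mpr fun i => by simp [he]
    have h1 := hu ⟨e, heP⟩ 0 (fun i => by simp [he]) (fun j => by simp)
    have h2 : ∏ j', u j' ^ Λ e (Sum.inr j') = u j := by
      simp [he]
    have h3 : V (.ofAdd e) = v j := by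
      simp [V, he]
    have h4 : AddMonoidAlgebra.single (0 : P) (1 : K) = 1 := rfl
    rw [h4, map_one, one_mul] at h1
    rw [← h2, ← h1, hH, hh', (hw0 _).mpr (fun i => by simp [he]), h3]
    simp
  have hHz : ∀ j, H (z j) = X (Sum.inr j) := by
    intro j
    rw [map_sub, map_one, Units.smul_def, map_smul, hHu, hv, smul_eq_C_mul, ← mul_assoc, ← map_mul,
      Units.inv_mul, map_one, one_mul, add_sub_cancel_left]
  obtain ⟨C, hC⟩ := h.le_mul_of_mem
  have hp0 : p 0 = 0 := Subtype.ext <| h.injective <| funext fun s => by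
    have := hp 0 (by rw [intExp_zero]; exact zero_mem _)
    cases s with
    | inl i => rw [this.1]; simp
    | inr j => rw [this.2]; simp
  have hy0 : y 0 = 1 := by
    change θ (AddMonoidAlgebra.single (p 0) 1) * ∏ j, z j ^ 0 = 1
    have h4 : AddMonoidAlgebra.single (0 : P) (1 : K) = 1 := rfl
    rw [hp0, h4, map_one]
    simp
  have hyadd : ∀ a b, intExp a ∈ LinearMap.range Λ → intExp b ∈ LinearMap.range Λ →
      y a * y b = y (a + b) := by
    intro a b ha hb
    have h1 : p (a + b) = p a + p b := Subtype.ext <| h.injective <| funext fun s => by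
      have := hp (a + b) (by rw [intExp_add]; exact add_mem ha hb)
      rw [AddSubmonoid.coe_add, map_add]
      cases s with
      | inl i => rw [this.1, Pi.add_apply, (hp a ha).1, (hp b hb).1]; simp
      | inr j => rw [this.2, Pi.add_apply, (hp a ha).2, (hp b hb).2]; simp
    change θ _ * _ * (θ _ * _) = θ (AddMonoidAlgebra.single (p (a + b)) 1) * ∏ j, z j ^ (_ + _)
    rw [h1, mul_mul_mul_comm, ← map_mul, AddMonoidAlgebra.single_mul_single, one_mul]
    simp_rw [pow_add]
    rw [Finset.prod_mul_distrib]
  refine ⟨H, ⟨y, ?_, ?_, ?_, hHm⟩, ε, fun m => by rw [hH, hcc]; congr,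
    fun m hm => ⟨p m, (hp m hm).1, Dvd.intro _ rfl⟩,
    fun p => ⟨w p, hwl p, by rw [hH, hh']; exact Dvd.intro _ rfl⟩⟩
  · intro m hm
    change H (θ (AddMonoidAlgebra.single (p m) 1) * ∏ j, z j ^ m (Sum.inr j)) = _
    rw [map_mul, hH, hh', map_prod]
    have hV1 : V (.ofAdd (p m : M)) = 1 := by
      simp [V, (hp m hm).2]
    simp_rw [map_pow, hHz, X_pow_eq]
    rw [hV1, Units.val_one, mul_one, prod_monomial, monomial_mul_monomial, one_mul,
      Finset.prod_const_one]
    congr 2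
    ext s
    rw [Finsupp.add_apply, Finsupp.finsetSum_apply]
    cases s with
    | inl i =>
      have := (hwl (p m) i).trans ((hp m hm).1 i)
      simpa using this
    | inr j => simp [hwr, Finsupp.single_apply]
  · -- monomials of large degree lie in large powers of the maximal ideal
    intro N
    refine ⟨(C + 1) * N, fun m hm hN => ?_⟩
    obtain ⟨N', h1, h2⟩ := hC (p m)
    have h3 : y m ∈ maximalIdeal T ^ (N' + ∑ j, m (Sum.inr j)) := by
      rw [pow_add, ← Finset.prod_pow_eq_pow_sum]
      exact Ideal.mul_mem_mul h1 (Ideal.prod_mem_prod fun j _ => Ideal.pow_mem_pow (hzm j) _)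
    refine Ideal.pow_le_pow_right ?_ h3
    have h4 : m.degree = ∑ i, m (Sum.inl i) + ∑ j, m (Sum.inr j) := by
      rw [Finsupp.degree_eq_sum, Fintype.sum_sum_type]
    have h5 : ∑ i, m (Sum.inl i) ≤ C * N' := by
      zify
      refine le_trans (le_of_eq (Finset.sum_congr rfl fun i _ => ?_)) h2
      exact ((hp m hm).1 i).symm
    by_contra! hlt
    have h6 := Nat.mul_le_mul_left (C + 1) hlt
    nlinarith [Nat.zero_le (C * ∑ j, m (Sum.inr j))]
  · -- the monomials span a subalgebra modulo each power of the maximal ideal, which contains the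
    -- units in the image of `θ` and hence everything
    intro N x
    let Y : Submonoid T :=
      { carrier := y '' {m | intExp m ∈ LinearMap.range Λ}
        one_mem' := ⟨0, by simp only [Set.mem_ofPred_eq, intExp_zero]; exact zero_mem _, hy0⟩
        mul_mem' := by
          rintro _ _ ⟨a, ha, rfl⟩ ⟨b, hb, rfl⟩
          refine ⟨a + b, ?_, (hyadd a b ha hb).symm⟩
          simp only [Set.mem_ofPred_eq, intExp_add]
          exact add_mem ha hb }
    let B : Subalgebra K T := ((Algebra.adjoin K (Y : Set T)).map
      (Ideal.Quotient.mkₐ K (maximalIdeal T ^ N))).comap (Ideal.Quotient.mkₐ K (maximalIdeal T ^ N))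
    have hBmem : ∀ x, x ∈ B → ∃ z ∈ Submodule.span K (y '' {m | intExp m ∈ LinearMap.range Λ}),
        x - z ∈ maximalIdeal T ^ N := by
      rintro x ⟨z, hz, hzx⟩
      refine ⟨z, ?_, Ideal.Quotient.eq.mp hzx.symm⟩
      have h1 : z ∈ Subalgebra.toSubmodule (Algebra.adjoin K (Y : Set T)) := hz
      rw [Algebra.adjoin_eq_span, Submonoid.closure_eq] at h1
      exact h1
    have hB1 : ∀ x ∈ maximalIdeal T ^ N, x ∈ B := fun x hx =>
      ⟨0, zero_mem _, (map_zero _).trans (Ideal.Quotient.eq_zero_iff_mem.mpr hx).symm⟩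
    have hB2 : ∀ m, intExp m ∈ LinearMap.range Λ → y m ∈ B := fun m hm =>
      ⟨y m, Algebra.subset_adjoin ⟨m, hm, rfl⟩, rfl⟩
    have hBu : ∀ j, (u j : T) ∈ B := by
      intro j
      have hj : intExp (Finsupp.single (Sum.inr j) 1 : ι ⊕ κ →₀ ℕ) ∈ LinearMap.range Λ := by
        obtain ⟨e, he⟩ := h.single j
        refine ⟨e, funext fun s => ?_⟩
        rw [he, intExp_apply, Finsupp.single_apply]
        simp only [eq_comm, Nat.cast_ite, Nat.cast_one, Nat.cast_zero]
      have h1 : p (Finsupp.single (Sum.inr j) 1) = 0 := Subtype.ext <| h.injective <|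
          funext fun s => by
        cases s with
        | inl i => rw [(hp _ hj).1]; simp
        | inr j' => rw [(hp _ hj).2]; simp
      have h2 : y (Finsupp.single (Sum.inr j) 1) = z j := by
        change θ (AddMonoidAlgebra.single (p _) 1) * ∏ j', z j' ^ _ = z j
        have h4 : AddMonoidAlgebra.single (0 : P) (1 : K) = 1 := rfl
        rw [h1, h4, map_one, one_mul, Finset.prod_eq_single j]
        · simp
        · intro j' _ hj'
          simp [hj'.symm]
        · simp
      have h3 : (u j : T) = (ε₀ j : K) • (z j + 1) := by
        rw [sub_add_cancel, ← Units.smul_def, smul_inv_smul]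
      rw [h3, ← h2]
      exact B.smul_mem (add_mem (hB2 _ hj) (one_mem _)) _
    have hBθ : ∀ r, θ r ∈ B := by
      intro r
      induction r using AddMonoidAlgebra.induction_linear with
      | zero => rw [map_zero]; exact zero_mem _
      | add a b ha hb => rw [map_add]; exact add_mem ha hb
      | single q a =>
        have h1 : AddMonoidAlgebra.single q a = a • AddMonoidAlgebra.single q (1 : K) := by
          rw [AddMonoidAlgebra.smul_single, smul_eq_mul, mul_one]
        have hq : intExp (w q) ∈ LinearMap.range Λ := by
          choose e he using h.single
          refine ⟨(q : M) - ∑ j, Λ q (Sum.inr j) • e j, funext fun s => ?_⟩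
          cases s with
          | inl i => simp [he, hwl]
          | inr j => simp [he, hwr]
        have h2 : θ (AddMonoidAlgebra.single (p (w q)) 1) = y (w q) := by
          change _ = θ (AddMonoidAlgebra.single (p _) 1) * ∏ j, z j ^ 0
          simp
        rw [h1, map_smul, hu q (p (w q)) (fun i => by rw [(hp _ hq).1, hwl]) (hp _ hq).2, h2]
        refine B.smul_mem (mul_mem (hB2 _ hq) ?_) _
        rw [Units.coe_prod]
        refine prod_mem fun j _ => ?_
        cases Λ q (Sum.inr j) with
        | ofNat n =>
          rw [Int.ofNat_eq_natCast, zpow_natCast, Units.val_pow_eq_pow_val]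
          exact pow_mem (hBu j) n
        | negSucc n =>
          rw [zpow_negSucc, ← inv_pow, Units.val_pow_eq_pow_val]
          exact pow_mem (inv_mem_of_mem ρ hρ hB1 (u j) (hBu j)) _
    obtain ⟨r, hr⟩ := h.dense.approx x N
    obtain ⟨z, hz, hzr⟩ := hBmem _ (hBθ r)
    exact ⟨z, hz, by rw [← sub_add_sub_cancel x (θ r)]; exact add_mem hr hzr⟩

/-- The completed local ring at a point of the closed orbit has a formal toric chart, in which the
boundary is defined by the monomials in the interior of the cone. -/
theorem exists_formalChart [Finite ι] [Finite κ] [IsAdicComplete (maximalIdeal T) T] :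
    ∃ (c : FormalChart K T ι κ) (ε : Multiplicative M →* Kˣ), (∀ v, v ∈ c.L ↔ ∃ m, Λ m = v) ∧
      (∀ m : P, (∀ i, Λ m (Sum.inl i) = 0) →
        c.ev (θ (AddMonoidAlgebra.single m 1)) = ε (.ofAdd m)) ∧
      (∀ m : P, (∃ i, Λ m (Sum.inl i) ≠ 0) → c.ev (θ (AddMonoidAlgebra.single m 1)) = 0) ∧
      ⨅ i, c.prime i = Ideal.span ((fun m : P => θ (AddMonoidAlgebra.single m 1)) ''
        {m | ∀ i, 0 < Λ m (Sum.inl i)}) := by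
  classical
  obtain ⟨H, S, ε, hε, hSy, hHθ⟩ := h.exists_monomialSystem
  have hnat : ∀ v : M, (∀ s, 0 ≤ Λ v s) → ∃ w : ι ⊕ κ →₀ ℕ, intExp w = Λ v := fun v hv =>
    ⟨Finsupp.equivFunOnFinite.symm fun s => (Λ v s).toNat, funext fun s =>
      Int.toNat_of_nonneg (hv s)⟩
  obtain ⟨c, hcL, hcH⟩ : ∃ c : FormalChart K T ι κ, c.L = LinearMap.range Λ ∧ c.Θ = H := by
    refine ⟨⟨LinearMap.range Λ, H, S.injective, fun f => ⟨fun hf => S.exists_eq hf, ?_⟩,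
      S.mem_maximalIdeal, S.exists_mem_pow, fun j => ?_, fun i => ?_, fun i => ?_⟩, rfl, rfl⟩
    · rintro ⟨x, rfl⟩
      exact S.isSupp x
    · obtain ⟨e, he⟩ := h.single j
      refine ⟨e, funext fun s => ?_⟩
      rw [he, intExp_apply, Finsupp.single_apply]
      simp only [eq_comm, Nat.cast_ite, Nat.cast_one, Nat.cast_zero]
    · obtain ⟨v, h0, h1, h2⟩ := h.facet i
      obtain ⟨w, hw⟩ := hnat v fun s => by
        cases s with
        | inl j =>
          by_cases hj : j = i
          · rw [hj, h0]
          · exact (h1 j hj).le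
        | inr j => rw [h2]
      have hw' : ∀ s, (w s : ℤ) = Λ v s := fun s => congrFun hw s
      refine ⟨w, ?_, fun j hj => ?_, fun j => ?_, v, hw.symm⟩ <;> zify <;> rw [hw']
      exacts [h0, h1 j hj, h2 j]
    · obtain ⟨v, h0, h1, h2⟩ := h.prim i
      obtain ⟨w, hw⟩ := hnat v fun s => by
        cases s with
        | inl j => exact h1 j
        | inr j => rw [h2]
      have hw' : ∀ s, (w s : ℤ) = Λ v s := fun s => congrFun hw s
      refine ⟨w, ?_, fun j => ?_, v, hw.symm⟩ <;> zify <;> rw [hw']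
      exacts [h0, h2 j]
  have := c.isNoetherianRing
  subst hcH
  refine ⟨c, ε, fun v => by rw [hcL]; rfl, fun m hm => (hε m).trans (if_pos hm),
    fun m hm => (hε m).trans (if_neg ?_), le_antisymm ?_ ?_⟩
  · push Not
    exact hm
  · -- an expansion divisible by all boundary variables only involves interior monomials
    intro x hx
    rw [Ideal.mem_iInf] at hx
    refine mem_of_forall_sub_mem_pow fun N => ?_
    obtain ⟨D, hD⟩ := S.exists_sub_mem_pow N
    obtain ⟨z, hz, hxz⟩ := hD x {m | ∀ i, m (Sum.inl i) ≠ 0} fun m hm _ => by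
      simp only [Set.mem_ofPred_eq, not_forall, not_not] at hm
      obtain ⟨i, hi⟩ := hm
      exact X_dvd_iff.mp ((FormalChart.mem_prime' _).mp (hx i)) m hi
    refine ⟨z, ?_, hxz⟩
    refine (Submodule.span_le (p := Submodule.restrictScalars K (Ideal.span _))).mpr ?_ hz
    rintro _ ⟨m, ⟨hm, hmQ⟩, rfl⟩
    obtain ⟨p, hp, hdvd⟩ := hSy m hm
    refine Ideal.mem_of_dvd _ hdvd (Ideal.subset_span ⟨p, fun i => ?_, rfl⟩)
    rw [hp]
    exact_mod_cast Nat.pos_of_ne_zero (hmQ i)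
  · rw [Ideal.span_le]
    rintro _ ⟨m, hm, rfl⟩
    refine Ideal.mem_iInf.mpr fun i => (FormalChart.mem_prime' _).mpr ?_
    obtain ⟨w, hw, hdvd⟩ := hHθ m
    refine dvd_trans (X_dvd_iff.mpr fun m' hm' => ?_) hdvd
    rw [coeff_monomial, if_neg]
    rintro rfl
    have := hm i
    rw [← hw, hm'] at this
    exact lt_irrefl _ this

end IsToricPoint

end ToricPoint

/-! ### The big torus -/

section BigTorus

variable {n : ℕ} {P : AddSubmonoid (Fin n → ℤ)}

/-- An element of the interior of the cone absorbs all lattice points. -/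
lemma IsToricMonoid.exists_absorbing (hP : IsToricMonoid P) :
    ∃ m₀ ∈ P, ∀ v, ∃ N : ℕ, v + N • m₀ ∈ P := by
  classical
  obtain ⟨S, hS⟩ := hP.fg
  have hSP : ∀ s ∈ S, s ∈ P := fun s hs => hS ▸ AddSubmonoid.subset_closure hs
  have h0 : ∑ s ∈ S, s ∈ P := sum_mem hSP
  have h1 : ∀ p ∈ P, ∃ N : ℕ, -p + N • ∑ s ∈ S, s ∈ P := by
    intro p hp
    rw [← hS] at hp
    induction hp using AddSubmonoid.closure_induction with
    | mem s hs =>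
      refine ⟨1, ?_⟩
      rw [one_smul, ← Finset.add_sum_erase S (fun s => s) hs, neg_add_cancel_left]
      exact sum_mem fun x hx => hSP x (Finset.mem_of_mem_erase hx)
    | zero => exact ⟨0, by simp⟩
    | add a b _ _ ha hb =>
      obtain ⟨N, hN⟩ := ha
      obtain ⟨N', hN'⟩ := hb
      refine ⟨N + N', ?_⟩
      rw [add_smul, neg_add, add_add_add_comm]
      exact add_mem hN hN'
  refine ⟨_, h0, fun v => ?_⟩
  have hv : v ∈ AddSubgroup.closure (P : Set (Fin n → ℤ)) := hP.generates ▸ AddSubgroup.mem_top v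
  suffices ∃ N : ℕ, v + N • ∑ s ∈ S, s ∈ P ∧ -v + N • ∑ s ∈ S, s ∈ P from this.imp fun _ => And.left
  induction hv using AddSubgroup.closure_induction with
  | mem p hp => exact (h1 p hp).imp fun N hN => ⟨add_mem hp (P.nsmul_mem h0 N), hN⟩
  | zero => exact ⟨0, by simp⟩
  | neg a _ ha => exact ha.imp fun N hN => ⟨hN.2, by rw [neg_neg]; exact hN.1⟩
  | add a b _ _ ha hb =>
    obtain ⟨N, hN⟩ := ha
    obtain ⟨N', hN'⟩ := hb
    refine ⟨N + N', ?_, ?_⟩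
    · rw [add_smul, add_add_add_comm]
      exact add_mem hN.1 hN'.1
    · rw [add_smul, neg_add, add_add_add_comm]
      exact add_mem hN.2 hN'.2

lemma single_nsmul {R A : Type*} [CommSemiring R] [AddMonoid A] (a : A) (N : ℕ) :
    AddMonoidAlgebra.single (N • a) (1 : R) = AddMonoidAlgebra.single a 1 ^ N := by
  rw [AddMonoidAlgebra.single_pow, one_pow]

lemma bigTorus_eq (k : Type u) [Field k] (m₀ : P) (h : ∀ v, ∃ N : ℕ, v + N • (m₀ : Fin n → ℤ) ∈ P) :
    bigTorus k P =
      (PrimeSpectrum.basicOpen (AddMonoidAlgebra.single m₀ (1 : k)) : Set (PrimeSpectrum _)) := by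
  let φ := AddMonoidAlgebra.mapDomainRingHom k P.subtype
  let _ : Algebra (coordRing k P) (AddMonoidAlgebra k (Fin n → ℤ)) := φ.toAlgebra
  have hφ : ∀ (p : P) (a : k), algebraMap (coordRing k P) (AddMonoidAlgebra k (Fin n → ℤ))
      (AddMonoidAlgebra.single p a) = AddMonoidAlgebra.single (p : Fin n → ℤ) a := fun p a =>
    AddMonoidAlgebra.mapDomain_single
  have hloc : IsLocalization.Away (AddMonoidAlgebra.single m₀ (1 : k))
      (AddMonoidAlgebra k (Fin n → ℤ)) :=
    { map_units := by
        rintro ⟨_, N, rfl⟩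
        rw [map_pow, hφ]
        refine (IsUnit.of_mul_eq_one (AddMonoidAlgebra.single (-(m₀ : Fin n → ℤ)) 1) ?_).pow N
        rw [AddMonoidAlgebra.single_mul_single, add_neg_cancel, one_mul]
        rfl
      surj := fun z => by
        suffices ∃ (N : ℕ) (x : coordRing k P), z * algebraMap (coordRing k P) _
            (AddMonoidAlgebra.single m₀ (1 : k) ^ N) = algebraMap (coordRing k P) _ x by
          obtain ⟨N, x, hx⟩ := this
          exact ⟨(x, ⟨_, N, rfl⟩), hx⟩
        induction z using AddMonoidAlgebra.induction_linear with
        | zero => exact ⟨0, 0, by rw [zero_mul, map_zero]⟩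
        | add a b ha hb =>
          obtain ⟨N, x, hx⟩ := ha
          obtain ⟨N', x', hx'⟩ := hb
          refine ⟨N + N', x * AddMonoidAlgebra.single m₀ (1 : k) ^ N' +
            x' * AddMonoidAlgebra.single m₀ (1 : k) ^ N, ?_⟩
          rw [pow_add, map_add, map_mul, map_mul, map_mul, ← hx, ← hx']
          ring
        | single v a =>
          obtain ⟨N, hN⟩ := h v
          refine ⟨N, AddMonoidAlgebra.single ⟨_, hN⟩ a, ?_⟩
          rw [← single_nsmul, hφ, hφ, AddMonoidAlgebra.single_mul_single, mul_one]
          rfl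
      exists_of_eq := fun {x y} hxy => ⟨1, by
        rw [AddMonoidAlgebra.mapDomain_injective Subtype.coe_injective hxy]⟩ }
  exact PrimeSpectrum.localization_away_comap_range (AddMonoidAlgebra k (Fin n → ℤ))
    (AddMonoidAlgebra.single m₀ (1 : k))

end BigTorus

/-! ### Reduction to the closed orbit -/

section Reduction

open IsLocalRing

variable {n : ℕ} {P : AddSubmonoid (Fin n → ℤ)} {K T : Type*} [Field K] [CommRing T] [IsLocalRing T]
  [Algebra K T]

/-- Any point of a toric variety lies on the closed orbit of an open toric subvariety, obtained by
inverting the monomials which do not vanish at the point. -/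
theorem exists_isToricPoint (hP : IsToricMonoid P) (θ₀ : AddMonoidAlgebra K P →ₐ[K] T)
    (hθ₀ : IsAdicDense θ₀.toRingHom)
    (hres : ∀ x : T, ∃ a : K, x - algebraMap K T a ∈ maximalIdeal T) :
    ∃ (P' : AddSubmonoid (Fin n → ℤ)) (hPP' : P ≤ P') (r d : ℕ)
      (Λ : (Fin n → ℤ) →ₗ[ℤ] (Fin r ⊕ Fin d → ℤ)) (θ : AddMonoidAlgebra K P' →ₐ[K] T),
      IsToricMonoid P' ∧ IsToricPoint Λ P' θ ∧
      (∀ p : P, θ (AddMonoidAlgebra.single ⟨p, hPP' p.2⟩ 1) = θ₀ (AddMonoidAlgebra.single p 1)) ∧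
      ∀ v ∈ P', ∃ f : P, IsUnit (θ₀ (AddMonoidAlgebra.single f 1)) ∧ v + f ∈ P := by
  classical
  let χ : P → T := fun p => θ₀ (AddMonoidAlgebra.single p 1)
  have hχ0 : χ 0 = 1 := map_one θ₀
  have hχadd : ∀ p q, χ (p + q) = χ p * χ q := fun p q => by
    rw [← map_mul, AddMonoidAlgebra.single_mul_single, one_mul]
  let F : AddSubmonoid (Fin n → ℤ) :=
    { carrier := {v | ∃ h : v ∈ P, IsUnit (χ ⟨v, h⟩)}
      zero_mem' := ⟨zero_mem P, by
        rw [show (⟨0, zero_mem P⟩ : P) = 0 from rfl, hχ0]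
        exact isUnit_one⟩
      add_mem' := by
        rintro a b ⟨ha, ha'⟩ ⟨hb, hb'⟩
        exact ⟨add_mem ha hb, (hχadd ⟨a, ha⟩ ⟨b, hb⟩).symm ▸ ha'.mul hb'⟩ }
  have hFP : F ≤ P := fun v hv => hv.1
  have hF : ∀ v ∈ P, ∀ w ∈ P, v + w ∈ F → v ∈ F ∧ w ∈ F := by
    rintro v hv w hw ⟨h1, h2⟩
    have h3 : IsUnit (χ ⟨v, hv⟩ * χ ⟨w, hw⟩) := (hχadd ⟨v, hv⟩ ⟨w, hw⟩) ▸ h2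
    exact ⟨⟨hv, isUnit_of_mul_isUnit_left h3⟩, ⟨hw, isUnit_of_mul_isUnit_right h3⟩⟩
  let P' := localizeFace P F
  have hP' : IsToricMonoid P' := hP.localizeFace hFP hF
  have hPP' : P ≤ P' := le_localizeFace P F
  -- the extension of the monomials to `P'`
  have hex : ∀ v : P', ∃ x : T, ∀ (f p : P), IsUnit (χ f) → (v : Fin n → ℤ) + f = p →
      x * χ f = χ p := by
    rintro ⟨v, f₀, ⟨hf₀, hu⟩, hv⟩
    refine ⟨χ ⟨v + f₀, hv⟩ * (hu.unit⁻¹ : Tˣ), fun f p hf hfp => ?_⟩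
    rw [mul_right_comm, Units.mul_inv_eq_iff_eq_mul, IsUnit.unit_spec, ← hχadd, ← hχadd]
    congr 1
    refine Subtype.ext ?_
    simp only [AddSubmonoid.coe_add, ← hfp]
    abel
  choose χ' hχ' using hex
  have hchoose : ∀ v : P', ∃ f p : P, IsUnit (χ f) ∧ (v : Fin n → ℤ) + f = p := by
    rintro ⟨v, f₀, ⟨hf₀, hu⟩, hv⟩
    exact ⟨⟨f₀, hf₀⟩, ⟨_, hv⟩, hu, rfl⟩
  have hχ'P : ∀ p : P, χ' ⟨p, hPP' p.2⟩ = χ p := fun p => by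
    have := hχ' ⟨p, hPP' p.2⟩ 0 p (hχ0 ▸ isUnit_one) (add_zero _)
    rwa [hχ0, mul_one] at this
  have hχ'add : ∀ v w, χ' (v + w) = χ' v * χ' w := fun v w => by
    obtain ⟨f, p, hf, hfp⟩ := hchoose v
    obtain ⟨g, q, hg, hgq⟩ := hchoose w
    have h1 := hχ' (v + w) (f + g) (p + q) (hχadd f g ▸ hf.mul hg) (by
      simp only [AddSubmonoid.coe_add, ← hfp, ← hgq]; abel)
    rw [hχadd, hχadd, ← hχ' v f p hf hfp, ← hχ' w g q hg hgq, mul_mul_mul_comm] at h1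
    exact (hf.mul hg).mul_left_injective h1
  let θ : AddMonoidAlgebra K P' →ₐ[K] T := AddMonoidAlgebra.lift K T P'
    { toFun := fun v => χ' v.toAdd
      map_one' := (hχ'P 0).trans hχ0
      map_mul' := fun v w => hχ'add _ _ }
  have hθ : ∀ v, θ (AddMonoidAlgebra.single v 1) = χ' v := fun v => by
    change AddMonoidAlgebra.lift K T P' _ _ = _
    rw [AddMonoidAlgebra.lift_single, one_smul]
    rfl
  let j : AddMonoidAlgebra K P →ₐ[K] AddMonoidAlgebra K P' :=
    AddMonoidAlgebra.mapDomainAlgHom K K (AddSubmonoid.inclusion hPP')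
  have hj : ∀ p a, j (AddMonoidAlgebra.single p a) = AddMonoidAlgebra.single ⟨p, hPP' p.2⟩ a :=
    fun p a => AddMonoidAlgebra.mapDomain_single
  have hsmul : ∀ {A : Type} [AddMonoid A] (v : A) (a : K), AddMonoidAlgebra.single v a =
      a • AddMonoidAlgebra.single v (1 : K) := fun v a => by
    rw [AddMonoidAlgebra.smul_single, smul_eq_mul, mul_one]
  have hθj : ∀ x, θ (j x) = θ₀ x := by
    intro x
    induction x using AddMonoidAlgebra.induction_linear with
    | zero => rw [map_zero, map_zero, map_zero]
    | add a b ha hb => rw [map_add, map_add, map_add, ha, hb]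
    | single p a => rw [hsmul, map_smul, map_smul, map_smul, hj, hθ, hχ'P]
  -- clearing denominators
  have hclear : ∀ x : AddMonoidAlgebra K P', ∃ (f : P) (y : AddMonoidAlgebra K P), IsUnit (χ f) ∧
      x * j (AddMonoidAlgebra.single f 1) = j y := by
    intro x
    induction x using AddMonoidAlgebra.induction_linear with
    | zero => exact ⟨0, 0, hχ0 ▸ isUnit_one, by rw [zero_mul, map_zero]⟩
    | add a b ha hb =>
      obtain ⟨f, y, hf, hy⟩ := ha
      obtain ⟨g, z, hg, hz⟩ := hb
      refine ⟨f + g, y * AddMonoidAlgebra.single g 1 + z * AddMonoidAlgebra.single f 1,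
        hχadd f g ▸ hf.mul hg, ?_⟩
      rw [← one_mul (1 : K), ← AddMonoidAlgebra.single_mul_single, one_mul, map_add, map_mul,
        map_mul, map_mul, ← hy, ← hz]
      ring
    | single v a =>
      obtain ⟨f, p, hf, hfp⟩ := hchoose v
      refine ⟨f, AddMonoidAlgebra.single p a, hf, ?_⟩
      rw [hj, hj, AddMonoidAlgebra.single_mul_single, mul_one]
      congr 1
      exact Subtype.ext hfp
  obtain ⟨r, d, Λ, h1, h2, h3, h4, h5⟩ := hP'.exists_coordinates
  refine ⟨P', hPP', r, d, Λ, θ, hP', ⟨h1, h2, fun i => ?_, h4, h5, hP'.fg, ⟨fun x N => ?_,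
    fun x N hx => ?_⟩, fun m hm => ?_, hres⟩, fun p => (hθ _).trans (hχ'P p), ?_⟩
  · obtain ⟨v, hv⟩ := h3 i
    refine ⟨v, fun s => ?_⟩
    rw [hv, Pi.single_apply]
    congr
  · obtain ⟨y, hy⟩ := hθ₀.approx x N
    exact ⟨j y, by rw [AlgHom.toRingHom_eq_coe, RingHom.coe_coe, hθj]; exact hy⟩
  · obtain ⟨f, y, hf, hy⟩ := hclear x
    have hy' : θ₀ y ∈ maximalIdeal T ^ N := by
      rw [← hθj, ← hy, map_mul]
      exact Ideal.mul_mem_right _ _ hx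
    have h6 : ((maximalIdeal T).comap θ₀.toRingHom).map j.toRingHom
        ≤ (maximalIdeal T).comap θ.toRingHom := by
      rw [Ideal.map_le_iff_le_comap]
      intro z hz
      change θ (j z) ∈ maximalIdeal T
      rw [hθj]
      exact hz
    have h7 : j y ∈ (maximalIdeal T).comap θ.toRingHom ^ N := by
      refine Ideal.pow_right_mono h6 N ?_
      rw [← Ideal.map_pow]
      exact Ideal.mem_map_of_mem j.toRingHom (hθ₀.mem_pow y N hy')
    have h8 : x = j y * AddMonoidAlgebra.single
        ⟨-(f : Fin n → ℤ), neg_mem_localizeFace P (F := F) ⟨f.2, hf⟩⟩ 1 := by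
      rw [← hy, mul_assoc, hj, AddMonoidAlgebra.single_mul_single, one_mul]
      conv_lhs => rw [← mul_one x, AddMonoidAlgebra.one_def]
      congr 2
      exact Subtype.ext (add_neg_cancel _).symm
    rw [h8]
    exact Ideal.mul_mem_right _ _ h7
  · rw [hθ, IsLocalRing.mem_maximalIdeal, mem_nonunits_iff]
    intro hu
    obtain ⟨f, p, hf, hfp⟩ := hchoose m
    have hp : IsUnit (χ p) := hχ' m f p hf hfp ▸ hu.mul hf
    have hneg : -(m : Fin n → ℤ) ∈ P' := by
      refine ⟨p, ⟨p.2, hp⟩, ?_⟩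
      rw [← hfp, neg_add_cancel_left]
      exact f.2
    obtain ⟨i, hi⟩ := hm
    have h6 := (h2 _).mp hneg i
    rw [map_neg, Pi.neg_apply] at h6
    exact hi (le_antisymm (by linarith) ((h2 _).mp m.2 i))
  · intro v hv
    obtain ⟨f, p, hf, hfp⟩ := hchoose ⟨v, hv⟩
    exact ⟨f, hf, hfp ▸ p.2⟩

/-- The ideal of the complement of the big torus becomes the boundary ideal of the chart. -/
theorem FormalChart.map_boundary_eq {r d : ℕ} {P' : AddSubmonoid (Fin n → ℤ)}
    {Λ : (Fin n → ℤ) →ₗ[ℤ] (Fin r ⊕ Fin d → ℤ)} {θ : AddMonoidAlgebra K P' →ₐ[K] T}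
    (hT : IsToricPoint Λ P' θ) (hPP' : P ≤ P') (c : FormalChart K T (Fin r) (Fin d))
    (hc : ⨅ i, c.prime i = Ideal.span ((fun m : P' => θ (AddMonoidAlgebra.single m 1)) ''
        {m | ∀ i, 0 < Λ m (Sum.inl i)}))
    {S : Type*} [CommRing S] [Algebra S T] [IsLocalHom (algebraMap S T)]
    (χ : Multiplicative P →* S)
    (hχ : ∀ p : P, θ (AddMonoidAlgebra.single ⟨p, hPP' p.2⟩ 1) = algebraMap S T (χ (.ofAdd p)))
    (hP' : ∀ v ∈ P', ∃ f : P, IsUnit (algebraMap S T (χ (.ofAdd f))) ∧ v + f ∈ P)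
    {m₀ : P} (hm₀ : ∀ v, ∃ N : ℕ, v + N • (m₀ : Fin n → ℤ) ∈ P) {I : Ideal S}
    (hI : ∀ x, x ∈ I ↔ ∃ N : ℕ, x ^ N ∈ Ideal.span {χ (.ofAdd m₀)}) :
    I.map (algebraMap S T) = ⨅ i, c.prime i := by
  have hpos : ∀ i, 0 < Λ m₀ (Sum.inl i) := by
    intro i
    refine lt_of_le_of_ne ((hT.mem_iff _).mp (hPP' m₀.2) i) fun h0 => ?_
    obtain ⟨v, hv, -⟩ := hT.prim i
    obtain ⟨N, hN⟩ := hm₀ (-v)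
    have h1 := (hT.mem_iff _).mp (hPP' hN) i
    rw [map_add, map_neg, map_nsmul, Pi.add_apply, Pi.neg_apply, Pi.smul_apply, hv, ← h0,
      smul_zero] at h1
    norm_num at h1
  refine le_antisymm ?_ ?_
  · rw [Ideal.map_le_iff_le_comap]
    intro x hx
    obtain ⟨N, hN⟩ := (hI x).mp hx
    rw [Ideal.mem_comap, Ideal.mem_iInf]
    intro i
    refine (inferInstance : (c.prime i).IsPrime).mem_of_pow_mem N ?_
    rw [← map_pow]
    obtain ⟨a, ha⟩ := Ideal.mem_span_singleton'.mp hN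
    rw [← ha, map_mul, ← hχ]
    refine Ideal.mul_mem_left _ _ ((iInf_le (fun i => c.prime i) i) ?_)
    rw [hc]
    exact Ideal.subset_span ⟨⟨m₀, hPP' m₀.2⟩, hpos, rfl⟩
  · rw [hc, Ideal.span_le]
    rintro _ ⟨m, hm, rfl⟩
    have hθadd : ∀ a b : P', θ (AddMonoidAlgebra.single (a + b) 1)
        = θ (AddMonoidAlgebra.single a 1) * θ (AddMonoidAlgebra.single b 1) := fun a b => by
      rw [← map_mul, AddMonoidAlgebra.single_mul_single, one_mul]
    obtain ⟨f, hf, hp⟩ := hP' m m.2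
    -- a multiple of `m + f` exceeds `m₀`
    obtain ⟨N, hN⟩ : ∃ N : ℕ, N • ((m : Fin n → ℤ) + f) - m₀ ∈ P' := by
      refine ⟨∑ i, (Λ m₀ (Sum.inl i)).toNat, (hT.mem_iff _).mpr fun i => ?_⟩
      have h1 : 1 ≤ Λ m (Sum.inl i) + Λ f (Sum.inl i) := by
        have := (hT.mem_iff _).mp (hPP' f.2) i
        have := hm i
        omega
      have h2 : Λ m₀ (Sum.inl i) ≤ ((∑ i, (Λ m₀ (Sum.inl i)).toNat : ℕ) : ℤ) := by
        rw [← Int.toNat_of_nonneg (hpos i).le]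
        exact_mod_cast Finset.single_le_sum (f := fun i => (Λ m₀ (Sum.inl i)).toNat)
          (fun _ _ => Nat.zero_le _) (Finset.mem_univ i)
      rw [map_sub, map_nsmul, map_add, Pi.sub_apply, Pi.smul_apply, Pi.add_apply, nsmul_eq_mul]
      nlinarith
    obtain ⟨g, hg, hq⟩ := hP' _ hN
    have hgu : IsUnit (χ (.ofAdd g)) := isUnit_of_map_unit (algebraMap S T) _ hg
    have h3 : χ (.ofAdd ⟨(m : Fin n → ℤ) + f, hp⟩) ∈ I := by
      rw [hI]
      refine ⟨N, (Ideal.unit_mul_mem_iff_mem _ hgu).mp ?_⟩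
      have h4 : χ (.ofAdd g) * χ (.ofAdd ⟨(m : Fin n → ℤ) + f, hp⟩) ^ N
          = χ (.ofAdd ⟨_, hq⟩) * χ (.ofAdd m₀) := by
        rw [← map_pow, ← map_mul, ← map_mul]
        congr 1
        refine congrArg Multiplicative.ofAdd (Subtype.ext ?_)
        change (g : Fin n → ℤ) + N • ((m : Fin n → ℤ) + f) = N • ((m : Fin n → ℤ) + f) - m₀ + g + m₀
        abel
      rw [h4]
      exact Ideal.mul_mem_left _ _ (Ideal.mem_span_singleton_self _)
    have h5 : θ (AddMonoidAlgebra.single m 1) * algebraMap S T (χ (.ofAdd f))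
        = algebraMap S T (χ (.ofAdd ⟨(m : Fin n → ℤ) + f, hp⟩)) := by
      rw [← hχ, ← hχ, ← hθadd]
      rfl
    rw [SetLike.mem_coe, ← Ideal.mul_unit_mem_iff_mem _ hf, h5]
    exact Ideal.mem_map_of_mem _ h3

end Reduction

/-! ### The toric homomorphism to the local ring -/

section Descent

open IsLocalRing TensorProduct

/-- A chart on the completion of a local ring `A'` of the base change of a local ring `A` descends:
there is a homomorphism to `A` from the monoid algebra of a toric monoid which is flat, formally
unramified, and cuts out the boundary. -/
theorem exists_toric_hom {k K A A' : Type u} {T : Type*} [Field k] [Field K] [Algebra k K]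
    [PerfectField K] [Algebra.IsAlgebraic k K] [CommRing A] [IsDomain A] [IsLocalRing A]
    [Algebra k A] [Algebra.EssFiniteType k A] [IsNoetherianRing A]
    [CommRing A'] [IsNoetherianRing A'] [IsLocalRing A'] [Algebra K A'] [Algebra.EssFiniteType K A']
    [Algebra (A ⊗[k] K) A'] (N : Submonoid (A ⊗[k] K)) [IsLocalization N A']
    (hK : ∀ x : K, algebraMap (A ⊗[k] K) A' (1 ⊗ₜ x) = algebraMap K A' x)
    [CommRing T] [IsLocalRing T] [IsAdicComplete (maximalIdeal T) T]
    [Algebra K T] [Algebra A' T] [IsScalarTower K A' T] [Algebra A A'] [Algebra A T]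
    [IsScalarTower A (A ⊗[k] K) A'] [IsScalarTower A A' T]
    [IsLocalHom (algebraMap A A')] [IsLocalHom (algebraMap A' T)] [Module.Flat A' T]
    (hd : IsAdicDense (algebraMap A' T)) {I : Ideal A} (hI : I.IsRadical)
    (hnormal : ∀ 𝔭 ∈ I.minimalPrimes, IsIntegrallyClosed (A ⧸ 𝔭))
    {n : ℕ} {P : AddSubmonoid (Fin n → ℤ)} (hP : IsToricMonoid P)
    (θ₀ : AddMonoidAlgebra K P →ₐ[K] T)
    (hθ₀ : IsAdicDense θ₀.toRingHom) (hres : ∀ x : T, ∃ a : K, x - algebraMap K T a ∈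
    maximalIdeal T)
    {S : Type*} [CommRing S] [Algebra S T] [IsLocalHom (algebraMap S T)] (χ : Multiplicative P →* S)
    (hχ : ∀ p : P, θ₀ (AddMonoidAlgebra.single p 1) = algebraMap S T (χ (.ofAdd p)))
    {m₀ : P} (hm₀ : ∀ v, ∃ N : ℕ, v + N • (m₀ : Fin n → ℤ) ∈ P) {J : Ideal S}
    (hJ : ∀ x, x ∈ J ↔ ∃ N : ℕ, x ^ N ∈ Ideal.span {χ (.ofAdd m₀)})
    (hIJ : I.map (algebraMap A T) = J.map (algebraMap S T)) :
    ∃ (P' : AddSubmonoid (Fin n → ℤ)) (_ : IsToricMonoid P') (ψ : Multiplicative P' →* A),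
      (AddMonoidAlgebra.lift k A P' ψ).toRingHom.Flat ∧
      (AddMonoidAlgebra.lift k A P' ψ).toRingHom.FormallyUnramified ∧
      ∀ m : P', (∀ v, ∃ N : ℕ, v + N • (m : Fin n → ℤ) ∈ P') →
        ψ (.ofAdd m) ∈ I ∧ ∀ x ∈ I, ∃ N : ℕ, x ^ N ∈ Ideal.span {ψ (.ofAdd m)} := by
  obtain ⟨P', hPP', r, d, Λ, θ, hP', hT, hθ, hclear⟩ := exists_isToricPoint hP θ₀ hθ₀ hres
  obtain ⟨c, ε, hL, hc0, hc1, hcspan⟩ := hT.exists_formalChart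
  have := c.isNoetherianRing
  have hIc : I.map (algebraMap A T) = ⨅ i, c.prime i := by
    rw [hIJ]
    refine c.map_boundary_eq hT hPP' hcspan χ (fun p => (hθ p).trans (hχ p)) (fun v hv => ?_) hm₀ hJ
    obtain ⟨f, hf, hvf⟩ := hclear v hv
    exact ⟨f, hχ f ▸ hf, hvf⟩
  have hAT : ∀ x, algebraMap A T x
      = algebraMap A' T (algebraMap (A ⊗[k] K) A' (algebraMap A (A ⊗[k] K) x)) := fun x => by
    rw [← IsScalarTower.algebraMap_apply A (A ⊗[k] K) A', ← IsScalarTower.algebraMap_apply A A' T]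
  have hkK : ∀ x : k, algebraMap K T (algebraMap k K x) = algebraMap A T (algebraMap k A x) := by
    intro x
    rw [hAT, IsScalarTower.algebraMap_apply K A' T, ← hK]
    congr 2
    rw [Algebra.TensorProduct.algebraMap_apply, Algebra.algebraMap_self_apply,
      Algebra.algebraMap_eq_smul_one x, Algebra.algebraMap_eq_smul_one x, TensorProduct.smul_tmul]
  have hlocT : IsLocalHom (algebraMap A T) := by
    rw [IsScalarTower.algebraMap_eq A A' T]
    infer_instance
  have hff : Module.FaithfullyFlat A' T := Module.FaithfullyFlat.of_flat_of_isLocalHom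
  have hflatAT : Module.Flat A T := by
    have := IsLocalization.flat A' N
    have : Module.Flat A A' := Module.Flat.trans A (A ⊗[k] K) A'
    exact Module.Flat.trans A A' T
  have hffA : Module.FaithfullyFlat A T := Module.FaithfullyFlat.of_flat_of_isLocalHom
  have h𝔭 : ∀ i, ∃ 𝔭 : Ideal A, 𝔭.map (algebraMap A T) = c.prime i := by
    refine c.exists_map_eq_prime hI hIc fun 𝔭 h𝔭 E hE => ?_
    have := hnormal 𝔭 h𝔭
    have : 𝔭.IsPrime := h𝔭.1.1
    refine c.subsingleton_of_isIntegrallyClosed N hd 𝔭 ?_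
    rw [← hE]
    congr 1
    exact RingHom.ext fun x => (hAT x).symm
  obtain ⟨ψ, hψ, hψd⟩ := c.exists_isAdicDense h𝔭 (c.exists_mem_span_sub_mem N hK hd)
    Λ.toAddMonoidHom hL P' hT.mem_iff θ hT.dense ε hc0 hc1
  have hfg : AddMonoid.FG P' := (AddMonoid.fg_iff_addSubmonoid_fg P').mpr hT.fg
  refine ⟨P', hP', ψ, flat_of_isAdicDense hkK ψ hψd, c.formallyUnramified ψ hψd N hkK hK,
    fun m hm => ?_⟩
  obtain ⟨w, y, u, hy, hw, hu⟩ := hψ m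
  refine c.boundary_eq_of_pos hIc hy (fun i hi => ?_) hu
  -- an absorbing element is in the interior
  have h0 : Λ m (Sum.inl i) = 0 := by
    rw [← LinearMap.toAddMonoidHom_coe, ← hw, hi, Nat.cast_zero]
  obtain ⟨v, hv, -⟩ := hT.prim i
  obtain ⟨N, hN⟩ := hm (-v)
  have h1 := (hT.mem_iff _).mp hN i
  rw [map_add, map_neg, map_nsmul, Pi.add_apply, Pi.neg_apply, Pi.smul_apply, hv, h0,
    smul_zero] at h1
  norm_num at h1

end Descent

/-! ### Étale neighbourhoods -/

section EtaleNeighbourhood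

open IsLocalRing TensorProduct

attribute [local instance] Algebra.FormallyEtale.of_formallyUnramified_of_field in
/-- A flat and formally unramified localization of an algebra of finite presentation is formally
étale, by the fibrewise criterion over the local ring of the base. -/
lemma formallyEtale_of_flat {R B A : Type u} [CommRing R] [CommRing B] [CommRing A] [IsLocalRing A]
    [Algebra R B] [Algebra.FinitePresentation R B] [Algebra B A] [Algebra R A] [IsScalarTower R B A]
    (M : Submonoid B) [IsLocalization M A] [Module.Flat R A] [Algebra.FormallyUnramified R A] :
    Algebra.FormallyEtale R A := by
  let p : Ideal R := (maximalIdeal A).comap (algebraMap R A)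
  let Rp := Localization.AtPrime p
  let Sp := Localization (Algebra.algebraMapSubmonoid B p.primeCompl)
  have hp : ∀ x ∈ p.primeCompl, IsUnit (algebraMap R A x) := fun x hx => by
    by_contra h
    exact hx h
  let g : Rp →+* A := IsLocalization.lift (M := p.primeCompl) (g := algebraMap R A)
    fun y => hp y y.2
  algebraize [g]
  have : IsScalarTower R Rp A := .of_algebraMap_eq fun x => (IsLocalization.lift_eq _ _).symm
  let f : Sp →ₐ[B] A := IsLocalization.liftAlgHom (M := Algebra.algebraMapSubmonoid B p.primeCompl)
    (f := Algebra.ofId _ _) (by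
      rintro ⟨_, x, hx, rfl⟩
      have := hp x hx
      rw [IsScalarTower.algebraMap_apply R B A] at this
      exact this)
  algebraize [f.toRingHom]
  have : IsScalarTower R Sp A := .to₁₃₄ _ B _ _
  have : IsScalarTower Rp Sp A := .of_algebraMap_eq' <| by
    apply IsLocalization.ringHom_ext p.primeCompl
    simp only [RingHom.comp_assoc, ← IsScalarTower.algebraMap_eq]
  have hunits : ∀ x ∈ M ⊔ Algebra.algebraMapSubmonoid B p.primeCompl,
    IsUnit (algebraMap B A x) := by
    intro x hx
    obtain ⟨m, hm, _, ⟨y, hy, rfl⟩, rfl⟩ := Submonoid.mem_sup.mp hx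
    rw [map_mul, ← IsScalarTower.algebraMap_apply R B A]
    exact (IsLocalization.map_units A ⟨m, hm⟩).mul (hp y hy)
  have : IsLocalization (M ⊔ Algebra.algebraMapSubmonoid B p.primeCompl) A :=
    IsLocalization.of_le M _ le_sup_left hunits
  have : IsLocalization (Algebra.algebraMapSubmonoid Sp
      (M ⊔ Algebra.algebraMapSubmonoid B p.primeCompl)) A :=
    .isLocalization_of_submonoid_le _ _ (Algebra.algebraMapSubmonoid B p.primeCompl) _ le_sup_right
  have : Algebra.FinitePresentation Rp Sp := by
    have : Algebra.IsPushout R Rp B Sp :=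
      .symm <| Algebra.isPushout_of_isLocalization p.primeCompl _ _ _
    exact .equiv (Algebra.IsPushout.equiv R Rp B Sp)
  have : Module.Flat Rp A := (Module.flat_iff_of_isLocalization Rp p.primeCompl A).mpr inferInstance
  have : Algebra.FormallyUnramified Rp A := .of_restrictScalars R Rp A
  have : Algebra.EssFiniteType Sp A := .of_isLocalization A
    (Algebra.algebraMapSubmonoid Sp (M ⊔ Algebra.algebraMapSubmonoid B p.primeCompl))
  have : Algebra.EssFiniteType Rp A := .comp Rp Sp A
  have : IsLocalHom (algebraMap Rp A) := ⟨fun x hx => by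
    obtain ⟨r, t, rfl⟩ := IsLocalization.exists_mk'_eq p.primeCompl x
    rw [IsLocalization.AtPrime.isUnit_mk'_iff Rp p]
    have h1 : IsUnit (algebraMap R A r) := by
      rw [IsScalarTower.algebraMap_apply R Rp A, ← IsLocalization.mk'_spec Rp r t, map_mul,
        ← IsScalarTower.algebraMap_apply R Rp A]
      exact hx.mul (hp t t.2)
    exact fun hr => hr h1⟩
  have : Algebra.FormallySmooth (ResidueField Rp) (ResidueField Rp ⊗[Rp] A) := inferInstance
  have := Algebra.FormallySmooth.of_formallySmooth_residueField_tensor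
    (R := Rp) (S := A) (P := Sp) (Algebra.algebraMapSubmonoid Sp
      (M ⊔ Algebra.algebraMapSubmonoid B p.primeCompl))
  have : Algebra.FormallySmooth R A := .comp R Rp A
  exact Algebra.FormallyEtale.iff_formallyUnramified_and_formallySmooth.mpr ⟨inferInstance, this⟩

/-- A homomorphism from an algebra of finite type to a local ring of an integral domain is defined
on a neighbourhood. -/
lemma exists_lift_away {k R₀ B A : Type u} [Field k] [CommRing R₀] [Algebra k R₀]
    [Algebra.FiniteType k R₀] [CommRing B] [IsDomain B] [Algebra k B] (q : Ideal B) [q.IsPrime]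
    [CommRing A] [Algebra B A] [IsLocalization.AtPrime A q] [Algebra k A] [IsScalarTower k B A]
    (θ : R₀ →ₐ[k] A) : ∃ f ∉ q, ∃ (_ : Algebra (Localization.Away f) A)
      (_ : IsScalarTower B (Localization.Away f) A) (φ : R₀ →ₐ[k] Localization.Away f),
      ∀ x, algebraMap (Localization.Away f) A (φ x) = θ x := by
  classical
  obtain ⟨s, hs⟩ := ‹Algebra.FiniteType k R₀›
  obtain ⟨⟨f, hf⟩, hint⟩ := IsLocalization.exist_integer_multiples_of_finset q.primeCompl
    (s.image θ)
  have hfu : IsUnit (algebraMap B A f) := IsLocalization.map_units A (⟨f, hf⟩ : q.primeCompl)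
  let lift : Localization.Away f →+* A := IsLocalization.Away.lift f hfu
  let _ : Algebra (Localization.Away f) A := lift.toAlgebra
  have htow : IsScalarTower B (Localization.Away f) A :=
    .of_algebraMap_eq fun x => (IsLocalization.Away.lift_eq f hfu x).symm
  have htowk : IsScalarTower k (Localization.Away f) A := .of_algebraMap_eq fun x => by
    rw [IsScalarTower.algebraMap_apply k B (Localization.Away f),
      ← IsScalarTower.algebraMap_apply B (Localization.Away f) A,
      ← IsScalarTower.algebraMap_apply k B A]
  let ι : Localization.Away f →ₐ[k] A := IsScalarTower.toAlgHom k (Localization.Away f) A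
  have hinj : Function.Injective ι := by
    have hinjB : Function.Injective (algebraMap B A) :=
      IsLocalization.injective A q.primeCompl_le_nonZeroDivisors
    have hinjf : Function.Injective (algebraMap B (Localization.Away f)) :=
      IsLocalization.injective _ (M := Submonoid.powers f)
        (powers_le_nonZeroDivisors_of_noZeroDivisors fun h0 => by
          rw [h0] at hf
          exact hf (zero_mem q))
    exact (IsLocalization.lift_injective_iff (M := Submonoid.powers f) _).mpr fun x y => by
      rw [hinjB.eq_iff, hinjf.eq_iff]
  have hrange : θ.range ≤ ι.range := by
    rw [← Algebra.map_top, ← hs, AlgHom.map_adjoin, Algebra.adjoin_le_iff]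
    rintro _ ⟨x, hx, rfl⟩
    obtain ⟨b, hb⟩ := hint (θ x) (Finset.mem_image_of_mem θ hx)
    refine ⟨IsLocalization.mk' (Localization.Away f) b (⟨f, 1, pow_one f⟩ :
      Submonoid.powers f), ?_⟩
    refine hfu.mul_left_injective ?_
    change lift _ * _ = θ x * _
    have hl : ∀ x, lift (algebraMap B _ x) = algebraMap B A x := IsLocalization.Away.lift_eq f hfu
    have h1 := congrArg lift (IsLocalization.mk'_spec (Localization.Away f) b
      (⟨f, 1, pow_one f⟩ : Submonoid.powers f))
    rw [map_mul, hl, hl, hb] at h1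
    exact h1.trans ((Algebra.smul_def _ _).trans (mul_comm _ _))
  let e := AlgEquiv.ofInjective ι hinj
  refine ⟨f, hf, inferInstance, htow, (e.symm : ι.range →ₐ[k] _).comp
    ((Subalgebra.inclusion hrange).comp θ.rangeRestrict), fun x => ?_⟩
  exact congrArg Subtype.val (e.apply_symm_apply _)

/-- A homomorphism to a local ring of a variety which is flat, formally unramified and cuts out the
radical of an ideal extends to an étale homomorphism on an open neighbourhood, which still cuts out
the radical of the ideal. -/
theorem exists_etale_neighbourhood {k R₀ B A : Type u} [Field k] [CommRing R₀] [Algebra k R₀]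
    [Algebra.FiniteType k R₀] [CommRing B] [IsDomain B] [Algebra k B] [Algebra.FiniteType k B]
    (q : Ideal B) [q.IsPrime] [CommRing A] [IsLocalRing A] [Algebra B A]
    [IsLocalization.AtPrime A q] [Algebra k A] [IsScalarTower k B A]
    (θ : R₀ →ₐ[k] A) (hflat : θ.toRingHom.Flat) (hunr : θ.toRingHom.FormallyUnramified) (g : R₀)
    (I : Ideal B) (hI : θ g ∈ I.map (algebraMap B A))
    (hI' : ∀ x ∈ I, ∃ N : ℕ, algebraMap B A x ^ N ∈ Ideal.span {θ g}) :
    ∃ (B' : Type u) (_ : CommRing B') (ι : B →+* B') (φ : R₀ →+* B') (q' : PrimeSpectrum B'),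
      IsOpenImmersion (Spec.map (CommRingCat.ofHom ι)) ∧ q'.asIdeal.comap ι = q ∧ φ.Etale ∧
      φ.comp (algebraMap k R₀) = ι.comp (algebraMap k B) ∧
      ∀ 𝔭 : PrimeSpectrum B', φ g ∈ 𝔭.asIdeal ↔ I ≤ 𝔭.asIdeal.comap ι := by
  classical
  have hnoeth : IsNoetherianRing B := Algebra.FiniteType.isNoetherianRing k B
  have hnoeth' : IsNoetherianRing R₀ := Algebra.FiniteType.isNoetherianRing k R₀
  obtain ⟨f, hf, alg, tow, φ, hφ⟩ := exists_lift_away q θ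
  let B₁ := Localization.Away f
  let _ : Algebra R₀ B₁ := φ.toAlgebra
  let _ : Algebra R₀ A := θ.toAlgebra
  have : IsScalarTower R₀ B₁ A := .of_algebraMap_eq fun x => (hφ x).symm
  have : IsScalarTower k R₀ B₁ := .of_algebraMap_eq fun x => (φ.commutes x).symm
  have : Module.Flat R₀ A := hflat
  have : Algebra.FormallyUnramified R₀ A := hunr
  have : Algebra.FiniteType k B₁ := .trans (S := B) ‹_› inferInstance
  have : Algebra.FiniteType R₀ B₁ := .of_restrictScalars_finiteType k R₀ B₁
  have : Algebra.FinitePresentation R₀ B₁ := Algebra.FinitePresentation.of_finiteType.mp ‹_›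
  let q₁ : Ideal B₁ := (maximalIdeal A).comap (algebraMap B₁ A)
  have hq₁ : q₁.comap (algebraMap B B₁) = q := by
    rw [Ideal.comap_comap, ← IsScalarTower.algebraMap_eq]
    exact IsLocalization.AtPrime.under_maximalIdeal A q
  have hloc : IsLocalization (Algebra.algebraMapSubmonoid B₁ q.primeCompl) A :=
    .isLocalization_of_submonoid_le B₁ A (Submonoid.powers f) _
      (Submonoid.powers_le.mpr hf)
  have hloc₁ : IsLocalization.AtPrime A q₁ := by
    refine IsLocalization.of_le (Algebra.algebraMapSubmonoid B₁ q.primeCompl) _ ?_ fun x hx => ?_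
    · rintro _ ⟨x, hx, rfl⟩ hx'
      exact hx (hq₁ ▸ hx')
    · by_contra h
      exact hx h
  have hA := formallyEtale_of_flat (R := R₀) (A := A) (Algebra.algebraMapSubmonoid B₁ q.primeCompl)
  have : Algebra.IsEtaleAt R₀ q₁ := by
    let e := (IsLocalization.algEquiv q₁.primeCompl (Localization.AtPrime q₁) A).restrictScalars R₀
    exact .of_equiv e.symm
  obtain ⟨f₂, hf₂, het⟩ := Algebra.exists_etale_of_isEtaleAt (R := R₀) q₁
  -- clear the denominators of the relations between `g` and the ideal
  obtain ⟨s₁, hs₁, hs₁'⟩ : ∃ s ∈ q₁.primeCompl, s * φ g ∈ I.map (algebraMap B B₁) := by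
    rw [← IsLocalization.algebraMap_mem_map_algebraMap_iff q₁.primeCompl A, hφ, Ideal.map_map,
      ← IsScalarTower.algebraMap_eq]
    exact hI
  obtain ⟨s₂, hs₂, hs₂'⟩ : ∃ s ∈ q₁.primeCompl, ∀ 𝔭 : Ideal B₁, 𝔭.IsPrime → s ∉ 𝔭 → φ g ∈ 𝔭 →
      I ≤ 𝔭.comap (algebraMap B B₁) := by
    obtain ⟨G, hG⟩ := IsNoetherian.noetherian I
    have h1 : ∀ x ∈ I, ∃ s ∈ q₁.primeCompl, ∃ N : ℕ, s * algebraMap B B₁ x ^ N ∈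
      Ideal.span {φ g} := by
      intro x hx
      obtain ⟨N, hN⟩ := hI' x hx
      have h2 := (IsLocalization.algebraMap_mem_map_algebraMap_iff q₁.primeCompl A
        (Ideal.span {φ g}) (algebraMap B B₁ x ^ N)).mp (by
          rw [Ideal.map_span, Set.image_singleton, hφ, map_pow,
            ← IsScalarTower.algebraMap_apply B B₁ A]
          exact hN)
      obtain ⟨s, hs, h3⟩ := h2
      exact ⟨s, hs, N, h3⟩
    have hGI : ∀ x ∈ G, x ∈ I := fun x hx => hG ▸ Ideal.subset_span hx
    choose! s hs N hN using h1
    refine ⟨∏ x ∈ G, s x, prod_mem fun x hx => hs x (hGI x hx), fun 𝔭 h𝔭 hs𝔭 hg𝔭 => ?_⟩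
    rw [← hG, Submodule.span_le]
    intro x hx
    have h4 : s x * algebraMap B B₁ x ^ N x ∈ 𝔭 :=
      (Ideal.span_singleton_le_iff_mem 𝔭).mpr hg𝔭 (hN x (hGI x hx))
    refine h𝔭.mem_of_pow_mem _ ((h𝔭.mem_or_mem h4).resolve_left fun h5 => hs𝔭 ?_)
    exact Ideal.mem_of_dvd _ (Finset.dvd_prod_of_mem s hx) h5
  let B₂ := Localization.Away f₂
  let s₃ := algebraMap B₁ B₂ (s₁ * s₂)
  let B₃ := Localization.Away s₃
  have hs₁₂ : s₁ * s₂ ∉ q₁ := q₁.primeCompl.mul_mem hs₁ hs₂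
  obtain ⟨q₂, hq₂⟩ : (⟨q₁, inferInstance⟩ : PrimeSpectrum B₁) ∈
      Set.range (PrimeSpectrum.comap (algebraMap B₁ B₂)) := by
    rw [PrimeSpectrum.localization_away_comap_range B₂ f₂]
    exact hf₂
  have hq₂' : q₂.asIdeal.comap (algebraMap B₁ B₂) = q₁ := congrArg PrimeSpectrum.asIdeal hq₂
  obtain ⟨q₃, hq₃⟩ : q₂ ∈ Set.range (PrimeSpectrum.comap (algebraMap B₂ B₃)) := by
    rw [PrimeSpectrum.localization_away_comap_range B₃ s₃]
    exact fun h => hs₁₂ (hq₂' ▸ h)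
  refine ⟨B₃, inferInstance, ((algebraMap B₂ B₃).comp (algebraMap B₁ B₂)).comp (algebraMap B B₁),
    (algebraMap B₂ B₃).comp (algebraMap R₀ B₂), q₃, ?_, ?_, ?_, ?_, fun 𝔭 => ?_⟩
  · have h1 : IsOpenImmersion (Spec.map (CommRingCat.ofHom (algebraMap B B₁))) := inferInstance
    have h2 : IsOpenImmersion (Spec.map (CommRingCat.ofHom (algebraMap B₁ B₂))) := inferInstance
    have h3 : IsOpenImmersion (Spec.map (CommRingCat.ofHom (algebraMap B₂ B₃))) := inferInstance
    have h4 : Spec.map (CommRingCat.ofHom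
        (((algebraMap B₂ B₃).comp (algebraMap B₁ B₂)).comp (algebraMap B B₁)))
        = Spec.map (CommRingCat.ofHom (algebraMap B₂ B₃)) ≫
          Spec.map (CommRingCat.ofHom (algebraMap B₁ B₂)) ≫
          Spec.map (CommRingCat.ofHom (algebraMap B B₁)) := by
      rw [← Spec.map_comp, ← Spec.map_comp]
      rfl
    rw [h4]
    infer_instance
  · rw [← Ideal.comap_comap, ← Ideal.comap_comap, ← hq₁, ← hq₂', ← hq₃]
    rfl
  · have h1 : (algebraMap R₀ B₂).Etale := RingHom.etale_algebraMap.mpr het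
    have h2 : (algebraMap B₂ B₃).Etale :=
      RingHom.etale_algebraMap.mpr (Algebra.Etale.of_isLocalizationAway s₃)
    exact RingHom.Etale.stableUnderComposition _ _ h1 h2
  · rw [RingHom.comp_assoc, RingHom.comp_assoc, RingHom.comp_assoc]
    congr 1
    rw [IsScalarTower.algebraMap_eq R₀ B₁ B₂, RingHom.comp_assoc]
    congr 1
    ext x
    exact (φ.commutes x).trans (IsScalarTower.algebraMap_apply k B B₁ x)
  · let 𝔭₁ : Ideal B₁ := 𝔭.asIdeal.comap ((algebraMap B₂ B₃).comp (algebraMap B₁ B₂))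
    have h𝔭₁ : 𝔭₁.IsPrime := inferInstance
    have hs : s₁ * s₂ ∉ 𝔭₁ := fun h =>
      𝔭.isPrime.ne_top (Ideal.eq_top_of_isUnit_mem _ h
        (IsLocalization.Away.algebraMap_isUnit (S := B₃) s₃))
    change φ g ∈ 𝔭₁ ↔ I ≤ 𝔭₁.comap (algebraMap B B₁)
    constructor
    · exact hs₂' 𝔭₁ h𝔭₁ fun h => hs (𝔭₁.mul_mem_left _ h)
    · intro h
      refine (h𝔭₁.mem_or_mem (Ideal.map_le_iff_le_comap.mpr h hs₁')).resolve_left fun h' => ?_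
      exact hs (𝔭₁.mul_mem_right _ h')

end EtaleNeighbourhood

/-! ### Étale charts of affine varieties -/

section AffineChart

open IsLocalRing TensorProduct

lemma isRadical_map_of_isReduced {k K B : Type u} [Field k] [Field K] [Algebra k K] [CommRing B]
    [Algebra k B] (I : Ideal B) [IsReduced ((B ⧸ I) ⊗[k] K)] :
    (I.map (algebraMap B (B ⊗[k] K))).IsRadical := by
  let π : B ⊗[k] K →ₐ[k] (B ⧸ I) ⊗[k] K :=
    Algebra.TensorProduct.map (Ideal.Quotient.mkₐ k I) (AlgHom.id k K)
  have hπker : RingHom.ker π = I.map (algebraMap B (B ⊗[k] K)) := by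
    have := Algebra.TensorProduct.rTensor_ker (R := k) (B := B ⧸ I) (C := K)
      (Ideal.Quotient.mkₐ k I)
      (Ideal.Quotient.mkₐ_surjective k I)
    have h0 : RingHom.ker (Ideal.Quotient.mkₐ k I) = I := Ideal.mk_ker
    rw [h0] at this
    exact this
  rw [← hπker]
  rintro x ⟨n, hn⟩
  rw [RingHom.mem_ker, map_pow] at hn
  exact (RingHom.mem_ker).mpr (IsNilpotent.eq_zero ⟨n, hn⟩)

/-- Normality of the components of a closed subset of an affine scheme, in terms of its ideal in a
local ring. -/
lemma isIntegrallyClosed_quotient {B A : Type u} [CommRing B] [CommRing A] [Algebra B A]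
    (q : Ideal B) [q.IsPrime] [IsLocalization.AtPrime A q] (I : Ideal B)
    (h : ∀ 𝔭 ∈ I.minimalPrimes, 𝔭 ≤ q → ∃ (C : Type u) (_ : CommRing C) (_ : Algebra (B ⧸ 𝔭) C),
      IsLocalization (q.primeCompl.map (Ideal.Quotient.mk 𝔭)) C ∧ IsIntegrallyClosed C)
    {𝔭' : Ideal A} (h𝔭' : 𝔭' ∈ (I.map (algebraMap B A)).minimalPrimes) :
    IsIntegrallyClosed (A ⧸ 𝔭') := by
  have hprime : 𝔭'.IsPrime := h𝔭'.1.1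
  let 𝔭 := 𝔭'.comap (algebraMap B A)
  have h𝔭 : 𝔭 ∈ I.minimalPrimes := by
    rw [IsLocalization.minimalPrimes_map q.primeCompl A I] at h𝔭'
    exact h𝔭'
  have hle : 𝔭 ≤ q := fun x hx => by
    by_contra hxq
    exact hprime.ne_top (Ideal.eq_top_of_isUnit_mem _ hx
      (IsLocalization.map_units A (⟨x, hxq⟩ : q.primeCompl)))
  obtain ⟨C, _, _, hC, hint⟩ := h 𝔭 h𝔭 hle
  let ρ : B ⧸ 𝔭 →+* A ⧸ 𝔭' := Ideal.quotientMap 𝔭' (algebraMap B A) le_rfl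
  let _ : Algebra (B ⧸ 𝔭) (A ⧸ 𝔭') := ρ.toAlgebra
  have hloc : IsLocalization (q.primeCompl.map (Ideal.Quotient.mk 𝔭)) (A ⧸ 𝔭') := by
    refine isLocalization_of_surjective q.primeCompl (Ideal.Quotient.mk 𝔭) (Ideal.Quotient.mk 𝔭')
      Ideal.Quotient.mk_surjective Ideal.Quotient.mk_surjective (fun x => rfl) ?_
    rw [Ideal.mk_ker, Ideal.mk_ker]
    exact (IsLocalization.map_under q.primeCompl A 𝔭').ge
  let e := IsLocalization.algEquiv (q.primeCompl.map (Ideal.Quotient.mk 𝔭)) C (A ⧸ 𝔭')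
  exact IsIntegrallyClosed.of_equiv e.toRingEquiv

/-- The affine form of the theorem: from a comparison of completed local rings over `K`, which
matches the boundary ideals, one obtains an étale chart over `k`. -/
theorem exists_etale_chart {k K B A' : Type u} {T : Type*} [Field k] [Field K] [Algebra k K]
    [PerfectField K] [Algebra.IsAlgebraic k K] [CommRing B] [IsDomain B] [Algebra k B]
    [Algebra.FiniteType k B] (q : Ideal B) [q.IsPrime] (I : Ideal B) (hI : I.IsRadical)
    [IsReduced ((B ⧸ I) ⊗[k] K)]
    (hnormal : ∀ 𝔭 ∈ I.minimalPrimes, 𝔭 ≤ q → ∃ (C : Type u) (_ : CommRing C)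
      (_ : Algebra (B ⧸ 𝔭) C),
      IsLocalization (q.primeCompl.map (Ideal.Quotient.mk 𝔭)) C ∧ IsIntegrallyClosed C)
    (Q : Ideal (B ⊗[k] K)) [Q.IsPrime] (hQ : Q.comap (algebraMap B (B ⊗[k] K)) = q)
    [CommRing A'] [IsLocalRing A'] [Algebra (B ⊗[k] K) A'] [IsLocalization.AtPrime A' Q]
    [Algebra K A'] (hK : ∀ x : K, algebraMap (B ⊗[k] K) A' (1 ⊗ₜ x) = algebraMap K A' x)
    [CommRing T] [IsLocalRing T] [IsAdicComplete (maximalIdeal T) T]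
    [Algebra K T] [Algebra A' T] [IsScalarTower K A' T]
    [IsLocalHom (algebraMap A' T)] [Module.Flat A' T]
    (hd : IsAdicDense (algebraMap A' T))
    {n : ℕ} {P : AddSubmonoid (Fin n → ℤ)} (hP : IsToricMonoid P)
    (θ₀ : AddMonoidAlgebra K P →ₐ[K] T)
    (hθ₀ : IsAdicDense θ₀.toRingHom)
    (hres : ∀ x : T, ∃ a : K, x - algebraMap K T a ∈ maximalIdeal T)
    {S : Type*} [CommRing S] [Algebra S T] [IsLocalHom (algebraMap S T)] (χ : Multiplicative P →* S)
    (hχ : ∀ p : P, θ₀ (AddMonoidAlgebra.single p 1) = algebraMap S T (χ (.ofAdd p)))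
    {m₀ : P} (hm₀ : ∀ v, ∃ N : ℕ, v + N • (m₀ : Fin n → ℤ) ∈ P) {J : Ideal S}
    (hJ : ∀ x, x ∈ J ↔ ∃ N : ℕ, x ^ N ∈ Ideal.span {χ (.ofAdd m₀)})
    (hIJ : ((I.map ((algebraMap (B ⊗[k] K) A').comp (algebraMap B (B ⊗[k] K)))).radical).map
      (algebraMap A' T) = J.map (algebraMap S T)) :
    ∃ (n' : ℕ) (P' : AddSubmonoid (Fin n' → ℤ)) (_ : IsToricMonoid P') (m : P')
      (_ : ∀ v, ∃ N : ℕ, v + N • (m : Fin n' → ℤ) ∈ P')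
      (B' : Type u) (_ : CommRing B') (ι : B →+* B') (φ : AddMonoidAlgebra k P' →+* B')
      (q' : PrimeSpectrum B'), IsOpenImmersion (Spec.map (CommRingCat.ofHom ι)) ∧
      q'.asIdeal.comap ι = q ∧ φ.Etale ∧
      φ.comp (algebraMap k (AddMonoidAlgebra k P')) = ι.comp (algebraMap k B) ∧
      ∀ 𝔭 : PrimeSpectrum B', φ (AddMonoidAlgebra.single m 1) ∈ 𝔭.asIdeal ↔
        I ≤ 𝔭.asIdeal.comap ι := by
  let A := Localization.AtPrime q
  let R := B ⊗[k] K
  let ι : B →+* A' := (algebraMap R A').comp (algebraMap B R)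
  have hιq : ∀ x ∉ q, IsUnit (ι x) := fun x hx => IsLocalization.map_units A'
    (⟨algebraMap B R x, fun h => hx (hQ ▸ h)⟩ : Q.primeCompl)
  let ιA : A →+* A' := IsLocalization.lift (M := q.primeCompl) (g := ι) fun y => hιq y y.2
  have hιA : ∀ x, ιA (algebraMap B A x) = ι x := fun x => IsLocalization.lift_eq _ x
  let _ : Algebra A A' := ιA.toAlgebra
  let _ : Algebra k A' := ((algebraMap K A').comp (algebraMap k K)).toAlgebra
  have : IsScalarTower k K A' := .of_algebraMap_eq fun _ => rfl
  have hkB : ∀ x : k, ι (algebraMap k B x) = algebraMap k A' x := by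
    intro x
    change _ = algebraMap K A' (algebraMap k K x)
    rw [← hK]
    change algebraMap R A' (algebraMap k B x ⊗ₜ 1) = _
    rw [Algebra.algebraMap_eq_smul_one x, Algebra.algebraMap_eq_smul_one x, TensorProduct.smul_tmul]
  have : IsScalarTower k A A' := .of_algebraMap_eq fun x => by
    change _ = ιA _
    rw [IsScalarTower.algebraMap_apply k B A, hιA, hkB]
  let ιAK : A ⊗[k] K →ₐ[A] A' := Algebra.TensorProduct.lift (Algebra.ofId A A')
    (IsScalarTower.toAlgHom k K A') fun _ _ => Commute.all _ _
  let _ : Algebra (A ⊗[k] K) A' := ιAK.toRingHom.toAlgebra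
  have : IsScalarTower A (A ⊗[k] K) A' := .of_algebraMap_eq fun x => (ιAK.commutes x).symm
  have hAK : ∀ (a : A) (x : K), algebraMap (A ⊗[k] K) A' (a ⊗ₜ x) = ιA a * algebraMap K A' x :=
    fun a x => Algebra.TensorProduct.lift_tmul _ _ _ _ _
  -- `A'` is a localization of `A ⊗ K`
  let j : R →ₐ[k] A ⊗[k] K := Algebra.TensorProduct.map (IsScalarTower.toAlgHom k B A)
    (AlgHom.id k K)
  let _ : Algebra R (A ⊗[k] K) := j.toRingHom.toAlgebra
  have : IsScalarTower B R (A ⊗[k] K) := .of_algebraMap_eq fun x => by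
    change _ = j (x ⊗ₜ 1)
    rw [Algebra.TensorProduct.map_tmul]
    rfl
  have hlocR : IsLocalization (Algebra.algebraMapSubmonoid R q.primeCompl) (A ⊗[k] K) := by
    refine IsLocalization.tensorProduct_tensorProduct k K q.primeCompl A ?_
    ext x
    change j (1 ⊗ₜ x) = _
    rw [Algebra.TensorProduct.map_tmul, map_one]
    rfl
  have htowR : IsScalarTower R (A ⊗[k] K) A' := .of_algebraMap_eq fun x => by
    induction x using TensorProduct.induction_on with
    | zero => rw [map_zero, map_zero, map_zero]
    | add x y hx hy => rw [map_add, map_add, map_add, hx, hy]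
    | tmul b x =>
      change _ = algebraMap (A ⊗[k] K) A' (j (b ⊗ₜ x))
      rw [Algebra.TensorProduct.map_tmul, hAK]
      change _ = ιA (algebraMap B A b) * algebraMap K A' x
      rw [hιA, ← hK, RingHom.comp_apply, ← map_mul]
      congr 1
      change b ⊗ₜ x = (b ⊗ₜ 1) * (1 ⊗ₜ x)
      rw [Algebra.TensorProduct.tmul_mul_tmul, mul_one, one_mul]
  let N := Algebra.algebraMapSubmonoid (A ⊗[k] K) Q.primeCompl
  have hN : IsLocalization N A' := .isLocalization_of_submonoid_le (A ⊗[k] K) A'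
    (Algebra.algebraMapSubmonoid R q.primeCompl) Q.primeCompl (by
      rintro _ ⟨x, hx, rfl⟩ hxQ
      exact hx (hQ ▸ hxQ))
  have hnoethB : IsNoetherianRing B := Algebra.FiniteType.isNoetherianRing k B
  have hess : Algebra.EssFiniteType K A' := by
    let _ : Algebra K R := Algebra.TensorProduct.rightAlgebra
    have : Algebra.FiniteType K R :=
      .equiv (inferInstance : Algebra.FiniteType K (K ⊗[k] B))
        (Algebra.TensorProduct.commRight k K B)
    have : IsScalarTower K R A' := .of_algebraMap_eq fun x => (hK x).symm
    have : Algebra.EssFiniteType R A' := .of_isLocalization A' Q.primeCompl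
    exact .comp K R A'
  have hnoethA' : IsNoetherianRing A' := Algebra.EssFiniteType.isNoetherianRing K A'
  have hessA : Algebra.EssFiniteType k A := by
    have : Algebra.EssFiniteType B A := .of_isLocalization A q.primeCompl
    exact .comp k B A
  have hlocal : IsLocalHom (algebraMap A A') := ⟨fun x hx => by
    obtain ⟨b, t, rfl⟩ := IsLocalization.exists_mk'_eq q.primeCompl x
    rw [IsLocalization.AtPrime.isUnit_mk'_iff A q]
    have h1 : IsUnit (ι b) := by
      rw [← hιA, ← IsLocalization.mk'_spec A b t, map_mul, hιA]
      exact hx.mul (hιq t t.2)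
    intro hb
    rw [← hQ] at hb
    exact (IsLocalization.AtPrime.to_map_mem_maximal_iff A' Q _).mpr hb h1⟩
  let _ : Algebra A T := ((algebraMap A' T).comp ιA).toAlgebra
  have : IsScalarTower A A' T := .of_algebraMap_eq fun _ => rfl
  have hrad : (I.map (algebraMap B A)).IsRadical := by
    have := IsLocalization.map_radical q.primeCompl A I
    rw [hI.radical] at this
    rw [this]
    exact Ideal.radical_isRadical _
  have hIJ' : (I.map (algebraMap B A)).map (algebraMap A T) = J.map (algebraMap S T) := by
    rw [← hIJ, Ideal.map_map]
    have h1 : (I.map ((algebraMap R A').comp (algebraMap B R))).radical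
        = I.map ((algebraMap R A').comp (algebraMap B R)) := by
      rw [← Ideal.map_map, ← IsLocalization.map_radical Q.primeCompl A',
        (isRadical_map_of_isReduced I).radical]
    rw [h1, Ideal.map_map]
    congr 1
    ext x
    exact congrArg (algebraMap A' T) (hιA x)
  obtain ⟨P', hP', ψ, hflat, hunr, hψ⟩ := exists_toric_hom (k := k) (A := A) N
    (fun x => by rw [hAK, map_one, one_mul]) hd hrad
    (fun 𝔭 h𝔭 => isIntegrallyClosed_quotient q I hnormal h𝔭) hP θ₀ hθ₀ hres χ hχ hm₀ hJ hIJ'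
  obtain ⟨m, hmP, hm⟩ := hP'.exists_absorbing
  have hfg : AddMonoid.FG P' := (AddMonoid.fg_iff_addSubmonoid_fg P').mpr hP'.fg
  have hψm : AddMonoidAlgebra.lift k A P' ψ (AddMonoidAlgebra.single ⟨m, hmP⟩ 1)
      = ψ (.ofAdd ⟨m, hmP⟩) := by
    rw [AddMonoidAlgebra.lift_single, one_smul]
  obtain ⟨h1, h2⟩ := hψ ⟨m, hmP⟩ hm
  exact ⟨n, P', hP', ⟨m, hmP⟩, hm, exists_etale_neighbourhood q (AddMonoidAlgebra.lift k A P' ψ)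
    hflat hunr (AddMonoidAlgebra.single ⟨m, hmP⟩ 1) I (hψm ▸ h1)
    fun x hx => hψm ▸ h2 _ (Ideal.mem_map_of_mem _ hx)⟩

end AffineChart

/-! ### Local rings at points of affine open subschemes -/

section Stalk

/-- The local ring of a scheme at a point of an affine open subscheme `Spec R`, presented as a
localization of `R`. -/
lemma exists_isLocalization_stalk {R : Type u} [CommRing R] {Y : Scheme.{u}}
    (j : Spec (.of R) ⟶ Y) [IsOpenImmersion j] (Q : PrimeSpectrum R) (y : Y) (hy : j Q = y) :
    ∃ r : R →+* Y.presheaf.stalk y,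
      (letI := r.toAlgebra; IsLocalization.AtPrime (Y.presheaf.stalk y) Q.asIdeal) ∧
      Spec.map (CommRingCat.ofHom r) ≫ j = Y.fromSpecStalk y := by
  subst hy
  let Q' : Spec (.of R) := Q
  let r₀ : CommRingCat.of R ⟶ (Spec (.of R)).presheaf.stalk Q' := StructureSheaf.toStalk R Q
  let r : CommRingCat.of R ⟶ Y.presheaf.stalk (j Q) := r₀ ≫ inv (j.stalkMap Q')
  refine ⟨r.hom, ?_, ?_⟩
  · let e : (Spec.structureSheaf R).presheaf.stalk Q ≃+* Y.presheaf.stalk (j Q) :=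
      (asIso (inv (j.stalkMap Q'))).commRingCatIsoToRingEquiv
    let _ := r.hom.toAlgebra
    let e' : (Spec.structureSheaf R).presheaf.stalk Q ≃ₐ[R] Y.presheaf.stalk (j Q) :=
      AlgEquiv.ofRingEquiv (f := e) fun x => rfl
    exact IsLocalization.isLocalization_of_algEquiv _ e'
  · have h1 : Spec.map r₀ = (Spec (.of R)).fromSpecStalk Q' := (Spec.fromSpecStalk_eq' _ _).symm
    rw [CommRingCat.ofHom_hom, Spec.map_comp, h1, Category.assoc,
      ← Scheme.SpecMap_stalkMap_fromSpecStalk, ← Spec.map_comp_assoc, IsIso.hom_inv_id,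
      Spec.map_id]
    exact Category.id_comp _

lemma SpecMap_constants {K : Type u} [Field K] {Y : Scheme.{u}} (g : Y ⟶ Spec (.of K)) (y : Y) :
    Spec.map ((Scheme.ΓSpecIso (.of K)).inv ≫ g.appTop ≫ Y.presheaf.germ ⊤ y trivial) =
      Y.fromSpecStalk y ≫ g := by
  rw [Spec.map_comp, Spec.map_comp, ← Scheme.fromSpecStalk_toSpecΓ, Category.assoc, Category.assoc,
    ← Scheme.toSpecΓ_naturality_assoc, toSpecΓ_SpecMap_ΓSpecIso_inv, Category.comp_id]

lemma constants_eq {K R : Type u} [Field K] [CommRing R] {Y : Scheme.{u}} (g : Y ⟶ Spec (.of K))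
    {j : Spec (.of R) ⟶ Y} {y : Y} {r : R →+* Y.presheaf.stalk y}
    (hr : Spec.map (CommRingCat.ofHom r) ≫ j = Y.fromSpecStalk y) {φ : K →+* R}
    (hφ : j ≫ g = Spec.map (CommRingCat.ofHom φ)) (a : K) :
    constants g y a = algebraMap _ (completedStalk Y y) (r (φ a)) := by
  have h1 := SpecMap_constants g y
  rw [← hr, Category.assoc, hφ, ← Spec.map_comp] at h1
  have h2 := congrArg CommRingCat.Hom.hom (Spec.map_injective h1)
  exact congrArg (algebraMap _ (completedStalk Y y)) (DFunLike.congr_fun h2 a)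

lemma stalkIdeal_eq {R : Type u} [CommRing R] {Y : Scheme.{u}} {Z : Set Y}
    {j : Spec (.of R) ⟶ Y} {y : Y} {r : R →+* Y.presheaf.stalk y}
    (hr : Spec.map (CommRingCat.ofHom r) ≫ j = Y.fromSpecStalk y) {I : Ideal R}
    (hI : j ⁻¹' Z = PrimeSpectrum.zeroLocus (I : Set R)) :
    stalkIdeal Y Z y = (I.map r).radical := by
  rw [← PrimeSpectrum.vanishingIdeal_zeroLocus_eq_radical, stalkIdeal, ← hr]
  refine congrArg PrimeSpectrum.vanishingIdeal ?_
  have h1 : (Spec.map (CommRingCat.ofHom r) ≫ j) ⁻¹' Z =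
      PrimeSpectrum.comap r ⁻¹' (j ⁻¹' Z) := rfl
  refine h1.trans ((congrArg (PrimeSpectrum.comap r ⁻¹' ·) hI).trans ?_)
  rw [PrimeSpectrum.preimage_comap_zeroLocus, Ideal.map, PrimeSpectrum.zeroLocus_span]

end Stalk

/-! ### Charts from isomorphisms of completed local rings -/

section Completion

open IsLocalRing TensorProduct

lemma exists_sub_mem_maximalIdeal_completion {A : Type*} [CommRing A] [IsLocalRing A]
    [IsNoetherianRing A] (x : AdicCompletion (maximalIdeal A) A) :
    ∃ a : A, x - algebraMap A _ a ∈ maximalIdeal (AdicCompletion (maximalIdeal A) A) := by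
  obtain ⟨y, hy⟩ := (AdicCompletion.residueField_map_bijective A).2 (residue _ x)
  obtain ⟨a, rfl⟩ := residue_surjective y
  refine ⟨a, ?_⟩
  rw [← residue_eq_zero_iff, map_sub, sub_eq_zero, ← hy]
  rfl

/-- A Noetherian local ring is dense in its completion. -/
lemma isAdicDense_completion (A : Type*) [CommRing A] [IsLocalRing A] [IsNoetherianRing A] :
    IsAdicDense (algebraMap A (AdicCompletion (maximalIdeal A) A)) :=
  .of_flat exists_sub_mem_maximalIdeal_completion (by
    rw [maximalIdeal_comap, AdicCompletion.maximalIdeal_eq_map])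

/-- The local ring at a maximal ideal has the same residue field as the ring. -/
lemma exists_sub_mem_maximalIdeal_completion' {R A : Type*} [CommRing R] [CommRing A]
    [IsLocalRing A] [IsNoetherianRing A] [Algebra R A] (Q : Ideal R) [hQ : Q.IsMaximal]
    [IsLocalization.AtPrime A Q] (x : AdicCompletion (maximalIdeal A) A) :
    ∃ a : R, x - algebraMap A _ (algebraMap R A a) ∈
      maximalIdeal (AdicCompletion (maximalIdeal A) A) := by
  obtain ⟨a, ha⟩ := exists_sub_mem_maximalIdeal_completion x
  obtain ⟨b, hb⟩ : ∃ b : R, a - algebraMap R A b ∈ maximalIdeal A := by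
    obtain ⟨r, s, rfl⟩ := IsLocalization.exists_mk'_eq Q.primeCompl a
    obtain ⟨t, i, hi, hti⟩ := hQ.exists_inv s.2
    refine ⟨t * r, ?_⟩
    rw [← Ideal.unit_mul_mem_iff_mem _ (IsLocalization.map_units A s), mul_sub,
      IsLocalization.mk'_spec',
      ← map_mul, ← map_sub, IsLocalization.AtPrime.to_map_mem_maximal_iff A Q]
    have h1 : r - s * (t * r) = i * r := by linear_combination -r * hti
    rw [h1]
    exact Ideal.mul_mem_right _ _ hi
  refine ⟨b, ?_⟩
  rw [← sub_add_sub_cancel x (algebraMap A _ a), ← map_sub]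
  refine add_mem ha ?_
  rw [AdicCompletion.maximalIdeal_eq_map]
  exact Ideal.mem_map_of_mem _ hb

/-- The coordinate ring is dense in the completed local ring at a closed point. -/
lemma isAdicDense_completion_comp {R A : Type*} [CommRing R] [CommRing A] [IsLocalRing A]
    [IsNoetherianRing A] [Algebra R A] (Q : Ideal R) [hQ : Q.IsMaximal]
    [IsLocalization.AtPrime A Q] :
    IsAdicDense ((algebraMap A (AdicCompletion (maximalIdeal A) A)).comp (algebraMap R A)) := by
  have := IsLocalization.flat A Q.primeCompl
  have := Module.Flat.trans R A (AdicCompletion (maximalIdeal A) A)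
  refine IsAdicDense.of_flat (exists_sub_mem_maximalIdeal_completion' Q) ?_
  have h1 : (maximalIdeal A).comap (algebraMap R A) = Q :=
    IsLocalization.AtPrime.under_maximalIdeal A Q
  rw [IsScalarTower.algebraMap_eq R A, ← Ideal.comap_comap, maximalIdeal_comap, ← Ideal.map_map, h1,
    IsLocalization.AtPrime.map_eq_maximalIdeal Q A, AdicCompletion.maximalIdeal_eq_map]

lemma map_maximalIdeal_pow {T T' : Type*} [CommRing T] [CommRing T'] [IsLocalRing T]
    [IsLocalRing T'] (e : T ≃+* T') (x : T) (n : ℕ) :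
    e x ∈ maximalIdeal T' ^ n ↔ x ∈ maximalIdeal T ^ n := by
  have hm : (maximalIdeal T).map (e : T →+* T') = maximalIdeal T' :=
    (eq_maximalIdeal (Ideal.map_isMaximal_of_equiv e))
  rw [← hm, ← Ideal.map_pow]
  exact Ideal.apply_mem_of_equiv_iff

lemma IsAdicDense.equiv_comp {R T T' : Type*} [CommRing R] [CommRing T] [CommRing T']
    [IsLocalRing T] [IsLocalRing T'] {φ : R →+* T} (h : IsAdicDense φ) (e : T ≃+* T') :
    IsAdicDense ((e : T →+* T').comp φ) where
  approx x n := by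
    obtain ⟨r, hr⟩ := h.approx (e.symm x) n
    refine ⟨r, ?_⟩
    rw [← map_maximalIdeal_pow e.symm, map_sub]
    simpa using hr
  mem_pow r n hr := by
    rw [← Ideal.comap_comap, maximalIdeal_comap]
    exact h.mem_pow r n ((map_maximalIdeal_pow e _ n).mp hr)

/-- The Nullstellensatz. -/
lemma exists_sub_algebraMap_mem {K R : Type*} [Field K] [IsAlgClosed K] [CommRing R] [Algebra K R]
    [Algebra.FiniteType K R] (Q : Ideal R) [Q.IsMaximal] (x : R) :
    ∃ a : K, x - algebraMap K R a ∈ Q := by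
  let _ : Field (R ⧸ Q) := Ideal.Quotient.field Q
  have h1 : Module.Finite K (R ⧸ Q) := finite_of_finite_type_of_isJacobsonRing K (R ⧸ Q)
  obtain ⟨a, ha⟩ := (IsAlgClosed.algebraMap_bijective_of_isIntegral (k := K) (K := R ⧸ Q)).2
    (Ideal.Quotient.mk Q x)
  exact ⟨a, Ideal.Quotient.eq.mp ha.symm⟩

/-- A toric chart exists at a point `q` as soon as the completed local ring at a point `Q` over `q`
is isomorphic to that of a toric variety at a closed point, compatibly with the boundaries. -/
theorem exists_etale_chart_of_completion {k K B A' S : Type u} [Field k] [Field K] [Algebra k K]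
    [IsAlgClosed K] [Algebra.IsAlgebraic k K] [CommRing B] [IsDomain B] [Algebra k B]
    [Algebra.FiniteType k B] (q : Ideal B) [q.IsPrime] (I : Ideal B) (hI : I.IsRadical)
    (hred : IsReduced ((B ⧸ I) ⊗[k] K))
    (hnormal : ∀ 𝔭 ∈ I.minimalPrimes, 𝔭 ≤ q → ∃ (C : Type u) (_ : CommRing C)
      (_ : Algebra (B ⧸ 𝔭) C),
      IsLocalization (q.primeCompl.map (Ideal.Quotient.mk 𝔭)) C ∧ IsIntegrallyClosed C)
    (Q : Ideal (B ⊗[k] K)) [Q.IsPrime] (hQ : Q.comap (algebraMap B (B ⊗[k] K)) = q)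
    [CommRing A'] [IsLocalRing A'] [Algebra (B ⊗[k] K) A'] [IsLocalization.AtPrime A' Q]
    {n : ℕ} {P : AddSubmonoid (Fin n → ℤ)} (hP : IsToricMonoid P)
    {m₀ : P} (hm₀ : ∀ v, ∃ N : ℕ, v + N • (m₀ : Fin n → ℤ) ∈ P)
    [CommRing S] [IsLocalRing S] [Algebra (AddMonoidAlgebra K P) S]
    (s : Ideal (AddMonoidAlgebra K P)) [s.IsMaximal] [IsLocalization.AtPrime S s]
    (e : AdicCompletion (maximalIdeal A') A' ≃+* AdicCompletion (maximalIdeal S) S)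
    (he : ∀ a : K, e (algebraMap A' _ (algebraMap (B ⊗[k] K) A' (1 ⊗ₜ a))) =
      algebraMap S _ (algebraMap (AddMonoidAlgebra K P) S (algebraMap K _ a)))
    (hIJ : (((I.map ((algebraMap (B ⊗[k] K) A').comp (algebraMap B (B ⊗[k] K)))).radical).map
      (algebraMap A' (AdicCompletion (maximalIdeal A') A'))).map
        (e : AdicCompletion (maximalIdeal A') A' →+* AdicCompletion (maximalIdeal S) S) =
      (((Ideal.span {AddMonoidAlgebra.single m₀ (1 : K)}).map
        (algebraMap (AddMonoidAlgebra K P) S)).radical).map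
          (algebraMap S (AdicCompletion (maximalIdeal S) S))) :
    ∃ (n' : ℕ) (P' : AddSubmonoid (Fin n' → ℤ)) (_ : IsToricMonoid P') (m : P')
      (_ : ∀ v, ∃ N : ℕ, v + N • (m : Fin n' → ℤ) ∈ P')
      (B' : Type u) (_ : CommRing B') (ι : B →+* B') (φ : AddMonoidAlgebra k P' →+* B')
      (q' : PrimeSpectrum B'), IsOpenImmersion (Spec.map (CommRingCat.ofHom ι)) ∧
      q'.asIdeal.comap ι = q ∧ φ.Etale ∧
      φ.comp (algebraMap k (AddMonoidAlgebra k P')) = ι.comp (algebraMap k B) ∧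
      ∀ 𝔭 : PrimeSpectrum B', φ (AddMonoidAlgebra.single m 1) ∈ 𝔭.asIdeal ↔
        I ≤ 𝔭.asIdeal.comap ι := by
  have hR : IsNoetherianRing (B ⊗[k] K) := by
    have : Algebra.FiniteType K (K ⊗[k] B) := inferInstance
    have := Algebra.FiniteType.isNoetherianRing K (K ⊗[k] B)
    exact isNoetherianRing_of_ringEquiv _ (Algebra.TensorProduct.comm k K B).toRingEquiv
  have hA' : IsNoetherianRing A' := IsLocalization.isNoetherianRing Q.primeCompl A' hR
  have hfg : Algebra.FiniteType K (AddMonoidAlgebra K P) := by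
    have : AddMonoid.FG P := (AddMonoid.fg_iff_addSubmonoid_fg P).mpr hP.fg
    infer_instance
  have hKP : IsNoetherianRing (AddMonoidAlgebra K P) := Algebra.FiniteType.isNoetherianRing K _
  have hS : IsNoetherianRing S := IsLocalization.isNoetherianRing s.primeCompl S hKP
  let T := AdicCompletion (maximalIdeal A') A'
  let T' := AdicCompletion (maximalIdeal S) S
  let _ : Algebra K A' := ((algebraMap (B ⊗[k] K) A').comp
    (Algebra.TensorProduct.includeRight (R := k) (A := B) (B := K)).toRingHom).toAlgebra
  have hKT : ∀ a : K, algebraMap K T a = algebraMap A' T (algebraMap (B ⊗[k] K) A' (1 ⊗ₜ a)) :=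
    fun a => rfl
  -- the monoid algebra is compared with the completion of `A'` through `e`
  let _ : Algebra S T := ((e.symm : T' →+* T).comp (algebraMap S T')).toAlgebra
  have hST : ∀ x, algebraMap S T x = e.symm (algebraMap S T' x) := fun x => rfl
  have hloc : IsLocalHom (algebraMap S T) :=
    RingHom.isLocalHom_comp (e.symm : T' →+* T) (algebraMap S T')
  let θ₀ : AddMonoidAlgebra K P →ₐ[K] T :=
    { (e.symm : T' →+* T).comp ((algebraMap S T').comp (algebraMap (AddMonoidAlgebra K P) S)) with
      commutes' := fun a => e.symm_apply_eq.mpr (he a).symm }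
  have hθ₀ : IsAdicDense θ₀.toRingHom := (isAdicDense_completion_comp (A := S) s).equiv_comp e.symm
  refine exists_etale_chart q I hI hnormal Q hQ (A' := A') (T := T) (fun a => rfl)
    (isAdicDense_completion A') hP θ₀ hθ₀ (fun x => ?_) (S := S)
    (((algebraMap (AddMonoidAlgebra K P) S).toMonoidHom).comp (AddMonoidAlgebra.of K P))
    (fun p => rfl) hm₀ (J := ((Ideal.span {AddMonoidAlgebra.single m₀ (1 : K)}).map
        (algebraMap (AddMonoidAlgebra K P) S)).radical) (fun x => ?_) ?_
  · obtain ⟨r, hr⟩ := exists_sub_mem_maximalIdeal_completion' (A := S) s (e x)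
    obtain ⟨a, ha⟩ := exists_sub_algebraMap_mem (K := K) s r
    refine ⟨a, ?_⟩
    have h1 := (map_maximalIdeal_pow e (x - algebraMap K T a) 1).mp
    rw [pow_one, pow_one] at h1
    refine h1 ?_
    rw [map_sub, hKT, he, ← sub_add_sub_cancel _ (algebraMap S T' (algebraMap _ S r)),
      ← map_sub, ← map_sub]
    refine add_mem hr ?_
    rw [AdicCompletion.maximalIdeal_eq_map]
    exact Ideal.mem_map_of_mem _ ((IsLocalization.AtPrime.to_map_mem_maximal_iff S s _).mpr ha)
  · rw [Ideal.map_span, Set.image_singleton]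
    rfl
  · rw [← Ideal.map_of_equiv (I := Ideal.map _ _) e, hIJ, Ideal.map_map]
    rfl

end Completion

/-! ### Base change to the algebraic closure -/

section BaseChange

open TensorProduct

/-- The base change of an affine open immersion. -/
lemma exists_isOpenImmersion_tensorProduct {k B : Type u} (K : Type u) [Field k] [Field K]
    [Algebra k K] [CommRing B] [Algebra k B] {X : Scheme.{u}} (f : X ⟶ Spec (.of k))
    (j : Spec (.of B) ⟶ X) [IsOpenImmersion j]
    (hj : j ≫ f = Spec.map (CommRingCat.ofHom (algebraMap k B))) :
    ∃ jK : Spec (.of (B ⊗[k] K)) ⟶ pullback f (Spec.map (CommRingCat.ofHom (algebraMap k K))),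
      IsOpenImmersion jK ∧
      jK ≫ pullback.fst _ _ = Spec.map (CommRingCat.ofHom (algebraMap B (B ⊗[k] K))) ≫ j ∧
      jK ≫ pullback.snd _ _ = Spec.map (CommRingCat.ofHom
        (Algebra.TensorProduct.includeRight (R := k) (A := B) (B := K)).toRingHom) := by
  have h1 := isPullback_SpecMap_of_isPushout _ _ _ _
    (CommRingCat.isPushout_tensorProduct k B K)
  have h2 := IsPullback.of_hasPullback f (Spec.map (CommRingCat.ofHom (algebraMap k K)))
  have hw := h1.w
  let jK := h2.lift (Spec.map (CommRingCat.ofHom (algebraMap B (B ⊗[k] K))) ≫ j)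
    (Spec.map (CommRingCat.ofHom
      (Algebra.TensorProduct.includeRight (R := k) (A := B) (B := K)).toRingHom))
      (by rw [Category.assoc, hj]; exact hw)
  have h3 : jK ≫ pullback.fst _ _ = _ := h2.lift_fst _ _ _
  have h4 : jK ≫ pullback.snd _ _ = _ := h2.lift_snd _ _ _
  have h5 : IsPullback jK (Spec.map (CommRingCat.ofHom (algebraMap B (B ⊗[k] K))))
      (pullback.fst _ _) j := by
    refine IsPullback.of_right ?_ h3 h2.flip
    rw [h4, hj]
    exact h1.flip
  exact ⟨jK, MorphismProperty.of_isPullback h5.flip ‹_›, h3, h4⟩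

/-- Closed points of an affine open subscheme are closed in a scheme of finite type over a field. -/
lemma isClosed_singleton_of_isMaximal {K R : Type u} [Field K] [CommRing R] {Y : Scheme.{u}}
    (g : Y ⟶ Spec (.of K)) [LocallyOfFiniteType g] (j : Spec (.of R) ⟶ Y) [IsOpenImmersion j]
    (Q : PrimeSpectrum R) (hQ : Q.asIdeal.IsMaximal) : IsClosed ({j Q} : Set Y) := by
  have : JacobsonSpace Y := LocallyOfFiniteType.jacobsonSpace g
  have h1 := j.isOpenEmbedding.preimage_closedPoints
  have h2 : Q ∈ closedPoints (PrimeSpectrum R) :=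
    (PrimeSpectrum.isClosed_singleton_iff_isMaximal Q).mpr hQ
  exact h1.ge h2

end BaseChange

/-! ### Affine charts of the boundary -/

section Boundary

open TensorProduct TopologicalSpace

variable {X : Scheme.{u}}

/-- The affine charts of a closed subset with its reduced scheme structure. -/
lemma exists_isOpenImmersion_reducedSubscheme (Z : Closeds X) (V : X.affineOpens)
    (I : Ideal Γ(X, V.1))
    (hI : I = PrimeSpectrum.vanishingIdeal (V.2.fromSpec ⁻¹' (Z : Set X))) :
    ∃ c : Spec (.of (Γ(X, V.1) ⧸ I)) ⟶ reducedSubscheme Z, IsOpenImmersion c ∧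
      c ≫ reducedSubschemeMap Z =
        Spec.map (CommRingCat.ofHom (Ideal.Quotient.mk I)) ≫ V.2.fromSpec := by
  subst hI
  let J := Scheme.IdealSheafData.vanishingIdeal Z
  refine ⟨J.subschemeCover.f V, J.subschemeCover.map_prop V, ?_⟩
  have h1 : J.subschemeCover.f V ≫ J.subschemeι = _ := J.subschemeCover_map_subschemeι V
  exact h1.trans (J.glueDataObjι_ι V)

lemma isReduced_tensorProduct_of_geometricallyReduced {k : Type u} (K : Type u) [Field k] [Field K]
    [Algebra k K] (f : X ⟶ Spec (.of k)) (Z : Closeds X)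
    [hZ : GeometricallyReduced (reducedSubschemeMap Z ≫ f)] (V : X.affineOpens)
    [Algebra k Γ(X, V.1)]
    (hV : V.2.fromSpec ≫ f = Spec.map (CommRingCat.ofHom (algebraMap k Γ(X, V.1))))
    (I : Ideal Γ(X, V.1))
    (hI : I = PrimeSpectrum.vanishingIdeal (V.2.fromSpec ⁻¹' (Z : Set X))) :
    IsReduced ((Γ(X, V.1) ⧸ I) ⊗[k] K) := by
  obtain ⟨c, hc, hcι⟩ := exists_isOpenImmersion_reducedSubscheme Z V I hI
  obtain ⟨cK, hcK, -, -⟩ := exists_isOpenImmersion_tensorProduct K (reducedSubschemeMap Z ≫ f) c (by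
    rw [reassoc_of% hcι, hV, ← Spec.map_comp]
    rfl)
  have h1 : AlgebraicGeometry.IsReduced (pullback (reducedSubschemeMap Z ≫ f)
      (Spec.map (CommRingCat.ofHom (algebraMap k K)))) :=
    hZ.geometrically_isReduced _ _ _ (.of_hasPullback _ _)
  have h2 := isReduced_of_isOpenImmersion cK
  exact (affine_isReduced_iff (.of ((Γ(X, V.1) ⧸ I) ⊗[k] K))).mp h2

/-- A minimal prime of the ideal of a closed subset of an affine open subscheme defines an
irreducible component of the closed subset. -/
lemma isComponentOf_closure_singleton (D : Closeds X) (V : X.affineOpens)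
    {I : Ideal Γ(X, V.1)}
    (hI : V.2.fromSpec ⁻¹' (D : Set X) = PrimeSpectrum.zeroLocus (I : Set Γ(X, V.1)))
    (𝔭 : PrimeSpectrum Γ(X, V.1)) (h𝔭 : 𝔭.asIdeal ∈ I.minimalPrimes) :
    IsComponentOf (Closeds.closure {V.2.fromSpec 𝔭}) (D : Set X) := by
  have := V.2.isOpenImmersion_fromSpec
  let 𝔭' : Spec Γ(X, V.1) := 𝔭
  have h1 : V.2.fromSpec 𝔭' ∈ (D : Set X) := hI.ge h𝔭.1.2
  refine ⟨⟨isIrreducible_singleton.closure,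
    closure_minimal (Set.singleton_subset_iff.mpr h1) D.isClosed⟩, ?_⟩
  rintro S ⟨hS, hSD⟩ hle
  let η := hS.genericPoint
  have hη : IsGenericPoint η (closure S) := hS.isGenericPoint_genericPoint_closure
  have hηp : η ⤳ V.2.fromSpec 𝔭' := hη.specializes (subset_closure (hle (subset_closure rfl)))
  have hηD : η ∈ (D : Set X) := closure_minimal hSD D.isClosed hη.mem
  obtain ⟨η', hη'⟩ : η ∈ Set.range V.2.fromSpec := by
    exact hηp.mem_open V.2.fromSpec.isOpenEmbedding.isOpen_range ⟨𝔭', rfl⟩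
  have h2 : η' ⤳ 𝔭' := by
    rw [← V.2.fromSpec.isOpenEmbedding.isInducing.specializes_iff, hη']
    exact hηp
  have h3 : (η' : PrimeSpectrum Γ(X, V.1)).asIdeal ≤ 𝔭.asIdeal :=
    (PrimeSpectrum.le_iff_specializes _ _).mpr h2
  have h4 : I ≤ (η' : PrimeSpectrum Γ(X, V.1)).asIdeal := by
    have : η' ∈ V.2.fromSpec ⁻¹' (D : Set X) := by rw [Set.mem_preimage, hη']; exact hηD
    exact hI.le this
  have h5 : η' = 𝔭' := PrimeSpectrum.ext (le_antisymm h3 (h𝔭.2 ⟨η'.2, h4⟩ h3))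
  have h6 : closure {V.2.fromSpec 𝔭'} = closure S := by rw [← h5, hη']; exact hη
  exact subset_closure.trans h6.ge

/-- The local rings of the components of the boundary of a strict toroidal embedding. -/
lemma exists_isIntegrallyClosed {k : Type u} [Field k] {f : X ⟶ Spec (.of k)} {U : X.Opens}
    (hU : IsStrictToroidal f U) (V : X.affineOpens) {I : Ideal Γ(X, V.1)}
    (hI : V.2.fromSpec ⁻¹' (U : Set X)ᶜ = PrimeSpectrum.zeroLocus (I : Set Γ(X, V.1)))
    (q : Ideal Γ(X, V.1)) [hq : q.IsPrime] (𝔭 : Ideal Γ(X, V.1)) (h𝔭 : 𝔭 ∈ I.minimalPrimes)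
    (h𝔭q : 𝔭 ≤ q) :
    ∃ (C : Type u) (_ : CommRing C) (_ : Algebra (Γ(X, V.1) ⧸ 𝔭) C),
      IsLocalization (q.primeCompl.map (Ideal.Quotient.mk 𝔭)) C ∧ IsIntegrallyClosed C := by
  have : 𝔭.IsPrime := h𝔭.1.1
  have := V.2.isOpenImmersion_fromSpec
  let Z : Closeds X := Closeds.closure {V.2.fromSpec ⟨𝔭, h𝔭.1.1⟩}
  have hZ : IsComponentOf Z (U : Set X)ᶜ :=
    isComponentOf_closure_singleton U.compl V hI ⟨𝔭, h𝔭.1.1⟩ h𝔭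
  have h𝔭Z : 𝔭 = PrimeSpectrum.vanishingIdeal (V.2.fromSpec ⁻¹' (Z : Set X)) := by
    have h1 := V.2.fromSpec.isOpenEmbedding.isInducing.closure_eq_preimage_closure_image
      {(⟨𝔭, h𝔭.1.1⟩ : PrimeSpectrum Γ(X, V.1))}
    have h2 : V.2.fromSpec ⁻¹' (Z : Set X) =
      closure {(⟨𝔭, h𝔭.1.1⟩ : PrimeSpectrum Γ(X, V.1))} :=
      (h1.trans (congrArg (V.2.fromSpec ⁻¹' closure ·) Set.image_singleton)).symm
    refine Eq.trans ?_ (congrArg PrimeSpectrum.vanishingIdeal h2.symm)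
    rw [PrimeSpectrum.vanishingIdeal_closure, PrimeSpectrum.vanishingIdeal_singleton]
  obtain ⟨c, hc, -⟩ := exists_isOpenImmersion_reducedSubscheme Z V 𝔭 h𝔭Z
  have hqp : (q.map (Ideal.Quotient.mk 𝔭)).IsPrime :=
    Ideal.map_isPrime_of_surjective Ideal.Quotient.mk_surjective (by rwa [Ideal.mk_ker])
  have hqc : (q.map (Ideal.Quotient.mk 𝔭)).comap (Ideal.Quotient.mk 𝔭) = q := by
    rw [Ideal.comap_map_of_surjective _ Ideal.Quotient.mk_surjective, ← RingHom.ker_eq_comap_bot,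
      Ideal.mk_ker, sup_eq_left.mpr h𝔭q]
  obtain ⟨r, hr, -⟩ := exists_isLocalization_stalk c ⟨_, hqp⟩ _ rfl
  refine ⟨_, inferInstance, r.toAlgebra, ?_, (hU.strict Z hZ _).2⟩
  have h1 : q.primeCompl.map (Ideal.Quotient.mk 𝔭) =
      (q.map (Ideal.Quotient.mk 𝔭)).primeCompl := by
    ext x
    constructor
    · rintro ⟨y, hy, rfl⟩ h2
      exact hy (hqc.le h2)
    · obtain ⟨x, rfl⟩ := Ideal.Quotient.mk_surjective x
      exact fun h2 => ⟨x, fun h3 => h2 (hqc.ge h3), rfl⟩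
  rw [h1]
  exact hr

end Boundary

/-! ### Toric charts of schemes -/

section Scheme

open TensorProduct

variable {X : Scheme.{u}}

lemma preimage_bigTorus_compl {k : Type u} [Field k] {n : ℕ} {P : AddSubmonoid (Fin n → ℤ)} {m : P}
    (hm : ∀ v, ∃ N : ℕ, v + N • (m : Fin n → ℤ) ∈ P) :
    (bigTorus k P)ᶜ = PrimeSpectrum.zeroLocus
      (Ideal.span {AddMonoidAlgebra.single m (1 : k)} : Set (AddMonoidAlgebra k P)) := by
  rw [bigTorus_eq k m hm, PrimeSpectrum.basicOpen_eq_zeroLocus_compl, PrimeSpectrum.zeroLocus_span]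
  exact compl_compl _

lemma preimage_compl_eq_zeroLocus (U : X.Opens) (V : X.affineOpens) :
    V.2.fromSpec ⁻¹' (U : Set X)ᶜ = PrimeSpectrum.zeroLocus
      (PrimeSpectrum.vanishingIdeal (V.2.fromSpec ⁻¹' (U : Set X)ᶜ) : Set Γ(X, V.1)) := by
  rw [PrimeSpectrum.zeroLocus_vanishingIdeal_eq_closure]
  exact (U.compl.isClosed.preimage V.2.fromSpec.continuous).closure_eq.symm

/-- A toric chart of an affine open subscheme is a toric chart of the scheme. -/
lemma exists_chart_of_isOpenImmersion {k B' : Type u} [Field k] [CommRing B']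
    (f : X ⟶ Spec (.of k)) (U : X.Opens) (i : Spec (.of B') ⟶ X) [IsOpenImmersion i]
    {n : ℕ} {P : AddSubmonoid (Fin n → ℤ)} (φ : AddMonoidAlgebra k P →+* B') (hφ : φ.Etale)
    (hφf : i ≫ f = Spec.map (CommRingCat.ofHom (φ.comp (algebraMap k (AddMonoidAlgebra k P)))))
    {m : P} (hm : ∀ v, ∃ N : ℕ, v + N • (m : Fin n → ℤ) ∈ P)
    (hφU : ∀ 𝔭 : PrimeSpectrum B', φ (AddMonoidAlgebra.single m 1) ∈ 𝔭.asIdeal ↔ i 𝔭 ∉ U) :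
    ∃ ψ : i.opensRange.toScheme ⟶ toricVariety k P,
      ψ ≫ toricVarietyStr k P = i.opensRange.ι ≫ f ∧ Etale ψ ∧
      ψ ⁻¹' bigTorus k P = i.opensRange.ι ⁻¹' (U : Set X) := by
  have hφ' : Etale (Spec.map (CommRingCat.ofHom φ)) :=
    (HasRingHomProperty.Spec_iff (P := @Etale)).mpr hφ
  let e := i.isoOpensRange
  have he : e.hom ≫ i.opensRange.ι = i := i.isoOpensRange_hom_ι
  refine ⟨e.inv ≫ Spec.map (CommRingCat.ofHom φ), ?_, inferInstance, ?_⟩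
  · rw [Category.assoc, ← Spec.map_comp, ← CommRingCat.ofHom_comp, ← hφf, Iso.inv_comp_eq,
      reassoc_of% he]
  · ext w
    have h0 : e.inv ≫ i = i.opensRange.ι := by rw [Iso.inv_comp_eq, he]
    have h1 : i (e.inv w) = i.opensRange.ι w := by rw [← h0, Scheme.Hom.comp_apply]
    have h2 : e.inv w ∈ Spec.map (CommRingCat.ofHom φ) ⁻¹' (bigTorus k P)ᶜ ↔ i (e.inv w) ∉ U := by
      rw [← hφU (e.inv w), preimage_bigTorus_compl hm]
      exact Ideal.span_singleton_le_iff_mem _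
    rw [h1] at h2
    exact not_iff_not.mp h2

/-- A toric chart of an affine open subscheme at a closed point of a strict toroidal embedding. -/
lemma exists_chart_of_affineOpens {k : Type u} [Field k] (f : X ⟶ Spec (.of k)) [IsIntegral X]
    [LocallyOfFiniteType f] {U : X.Opens} (hU : IsStrictToroidal f U)
    [hD : GeometricallyReduced (reducedSubschemeMap U.compl ≫ f)] (V : X.affineOpens)
    [Algebra k Γ(X, V.1)]
    (hV : V.2.fromSpec ≫ f = Spec.map (CommRingCat.ofHom (algebraMap k Γ(X, V.1))))
    (q : Ideal Γ(X, V.1)) [hq : q.IsMaximal] (I : Ideal Γ(X, V.1))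
    (hI : I = PrimeSpectrum.vanishingIdeal (V.2.fromSpec ⁻¹' (U : Set X)ᶜ)) :
    ∃ (n' : ℕ) (P' : AddSubmonoid (Fin n' → ℤ)) (_ : IsToricMonoid P') (m : P')
      (_ : ∀ v, ∃ N : ℕ, v + N • (m : Fin n' → ℤ) ∈ P')
      (B' : Type u) (_ : CommRing B') (ι : Γ(X, V.1) →+* B') (φ : AddMonoidAlgebra k P' →+* B')
      (q' : PrimeSpectrum B'), IsOpenImmersion (Spec.map (CommRingCat.ofHom ι)) ∧
      q'.asIdeal.comap ι = q ∧ φ.Etale ∧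
      φ.comp (algebraMap k (AddMonoidAlgebra k P')) = ι.comp (algebraMap k Γ(X, V.1)) ∧
      ∀ 𝔭 : PrimeSpectrum B', φ (AddMonoidAlgebra.single m 1) ∈ 𝔭.asIdeal ↔
        I ≤ 𝔭.asIdeal.comap ι := by
  have := V.2.isOpenImmersion_fromSpec
  let K := AlgebraicClosure k
  let B : Type u := Γ(X, V.1)
  have hIz : V.2.fromSpec ⁻¹' (U : Set X)ᶜ = PrimeSpectrum.zeroLocus (I : Set Γ(X, V.1)) :=
    hI ▸ preimage_compl_eq_zeroLocus U V
  have hIrad : I.IsRadical := by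
    rw [hI]
    exact PrimeSpectrum.isRadical_vanishingIdeal _
  have hred : IsReduced ((B ⧸ I) ⊗[k] K) :=
    isReduced_tensorProduct_of_geometricallyReduced K f U.compl V hV I hI
  have hdom : IsDomain B := by
    have hV' : Nonempty V.1 :=
      ⟨⟨V.2.fromSpec ⟨q, hq.isPrime⟩, V.2.range_fromSpec.le ⟨_, rfl⟩⟩⟩
    exact IsIntegral.component_integral V.1
  have hft : Algebra.FiniteType k B := by
    have h1 : LocallyOfFiniteType (Spec.map (CommRingCat.ofHom (algebraMap k Γ(X, V.1)))) :=
      hV ▸ inferInstance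
    exact RingHom.finiteType_algebraMap.mp
      ((HasRingHomProperty.Spec_iff (P := @LocallyOfFiniteType)).mp h1)
  -- a closed point of the base change over the given point
  obtain ⟨Q, hQ⟩ := PrimeSpectrum.comap_surjective_of_faithfullyFlat (A := B) (B := B ⊗[k] K)
    ⟨q, hq.isPrime⟩
  have hQ' : Q.asIdeal.comap (algebraMap B (B ⊗[k] K)) = q := congrArg PrimeSpectrum.asIdeal hQ
  have hQmax : Q.asIdeal.IsMaximal :=
    Ideal.isMaximal_of_isIntegral_of_isMaximal_comap (R := B) Q.asIdeal (by rwa [hQ'])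
  obtain ⟨jK, hjK, hfst, hsnd⟩ := exists_isOpenImmersion_tensorProduct K f V.2.fromSpec hV
  have hclosed := isClosed_singleton_of_isMaximal (pullback.snd f _) jK Q hQmax
  obtain ⟨n, P, hP, s, hs, e, he1, he2⟩ := hU.toroidal _ hclosed
  obtain ⟨m₀, hm₀P, hm₀⟩ := hP.exists_absorbing
  have hsmax : (s : PrimeSpectrum (AddMonoidAlgebra K P)).asIdeal.IsMaximal :=
    (PrimeSpectrum.isClosed_singleton_iff_isMaximal _).mp hs
  obtain ⟨r, hr, hrj⟩ := exists_isLocalization_stalk jK Q _ rfl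
  obtain ⟨r', hr', hrj'⟩ := exists_isLocalization_stalk (𝟙 (toricVariety K P)) s s rfl
  let _ := r.toAlgebra
  let _ := r'.toAlgebra
  refine exists_etale_chart_of_completion q I hIrad hred
    (fun 𝔭 h𝔭 h𝔭q => exists_isIntegrallyClosed hU V hIz q 𝔭 h𝔭 h𝔭q) Q.asIdeal hQ' hP
    (m₀ := ⟨m₀, hm₀P⟩) hm₀ (s : PrimeSpectrum (AddMonoidAlgebra K P)).asIdeal e (fun a => ?_) ?_
  · have h1 := he1 a
    rw [constants_eq _ hrj hsnd, constants_eq _ hrj' (Category.id_comp _)] at h1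
    exact h1
  · rw [completedIdeal, completedIdeal,
      stalkIdeal_eq hrj (I := I.map (algebraMap B (B ⊗[k] K))) ?_,
      stalkIdeal_eq (Z := (bigTorus K P)ᶜ) hrj'
        (preimage_bigTorus_compl (k := K) (m := ⟨m₀, hm₀P⟩) hm₀),
      Ideal.map_map (algebraMap B (B ⊗[k] K)) r] at he2
    · exact he2
    · have h1 : jK ⁻¹' (((pullback.fst f (Spec.map (CommRingCat.ofHom (algebraMap k K)))) ⁻¹ᵁ U :
          Scheme.Opens _) : Set _)ᶜ =
          PrimeSpectrum.comap (algebraMap B (B ⊗[k] K)) ⁻¹' (V.2.fromSpec ⁻¹' (U : Set X)ᶜ) := by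
        ext p
        have h2 : pullback.fst f (Spec.map (CommRingCat.ofHom (algebraMap k K))) (jK p) =
            V.2.fromSpec (PrimeSpectrum.comap (algebraMap B (B ⊗[k] K)) p) := by
          rw [← Scheme.Hom.comp_apply, hfst]
          rfl
        exact not_congr (h2 ▸ Iff.rfl)
      refine h1.trans ((congrArg (PrimeSpectrum.comap _ ⁻¹' ·) hIz).trans ?_)
      rw [PrimeSpectrum.preimage_comap_zeroLocus, Ideal.map, PrimeSpectrum.zeroLocus_span]

end Scheme

end Toroidal

theorem proposition1 {k : Type u} [Field k] {X : Scheme.{u}} (f : X ⟶ Spec (.of k))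
    [IsIntegral X] [IsSeparated f] [LocallyOfFiniteType f] [QuasiCompact f]
    (U : X.Opens) (hU : Toroidal.IsStrictToroidal f U)
    -- The boundary is geometrically reduced over `k` (automatic if `k` is perfect).
    (hD : GeometricallyReduced (Toroidal.reducedSubschemeMap U.compl ≫ f))
    (x : X) (hx : IsClosed ({x} : Set X)) :
    ∃ (n : ℕ) (P : AddSubmonoid (Fin n → ℤ)) (W : X.Opens)
      (φ : W.toScheme ⟶ Toroidal.toricVariety k P),
      Toroidal.IsToricMonoid P ∧ x ∈ W ∧
      φ ≫ Toroidal.toricVarietyStr k P = W.ι ≫ f ∧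
      Etale φ ∧
      φ ⁻¹' Toroidal.bigTorus k P = W.ι ⁻¹' (U : Set X) := by
  obtain ⟨_, ⟨V, hV, rfl⟩, hxV, -⟩ := X.isBasis_affineOpens.exists_subset_of_mem_open
    (Set.mem_univ x) isOpen_univ
  have := hV.isOpenImmersion_fromSpec
  let α : CommRingCat.of k ⟶ Γ(X, V) := Spec.preimage (hV.fromSpec ≫ f)
  have hα : hV.fromSpec ≫ f = Spec.map α := (Spec.map_preimage _).symm
  let _ : Algebra k Γ(X, V) := α.hom.toAlgebra
  have hq := hV.primeIdealOf_isMaximal_of_isClosed ⟨x, hxV⟩ hx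
  have hqx := hV.fromSpec_primeIdealOf ⟨x, hxV⟩
  set q := hV.primeIdealOf ⟨x, hxV⟩
  obtain ⟨n, P, hP, m, hm, B', _, ι, φ, q', hι, hq', hφ, hφι, hφI⟩ :=
    Toroidal.exists_chart_of_affineOpens f hU ⟨V, hV⟩ hα q.asIdeal _ rfl
  let i : Spec (.of B') ⟶ X := Spec.map (CommRingCat.ofHom ι) ≫ hV.fromSpec
  have hi : ∀ 𝔭 : PrimeSpectrum B', i 𝔭 = hV.fromSpec (PrimeSpectrum.comap ι 𝔭) := fun 𝔭 =>
    Scheme.Hom.comp_apply _ _ _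
  have hi' : IsOpenImmersion i := inferInstance
  obtain ⟨ψ, h1, h2, h3⟩ := Toroidal.exists_chart_of_isOpenImmersion f U i φ hφ (by
    rw [hφι, CommRingCat.ofHom_comp, Spec.map_comp, Category.assoc, hα]
    rfl) hm (fun 𝔭 => by
      rw [hφI, hi]
      exact (Set.ext_iff.mp (Toroidal.preimage_compl_eq_zeroLocus U ⟨V, hV⟩)
        (PrimeSpectrum.comap ι 𝔭)).symm)
  refine ⟨n, P, i.opensRange, ψ, hP, ⟨q', ?_⟩, h1, h2, h3⟩
  have h4 : PrimeSpectrum.comap ι q' = q := PrimeSpectrum.ext hq'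
  exact (hi q').trans ((congrArg hV.fromSpec h4).trans hqx)
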